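/- Let $M$ be a connected, oriented, smooth 4-manifold with a smooth Lorentzian metric $g$ of signature $(-+++)$ and a smooth torsion tensor $S_{\alpha\beta}{}^{\gamma}=S_{[\alpha\beta]}{}^{\gamma}$, and let $\nabla$ be the metric compatible connection $C^\gamma_{\alpha\beta}=\Gamma^\gamma_{\alpha\beta}+S_{\alpha\beta}{}^\gamma+S^\gamma{}_{\alpha\beta}-S_\beta{}^\gamma{}_\alpha$. Let $R_{\alpha\beta\gamma}{}^{\rho}=\partial_\beta C^\rho_{\alpha\gamma}-\partial_\alpha C^\rho_{\beta\gamma}+C^\rho_{\beta\sigma}C^\sigma_{\alpha\gamma}-C^\rho_{\alpha\sigma}C^\sigma_{\beta\gamma}$ be its curvature, $R_{\alpha\beta}=R_{\alpha\mu\beta}{}^{\mu}$, $R=R_\mu{}^\mu$, and $$C_{\alpha\beta\gamma\delta}=R_{\alpha\beta\gamma\delta}-R_{\alpha[\gamma}g_{\delta]\beta}+R_{\beta[\gamma}g_{\delta]\alpha}+\tfrac13R\,g_{\alpha[\gamma}g_{\delta]\beta}$$ the Weyl tensor. Let $u$ be a smooth vector field with $u_\alpha u^\alpha=-1$, $h_{\alpha\beta}=g_{\alpha\beta}+u_\alpha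 u_\beta$, $\varepsilon_{\alpha\beta\gamma}=\varepsilon_{\alpha\beta\gamma\sigma}u^\sigma$ with $\varepsilon_{\alpha\beta\gamma\delta}$ the volume form, and let $D_\alpha$ be $\nabla_\alpha$ projected with $h$ on all indices. Put $$\bar H_{\alpha\beta}=\tfrac12\varepsilon_\alpha{}^{\mu\nu}C_{\beta\delta\mu\nu}u^\delta,\quad S_{\alpha\beta}=-h_\alpha{}^\mu h_\beta{}^\nu u^\sigma S_{\mu\nu\sigma},\quad S^\gamma=\tfrac12\varepsilon^{\gamma\mu\nu}S_{\mu\nu},$$ and let $\theta$, $\sigma_{\alpha\beta}$, $\omega_{\alpha\beta}$ be the trace, the symmetric trace-free part and the antisymmetric part of the $h$-projection of $B_{\alpha\beta}=\nabla_\alpha u_\beta+2S_{\gamma\alpha\beta}u^\gamma$. Let a Weyssenhoff fluid with 4-velocity $u$ be given: functions $\mu,p$ on $M$, a covector field $q_\alpha$ with $q_\alpha u^\alpha=0$, and an antisymmetric spin density $\Delta_{\alpha\beta}$ with $\Delta_{\alpha\beta}u^\beta=0$; put $\Delta^\gamma=\frac12\varepsilon^{\gamma\mu\nu}\Delta_{\mu\nu}$.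 Suppose that for some constant $\Lambda$ the Einstein–Cartan equations hold: $$R_{\alpha\beta}-\tfrac12g_{\alpha\beta}R+\Lambda g_{\alpha\beta}=8\pi(\mu u_\alpha u_\beta+p\,h_{\alpha\beta}+q_\alpha u_\beta),\qquad S^{\alpha\beta\gamma}+2g^{\gamma[\alpha}S^{\beta]}{}_\mu{}^\mu=\Delta^{\alpha\beta}u^\gamma .$$ Suppose further that $\sigma_{\alpha\beta}=0$, $D_\alpha\theta=D_\alpha\mu=D_\alpha p=0$, $u^\gamma\nabla_\gamma u^\alpha=0$, $\omega_{\alpha\beta}=S_{\alpha\beta}$, and that through every point of $M$ passes a complete, simply connected hypersurface orthogonal to $u$. Let ${}^3R_{abcd}$ and ${}^3R$ denote the Riemann tensor and the Ricci scalar of the metric $h_{ab}$ induced on a hypersurface orthogonal to $u$. If $S_\alpha S^\alpha\neq0$ at every point and $D_\alpha\Delta^\alpha=f(\mu,p)$, where $f$ is a real function differentiable at all values taken by $(\mu,p)$, then: 1. ${}^3R\le0$ on every hypersurface orthogonal to $u$. 2. The curvature constant of the FLRW metric is $K=-1$ or $K=0$: there are $K\in\{-1,0\}$ and a smooth function $\ell>0$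 on $M$ (the scale factor) with $D_\alpha\ell=0$ and $\frac13\theta=\dot\ell/\ell$, where $\dot\ell=u^\alpha\partial_\alpha\ell$, such that on every hypersurface orthogonal to $u$ one has ${}^3R=6K/\ell^2$ and ${}^3R_{abcd}=\frac{K}{\ell^2}(h_{ac}h_{bd}-h_{ad}h_{bc})$. 3. A hypersurface orthogonal to $u$ is flat, ${}^3R=0$, if and only if $\bar H^{\alpha\beta}=0$ at all of its points. 4. At every point of a hypersurface orthogonal to $u$, $\bar H^{\mu\nu}\bar H_{\mu\nu}=-\frac{{}^3R}{3}S_\delta S^\delta$. -/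

import Mathlib

open scoped Manifold ContDiff Topology

universe w

noncomputable section

namespace EinsteinCartan

/-! ### Tensor calculus in a coordinate domain of `ℝⁿ`

Components are functions of the coordinate point; sums over indices are written out.
Index positions follow the order of the arguments. -/

/-- The coordinate space `ℝⁿ`. -/
abbrev Coord (n : ℕ) := EuclideanSpace ℝ (Fin n)

/-- Partial derivative `∂ᵢ F` at `y`. -/
def pd {n : ℕ} (i : Fin n) (F : Coord n → ℝ) (y : Coord n) : ℝ :=
  fderiv ℝ F y (EuclideanSpace.single i 1)

/-- Christoffel symbols: `christoffel G y α β γ` is `Γ^γ_{αβ}`. -/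
def christoffel {n : ℕ} (G : Coord n → Matrix (Fin n) (Fin n) ℝ) (y : Coord n)
    (α β γ : Fin n) : ℝ :=
  (1 / 2) * ∑ σ, (G y)⁻¹ γ σ *
    (pd α (fun z => G z σ β) y + pd β (fun z => G z α σ) y - pd σ (fun z => G z α β) y)

/-- Curvature of the connection coefficients `C y α β γ = C^γ_{αβ}`
(with `∇_α Y^γ = ∂_α Y^γ + C^γ_{αρ} Y^ρ`):
`riemann C y α β γ ρ` is
`R_{αβγ}^ρ = ∂_β C^ρ_{αγ} - ∂_α C^ρ_{βγ} + C^ρ_{βσ} C^σ_{αγ} - C^ρ_{ασ} C^σ_{βγ}`. -/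
def riemann {n : ℕ} (C : Coord n → Fin n → Fin n → Fin n → ℝ) (y : Coord n)
    (α β γ ρ : Fin n) : ℝ :=
  pd β (fun z => C z α γ ρ) y - pd α (fun z => C z β γ ρ) y
    + ∑ σ, (C y β σ ρ * C y α γ σ - C y α σ ρ * C y β γ σ)

/-- `R_{αβγδ} = R_{αβγ}^ρ g_{ρδ}`. -/
def riemannLow {n : ℕ} (G : Coord n → Matrix (Fin n) (Fin n) ℝ)
    (C : Coord n → Fin n → Fin n → Fin n → ℝ) (y : Coord n) (α β γ δ : Fin n) : ℝ :=
  ∑ ρ, riemann C y α β γ ρ * G y ρ δ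

/-- Ricci tensor `R_{αβ} = R_{αμβ}^μ`. -/
def ricci {n : ℕ} (C : Coord n → Fin n → Fin n → Fin n → ℝ) (y : Coord n) (α β : Fin n) : ℝ :=
  ∑ μ, riemann C y α μ β μ

/-- Ricci scalar `R = g^{αβ} R_{αβ}`. -/
def ricciScalar {n : ℕ} (G : Coord n → Matrix (Fin n) (Fin n) ℝ)
    (C : Coord n → Fin n → Fin n → Fin n → ℝ) (y : Coord n) : ℝ :=
  ∑ α, ∑ β, (G y)⁻¹ α β * ricci C y α β

/-- Levi-Civita symbol `η_{αβγδ}`, with `η_{0123} = 1`. -/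
def leviCivitaSymbol (α β γ δ : Fin 4) : ℝ :=
  ((1 : Matrix (Fin 4) (Fin 4) ℝ).submatrix ![α, β, γ, δ] id).det

/-- The components, in one positively oriented coordinate system, of a metric `g_{αβ}`, a torsion
tensor `tor y α β γ = S_{αβ}^γ` and a vector field `u^α`. -/
structure LocalFields where
  g : Coord 4 → Matrix (Fin 4) (Fin 4) ℝ
  tor : Coord 4 → Fin 4 → Fin 4 → Fin 4 → ℝ
  u : Coord 4 → Fin 4 → ℝ

namespace LocalFields

variable (F : LocalFields) (y : Coord 4)

/-- `g^{αβ}`. -/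
def gInv (α β : Fin 4) : ℝ := (F.g y)⁻¹ α β

/-- `u_α`. -/
def uLow (α : Fin 4) : ℝ := ∑ β, F.g y α β * F.u y β

/-- The projector `h_{αβ} = g_{αβ} + u_α u_β`. -/
def h (α β : Fin 4) : ℝ := F.g y α β + F.uLow y α * F.uLow y β

/-- The projector `h_α^β = δ_α^β + u_α u^β`. -/
def hMix (α β : Fin 4) : ℝ := (if α = β then 1 else 0) + F.uLow y α * F.u y β

/-- `S_{αβγ}`. -/
def torLow (α β γ : Fin 4) : ℝ := ∑ σ, F.tor y α β σ * F.g y σ γ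

/-- Contorsion `K_{αβ}^γ = S_{αβ}^γ + S^γ_{αβ} - S_β^γ_α`. -/
def contorsion (α β γ : Fin 4) : ℝ :=
  F.tor y α β γ + ∑ ρ, F.gInv y γ ρ * F.torLow y ρ α β - ∑ ρ, F.gInv y γ ρ * F.torLow y β ρ α

/-- The metric connection with torsion, `C^γ_{αβ} = Γ^γ_{αβ} + K_{αβ}^γ`. -/
def conn (z : Coord 4) (α β γ : Fin 4) : ℝ := christoffel F.g z α β γ + F.contorsion z α β γ

/-- `∇_α Y^β`. -/
def nablaVec (Y : Coord 4 → Fin 4 → ℝ) (α β : Fin 4) : ℝ :=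
  pd α (fun z => Y z β) y + ∑ ρ, F.conn y α ρ β * Y y ρ

/-- Ricci tensor of the connection with torsion. -/
def ric (α β : Fin 4) : ℝ := ricci F.conn y α β

/-- Ricci scalar of the connection with torsion. -/
def scal : ℝ := ricciScalar F.g F.conn y

/-- Weyl tensor
`C_{αβγδ} = R_{αβγδ} - R_{α[γ}g_{δ]β} + R_{β[γ}g_{δ]α} + (1/3) R g_{α[γ}g_{δ]β}`. -/
def weyl (α β γ δ : Fin 4) : ℝ :=
  riemannLow F.g F.conn y α β γ δ
    - (1 / 2) * (F.ric y α γ * F.g y δ β - F.ric y α δ * F.g y γ β)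
    + (1 / 2) * (F.ric y β γ * F.g y δ α - F.ric y β δ * F.g y γ α)
    + (1 / 3) * F.scal y * ((1 / 2) * (F.g y α γ * F.g y δ β - F.g y α δ * F.g y γ β))

/-- The Levi-Civita volume form `ε_{αβγδ}`. -/
def eps4 (α β γ δ : Fin 4) : ℝ := √|(F.g y).det| * leviCivitaSymbol α β γ δ

/-- The projected Levi-Civita tensor `ε_{αβγ} = ε_{αβγσ} u^σ`. -/
def eps (α β γ : Fin 4) : ℝ := ∑ σ, F.eps4 y α β γ σ * F.u y σ

/-- `ε_α^{μν}`. -/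
def epsUp2 (α μ ν : Fin 4) : ℝ := ∑ ρ, ∑ σ, F.gInv y μ ρ * F.gInv y ν σ * F.eps y α ρ σ

/-- The vector `A^γ = (1/2) ε^{γμν} A_{μν}` of a 2-tensor. -/
def axial (A : Coord 4 → Fin 4 → Fin 4 → ℝ) (γ : Fin 4) : ℝ :=
  (1 / 2) * ∑ α, ∑ μ, ∑ ν, F.gInv y γ α * F.epsUp2 y α μ ν * A y μ ν

/-- Magnetic part `H̄_{αβ} = (1/2) ε_α^{μν} C_{βδμν} u^δ` of the Weyl tensor. -/
def hBarLow (α β : Fin 4) : ℝ :=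
  (1 / 2) * ∑ μ, ∑ ν, ∑ δ, F.epsUp2 y α μ ν * F.weyl y β δ μ ν * F.u y δ

/-- `H̄^{αβ}`. -/
def hBar (α β : Fin 4) : ℝ := ∑ ρ, ∑ σ, F.gInv y α ρ * F.gInv y β σ * F.hBarLow y ρ σ

/-- `H̄^{αβ} H̄_{αβ}`. -/
def hBarSq : ℝ := ∑ α, ∑ β, F.hBar y α β * F.hBarLow y α β

/-- The part `S_{αβ} = -h_α^μ h_β^ν u^σ S_{μνσ}` of the torsion. -/
def torS (α β : Fin 4) : ℝ :=
  -∑ μ, ∑ ν, ∑ σ, F.hMix y α μ * F.hMix y β ν * F.u y σ * F.torLow y μ ν σ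

/-- The torsion vector `S^γ = (1/2) ε^{γμν} S_{μν}`. -/
def torVec (γ : Fin 4) : ℝ := F.axial y F.torS γ

/-- `S_γ S^γ`. -/
def torVecSq : ℝ := ∑ α, ∑ β, F.g y α β * F.torVec y α * F.torVec y β

/-- `B_{αβ}`, where `B_α^β = ∇_α u^β + 2 S_{γα}^β u^γ`. -/
def bLow (α β : Fin 4) : ℝ :=
  ∑ σ, (F.nablaVec y F.u α σ + 2 * ∑ γ, F.tor y γ α σ * F.u y γ) * F.g y σ β

/-- `B_⊥{αβ} = h_α^γ h_β^σ B_{γσ}`. -/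
def bPerp (α β : Fin 4) : ℝ := ∑ γ, ∑ σ, F.hMix y α γ * F.hMix y β σ * F.bLow y γ σ

/-- Expansion `θ`. -/
def expansion : ℝ := ∑ α, ∑ β, F.gInv y α β * F.bPerp y α β

/-- Shear `σ_{αβ}`. -/
def shear (α β : Fin 4) : ℝ :=
  (1 / 2) * (F.bPerp y α β + F.bPerp y β α) - (1 / 3) * F.h y α β * F.expansion y

/-- Vorticity `ω_{αβ}`. -/
def vorticity (α β : Fin 4) : ℝ := (1 / 2) * (F.bPerp y α β - F.bPerp y β α)

/-- Acceleration `a^α = u^γ ∇_γ u^α`. -/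
def accel (α : Fin 4) : ℝ := ∑ γ, F.u y γ * F.nablaVec y F.u γ α

/-- Projected gradient `D_α f = h_α^ν ∂_ν f` of a function. -/
def projGrad (f : Coord 4 → ℝ) (α : Fin 4) : ℝ := ∑ ν, F.hMix y α ν * pd ν f y

/-- Derivative `u^ν ∂_ν f` of a function along `u`. -/
def dot (f : Coord 4 → ℝ) : ℝ := ∑ ν, F.u y ν * pd ν f y

/-- `D_α Y^α = h_α^μ h_λ^α ∇_μ Y^λ`. -/
def projDiv (Y : Coord 4 → Fin 4 → ℝ) : ℝ :=
  ∑ α, ∑ μ, ∑ lam, F.hMix y α μ * F.hMix y lam α * F.nablaVec y Y μ lam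

end LocalFields

/-! ### Manifolds and components in charts -/

section Manifolds

variable {n : ℕ} {M : Type w} [TopologicalSpace M] [ChartedSpace (Coord n) M]

/-- The chart transitions of the given atlas preserve the orientation of `ℝⁿ`: the atlas consists of
the positively oriented coordinate systems of an oriented manifold. -/
def OrientedAtlas (n : ℕ) (M : Type w) [TopologicalSpace M] [ChartedSpace (Coord n) M] : Prop :=
  ∀ e ∈ atlas (Coord n) M, ∀ e' ∈ atlas (Coord n) M, ∀ x ∈ e.source ∩ e'.source,
    0 < (fderiv ℝ (e' ∘ e.symm) (e x)).det

/-- The coordinate vector `∂_i` of the chart `e` at the point with coordinates `y`. -/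
def coordVec (e : OpenPartialHomeomorph M (Coord n)) (y : Coord n) (i : Fin n) :
    TangentSpace (𝓡 n) (e.symm y) :=
  mfderiv (𝓡 n) (𝓡 n) e.symm y (EuclideanSpace.single i 1 : Coord n)

/-- The `i`-th component in the chart `e` of a tangent vector at the point with coordinates `y`. -/
def vecComp (e : OpenPartialHomeomorph M (Coord n)) (y : Coord n)
    (v : TangentSpace (𝓡 n) (e.symm y)) (i : Fin n) : ℝ :=
  let v' : Coord n := mfderiv (𝓡 n) (𝓡 n) e (e.symm y) v
  v' i

/-- Components in the chart `e` of a field of bilinear forms. -/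
def bilinComp (b : ∀ x : M, TangentSpace (𝓡 n) x →ₗ[ℝ] TangentSpace (𝓡 n) x →ₗ[ℝ] ℝ)
    (e : OpenPartialHomeomorph M (Coord n)) (y : Coord n) : Matrix (Fin n) (Fin n) ℝ :=
  Matrix.of fun i j => b (e.symm y) (coordVec e y i) (coordVec e y j)

end Manifolds

/-- A smooth Lorentzian metric of signature `(-+++)` and a smooth torsion tensor on a 4-manifold;
they determine the metric compatible connection with this torsion. -/
structure Spacetime (M : Type w) [TopologicalSpace M] [ChartedSpace (Coord 4) M] where
  metric : ∀ x : M, TangentSpace (𝓡 4) x →ₗ[ℝ] TangentSpace (𝓡 4) x →ₗ[ℝ] ℝ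
  metric_symm : ∀ x v v', metric x v v' = metric x v' v
  metric_lorentzian : ∀ x, ∃ v, metric x v v < 0 ∧
    ∀ v', metric x v v' = 0 → v' ≠ 0 → 0 < metric x v' v'
  metric_smooth : ∀ e ∈ atlas (Coord 4) M, ∀ i j,
    ContDiffOn ℝ ∞ (fun y => bilinComp metric e y i j) e.target
  torsion : ∀ x : M, TangentSpace (𝓡 4) x →ₗ[ℝ] TangentSpace (𝓡 4) x →ₗ[ℝ] TangentSpace (𝓡 4) x
  torsion_antisymm : ∀ x v v', torsion x v v' = -torsion x v' v
  torsion_smooth : ∀ e ∈ atlas (Coord 4) M, ∀ i j k,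
    ContDiffOn ℝ ∞
      (fun y => vecComp e y (torsion (e.symm y) (coordVec e y i) (coordVec e y j)) k) e.target

variable {M : Type w} [TopologicalSpace M] [ChartedSpace (Coord 4) M]

/-- A Weyssenhoff fluid: 4-velocity `u`, energy density, pressure, heat flow `q_α` and
antisymmetric spin density `Δ_{αβ}`, the last two orthogonal to `u`. -/
structure WeyssenhoffFluid (X : Spacetime M) where
  u : ∀ x : M, TangentSpace (𝓡 4) x
  u_unit : ∀ x, X.metric x (u x) (u x) = -1
  u_smooth : ∀ e ∈ atlas (Coord 4) M, ∀ i,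
    ContDiffOn ℝ ∞ (fun y => vecComp e y (u (e.symm y)) i) e.target
  energy : M → ℝ
  pressure : M → ℝ
  heat : ∀ x : M, TangentSpace (𝓡 4) x →ₗ[ℝ] ℝ
  heat_orth : ∀ x, heat x (u x) = 0
  spin : ∀ x : M, TangentSpace (𝓡 4) x →ₗ[ℝ] TangentSpace (𝓡 4) x →ₗ[ℝ] ℝ
  spin_antisymm : ∀ x v v', spin x v v' = -spin x v' v
  spin_orth : ∀ x v, spin x v (u x) = 0

namespace WeyssenhoffFluid

variable {X : Spacetime M} (W : WeyssenhoffFluid X) (e : OpenPartialHomeomorph M (Coord 4))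

/-- The components of metric, torsion and 4-velocity in the chart `e`. -/
def fields : LocalFields where
  g := bilinComp X.metric e
  tor := fun y α β γ =>
    vecComp e y (X.torsion (e.symm y) (coordVec e y α) (coordVec e y β)) γ
  u := fun y α => vecComp e y (W.u (e.symm y)) α

/-- Canonical stress-energy tensor `T_{αβ} = μ u_α u_β + p h_{αβ} + q_α u_β`. -/
def stressEnergy (y : Coord 4) (α β : Fin 4) : ℝ :=
  W.energy (e.symm y) * (W.fields e).uLow y α * (W.fields e).uLow y β
    + W.pressure (e.symm y) * (W.fields e).h y α β
    + W.heat (e.symm y) (coordVec e y α) * (W.fields e).uLow y β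

/-- `Δ_{αβ}`. -/
def spinLow (y : Coord 4) (α β : Fin 4) : ℝ := bilinComp W.spin e y α β

/-- Intrinsic hypermomentum `Δ^{αβγ} = -(1/8π) Δ^{αβ} u^γ`. -/
def hypermomentum (y : Coord 4) (α β γ : Fin 4) : ℝ :=
  -(1 / (8 * Real.pi)) *
    (∑ ρ, ∑ σ, (W.fields e).gInv y α ρ * (W.fields e).gInv y β σ * W.spinLow e y ρ σ) *
    (W.fields e).u y γ

/-- The spin density vector `Δ^γ = (1/2) ε^{γμν} Δ_{μν}`. -/
def spinVec (y : Coord 4) (γ : Fin 4) : ℝ := (W.fields e).axial y (W.spinLow e) γ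

/-- Trace `S^β_μ^μ` of the torsion. -/
def torTrace (y : Coord 4) (β : Fin 4) : ℝ :=
  ∑ ρ, ∑ μ, (W.fields e).gInv y β ρ * (W.fields e).tor y ρ μ μ

/-- The Einstein–Cartan field equations with cosmological constant `Λ`,
`R_{αβ} - (1/2) g_{αβ} R + Λ g_{αβ} = 8π T_{αβ}` and
`S^{αβγ} + 2 g^{γ[α} S^{β]}_μ^μ = -8π Δ^{αβγ}`. -/
structure FieldEquations (Λ : ℝ) : Prop where
  einstein : ∀ e ∈ atlas (Coord 4) M, ∀ y ∈ e.target, ∀ α β,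
    (W.fields e).ric y α β - (1 / 2) * (W.fields e).g y α β * (W.fields e).scal y
      + Λ * (W.fields e).g y α β = 8 * Real.pi * W.stressEnergy e y α β
  cartan : ∀ e ∈ atlas (Coord 4) M, ∀ y ∈ e.target, ∀ α β γ,
    (∑ ρ, ∑ σ, (W.fields e).gInv y α ρ * (W.fields e).gInv y β σ * (W.fields e).tor y ρ σ γ)
      + ((W.fields e).gInv y γ α * W.torTrace e y β - (W.fields e).gInv y γ β * W.torTrace e y α)
      = -(8 * Real.pi) * W.hypermomentum e y α β γ

/-- The kinematical conditions on the cosmological fluid: no shear, no spatial gradients of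
expansion, energy density and pressure, no acceleration, and `ω_{αβ} = S_{αβ}`. -/
structure IsCosmological : Prop where
  shear_free : ∀ e ∈ atlas (Coord 4) M, ∀ y ∈ e.target, ∀ α β, (W.fields e).shear y α β = 0
  expansion_homogeneous : ∀ e ∈ atlas (Coord 4) M, ∀ y ∈ e.target, ∀ α,
    (W.fields e).projGrad y (W.fields e).expansion α = 0
  energy_homogeneous : ∀ e ∈ atlas (Coord 4) M, ∀ y ∈ e.target, ∀ α,
    (W.fields e).projGrad y (fun z => W.energy (e.symm z)) α = 0
  pressure_homogeneous : ∀ e ∈ atlas (Coord 4) M, ∀ y ∈ e.target, ∀ α,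
    (W.fields e).projGrad y (fun z => W.pressure (e.symm z)) α = 0
  geodesic : ∀ e ∈ atlas (Coord 4) M, ∀ y ∈ e.target, ∀ α, (W.fields e).accel y α = 0
  vorticity_eq : ∀ e ∈ atlas (Coord 4) M, ∀ y ∈ e.target, ∀ α β,
    (W.fields e).vorticity y α β = (W.fields e).torS y α β

/-- An orthogonal hypersurface: a smooth 3-manifold with a smooth injective immersion into `M`
whose tangent spaces are orthogonal to `u`. -/
structure OrthogonalSlice where
  carrier : Type w
  [top : TopologicalSpace carrier]
  [charted : ChartedSpace (Coord 3) carrier]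
  [manifold : IsManifold (𝓡 3) ∞ carrier]
  ι : carrier → M
  ι_smooth : ContMDiff (𝓡 3) (𝓡 4) ∞ ι
  ι_injective : Function.Injective ι
  ι_immersion : ∀ y, Function.Injective (mfderiv (𝓡 3) (𝓡 4) ι y)
  ι_orthogonal : ∀ y v, X.metric (ι y) (W.u (ι y)) (mfderiv (𝓡 3) (𝓡 4) ι y v) = 0

attribute [instance] OrthogonalSlice.top OrthogonalSlice.charted OrthogonalSlice.manifold

namespace OrthogonalSlice

variable {W}
variable (V : W.OrthogonalSlice)

/-- The induced metric of a slice. -/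
def induced (y : V.carrier) : TangentSpace (𝓡 3) y →ₗ[ℝ] TangentSpace (𝓡 3) y →ₗ[ℝ] ℝ :=
  (X.metric (V.ι y)).compl₁₂ (mfderiv (𝓡 3) (𝓡 4) V.ι y).toLinearMap
    (mfderiv (𝓡 3) (𝓡 4) V.ι y).toLinearMap

/-- The intrinsic Riemann tensor `³R_{abcd}` (of the Levi-Civita connection of the induced metric)
in the chart `c` of the slice. -/
def riemann3 (c : OpenPartialHomeomorph V.carrier (Coord 3)) (z : Coord 3) (i j k l : Fin 3) : ℝ :=
  riemannLow (bilinComp V.induced c) (christoffel (bilinComp V.induced c)) z i j k l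

/-- The intrinsic Ricci scalar `³R` of the slice at `y`, computed in the preferred chart there. -/
def scalarCurvature (y : V.carrier) : ℝ :=
  ricciScalar (bilinComp V.induced (chartAt (Coord 3) y))
    (christoffel (bilinComp V.induced (chartAt (Coord 3) y))) (chartAt (Coord 3) y y)

/-- The Riemannian distance of the slice: the infimum of the lengths, for the induced metric, of
the `C¹` curves joining two points. -/
def dist (y z : V.carrier) : ENNReal :=
  @Manifold.riemannianEDist (Coord 3) _ _ (Coord 3) _ (𝓡 3) V.carrier _ _
    (fun y => ⟨fun v => ENNReal.ofReal √(V.induced y v v)⟩) y z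

/-- The slice is complete: Cauchy sequences for the Riemannian distance converge. -/
def IsComplete : Prop :=
  ∀ s : ℕ → V.carrier,
    (∀ ε : ENNReal, 0 < ε → ∃ m, ∀ i ≥ m, ∀ j ≥ m, V.dist (s i) (s j) < ε) →
    ∃ y, Filter.Tendsto s Filter.atTop (𝓝 y)

end OrthogonalSlice

end WeyssenhoffFluid

end EinsteinCartan

end

/-! In a chart the Cartan equation is linear in the torsion and forces it to be `A_{αβ} u^γ`, where
`A` is the spin density (`cartan_solve`). The condition `ω = S` says that the vorticity is due to
torsion alone. With vanishing shear and acceleration this leaves `∇_μ u^ρ = H h_μ^ρ` for the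
Levi-Civita connection, where `H = θ/3` (`IsLocalSolution.isHubbleFlow`). Let `Hd` be the derivative
of `H` along `u`.

Inserting the contorsion into the Ricci tensor (`IsSpin.ricci_contorsion`) and splitting the
Einstein equations along `u` (`IsSpin.einstein_split`) gives the following. The heat flow vanishes,
`A` is divergence free, and `∇_u A = -3HA`. The Levi-Civita Ricci tensor is `lam h - 3(H² + Hd) u
u`, and `|S|²` is a combination of spatially homogeneous functions. For the spatial vector `S` dual
to `A` this means that `∇_u S = -3HS`, that `S` is closed within the slices, and that `|S|²` is
constant on them. The divergence `f(mu, p)` of `S` is also constant on slices, by the chain rule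
(`sv_div`).

The heart is a Bochner argument. A closed field of constant norm is not accelerated along itself
within a slice. Take the divergence of this relation and exchange derivatives: `|DS|² = -³Ric(S, S)
- S(div S)`, and the last term is zero. Put `k = (lam - Hd - 3H²)/2`, so that `³Ric = 2k h`; then
`|DS|² = -2k |S|²` (`IsSpinVector.bochner`, `IsSpinGradient.square_spatial`). On the other hand the
magnetic part of the Weyl tensor is `H̄ = -DS` (`hBarLow_eq`). Therefore `H̄² = -2k |S|²`, so `k ≤
0`, with equality exactly where `H̄` vanishes.

Differentiating the Bochner identity along `u` shows that `k` has logarithmic rate `-2H`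
(`IsSpinVector.curvature_grad`), while `|S|²` has rate `-6H`. Hence `ℓ = (|S|²)^(-1/6)` is an
explicit scale factor and `k ℓ²` is locally constant. Connectedness of `M` makes it constant, and
rescaling `ℓ` normalises it to `-1` or `0` (`exists_scale`).

Finally, in three dimensions the Ricci tensor determines the curvature: the ambient metric has
spatial sectional curvature `k + H²` (`spatial_curvature`). A slice is umbilic with factor `H`, so
the Gauss equation subtracts `H²` (`IsHubbleFlow.gauss`). Slices thus have constant curvature `k`
and `³R = 6k`.

Differential identities are proved in a ring with commuting derivations, later taken to be the
smooth functions on a chart domain. Pointwise identities with the volume form are proved in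
orthonormal frames whose first vector is `u`. -/

noncomputable section

namespace EinsteinCartan

/-! ### The differential ring of smooth functions on an open set -/

section SmoothRing

variable {n : ℕ}

/-- Extension by zero of a function on an open set. -/
def extendZero (U : TopologicalSpace.Opens (Coord n)) (f : U → ℝ) (z : Coord n) : ℝ :=
  open Classical in if h : z ∈ U then f ⟨z, h⟩ else 0

theorem extendZero_apply {U : TopologicalSpace.Opens (Coord n)} (f : U → ℝ) (y : U) :
    extendZero U f y = f y := by
  simp [extendZero]

theorem extendZero_of_mem {U : TopologicalSpace.Opens (Coord n)} (f : U → ℝ) {y : Coord n}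
    (hy : y ∈ U) : extendZero U f y = f ⟨y, hy⟩ := by
  simp [extendZero, hy]

/-- The smooth functions on an open subset of `ℝⁿ` as a subalgebra. -/
def smoothSubalgebra (U : TopologicalSpace.Opens (Coord n)) : Subalgebra ℝ (U → ℝ) where
  carrier := {f | ContDiffOn ℝ ∞ (extendZero U f) U}
  mul_mem' {f g} hf hg := by
    refine (ContDiffOn.mul hf hg).congr fun y hy => ?_
    simp [extendZero_of_mem _ hy]
  add_mem' {f g} hf hg := by
    refine (ContDiffOn.add hf hg).congr fun y hy => ?_
    simp [extendZero_of_mem _ hy]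
  algebraMap_mem' r := by
    refine (contDiffOn_const (c := r)).congr fun y hy => ?_
    simp [extendZero_of_mem _ hy]

/-- The algebra of smooth functions on an open subset of `ℝⁿ`. -/
def Sm (U : TopologicalSpace.Opens (Coord n)) : Type := smoothSubalgebra U

instance (U : TopologicalSpace.Opens (Coord n)) : CommRing (Sm U) :=
  inferInstanceAs (CommRing (smoothSubalgebra U))

instance (U : TopologicalSpace.Opens (Coord n)) : Algebra ℝ (Sm U) :=
  inferInstanceAs (Algebra ℝ (smoothSubalgebra U))

variable {U : TopologicalSpace.Opens (Coord n)}

theorem Sm.smooth (f : Sm U) : ContDiffOn ℝ ∞ (extendZero U f.1) U := f.2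

/-- The element of `Sm U` given by a function that is smooth on `U`. -/
def Sm.mk (F : Coord n → ℝ) (hF : ContDiffOn ℝ ∞ F U) : Sm U :=
  ⟨fun y => F y, hF.congr fun y hy => by simp [extendZero_of_mem _ hy]⟩

/-- Evaluation at a point. -/
def Sm.ev (y : U) : Sm U →ₐ[ℝ] ℝ := (Pi.evalAlgHom ℝ (fun _ : U => ℝ) y).comp (smoothSubalgebra U).val

@[simp] theorem Sm.ev_mk (F : Coord n → ℝ) (hF : ContDiffOn ℝ ∞ F U) (y : U) :
    Sm.ev y (Sm.mk F hF) = F y := rfl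

theorem Sm.ev_ext {f g : Sm U} (h : ∀ y, Sm.ev y f = Sm.ev y g) : f = g :=
  Subtype.ext (funext h)

theorem Sm.extendZero_ev (f : Sm U) (y : U) : extendZero U f.1 y = Sm.ev y f :=
  extendZero_apply _ _

theorem Sm.differentiableAt (f : Sm U) (y : U) : DifferentiableAt ℝ (extendZero U f.1) y :=
  ((Sm.smooth f).contDiffAt (U.isOpen.mem_nhds y.2)).differentiableAt (by simp)

theorem pd_congr_of_eqOn {F F' : Coord n → ℝ} (h : ∀ y ∈ U, F y = F' y) (i : Fin n) {y : Coord n}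
    (hy : y ∈ U) : pd i F y = pd i F' y := by
  have : F =ᶠ[𝓝 y] F' := Filter.eventuallyEq_of_mem (U.isOpen.mem_nhds hy) h
  rw [pd, pd, this.fderiv_eq]

theorem contDiffOn_pd {F : Coord n → ℝ} (hF : ContDiffOn ℝ ∞ F U) (i : Fin n) :
    ContDiffOn ℝ ∞ (pd i F) U := by
  have h := hF.fderiv_of_isOpen (m := ∞) U.isOpen (by simp)
  exact h.clm_apply contDiffOn_const

theorem Sm.pd_add (i : Fin n) (f g : Sm U) (y : U) :
    pd i (extendZero U (f + g).1) y = pd i (extendZero U f.1) y + pd i (extendZero U g.1) y := by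
  have : pd i (extendZero U (f + g).1) y
      = pd i (fun z => extendZero U f.1 z + extendZero U g.1 z) y :=
    pd_congr_of_eqOn (fun z hz => by simp only [extendZero_of_mem _ hz]; rfl) i y.2
  rw [this, pd, fderiv_fun_add (Sm.differentiableAt f y) (Sm.differentiableAt g y)]
  rfl

theorem Sm.pd_smul (i : Fin n) (r : ℝ) (f : Sm U) (y : U) :
    pd i (extendZero U (r • f).1) y = r * pd i (extendZero U f.1) y := by
  have : pd i (extendZero U (r • f).1) y = pd i (fun z => r • extendZero U f.1 z) y :=
    pd_congr_of_eqOn (fun z hz => by simp only [extendZero_of_mem _ hz]; rfl) i y.2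
  rw [this, pd, fderiv_fun_const_smul (Sm.differentiableAt f y)]
  rfl

theorem Sm.pd_one (i : Fin n) (y : U) : pd i (extendZero U (1 : Sm U).1) y = 0 := by
  have : pd i (extendZero U (1 : Sm U).1) y = pd i (fun _ => 1) y :=
    pd_congr_of_eqOn (fun z hz => by simp only [extendZero_of_mem _ hz]; rfl) i y.2
  rw [this]
  simp [pd]

theorem Sm.pd_mul (i : Fin n) (f g : Sm U) (y : U) :
    pd i (extendZero U (f * g).1) y =
      Sm.ev y f * pd i (extendZero U g.1) y + Sm.ev y g * pd i (extendZero U f.1) y := by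
  have : pd i (extendZero U (f * g).1) y
      = pd i (fun z => extendZero U f.1 z * extendZero U g.1 z) y :=
    pd_congr_of_eqOn (fun z hz => by simp only [extendZero_of_mem _ hz]; rfl) i y.2
  rw [this, pd, fderiv_fun_mul (Sm.differentiableAt f y) (Sm.differentiableAt g y)]
  simp [Sm.extendZero_ev, pd]

/-- Partial derivatives as derivations of the ring of smooth functions. -/
def Sm.d (i : Fin n) : Derivation ℝ (Sm U) (Sm U) where
  toFun f := Sm.mk (pd i (extendZero U f.1)) (contDiffOn_pd (Sm.smooth f) i)
  map_add' f g := Sm.ev_ext fun y => Sm.pd_add i f g y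
  map_smul' r f := Sm.ev_ext fun y => Sm.pd_smul i r f y
  map_one_eq_zero' := Sm.ev_ext fun y => Sm.pd_one i y
  leibniz' f g := Sm.ev_ext fun y => Sm.pd_mul i f g y

theorem Sm.ev_d (i : Fin n) (f : Sm U) (y : U) :
    Sm.ev y (Sm.d i f) = pd i (extendZero U f.1) y := rfl

/-- A function that agrees on `U` with a smooth function has its partial derivatives. -/
theorem Sm.pd_eq {F : Coord n → ℝ} (f : Sm U) (h : ∀ y : U, F y = Sm.ev y f) (i : Fin n) (y : U) :
    pd i F y = Sm.ev y (Sm.d i f) :=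
  pd_congr_of_eqOn (fun z hz => by
    rw [h ⟨z, hz⟩, ← Sm.extendZero_ev]) i y.2

/-- Symmetry of the second Fréchet derivative. It supplies the commutation hypothesis of the
curvature identities in the abstract ring. -/
theorem Sm.d_comm (i j : Fin n) (f : Sm U) : Sm.d i (Sm.d j f) = Sm.d j (Sm.d i f) := by
  refine Sm.ev_ext fun y => ?_
  set F := extendZero U f.1
  have hF : ContDiffAt ℝ ∞ F y := (Sm.smooth f).contDiffAt (U.isOpen.mem_nhds y.2)
  have key : ∀ i j : Fin n, Sm.ev y (Sm.d i (Sm.d j f)) =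
      fderiv ℝ (fderiv ℝ F) y (EuclideanSpace.single i 1) (EuclideanSpace.single j 1) := by
    intro i j
    rw [← Sm.pd_eq (F := pd j F) _ (fun z => by rw [Sm.ev_d]) i y]
    have hd : DifferentiableAt ℝ (fderiv ℝ F) y :=
      (hF.fderiv_right (m := 1) (by norm_cast)).differentiableAt (by simp)
    change fderiv ℝ (fun z => fderiv ℝ F z (EuclideanSpace.single j 1)) y _ = _
    rw [fderiv_clm_apply hd (differentiableAt_const _)]
    simp
  rw [key, key]
  exact (hF.isSymmSndFDerivAt (by
    rw [minSmoothness_of_isRCLikeNormedField]; exact WithTop.coe_le_coe.mpr (le_top : (2 : ℕ∞) ≤ ⊤))) _ _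

/-- The reciprocal is again smooth, so nowhere vanishing functions may be cancelled in `Sm U`. This
is applied to the metric determinant, the volume density and the square of the spin vector. -/
theorem Sm.isUnit_of_ev_ne_zero (f : Sm U) (h : ∀ y, Sm.ev y f ≠ 0) : IsUnit f := by
  have hinv : ContDiffOn ℝ ∞ (fun z => (extendZero U f.1 z)⁻¹) U :=
    (Sm.smooth f).inv fun z hz => by rw [Sm.extendZero_ev f ⟨z, hz⟩]; exact h _
  refine IsUnit.of_mul_eq_one (Sm.mk _ hinv) (Sm.ev_ext fun y => ?_)
  rw [map_mul, Sm.ev_mk, Sm.extendZero_ev, mul_inv_cancel₀ (h y), map_one]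

end SmoothRing

end EinsteinCartan

end

noncomputable section

namespace EinsteinCartan

/-! ### Tensor calculus in a ring with commuting derivations -/

section DifferentialRing

variable {R : Type*} [CommRing R] [Algebra ℝ R] {n : ℕ}

/-- Covariant derivative `∇_μ Y^ρ`. -/
def covVec (d : Fin n → Derivation ℝ R R) (C : Fin n → Fin n → Fin n → R) (Y : Fin n → R)
    (μ ρ : Fin n) : R :=
  d μ (Y ρ) + ∑ σ, C μ σ ρ * Y σ

/-- Covariant derivative `∇_μ A_{αβ}`. -/
def covTwo (d : Fin n → Derivation ℝ R R) (C : Fin n → Fin n → Fin n → R) (A : Fin n → Fin n → R)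
    (μ α β : Fin n) : R :=
  d μ (A α β) - ∑ σ, C μ α σ * A σ β - ∑ σ, C μ β σ * A α σ

/-- Covariant derivative `∇_μ T_α^ρ`. -/
def covEnd (d : Fin n → Derivation ℝ R R) (C : Fin n → Fin n → Fin n → R) (T : Fin n → Fin n → R)
    (μ α ρ : Fin n) : R :=
  d μ (T α ρ) + ∑ σ, C μ σ ρ * T α σ - ∑ σ, C μ α σ * T σ ρ

/-- Covariant derivative `∇_μ K_{αβ}^ρ`. -/
def covThree (d : Fin n → Derivation ℝ R R) (C : Fin n → Fin n → Fin n → R)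
    (K : Fin n → Fin n → Fin n → R) (μ α β ρ : Fin n) : R :=
  d μ (K α β ρ) + ∑ σ, C μ σ ρ * K α β σ - ∑ σ, C μ α σ * K σ β ρ - ∑ σ, C μ β σ * K α σ ρ

/-- Curvature `R_{αβγ}^ρ` of connection coefficients. -/
def curv (d : Fin n → Derivation ℝ R R) (C : Fin n → Fin n → Fin n → R) (α β γ ρ : Fin n) : R :=
  d β (C α γ ρ) - d α (C β γ ρ) + ∑ σ, (C β σ ρ * C α γ σ - C α σ ρ * C β γ σ)

/-- Lowered curvature `R_{αβγδ}`. -/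
def curvLow (d : Fin n → Derivation ℝ R R) (G : Fin n → Fin n → R)
    (C : Fin n → Fin n → Fin n → R) (α β γ δ : Fin n) : R :=
  ∑ ρ, curv d C α β γ ρ * G ρ δ

/-- `Γ` is the Levi-Civita connection of `G`, whose inverse is `Gi`. -/
structure IsLeviCivita (d : Fin n → Derivation ℝ R R) (G Gi : Fin n → Fin n → R)
    (Γ : Fin n → Fin n → Fin n → R) : Prop where
  metric_symm : ∀ α β, G α β = G β α
  inv_symm : ∀ α β, Gi α β = Gi β α
  inv_mul : ∀ α β, ∑ σ, Gi α σ * G σ β = if α = β then 1 else 0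
  symm : ∀ α β γ, Γ α β γ = Γ β α γ
  compat : ∀ μ α β, d μ (G α β) = ∑ σ, Γ μ α σ * G σ β + ∑ σ, Γ μ β σ * G σ α

/-- An algebra over `ℝ` contains `1/2`, so 2 can be cancelled although `R` may have zero divisors.
-/
theorem half_cancel {x y : R} (h : 2 * x = 2 * y) : x = y := by
  have h2 : (algebraMap ℝ R (1 / 2)) * 2 = 1 := by
    rw [← map_ofNat (algebraMap ℝ R) 2, ← map_mul]; norm_num
  linear_combination (algebraMap ℝ R (1 / 2)) * h - (x - y) * h2

theorem curv_swap (d : Fin n → Derivation ℝ R R) (C : Fin n → Fin n → Fin n → R)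
    (α β γ ρ : Fin n) : curv d C α β γ ρ = -curv d C β α γ ρ := by
  simp only [curv, Finset.sum_sub_distrib]; ring

theorem curvLow_swap (d : Fin n → Derivation ℝ R R) (G : Fin n → Fin n → R)
    (C : Fin n → Fin n → Fin n → R)
    (α β γ δ : Fin n) : curvLow d G C α β γ δ = -curvLow d G C β α γ δ := by
  simp only [curvLow, curv_swap d C α β, neg_mul, Finset.sum_neg_distrib]

/-- Nondegeneracy: a vector is determined by its lowered components. -/
theorem eq_of_lower_eq {R : Type*} [CommRing R] {G Gi : Fin n → Fin n → R}
    (h : ∀ α β, ∑ σ, Gi α σ * G σ β = if α = β then 1 else 0) {v w : Fin n → R}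
    (hv : ∀ δ, ∑ γ, G δ γ * v γ = ∑ γ, G δ γ * w γ) : v = w := by
  have key : ∀ v : Fin n → R, ∀ α, ∑ δ, Gi α δ * ∑ γ, G δ γ * v γ = v α := by
    intro v α
    simp only [Finset.mul_sum, ← mul_assoc]
    rw [Finset.sum_comm]
    simp only [← Finset.sum_mul, h]
    simp
  funext α
  rw [← key v α, ← key w α]
  simp only [hv]

variable {d : Fin 4 → Derivation ℝ R R} {G Gi : Fin 4 → Fin 4 → R} {Γ : Fin 4 → Fin 4 → Fin 4 → R}

/-- Differentiate the metric twice: when `∂g` is rewritten by compatibility, `[∂_α, ∂_β] g_{γδ} = 0`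
becomes the vanishing of the symmetric part of the lowered curvature. -/
theorem IsLeviCivita.curvLow_antisymm (h : IsLeviCivita d G Gi Γ)
    (hd : ∀ i j f, d i (d j f) = d j (d i f)) (α β γ δ : Fin 4) :
    curvLow d G Γ α β γ δ = -curvLow d G Γ α β δ γ := by
  have h1 := hd α β (G γ δ)
  simp only [h.compat, Fin.sum_univ_four, map_add, Derivation.leibniz, smul_eq_mul] at h1
  simp only [curvLow, curv, Fin.sum_univ_four]
  simp only [h.metric_symm 1 0, h.metric_symm 2 0, h.metric_symm 3 0, h.metric_symm 2 1,
    h.metric_symm 3 1, h.metric_symm 3 2] at h1 ⊢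
  linear_combination -h1

/-- For a symmetric connection all terms cancel in pairs; neither the metric nor commuting
derivations are needed. -/
theorem IsLeviCivita.curv_cyclic (h : IsLeviCivita d G Gi Γ) (α β γ ρ : Fin 4) :
    curv d Γ α β γ ρ + curv d Γ β γ α ρ + curv d Γ γ α β ρ = 0 := by
  simp only [curv, Fin.sum_univ_four, h.symm γ α, h.symm γ β, h.symm β α]
  ring

theorem IsLeviCivita.curvLow_cyclic (h : IsLeviCivita d G Gi Γ) (α β γ δ : Fin 4) :
    curvLow d G Γ α β γ δ + curvLow d G Γ β γ α δ + curvLow d G Γ γ α β δ = 0 := by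
  simp only [curvLow, ← Finset.sum_add_distrib, ← add_mul, h.curv_cyclic, zero_mul,
    Finset.sum_const_zero]

/-- The octahedron argument: four instances of the cyclic identity with alternating signs leave
twice the difference of the two sides, once the antisymmetries are used. -/
theorem IsLeviCivita.curvLow_pair (h : IsLeviCivita d G Gi Γ)
    (hd : ∀ i j f, d i (d j f) = d j (d i f)) (α β γ δ : Fin 4) :
    curvLow d G Γ α β γ δ = curvLow d G Γ γ δ α β := by
  have c := h.curvLow_cyclic
  have s := curvLow_swap d G Γ
  have t := h.curvLow_antisymm hd
  apply half_cancel
  linear_combination c α β γ δ - c δ α β γ + c β γ δ α - c γ δ α β + t δ α β γ + t α β δ γ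
    - t β γ δ α - t γ δ β α - s δ β γ α + t β δ γ α + s α γ δ β - t γ α δ β

/-- Contracting the cyclic identity expresses the antisymmetric part of the Ricci tensor by the
trace of the curvature over its last two indices. That trace is zero because the lowered curvature
is antisymmetric there. -/
theorem IsLeviCivita.ricci_symm (h : IsLeviCivita d G Gi Γ)
    (hd : ∀ i j f, d i (d j f) = d j (d i f)) (α γ : Fin 4) :
    ∑ μ, curv d Γ α μ γ μ = ∑ μ, curv d Γ γ μ α μ := by
  have tr : ∑ μ, curv d Γ γ α μ μ = 0 := by
    have e : ∀ μ, curv d Γ γ α μ μ = ∑ δ, curvLow d G Γ γ α μ δ * Gi δ μ := by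
      intro μ
      simp only [curvLow, Finset.sum_mul]
      rw [Finset.sum_comm]
      have : ∀ ρ, ∑ δ, curv d Γ γ α μ ρ * G ρ δ * Gi δ μ
          = curv d Γ γ α μ ρ * if μ = ρ then 1 else 0 := by
        intro ρ
        rw [← h.inv_mul, Finset.mul_sum]
        exact Finset.sum_congr rfl fun δ _ => by
          rw [h.inv_symm μ δ, h.metric_symm ρ δ]; ring
      simp [this]
    apply half_cancel
    simp only [e]
    rw [two_mul]
    nth_rewrite 2 [Finset.sum_comm]
    rw [← Finset.sum_add_distrib, mul_zero]
    refine Finset.sum_eq_zero fun μ _ => ?_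
    rw [← Finset.sum_add_distrib]
    refine Finset.sum_eq_zero fun δ _ => ?_
    rw [h.inv_symm δ μ, h.curvLow_antisymm hd]
    ring
  have : ∑ μ, curv d Γ α μ γ μ - ∑ μ, curv d Γ γ μ α μ = -∑ μ, curv d Γ γ α μ μ := by
    rw [← Finset.sum_sub_distrib, ← Finset.sum_neg_distrib]
    refine Finset.sum_congr rfl fun μ _ => ?_
    linear_combination h.curv_cyclic α μ γ μ - curv_swap d Γ γ μ α μ
  rw [tr, neg_zero] at this
  exact sub_eq_zero.mp this

/-- Ricci identity for vector fields. -/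
theorem IsLeviCivita.ricci_identity (h : IsLeviCivita d G Gi Γ)
    (hd : ∀ i j f, d i (d j f) = d j (d i f)) (Y : Fin 4 → R) (α β ρ : Fin 4) :
    covEnd d Γ (covVec d Γ Y) β α ρ - covEnd d Γ (covVec d Γ Y) α β ρ
      = ∑ γ, curv d Γ α β γ ρ * Y γ := by
  simp only [covEnd, covVec, curv, Fin.sum_univ_four, map_add, Derivation.leibniz, smul_eq_mul,
    h.symm β α, hd β α]
  ring

end DifferentialRing

end EinsteinCartan

end

noncomputable section

namespace EinsteinCartan

/-! ### Product rules for covariant derivatives -/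

section ProductRules

variable {R : Type*} [CommRing R] {n : ℕ}

/-- The Kronecker symbol with values in a ring. -/
def kron (α β : Fin n) : R := if α = β then 1 else 0

/-- Lowering an index. -/
def lower (G : Fin n → Fin n → R) (Y : Fin n → R) (α : Fin n) : R := ∑ β, G α β * Y β

@[simp] theorem sum_kron_mul (α : Fin n) (f : Fin n → R) : ∑ σ, kron α σ * f σ = f α := by
  simp [kron]

@[simp] theorem sum_mul_kron (α : Fin n) (f : Fin n → R) : ∑ σ, f σ * kron σ α = f α := by
  simp [kron]

@[simp] theorem sum_kron_mul' (α : Fin n) (f : Fin n → R) : ∑ σ, kron σ α * f σ = f α := by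
  simp [kron]

@[simp] theorem sum_mul_kron' (α : Fin n) (f : Fin n → R) : ∑ σ, f σ * kron α σ = f α := by
  simp [kron]

theorem kron_comm (α β : Fin n) : (kron α β : R) = kron β α := by
  simp [kron, eq_comm]

variable [Algebra ℝ R]

/-- Covariant derivative `∇_μ w_α`. -/
def covOne (d : Fin n → Derivation ℝ R R) (C : Fin n → Fin n → Fin n → R) (w : Fin n → R)
    (μ α : Fin n) : R :=
  d μ (w α) - ∑ σ, C μ α σ * w σ

@[simp] theorem map_kron (D : Derivation ℝ R R) (α β : Fin n) : D (kron α β) = 0 := by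
  unfold kron; split_ifs <;> simp

variable (d : Fin n → Derivation ℝ R R) (C : Fin n → Fin n → Fin n → R)

theorem covEnd_kron (μ α ρ : Fin n) : covEnd d C kron μ α ρ = 0 := by
  simp [covEnd]

theorem covEnd_add (S T : Fin n → Fin n → R) (μ α ρ : Fin n) :
    covEnd d C (fun α ρ => S α ρ + T α ρ) μ α ρ = covEnd d C S μ α ρ + covEnd d C T μ α ρ := by
  simp only [covEnd, map_add, mul_add, Finset.sum_add_distrib]; ring

theorem covEnd_mul (f : R) (T : Fin n → Fin n → R) (μ α ρ : Fin n) :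
    covEnd d C (fun α ρ => f * T α ρ) μ α ρ = d μ f * T α ρ + f * covEnd d C T μ α ρ := by
  simp only [covEnd, Derivation.leibniz, smul_eq_mul, mul_left_comm _ f, ← Finset.mul_sum]; ring

theorem covEnd_outer (v Y : Fin n → R) (μ α ρ : Fin n) :
    covEnd d C (fun α ρ => v α * Y ρ) μ α ρ = covOne d C v μ α * Y ρ + v α * covVec d C Y μ ρ := by
  simp only [covEnd, covOne, covVec, Derivation.leibniz, smul_eq_mul, mul_add, mul_sub,
    Finset.mul_sum, mul_comm, mul_left_comm]; ring

theorem covVec_mul (f : R) (Y : Fin n → R) (μ ρ : Fin n) :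
    covVec d C (fun ρ => f * Y ρ) μ ρ = d μ f * Y ρ + f * covVec d C Y μ ρ := by
  simp only [covVec, Derivation.leibniz, smul_eq_mul, mul_left_comm _ f, ← Finset.mul_sum]; ring

theorem covThree_add (S T : Fin n → Fin n → Fin n → R) (μ α β ρ : Fin n) :
    covThree d C (fun α β ρ => S α β ρ + T α β ρ) μ α β ρ
      = covThree d C S μ α β ρ + covThree d C T μ α β ρ := by
  simp only [covThree, map_add, mul_add, Finset.sum_add_distrib]; ring

theorem covThree_two_vec (A : Fin n → Fin n → R) (Y : Fin n → R) (μ α β ρ : Fin n) :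
    covThree d C (fun α β ρ => A α β * Y ρ) μ α β ρ
      = covTwo d C A μ α β * Y ρ + A α β * covVec d C Y μ ρ := by
  simp only [covThree, covTwo, covVec, Derivation.leibniz, smul_eq_mul, mul_add, mul_sub,
    Finset.mul_sum, mul_comm, mul_left_comm]; ring

theorem covThree_end_one (T : Fin n → Fin n → R) (v : Fin n → R) (μ α β ρ : Fin n) :
    covThree d C (fun α β ρ => T α ρ * v β) μ α β ρ
      = covEnd d C T μ α ρ * v β + T α ρ * covOne d C v μ β := by
  simp only [covThree, covEnd, covOne, Derivation.leibniz, smul_eq_mul, mul_add, mul_sub,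
    Finset.mul_sum, mul_comm, mul_left_comm]; ring

theorem covThree_end_one' (T : Fin n → Fin n → R) (v : Fin n → R) (μ α β ρ : Fin n) :
    covThree d C (fun α β ρ => T β ρ * v α) μ α β ρ
      = covEnd d C T μ β ρ * v α + T β ρ * covOne d C v μ α := by
  simp only [covThree, covEnd, covOne, Derivation.leibniz, smul_eq_mul, mul_add, mul_sub,
    Finset.mul_sum, mul_comm, mul_left_comm]; ring

/-- Leibniz rule for the contraction of a covector with a vector. -/
theorem d_contract (v Y : Fin n → R) (μ : Fin n) :
    d μ (∑ α, v α * Y α) = ∑ α, (covOne d C v μ α * Y α + v α * covVec d C Y μ α) := by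
  simp only [covOne, covVec, map_sum, Derivation.leibniz, smul_eq_mul, sub_mul, mul_add,
    Finset.sum_add_distrib, Finset.sum_sub_distrib, Finset.sum_mul, Finset.mul_sum]
  have : ∑ α, ∑ σ, C μ α σ * v σ * Y α = ∑ α, ∑ σ, v α * (C μ σ α * Y σ) := by
    rw [Finset.sum_comm]
    exact Finset.sum_congr rfl fun _ _ => Finset.sum_congr rfl fun _ _ => by ring
  rw [this]
  simp only [mul_comm (Y _)]
  ring

/-- Leibniz rule for the contraction of a 2-tensor with a vector. -/
theorem covOne_contract_two (A : Fin n → Fin n → R) (Y : Fin n → R) (μ α : Fin n) :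
    covOne d C (fun α => ∑ β, A α β * Y β) μ α
      = ∑ β, (covTwo d C A μ α β * Y β + A α β * covVec d C Y μ β) := by
  have h1 := d_contract d C (fun β => A α β) Y μ
  simp only [covOne, covTwo, sub_mul, Finset.sum_add_distrib, Finset.sum_sub_distrib] at h1 ⊢
  rw [h1]
  have : ∑ σ, C μ α σ * ∑ β, A σ β * Y β = ∑ β, (∑ σ, C μ α σ * A σ β) * Y β := by
    simp only [Finset.mul_sum, Finset.sum_mul]
    rw [Finset.sum_comm]
    exact Finset.sum_congr rfl fun _ _ => Finset.sum_congr rfl fun _ _ => by ring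
  rw [this]
  ring

/-- Leibniz rule for lowering an index of an endomorphism. -/
theorem covTwo_contract_end (A T : Fin n → Fin n → R) (μ α β : Fin n) :
    covTwo d C (fun α β => ∑ γ, A α γ * T β γ) μ α β
      = ∑ γ, (covTwo d C A μ α γ * T β γ + A α γ * covEnd d C T μ β γ) := by
  have h1 := covOne_contract_two d C A (fun γ => T β γ) μ α
  simp only [covOne, covTwo, covVec, covEnd, mul_add, mul_sub, Finset.sum_add_distrib,
    Finset.sum_sub_distrib] at h1 ⊢
  have : ∑ σ, C μ β σ * ∑ γ, A α γ * T σ γ = ∑ γ, A α γ * ∑ σ, C μ β σ * T σ γ := by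
    simp only [Finset.mul_sum]
    rw [Finset.sum_comm]
    exact Finset.sum_congr rfl fun _ _ => Finset.sum_congr rfl fun _ _ => by ring
  rw [this, h1]
  ring

variable {d C} {G Gi : Fin n → Fin n → R}

theorem IsLeviCivita.covTwo_metric (h : IsLeviCivita d G Gi C) (μ α β : Fin n) :
    covTwo d C G μ α β = 0 := by
  simp only [covTwo, h.compat, h.metric_symm α]
  ring

theorem IsLeviCivita.covOne_lower (h : IsLeviCivita d G Gi C) (Y : Fin n → R) (μ α : Fin n) :
    covOne d C (lower G Y) μ α = ∑ ρ, G α ρ * covVec d C Y μ ρ := by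
  have := covOne_contract_two d C G Y μ α
  simp only [h.covTwo_metric, zero_mul, zero_add] at this
  exact this

/-- Leibniz rule for the inner product. -/
theorem IsLeviCivita.d_inner (h : IsLeviCivita d G Gi C) (Y Z : Fin n → R) (μ : Fin n) :
    d μ (∑ α, lower G Y α * Z α)
      = ∑ α, lower G Z α * covVec d C Y μ α + ∑ α, lower G Y α * covVec d C Z μ α := by
  rw [d_contract d C, Finset.sum_add_distrib]
  congr 1
  simp only [h.covOne_lower, lower, Finset.sum_mul]
  rw [Finset.sum_comm]
  exact Finset.sum_congr rfl fun _ _ => Finset.sum_congr rfl fun _ _ => by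
    rw [h.metric_symm]; ring

end ProductRules

/-! ### Shear-free, irrotational, geodesic congruences with homogeneous expansion -/

section HubbleFlow

variable {R : Type*} [CommRing R] [Algebra ℝ R]

/-- A unit timelike vector field `u` with `∇_μ u^ρ = H h_μ^ρ`, where the gradient of `H` is parallel
to `u`. -/
structure IsHubbleFlow (d : Fin 4 → Derivation ℝ R R) (G Gi : Fin 4 → Fin 4 → R)
    (Γ : Fin 4 → Fin 4 → Fin 4 → R) (u : Fin 4 → R) (H Hd : R) : Prop where
  comm : ∀ i j f, d i (d j f) = d j (d i f)
  lc : IsLeviCivita d G Gi Γ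
  unit : ∑ α, lower G u α * u α = -1
  nabla : ∀ μ ρ, covVec d Γ u μ ρ = H * (kron μ ρ + lower G u μ * u ρ)
  grad : ∀ μ, d μ H = -(Hd * lower G u μ)

variable {d : Fin 4 → Derivation ℝ R R} {G Gi : Fin 4 → Fin 4 → R} {Γ : Fin 4 → Fin 4 → Fin 4 → R}
  {u : Fin 4 → R} {H Hd : R}

namespace IsHubbleFlow

theorem covOne_lower_u (h : IsHubbleFlow d G Gi Γ u H Hd) (μ α : Fin 4) :
    covOne d Γ (lower G u) μ α = H * (G μ α + lower G u μ * lower G u α) := by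
  rw [h.lc.covOne_lower]
  simp only [h.nabla]
  have : ∀ ρ, G α ρ * (H * (kron μ ρ + lower G u μ * u ρ))
      = H * (G α ρ * kron μ ρ) + H * lower G u μ * (G α ρ * u ρ) := fun ρ => by ring
  simp only [this, Finset.sum_add_distrib, ← Finset.mul_sum, sum_mul_kron']
  rw [h.lc.metric_symm α μ]
  simp only [lower]
  ring

theorem covEnd_nabla_u (h : IsHubbleFlow d G Gi Γ u H Hd) (μ α ρ : Fin 4) :
    covEnd d Γ (covVec d Γ u) μ α ρ = -(Hd * lower G u μ) * (kron α ρ + lower G u α * u ρ)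
      + H * (H * (G μ α + lower G u μ * lower G u α) * u ρ
        + lower G u α * (H * (kron μ ρ + lower G u μ * u ρ))) := by
  have e : covVec d Γ u = fun α ρ => H * (kron α ρ + lower G u α * u ρ) := by
    funext α ρ; exact h.nabla α ρ
  rw [e, covEnd_mul, covEnd_add, covEnd_kron, covEnd_outer, h.covOne_lower_u, h.nabla, h.grad,
    zero_add]

/-- Ricci identity for `∇u = H h`: the second derivatives of `u` contain only `H`, `Hd`, `u` and the
metric. -/
theorem curv_u (h : IsHubbleFlow d G Gi Γ u H Hd) (α β ρ : Fin 4) :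
    ∑ γ, curv d Γ α β γ ρ * u γ = (Hd + H ^ 2) *
      (lower G u α * (kron β ρ + lower G u β * u ρ)
        - lower G u β * (kron α ρ + lower G u α * u ρ)) := by
  rw [← h.lc.ricci_identity h.comm, h.covEnd_nabla_u, h.covEnd_nabla_u, h.lc.metric_symm β α]
  ring

theorem ricci_u (h : IsHubbleFlow d G Gi Γ u H Hd) (α : Fin 4) :
    ∑ γ, (∑ μ, curv d Γ α μ γ μ) * u γ = 3 * (H ^ 2 + Hd) * lower G u α := by
  have e : ∑ γ, (∑ μ, curv d Γ α μ γ μ) * u γ = ∑ μ, ∑ γ, curv d Γ α μ γ μ * u γ := by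
    simp only [Finset.sum_mul]; exact Finset.sum_comm
  rw [e]
  simp only [h.curv_u]
  have hu := h.unit
  have k1 : ∑ μ : Fin 4, (kron μ μ : R) = 4 := by simp [kron]
  have k2 : ∑ μ, lower G u μ * kron α μ = lower G u α := sum_mul_kron' _ _
  have : ∀ μ, (Hd + H ^ 2) * (lower G u α * (kron μ μ + lower G u μ * u μ)
        - lower G u μ * (kron α μ + lower G u α * u μ))
      = (Hd + H ^ 2) * lower G u α * kron μ μ - (Hd + H ^ 2) * (lower G u μ * kron α μ) :=
    fun μ => by ring
  simp only [this, Finset.sum_sub_distrib, ← Finset.mul_sum, k1, k2]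
  ring

/-- The rate of change of the expansion has its gradient parallel to `u`. -/
theorem grad_rate (h : IsHubbleFlow d G Gi Γ u H Hd) (μ : Fin 4) :
    d μ Hd = -((∑ ν, u ν * d ν Hd) * lower G u μ) := by
  -- Commuting second derivatives of `H` make the covector `Hd u_ν` closed. Since `∇u` is symmetric,
  -- `u_ν` is closed itself, and only `d Hd ∧ u = 0` survives.
  have key : ∀ μ ν, d μ Hd * lower G u ν = d ν Hd * lower G u μ := by
    intro μ ν
    have h1 := h.comm μ ν H
    simp only [h.grad, map_neg, Derivation.leibniz, smul_eq_mul] at h1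
    have c1 := h.covOne_lower_u μ ν
    have c2 := h.covOne_lower_u ν μ
    simp only [covOne, h.lc.symm ν μ] at c1 c2
    rw [h.lc.metric_symm ν μ] at c2
    linear_combination -h1 - Hd * c1 + Hd * c2
  have e : d μ Hd * ∑ ν, lower G u ν * u ν = ∑ ν, (u ν * d ν Hd) * lower G u μ := by
    rw [Finset.mul_sum]
    exact Finset.sum_congr rfl fun ν _ => by linear_combination u ν * key μ ν
  rw [h.unit, ← Finset.sum_mul] at e
  linear_combination -e

end IsHubbleFlow

end HubbleFlow

end EinsteinCartan

end

noncomputable section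

namespace EinsteinCartan

/-! ### Curvature of the connection with spin torsion -/

set_option linter.unusedSectionVars false

section SpinTorsion

variable {R : Type*} [CommRing R] [Algebra ℝ R]

theorem covVec_contract_end {n : ℕ} (d : Fin n → Derivation ℝ R R) (C : Fin n → Fin n → Fin n → R)
    (T : Fin n → Fin n → R) (Y : Fin n → R) (μ ρ : Fin n) :
    covVec d C (fun ρ => ∑ α, T α ρ * Y α) μ ρ
      = ∑ α, (covEnd d C T μ α ρ * Y α + T α ρ * covVec d C Y μ α) := by
  have h1 := d_contract d C (fun α => T α ρ) Y μ
  simp only [covOne, covEnd, covVec, sub_mul, add_mul, Finset.sum_add_distrib,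
    Finset.sum_sub_distrib] at h1 ⊢
  rw [h1]
  have : ∑ σ, C μ σ ρ * ∑ α, T α σ * Y α = ∑ α, (∑ σ, C μ σ ρ * T α σ) * Y α := by
    simp only [Finset.mul_sum, Finset.sum_mul]
    rw [Finset.sum_comm]
    exact Finset.sum_congr rfl fun _ _ => Finset.sum_congr rfl fun _ _ => by ring
  rw [this]
  ring

theorem d_trace_end {n : ℕ} (d : Fin n → Derivation ℝ R R) (C : Fin n → Fin n → Fin n → R)
    (T : Fin n → Fin n → R) (μ : Fin n) : d μ (∑ α, T α α) = ∑ α, covEnd d C T μ α α := by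
  simp only [covEnd, Finset.sum_add_distrib, Finset.sum_sub_distrib, map_sum]
  rw [Finset.sum_comm (f := fun α σ => C μ α σ * T σ α)]
  ring

theorem covTwo_antisymm {n : ℕ} {d : Fin n → Derivation ℝ R R} {C : Fin n → Fin n → Fin n → R}
    {A : Fin n → Fin n → R} (hA : ∀ α β, A α β = -A β α) (μ α β : Fin n) :
    covTwo d C A μ α β = -covTwo d C A μ β α := by
  simp only [covTwo]
  rw [hA α β, map_neg]
  simp only [hA α, hA _ β, mul_neg, Finset.sum_neg_distrib]
  ring

/-- The contorsion `K_{αβ}^γ` of the torsion `A_{αβ} u^γ`; here `a α γ = A^γ_α`. -/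
def spinContorsion (G A a : Fin 4 → Fin 4 → R) (u : Fin 4 → R) (α β γ : Fin 4) : R :=
  A α β * u γ + a α γ * lower G u β + a β γ * lower G u α

/-- `A` is an antisymmetric tensor orthogonal to `u`, and `a` is `A` with its first index raised. -/
structure IsSpin (G Gi A a : Fin 4 → Fin 4 → R) (u : Fin 4 → R) : Prop where
  antisymm : ∀ α β, A α β = -A β α
  orth : ∀ α, ∑ β, A α β * u β = 0
  raise : ∀ α γ, a α γ = ∑ δ, Gi γ δ * A δ α
  lowered : ∀ δ α, ∑ γ, G δ γ * a α γ = A δ α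

variable {d : Fin 4 → Derivation ℝ R R} {G Gi A a : Fin 4 → Fin 4 → R}
  {Γ : Fin 4 → Fin 4 → Fin 4 → R} {u : Fin 4 → R} {H Hd : R}

/-- The difference of two connections is a tensor, so the curvature changes by its exterior
covariant derivative and a commutator. Symmetry of `Γ` cancels the connection terms for the
antisymmetrised index pair. -/
theorem IsLeviCivita.curv_add (h : IsLeviCivita d G Gi Γ) (K : Fin 4 → Fin 4 → Fin 4 → R)
    (α β γ ρ : Fin 4) :
    curv d (fun α β γ => Γ α β γ + K α β γ) α β γ ρ = curv d Γ α β γ ρ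
      + covThree d Γ K β α γ ρ - covThree d Γ K α β γ ρ
      + ∑ σ, (K β σ ρ * K α γ σ - K α σ ρ * K β γ σ) := by
  simp only [curv, covThree, map_add, Fin.sum_univ_four, h.symm β α]
  ring

namespace IsSpin

theorem orth' (s : IsSpin G Gi A a u) (β : Fin 4) : ∑ α, u α * A α β = 0 := by
  have := s.orth β
  simp only [s.antisymm β, neg_mul, Finset.sum_neg_distrib, neg_eq_zero] at this
  simpa only [mul_comm] using this

theorem raise_orth_left (s : IsSpin G Gi A a u) (γ : Fin 4) : ∑ α, a α γ * u α = 0 := by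
  have : ∑ α, a α γ * u α = ∑ δ, Gi γ δ * ∑ α, A δ α * u α := by
    simp only [s.raise, Finset.sum_mul, Finset.mul_sum]
    rw [Finset.sum_comm]
    exact Finset.sum_congr rfl fun _ _ => Finset.sum_congr rfl fun _ _ => by ring
  simp [this, s.orth]

theorem raise_orth_right (h : IsLeviCivita d G Gi Γ) (s : IsSpin G Gi A a u) (α : Fin 4) :
    ∑ γ, lower G u γ * a α γ = 0 := by
  have : ∑ γ, lower G u γ * a α γ = ∑ δ, u δ * ∑ γ, G δ γ * a α γ := by
    simp only [lower, Finset.sum_mul, Finset.mul_sum]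
    rw [Finset.sum_comm]
    exact Finset.sum_congr rfl fun _ _ => Finset.sum_congr rfl fun _ _ => by
      rw [h.metric_symm]; ring
  simp [this, s.lowered, s.orth']

theorem trace_raise (h : IsLeviCivita d G Gi Γ) (s : IsSpin G Gi A a u) : ∑ α, a α α = 0 := by
  apply half_cancel
  rw [mul_zero, two_mul]
  simp only [s.raise]
  nth_rewrite 2 [Finset.sum_comm]
  rw [← Finset.sum_add_distrib]
  refine Finset.sum_eq_zero fun μ _ => ?_
  rw [← Finset.sum_add_distrib]
  refine Finset.sum_eq_zero fun δ _ => ?_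
  rw [h.inv_symm δ μ, s.antisymm]
  ring

/-- Both sides are entries of the symmetric matrix `A g⁻¹ A`. -/
theorem mul_raise_symm (h : IsLeviCivita d G Gi Γ) (s : IsSpin G Gi A a u) (α γ : Fin 4) :
    ∑ σ, A α σ * a γ σ = ∑ σ, A γ σ * a α σ := by
  simp only [s.raise, Finset.mul_sum]
  rw [Finset.sum_comm]
  refine Finset.sum_congr rfl fun σ _ => Finset.sum_congr rfl fun δ _ => ?_
  rw [h.inv_symm, s.antisymm α, s.antisymm γ]
  ring

/-- Differentiate `A_{αβ} u^β = 0` and insert `∇u = H h`. -/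
theorem cov_orth (h : IsHubbleFlow d G Gi Γ u H Hd) (s : IsSpin G Gi A a u) (μ α : Fin 4) :
    ∑ β, covTwo d Γ A μ α β * u β = -(H * A α μ) := by
  have e := covOne_contract_two d Γ A u μ α
  simp only [s.orth, h.nabla, Finset.sum_add_distrib] at e
  have : ∀ β, A α β * (H * (kron μ β + lower G u μ * u β))
      = H * (A α β * kron μ β) + H * lower G u μ * (A α β * u β) := fun β => by ring
  simp only [this, Finset.sum_add_distrib, ← Finset.mul_sum, s.orth, sum_mul_kron'] at e
  simp [covOne] at e
  linear_combination -e

theorem cov_raise_lower (h : IsLeviCivita d G Gi Γ) (s : IsSpin G Gi A a u) (μ δ α : Fin 4) :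
    ∑ γ, G δ γ * covEnd d Γ a μ α γ = covTwo d Γ A μ δ α := by
  have e := covTwo_contract_end d Γ G a μ δ α
  simp only [s.lowered, h.covTwo_metric, zero_mul, zero_add] at e
  exact e.symm

theorem cov_raise_orth_right (h : IsHubbleFlow d G Gi Γ u H Hd) (s : IsSpin G Gi A a u)
    (μ α : Fin 4) : ∑ γ, lower G u γ * covEnd d Γ a μ α γ = H * A α μ := by
  have : ∑ γ, lower G u γ * covEnd d Γ a μ α γ = ∑ δ, u δ * ∑ γ, G δ γ * covEnd d Γ a μ α γ := by
    simp only [lower, Finset.sum_mul, Finset.mul_sum]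
    rw [Finset.sum_comm]
    exact Finset.sum_congr rfl fun _ _ => Finset.sum_congr rfl fun _ _ => by
      rw [h.lc.metric_symm]; ring
  rw [this]
  simp only [cov_raise_lower h.lc s, covTwo_antisymm s.antisymm μ _ α, mul_neg,
    Finset.sum_neg_distrib]
  have e := cov_orth h s μ α
  simp only [mul_comm (u _)]
  rw [e, neg_neg]

theorem cov_raise_orth_left (h : IsHubbleFlow d G Gi Γ u H Hd) (s : IsSpin G Gi A a u)
    (μ γ : Fin 4) : ∑ α, covEnd d Γ a μ α γ * u α = -(H * a μ γ) := by
  have e := covVec_contract_end d Γ a u μ γ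
  simp only [s.raise_orth_left, h.nabla, Finset.sum_add_distrib] at e
  have : ∀ α, a α γ * (H * (kron μ α + lower G u μ * u α))
      = H * (a α γ * kron μ α) + H * lower G u μ * (a α γ * u α) := fun α => by ring
  simp only [this, Finset.sum_add_distrib, ← Finset.mul_sum, s.raise_orth_left,
    sum_mul_kron'] at e
  simp [covVec] at e
  linear_combination -e

theorem covThree_contorsion (h : IsHubbleFlow d G Gi Γ u H Hd) (β α γ ρ : Fin 4) :
    covThree d Γ (spinContorsion G A a u) β α γ ρ =
      covTwo d Γ A β α γ * u ρ + A α γ * (H * (kron β ρ + lower G u β * u ρ))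
      + (covEnd d Γ a β α ρ * lower G u γ + a α ρ * (H * (G β γ + lower G u β * lower G u γ)))
      + (covEnd d Γ a β γ ρ * lower G u α + a γ ρ * (H * (G β α + lower G u β * lower G u α))) := by
  have e : spinContorsion G A a u = fun α β γ =>
    (A α β * u γ + a α γ * lower G u β) + a β γ * lower G u α := rfl
  rw [e, covThree_add d Γ (fun α β γ => A α β * u γ + a α γ * lower G u β),
    covThree_add d Γ (fun α β γ => A α β * u γ), covThree_two_vec, covThree_end_one,
    covThree_end_one', h.covOne_lower_u, h.covOne_lower_u, h.nabla]

/-- Each term is a contraction of `A` or `a` with `u`, or the trace of `a`. As a consequence,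
divergences of vector fields do not see the torsion. -/
theorem contorsion_trace (h : IsLeviCivita d G Gi Γ) (s : IsSpin G Gi A a u) (σ : Fin 4) :
    ∑ μ, spinContorsion G A a u μ σ μ = 0 := by
  have h1 := s.orth' σ
  have h2 := trace_raise h s
  have h3 := raise_orth_right h s σ
  simp only [spinContorsion, Fin.sum_univ_four] at *
  linear_combination h1 + lower G u σ * h2 + h3

/-- The Ricci tensor of the connection with spin torsion. -/
theorem ricci_contorsion (h : IsHubbleFlow d G Gi Γ u H Hd) (s : IsSpin G Gi A a u)
    (α γ : Fin 4) :
    ∑ μ, curv d (fun α β γ => Γ α β γ + spinContorsion G A a u α β γ) α μ γ μ =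
      ∑ μ, curv d Γ α μ γ μ + ∑ μ, u μ * covTwo d Γ A μ α γ + 3 * H * A α γ
      + (∑ μ, covEnd d Γ a μ α μ) * lower G u γ + (∑ μ, covEnd d Γ a μ γ μ) * lower G u α
      - (∑ μ, ∑ σ, a μ σ * a σ μ) * (lower G u α * lower G u γ) := by
  simp only [h.lc.curv_add, covThree_contorsion h, Finset.sum_add_distrib, Finset.sum_sub_distrib]
  have tr := contorsion_trace h.lc s
  -- Of the two quadratic terms, this one contains the trace of the contorsion.
  have q1 : ∑ μ, ∑ σ, spinContorsion G A a u μ σ μ * spinContorsion G A a u α γ σ = 0 := by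
    rw [Finset.sum_comm]
    simp only [← Finset.sum_mul, tr, zero_mul, Finset.sum_const_zero]
  -- In the other quadratic term orthogonality to `u` removes most products. The two products of `A`
  -- with `a` cancel by `mul_raise_symm`, and only the square of `a` is left.
  have q2 : ∑ μ, ∑ σ, spinContorsion G A a u α σ μ * spinContorsion G A a u μ γ σ =
      (∑ μ, ∑ σ, a μ σ * a σ μ) * (lower G u α * lower G u γ) := by
    have f1 := s.orth α
    have f1' := s.orth' γ
    have f2 := fun α => raise_orth_right h.lc s α
    have f3 := fun α => s.raise_orth_left α
    have f4 := mul_raise_symm h.lc s α γ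
    have f5 := h.unit
    have f6 : ∑ μ, a α μ * A μ γ = -∑ μ, A γ μ * a α μ := by
      rw [← Finset.sum_neg_distrib]
      exact Finset.sum_congr rfl fun μ _ => by rw [s.antisymm μ γ]; ring
    have f2α := f2 α
    have f2γ := f2 γ
    have e : ∀ μ σ, spinContorsion G A a u α σ μ * spinContorsion G A a u μ γ σ =
        (A α σ * u σ) * (u μ * A μ γ) + A α σ * (a μ σ * u μ) * lower G u γ
        + (A α σ * a γ σ) * (lower G u μ * u μ)
        + (a α μ * A μ γ) * (lower G u σ * u σ) + a α μ * (lower G u σ * a μ σ) * lower G u γ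
        + (lower G u σ * a γ σ) * (lower G u μ * a α μ)
        + a σ μ * u σ * A μ γ * lower G u α + a μ σ * a σ μ * (lower G u α * lower G u γ)
        + (lower G u μ * a σ μ) * (a γ σ * lower G u α) := by
      intro μ σ
      simp only [spinContorsion]
      ring
    simp only [e, Finset.sum_add_distrib]
    have t1 : ∑ μ, ∑ σ, (A α σ * u σ) * (u μ * A μ γ) = 0 := by
      simp only [← Finset.sum_mul, f1, zero_mul, Finset.sum_const_zero]
    have t2 : ∑ μ, ∑ σ, A α σ * (a μ σ * u μ) * lower G u γ = 0 := by
      rw [Finset.sum_comm]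
      simp only [← Finset.sum_mul, ← Finset.mul_sum, f3, zero_mul, mul_zero, Finset.sum_const_zero]
    have t3 : ∑ μ, ∑ σ, (A α σ * a γ σ) * (lower G u μ * u μ) = -∑ σ, A α σ * a γ σ := by
      simp only [← Finset.sum_mul, ← Finset.mul_sum, f5]; ring
    have t4 : ∑ μ, ∑ σ, (a α μ * A μ γ) * (lower G u σ * u σ) = ∑ σ, A γ σ * a α σ := by
      simp only [← Finset.sum_mul, ← Finset.mul_sum, f5, f6]; ring
    have t5 : ∑ μ, ∑ σ, a α μ * (lower G u σ * a μ σ) * lower G u γ = 0 := by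
      simp only [← Finset.sum_mul, ← Finset.mul_sum, f2, zero_mul, mul_zero, Finset.sum_const_zero]
    have t6 : ∑ μ, ∑ σ, (lower G u σ * a γ σ) * (lower G u μ * a α μ) = 0 := by
      simp only [← Finset.sum_mul, f2, zero_mul, Finset.sum_const_zero]
    have t7 : ∑ μ, ∑ σ, a σ μ * u σ * A μ γ * lower G u α = 0 := by
      simp only [← Finset.sum_mul, f3, zero_mul, Finset.sum_const_zero]
    have t8 : ∑ μ, ∑ σ, (lower G u μ * a σ μ) * (a γ σ * lower G u α) = 0 := by
      rw [Finset.sum_comm]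
      simp only [← Finset.sum_mul, f2, zero_mul, Finset.sum_const_zero]
    rw [t1, t2, t3, t4, t5, t6, t7, t8, f4]
    simp only [Finset.sum_mul]
    ring
  rw [q1, q2]
  -- Among the terms of the form `H A` only this trace survives; those computed after it vanish or
  -- cancel in pairs by antisymmetry.
  have g1 : ∑ μ, A α γ * (H * (kron μ μ + lower G u μ * u μ)) = 3 * H * A α γ := by
    have k1 : ∑ μ : Fin 4, (kron μ μ : R) = 4 := by simp [kron]
    simp only [← Finset.mul_sum, Finset.sum_add_distrib, k1, h.unit]
    ring
  have gg : ∀ α γ, ∑ μ, a α μ * (H * (G μ γ + lower G u μ * lower G u γ)) = H * A γ α := by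
    intro α γ
    have : ∀ μ, a α μ * (H * (G μ γ + lower G u μ * lower G u γ))
        = H * (G γ μ * a α μ) + H * lower G u γ * (lower G u μ * a α μ) := fun μ => by
      rw [h.lc.metric_symm γ μ]; ring
    simp only [this, Finset.sum_add_distrib, ← Finset.mul_sum, s.lowered,
      raise_orth_right h.lc s]
    ring
  have g2 : ∑ μ, covTwo d Γ A α μ γ * u μ = H * A γ α := by
    simp only [covTwo_antisymm s.antisymm α _ γ, neg_mul, Finset.sum_neg_distrib, cov_orth h s]
    ring
  have g3 : ∑ μ, A μ γ * (H * (kron α μ + lower G u α * u μ)) = H * A α γ := by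
    have : ∀ μ, A μ γ * (H * (kron α μ + lower G u α * u μ))
        = H * (A μ γ * kron α μ) + H * lower G u α * (u μ * A μ γ) := fun μ => by ring
    simp only [this, Finset.sum_add_distrib, ← Finset.mul_sum, s.orth', sum_mul_kron']
    ring
  have g4 : ∑ μ, covEnd d Γ a α μ μ * lower G u γ = 0 := by
    rw [← Finset.sum_mul, ← d_trace_end, trace_raise h.lc s, map_zero, zero_mul]
  have g5 : ∑ μ, a μ μ * (H * (G α γ + lower G u α * lower G u γ)) = 0 := by
    rw [← Finset.sum_mul, trace_raise h.lc s, zero_mul]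
  have g6 : ∑ μ, covEnd d Γ a α γ μ * lower G u μ = H * A γ α := by
    simp only [mul_comm _ (lower G u _), cov_raise_orth_right h s]
  have g7 : ∑ μ, a γ μ * (H * (G α μ + lower G u α * lower G u μ)) = H * A α γ := by
    rw [← gg]
    exact Finset.sum_congr rfl fun μ _ => by rw [h.lc.metric_symm α μ]; ring
  rw [g1, g2, g3, g4, g5, g6, g7, gg, gg]
  simp only [← Finset.sum_mul, mul_comm (u _)]
  rw [s.antisymm γ α]
  ring

theorem square_raise_lower (h : IsLeviCivita d G Gi Γ) (s : IsSpin G Gi A a u) (β ν : Fin 4) :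
    ∑ ρ, (∑ σ, a β σ * a σ ρ) * G ρ ν = ∑ σ, a β σ * A ν σ := by
  simp only [Finset.sum_mul]
  rw [Finset.sum_comm]
  refine Finset.sum_congr rfl fun σ _ => ?_
  rw [← s.lowered, Finset.mul_sum]
  exact Finset.sum_congr rfl fun ρ _ => by rw [h.metric_symm ρ ν]; ring

/-- The contraction of the curvature of the connection with spin torsion with `u`, up to terms
that are longitudinal in the last two indices. -/
theorem curvLow_contorsion_u (h : IsHubbleFlow d G Gi Γ u H Hd) (s : IsSpin G Gi A a u)
    (hA : ∀ α β, ∑ μ, u μ * covTwo d Γ A μ α β = -(3 * H * A α β)) :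
    ∃ X Y : Fin 4 → Fin 4 → R, ∀ β μ ν,
      ∑ δ, curvLow d G (fun α β γ => Γ α β γ + spinContorsion G A a u α β γ) β δ μ ν * u δ =
        -covTwo d Γ A β μ ν + 3 * H * lower G u β * A μ ν
          + lower G u μ * X β ν + Y β μ * lower G u ν := by
  -- The metric is parallel, so the transport law of `A` along `u` passes to `a`; the comparison is
  -- made after lowering the index.
  have ha : ∀ α γ, ∑ μ, u μ * covEnd d Γ a μ α γ = -(3 * H * a α γ) := by
    intro α γ
    refine congrFun (eq_of_lower_eq h.lc.inv_mul (v := fun γ => ∑ μ, u μ * covEnd d Γ a μ α γ)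
      (w := fun γ => -(3 * H * a α γ)) fun δ => ?_) γ
    have e1 : ∑ γ, G δ γ * ∑ μ, u μ * covEnd d Γ a μ α γ
        = ∑ μ, u μ * ∑ γ, G δ γ * covEnd d Γ a μ α γ := by
      simp only [Finset.mul_sum]
      rw [Finset.sum_comm]
      exact Finset.sum_congr rfl fun _ _ => Finset.sum_congr rfl fun _ _ => by ring
    have e2 : ∑ γ, G δ γ * -(3 * H * a α γ) = -(3 * H) * ∑ γ, G δ γ * a α γ := by
      rw [Finset.mul_sum]
      exact Finset.sum_congr rfl fun _ _ => by ring
    rw [e1, e2]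
    simp only [cov_raise_lower h.lc s, hA, s.lowered]
    ring
  have hu := h.unit
  have mixed : ∀ β μ ρ,
      ∑ δ, curv d (fun α β γ => Γ α β γ + spinContorsion G A a u α β γ) β δ μ ρ * u δ =
        ∑ δ, curv d Γ β δ μ ρ * u δ + covEnd d Γ a β μ ρ - 3 * H * lower G u β * a μ ρ
        + lower G u μ * (-(2 * H * a β ρ) - ∑ σ, a β σ * a σ ρ)
        + (∑ σ, A β σ * a μ σ - 2 * H * A β μ) * u ρ := by
    intro β μ ρ
    have c1 : ∑ δ, covThree d Γ (spinContorsion G A a u) δ β μ ρ * u δ =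
        -(3 * H * A β μ) * u ρ - 3 * H * a β ρ * lower G u μ - 3 * H * a μ ρ * lower G u β := by
      have e : ∀ δ, covThree d Γ (spinContorsion G A a u) δ β μ ρ * u δ =
          (u δ * covTwo d Γ A δ β μ) * u ρ + A β μ * H * (kron δ ρ * u δ)
          + A β μ * H * u ρ * (lower G u δ * u δ)
          + (u δ * covEnd d Γ a δ β ρ) * lower G u μ + a β ρ * H * (G δ μ * u δ)
          + a β ρ * H * lower G u μ * (lower G u δ * u δ)
          + (u δ * covEnd d Γ a δ μ ρ) * lower G u β + a μ ρ * H * (G δ β * u δ)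
          + a μ ρ * H * lower G u β * (lower G u δ * u δ) := fun δ => by
        rw [covThree_contorsion h]; ring
      have l1 : ∀ μ, ∑ δ, G δ μ * u δ = lower G u μ := fun μ =>
        Finset.sum_congr rfl fun δ _ => by rw [h.lc.metric_symm]
      simp only [e, Finset.sum_add_distrib, ← Finset.sum_mul, ← Finset.mul_sum, hA, ha, hu, l1,
        sum_kron_mul']
      ring
    have c2 : ∑ δ, covThree d Γ (spinContorsion G A a u) β δ μ ρ * u δ =
        H * A μ β * u ρ - H * a β ρ * lower G u μ - covEnd d Γ a β μ ρ := by
      have l1 : ∑ δ, G β δ * u δ = lower G u β := rfl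
      have l2 : ∑ δ, covTwo d Γ A β δ μ * u δ = H * A μ β := by
        simp only [covTwo_antisymm s.antisymm β _ μ, neg_mul, Finset.sum_neg_distrib, cov_orth h s]
        ring
      have l3 : ∑ δ, A δ μ * u δ = 0 := by simpa only [mul_comm] using s.orth' μ
      have e : ∀ δ, covThree d Γ (spinContorsion G A a u) β δ μ ρ * u δ =
          (covTwo d Γ A β δ μ * u δ) * u ρ + (A δ μ * u δ) * (H * (kron β ρ + lower G u β * u ρ))
          + (covEnd d Γ a β δ ρ * u δ) * lower G u μ
          + (a δ ρ * u δ) * (H * (G β μ + lower G u β * lower G u μ))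
          + covEnd d Γ a β μ ρ * (lower G u δ * u δ) + a μ ρ * H * (G β δ * u δ)
          + a μ ρ * H * lower G u β * (lower G u δ * u δ) := fun δ => by
        rw [covThree_contorsion h]; ring
      simp only [e, Finset.sum_add_distrib, ← Finset.sum_mul, ← Finset.mul_sum, hu, l1, l2, l3,
        s.raise_orth_left, cov_raise_orth_left h s]
      ring
    have ku : ∀ σ ρ, ∑ δ, spinContorsion G A a u δ σ ρ * u δ = -a σ ρ := by
      intro σ ρ
      have l3 : ∑ δ, A δ σ * u δ = 0 := by simpa only [mul_comm] using s.orth' σ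
      have e : ∀ δ, spinContorsion G A a u δ σ ρ * u δ = (A δ σ * u δ) * u ρ
          + (a δ ρ * u δ) * lower G u σ + a σ ρ * (lower G u δ * u δ) := fun δ => by
        rw [spinContorsion]; ring
      simp only [e, Finset.sum_add_distrib, ← Finset.sum_mul, ← Finset.mul_sum, hu, l3,
        s.raise_orth_left]
      ring
    have c3 : ∑ δ, (∑ σ, (spinContorsion G A a u δ σ ρ * spinContorsion G A a u β μ σ
          - spinContorsion G A a u β σ ρ * spinContorsion G A a u δ μ σ)) * u δ =
        ∑ σ, A β σ * a μ σ * u ρ - lower G u μ * ∑ σ, a β σ * a σ ρ := by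
      have e : ∑ δ, (∑ σ, (spinContorsion G A a u δ σ ρ * spinContorsion G A a u β μ σ
          - spinContorsion G A a u β σ ρ * spinContorsion G A a u δ μ σ)) * u δ =
          ∑ σ, ((∑ δ, spinContorsion G A a u δ σ ρ * u δ) * spinContorsion G A a u β μ σ
          - spinContorsion G A a u β σ ρ * ∑ δ, spinContorsion G A a u δ μ σ * u δ) := by
        simp only [Finset.sum_mul, Finset.mul_sum, Finset.sum_sub_distrib, sub_mul]
        congr 1 <;>
        · rw [Finset.sum_comm]
          exact Finset.sum_congr rfl fun _ _ => Finset.sum_congr rfl fun _ _ => by ring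
      rw [e]
      simp only [ku]
      have e2 : ∀ σ, -a σ ρ * spinContorsion G A a u β μ σ
            - spinContorsion G A a u β σ ρ * -a μ σ =
          -A β μ * (a σ ρ * u σ) - lower G u μ * (a β σ * a σ ρ)
          + A β σ * a μ σ * u ρ + a β ρ * (lower G u σ * a μ σ) := fun σ => by
        simp only [spinContorsion]; ring
      simp only [e2, Finset.sum_add_distrib, Finset.sum_sub_distrib, ← Finset.mul_sum,
        s.raise_orth_left, raise_orth_right h.lc s]
      ring
    have e : ∀ δ, curv d (fun α β γ => Γ α β γ + spinContorsion G A a u α β γ) β δ μ ρ * u δ =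
        curv d Γ β δ μ ρ * u δ + covThree d Γ (spinContorsion G A a u) δ β μ ρ * u δ
        - covThree d Γ (spinContorsion G A a u) β δ μ ρ * u δ
        + (∑ σ, (spinContorsion G A a u δ σ ρ * spinContorsion G A a u β μ σ
          - spinContorsion G A a u β σ ρ * spinContorsion G A a u δ μ σ)) * u δ := fun δ => by
      rw [h.lc.curv_add]; ring
    rw [Finset.sum_congr rfl fun δ _ => e δ, Finset.sum_add_distrib, Finset.sum_sub_distrib,
      Finset.sum_add_distrib, c1, c2, c3, s.antisymm μ β, ← Finset.sum_mul]
    ring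
  have low : ∀ (C : Fin 4 → Fin 4 → Fin 4 → R) β μ ν, ∑ δ, curvLow d G C β δ μ ν * u δ =
      ∑ ρ, (∑ δ, curv d C β δ μ ρ * u δ) * G ρ ν := by
    intro C β μ ν
    simp only [curvLow, Finset.sum_mul]
    rw [Finset.sum_comm]
    exact Finset.sum_congr rfl fun _ _ => Finset.sum_congr rfl fun _ _ => by ring
  have lowu : ∀ ν, ∑ ρ, u ρ * G ρ ν = lower G u ν := fun ν =>
    Finset.sum_congr rfl fun ρ _ => by rw [h.lc.metric_symm]; ring
  have lowa : ∀ μ ν, ∑ ρ, a μ ρ * G ρ ν = A ν μ := fun μ ν => by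
    rw [← s.lowered]
    exact Finset.sum_congr rfl fun ρ _ => by rw [h.lc.metric_symm]; ring
  have lowNa : ∀ β μ ν, ∑ ρ, covEnd d Γ a β μ ρ * G ρ ν = covTwo d Γ A β ν μ := fun β μ ν => by
    rw [← cov_raise_lower h.lc s]
    exact Finset.sum_congr rfl fun ρ _ => by rw [h.lc.metric_symm]; ring
  -- By pair symmetry the Levi-Civita part is `curv_u` with the index pairs exchanged, so every term
  -- has a factor `u_μ` or `u_ν`.
  have lc : ∀ β μ ν, ∑ ρ, (∑ δ, curv d Γ β δ μ ρ * u δ) * G ρ ν =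
      -((Hd + H ^ 2) * (lower G u μ * G ν β - lower G u ν * G μ β)) := by
    intro β μ ν
    have e1 : ∀ δ, curvLow d G Γ β δ μ ν * u δ = -∑ ρ, curv d Γ μ ν δ ρ * u δ * G ρ β := by
      intro δ
      rw [h.lc.curvLow_pair h.comm, h.lc.curvLow_antisymm h.comm, curvLow, neg_mul, Finset.sum_mul]
      exact congrArg Neg.neg (Finset.sum_congr rfl fun _ _ => by ring)
    rw [← low]
    simp only [e1, Finset.sum_neg_distrib]
    rw [Finset.sum_comm]
    simp only [← Finset.sum_mul, h.curv_u]
    have e2 : ∀ ρ, (Hd + H ^ 2) * (lower G u μ * (kron ν ρ + lower G u ν * u ρ)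
          - lower G u ν * (kron μ ρ + lower G u μ * u ρ)) * G ρ β =
        (Hd + H ^ 2) * lower G u μ * (kron ν ρ * G ρ β)
          - (Hd + H ^ 2) * lower G u ν * (kron μ ρ * G ρ β) := fun ρ => by ring
    simp only [e2, Finset.sum_sub_distrib, ← Finset.mul_sum, sum_kron_mul]
    ring
  -- Everything with a factor `u_μ` or `u_ν` is collected in `X` and `Y`. Their values play no role,
  -- because the dual with the spatial volume form annihilates such terms.
  refine ⟨fun β ν => -((Hd + H ^ 2) * G ν β) - 2 * H * A ν β - ∑ σ, a β σ * A ν σ,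
    fun β μ => (Hd + H ^ 2) * G μ β + ∑ σ, A β σ * a μ σ - 2 * H * A β μ, fun β μ ν => ?_⟩
  rw [low]
  simp only [mixed]
  have e : ∀ ρ, (∑ δ, curv d Γ β δ μ ρ * u δ + covEnd d Γ a β μ ρ - 3 * H * lower G u β * a μ ρ
        + lower G u μ * (-(2 * H * a β ρ) - ∑ σ, a β σ * a σ ρ)
        + (∑ σ, A β σ * a μ σ - 2 * H * A β μ) * u ρ) * G ρ ν =
      (∑ δ, curv d Γ β δ μ ρ * u δ) * G ρ ν + covEnd d Γ a β μ ρ * G ρ ν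
        - 3 * H * lower G u β * (a μ ρ * G ρ ν) - lower G u μ * (2 * H) * (a β ρ * G ρ ν)
        - lower G u μ * ((∑ σ, a β σ * a σ ρ) * G ρ ν)
        + (∑ σ, A β σ * a μ σ - 2 * H * A β μ) * (u ρ * G ρ ν) := fun ρ => by ring
  rw [Finset.sum_congr rfl fun ρ _ => e ρ]
  simp only [Finset.sum_add_distrib, Finset.sum_sub_distrib, ← Finset.mul_sum, lc, lowNa, lowa,
    lowu, square_raise_lower h.lc s]
  rw [covTwo_antisymm s.antisymm β ν μ, s.antisymm ν μ]
  ring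

end IsSpin

end SpinTorsion

end EinsteinCartan

end

noncomputable section

namespace EinsteinCartan

/-! ### The Levi-Civita symbol -/

section LeviCivita

/-- The Levi-Civita symbol with integer values. -/
def leviInt (α β γ δ : Fin 4) : ℤ :=
  -- A Vandermonde product: it vanishes when two indices agree and is `±12` on permutations of 0, 1,
  -- 2, 3, where `12 = 1! 2! 3!`.
  ((β : ℤ) - α) * ((γ : ℤ) - α) * ((δ : ℤ) - α) * ((γ : ℤ) - β) * ((δ : ℤ) - β) * ((δ : ℤ) - γ) / 12

/-- The determinant has integer entries, so the identity is decided over `ℤ` for all index choices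
and then cast. -/
theorem leviCivitaSymbol_eq (α β γ δ : Fin 4) :
    leviCivitaSymbol α β γ δ = (leviInt α β γ δ : ℝ) := by
  have h : ∀ α β γ δ : Fin 4,
      ((1 : Matrix (Fin 4) (Fin 4) ℤ).submatrix ![α, β, γ, δ] id).det = leviInt α β γ δ := by
    simp only [Matrix.det_succ_row_zero, Fin.sum_univ_succ, Fin.succAbove, Matrix.submatrix_apply,
      Matrix.one_apply]
    simp
    decide
  rw [← h, leviCivitaSymbol, Int.cast_det]
  congr 1
  ext i j
  rw [Matrix.map_apply, Matrix.submatrix_apply, Matrix.submatrix_apply, Matrix.one_apply, Matrix.one_apply]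
  simp

theorem sum_levi {R : Type*} [CommRing R] (X Y Z W : Fin 4 → R) :
    ∑ α, ∑ β, ∑ γ, ∑ δ, (leviInt α β γ δ : R) * X α * Y β * Z γ * W δ
      = (Matrix.of ![X, Y, Z, W]).det := by
  simp [leviInt, Matrix.det_succ_row_zero, Fin.sum_univ_succ, Fin.succAbove]
  ring

/-- Infinitesimal form of the multiplicativity of the determinant: a linear map acts on the
determinant of four vectors as a derivation, and the total effect is its trace. -/
theorem det_derivation {R : Type*} [CommRing R] (M : Fin 4 → Fin 4 → R) (X Y S T : Fin 4 → R) :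
    (∑ σ, M σ σ) * (Matrix.of ![X, Y, S, T]).det =
      (Matrix.of ![fun γ => ∑ σ, M σ γ * X σ, Y, S, T]).det
      + (Matrix.of ![X, fun γ => ∑ σ, M σ γ * Y σ, S, T]).det
      + (Matrix.of ![X, Y, fun γ => ∑ σ, M σ γ * S σ, T]).det
      + (Matrix.of ![X, Y, S, fun γ => ∑ σ, M σ γ * T σ]).det := by
  simp [Matrix.det_succ_row_zero, Fin.sum_univ_succ, Fin.succAbove]
  ring

theorem sum_levi_kron {R : Type*} [CommRing R] (V : Fin 4 → R) (S T : Fin 4 → R) (β : Fin 4) :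
    (Matrix.of ![V, kron β, S, T]).det =
      ∑ σ, V σ * (∑ γ, ∑ δ, (leviInt σ β γ δ : R) * S γ * T δ) := by
  rw [← sum_levi]
  refine Finset.sum_congr rfl fun σ _ => ?_
  have : ∀ b γ δ, (leviInt σ b γ δ : R) * V σ * kron β b * S γ * T δ
    = kron β b * ((leviInt σ b γ δ : R) * V σ * S γ * T δ) := fun b γ δ => by ring
  simp only [this, ← Finset.mul_sum, sum_kron_mul]
  simp only [Finset.mul_sum]
  exact Finset.sum_congr rfl fun _ _ => Finset.sum_congr rfl fun _ _ => by ring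

theorem sum_levi_kron' {R : Type*} [CommRing R] (V : Fin 4 → R) (S T : Fin 4 → R) (α : Fin 4) :
    (Matrix.of ![kron α, V, S, T]).det =
      ∑ σ, V σ * (∑ γ, ∑ δ, (leviInt α σ γ δ : R) * S γ * T δ) := by
  rw [← sum_levi]
  have : ∀ a b γ δ, (leviInt a b γ δ : R) * kron α a * V b * S γ * T δ
    = kron α a * ((leviInt a b γ δ : R) * V b * S γ * T δ) := fun a b γ δ => by ring
  simp only [this, ← Finset.mul_sum, sum_kron_mul]
  simp only [Finset.mul_sum]
  refine Finset.sum_congr rfl fun _ _ => ?_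
  exact Finset.sum_congr rfl fun _ _ => Finset.sum_congr rfl fun _ _ => by ring

/-- `det_derivation` with two of the vectors taken from the standard basis. For `M = Γ μ` it says
that the Levi-Civita symbol is parallel up to the trace of the connection. -/
theorem levi_derivation {R : Type*} [CommRing R] (M : Fin 4 → Fin 4 → R) (S T : Fin 4 → R)
    (α β : Fin 4) :
    (∑ σ, M σ σ) * (∑ γ, ∑ δ, (leviInt α β γ δ : R) * S γ * T δ)
      - ∑ σ, M α σ * (∑ γ, ∑ δ, (leviInt σ β γ δ : R) * S γ * T δ)
      - ∑ σ, M β σ * (∑ γ, ∑ δ, (leviInt α σ γ δ : R) * S γ * T δ)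
     = ∑ γ, ∑ δ, (leviInt α β γ δ : R) * (∑ σ, M σ γ * S σ) * T δ
       + ∑ γ, ∑ δ, (leviInt α β γ δ : R) * S γ * ∑ σ, M σ δ * T σ := by
  have h := det_derivation M (kron α) (kron β) S T
  have e1 : (fun γ => ∑ σ, M σ γ * (kron α σ : R)) = M α := by funext γ; simp
  have e2 : (fun γ => ∑ σ, M σ γ * (kron β σ : R)) = M β := by funext γ; simp
  rw [e1, e2] at h
  simp only [sum_levi_kron (M α), sum_levi_kron' (M β)] at h
  simp only [sum_levi_kron, sum_kron_mul] at h
  linear_combination h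

/-- Jacobi's formula. By compatibility each of the two slots of the metric contributes one trace of
the connection, whence the factor 2. -/
theorem d_det {R : Type*} [CommRing R] [Algebra ℝ R] (D : Derivation ℝ R R) (G M : Fin 4 → Fin 4 → R)
   (h : ∀ α β, D (G α β) = ∑ σ, M α σ * G σ β + ∑ σ, M β σ * G α σ) :
   D (Matrix.of G).det = 2 * (∑ σ, M σ σ) * (Matrix.of G).det := by
  simp [Matrix.det_succ_row_zero, Fin.sum_univ_succ, Fin.succAbove, h]
  ring

end LeviCivita

end EinsteinCartan

end

noncomputable section

namespace EinsteinCartan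

/-! ### Orthonormal frames at a point -/

section Frames

/-- The diagonal entries of the Minkowski metric. -/
def eta (a : Fin 4) : ℝ := if a = 0 then -1 else 1

/-- The vectors `J a` form an orthonormal frame of `G` whose first member is `u`. -/
structure IsFrame (G : Matrix (Fin 4) (Fin 4) ℝ) (u : Fin 4 → ℝ)
    (J : Matrix (Fin 4) (Fin 4) ℝ) : Prop where
  zero : J 0 = u
  ortho : J * G * J.transpose = Matrix.diagonal eta

variable {G J : Matrix (Fin 4) (Fin 4) ℝ} {u : Fin 4 → ℝ}

theorem eta_mul_self (a : Fin 4) : eta a * eta a = 1 := by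
  unfold eta; split_ifs <;> norm_num

theorem diagonal_eta_mul_self :
    (Matrix.diagonal eta : Matrix (Fin 4) (Fin 4) ℝ) * Matrix.diagonal eta = 1 := by
  rw [Matrix.diagonal_mul_diagonal]
  simp [eta_mul_self]

namespace IsFrame

theorem right_inv (h : IsFrame G u J) : J * (G * J.transpose * Matrix.diagonal eta) = 1 := by
  rw [← diagonal_eta_mul_self, ← h.ortho]
  simp only [Matrix.mul_assoc]

theorem left_inv (h : IsFrame G u J) : (G * J.transpose * Matrix.diagonal eta) * J = 1 :=
  mul_eq_one_comm.mp h.right_inv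

theorem inv_eq (h : IsFrame G u J) : G⁻¹ = J.transpose * Matrix.diagonal eta * J := by
  refine Matrix.inv_eq_right_inv ?_
  simpa only [Matrix.mul_assoc] using h.left_inv

theorem det_mul (h : IsFrame G u J) : J.det * J.det * G.det = -1 := by
  have := congrArg Matrix.det h.ortho
  rw [Matrix.det_mul, Matrix.det_mul, Matrix.det_transpose, Matrix.det_diagonal,
    Fin.prod_univ_four] at this
  simp [eta] at this
  linear_combination this

theorem det_ne_zero (h : IsFrame G u J) : G.det ≠ 0 := by
  intro h0
  have := h.det_mul
  simp [h0] at this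

theorem det_neg (h : IsFrame G u J) : G.det < 0 := by
  have := h.det_mul
  nlinarith [mul_self_nonneg J.det]

/-- The sign of a frame. -/
def sign (G J : Matrix (Fin 4) (Fin 4) ℝ) : ℝ := √|G.det| * J.det

/-- Frames of either orientation are admitted: dualising twice brings in the square of the sign, so
the orientation of the frame drops out. -/
theorem sign_mul_self (h : IsFrame G u J) : sign G J * sign G J = 1 := by
  have h1 : √|G.det| * √|G.det| = -G.det := by
    rw [Real.mul_self_sqrt (abs_nonneg _), abs_of_neg h.det_neg]
  unfold sign
  linear_combination J.det * J.det * h1 - h.det_mul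

end IsFrame

/-- Frame components of a covariant 2-tensor. -/
def comp2 (J : Matrix (Fin 4) (Fin 4) ℝ) (T : Fin 4 → Fin 4 → ℝ) (a b : Fin 4) : ℝ :=
  ∑ α, ∑ β, J a α * J b β * T α β

/-- Frame components of a covector. -/
def comp1 (J : Matrix (Fin 4) (Fin 4) ℝ) (v : Fin 4 → ℝ) (a : Fin 4) : ℝ := ∑ α, J a α * v α

theorem comp2_eq (J : Matrix (Fin 4) (Fin 4) ℝ) (T : Fin 4 → Fin 4 → ℝ) (a b : Fin 4) :
    comp2 J T a b = (J * Matrix.of T * J.transpose) a b := by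
  simp only [comp2, Matrix.mul_apply, Matrix.transpose_apply, Matrix.of_apply, Finset.sum_mul]
  rw [Finset.sum_comm]
  exact Finset.sum_congr rfl fun _ _ => Finset.sum_congr rfl fun _ _ => by ring

theorem comp2_eq_comp1 (J : Matrix (Fin 4) (Fin 4) ℝ) (T : Fin 4 → Fin 4 → ℝ) (a b : Fin 4) :
    comp2 J T a b = ∑ α, J a α * comp1 J (T α) b := by
  simp only [comp2, comp1, Finset.mul_sum, mul_assoc]

theorem sum_sum_mul_sum (f e : Fin 4 → ℝ) (p q : Fin 4 → Fin 4 → ℝ) :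
    ∑ x, ∑ y, f x * f y * ∑ m, e m * (p m y * q m x) =
      ∑ m, e m * ((∑ y, f y * p m y) * ∑ x, f x * q m x) := by
  simp only [Finset.mul_sum, Finset.sum_mul]
  rw [Finset.sum_comm_cycle]
  exact Finset.sum_congr rfl fun _ _ => Finset.sum_congr rfl fun _ _ =>
    Finset.sum_congr rfl fun _ _ => by ring

namespace IsFrame

theorem comp1_ext (h : IsFrame G u J) {v w : Fin 4 → ℝ} (hvw : ∀ a, comp1 J v a = comp1 J w a) :
    v = w := by
  have h1 : J.mulVec v = J.mulVec w := funext hvw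
  have h2 := congrArg (G * J.transpose * Matrix.diagonal eta).mulVec h1
  simpa only [Matrix.mulVec_mulVec, h.left_inv, Matrix.one_mulVec] using h2

theorem comp2_ext (h : IsFrame G u J) {S T : Fin 4 → Fin 4 → ℝ}
    (hST : ∀ a b, comp2 J S a b = comp2 J T a b) : S = T := by
  have key : ∀ b, (fun α => comp1 J (S α) b) = fun α => comp1 J (T α) b := by
    intro b
    apply h.comp1_ext
    intro a
    have := hST a b
    rwa [comp2_eq_comp1, comp2_eq_comp1] at this
  funext α
  exact h.comp1_ext fun b => congrFun (key b) α

/-- A vector in terms of the frame components of the associated covector. -/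
theorem expand (h : IsFrame G u J) (V : Fin 4 → ℝ) :
    V = fun β => ∑ a, eta a * comp1 J (lower G V) a * J a β := by
  have h0 : (J.transpose * Matrix.diagonal eta * J * G) = 1 := by
    rw [← h.inv_eq]; exact Matrix.nonsing_inv_mul _ (isUnit_iff_ne_zero.mpr h.det_ne_zero)
  have h1 : (J.transpose * Matrix.diagonal eta * J * G).mulVec V = V := by
    rw [h0, Matrix.one_mulVec]
  have h2 : lower G V = G.mulVec V := rfl
  have h3 : ∀ v, comp1 J v = J.mulVec v := fun v => rfl
  conv_lhs => rw [← h1]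
  funext β
  rw [h2, h3, ← Matrix.mulVec_mulVec, ← Matrix.mulVec_mulVec, ← Matrix.mulVec_mulVec,
    Matrix.mulVec, dotProduct]
  exact Finset.sum_congr rfl fun a _ => by
    rw [Matrix.transpose_apply, Matrix.mulVec_diagonal]; ring

/-- Contraction with the inverse metric in frame components. -/
theorem contract (h : IsFrame G u J) (T : Fin 4 → Fin 4 → ℝ) :
    ∑ α, ∑ β, G⁻¹ α β * T α β = ∑ a, eta a * comp2 J T a a := by
  have : ∀ α β, G⁻¹ α β = ∑ a, eta a * J a α * J a β := by
    intro α β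
    rw [h.inv_eq, Matrix.mul_apply]
    exact Finset.sum_congr rfl fun a _ => by rw [Matrix.mul_diagonal, Matrix.transpose_apply]; ring
  simp only [this, comp2, Finset.sum_mul, Finset.mul_sum]
  rw [Finset.sum_comm_cycle]
  refine Finset.sum_congr rfl fun a _ => ?_
  exact Finset.sum_congr rfl fun _ _ => Finset.sum_congr rfl fun _ _ => by ring

/-- Double contraction with the inverse metric in frame components. -/
theorem contract_two (h : IsFrame G u J) (S T : Fin 4 → Fin 4 → ℝ) :
    ∑ μ, ∑ ν, (∑ ρ, ∑ σ, G⁻¹ μ ρ * G⁻¹ ν σ * S ρ σ) * T μ ν =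
      ∑ m, ∑ n, eta m * eta n * comp2 J S m n * comp2 J T m n := by
  have e1 : ∑ μ, ∑ ν, (∑ ρ, ∑ σ, G⁻¹ μ ρ * G⁻¹ ν σ * S ρ σ) * T μ ν =
      ∑ ν, ∑ σ, G⁻¹ ν σ * ∑ μ, ∑ ρ, G⁻¹ μ ρ * (S ρ σ * T μ ν) := by
    simp only [Finset.sum_mul, Finset.mul_sum]
    rw [Finset.sum_comm]
    refine Finset.sum_congr rfl fun ν _ => ?_
    rw [Finset.sum_comm_cycle]
    refine Finset.sum_congr rfl fun σ _ => ?_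
    exact Finset.sum_congr rfl fun _ _ => Finset.sum_congr rfl fun _ _ => by ring
  have e2 : ∀ ν σ, ∑ μ, ∑ ρ, G⁻¹ μ ρ * (S ρ σ * T μ ν) =
      ∑ m, eta m * ((∑ ρ, J m ρ * S ρ σ) * (∑ μ, J m μ * T μ ν)) := by
    intro ν σ
    rw [h.contract (fun μ ρ => S ρ σ * T μ ν)]
    refine Finset.sum_congr rfl fun m _ => ?_
    rw [comp2, Finset.sum_mul_sum, Finset.sum_comm]
    congr 1
    exact Finset.sum_congr rfl fun _ _ => Finset.sum_congr rfl fun _ _ => by ring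
  rw [e1]
  simp only [e2]
  rw [h.contract (fun ν σ => ∑ m, eta m * ((∑ ρ, J m ρ * S ρ σ) * (∑ μ, J m μ * T μ ν))),
    Finset.sum_comm (f := fun m n => eta m * eta n * comp2 J S m n * comp2 J T m n)]
  refine Finset.sum_congr rfl fun n _ => ?_
  have e3 : comp2 J (fun ν σ => ∑ m, eta m * ((∑ ρ, J m ρ * S ρ σ) * (∑ μ, J m μ * T μ ν))) n n =
      ∑ m, eta m * ((∑ σ, J n σ * ∑ ρ, J m ρ * S ρ σ) * (∑ ν, J n ν * ∑ μ, J m μ * T μ ν)) := by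
    exact sum_sum_mul_sum _ _ _ _
  have e4 : ∀ (T : Fin 4 → Fin 4 → ℝ) m, ∑ σ, J n σ * ∑ ρ, J m ρ * T ρ σ = comp2 J T m n := by
    intro T m
    simp only [comp2, Finset.mul_sum]
    rw [Finset.sum_comm]
    exact Finset.sum_congr rfl fun _ _ => Finset.sum_congr rfl fun _ _ => by ring
  rw [e3, Finset.mul_sum]
  exact Finset.sum_congr rfl fun m _ => by rw [e4, e4]; ring

theorem comp1_lower_frame (h : IsFrame G u J) (a b : Fin 4) :
    comp1 J (lower G (J b)) a = eta a * kron a b := by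
  have := congrFun (congrFun h.ortho a) b
  rw [Matrix.mul_assoc, Matrix.mul_apply] at this
  simp only [Matrix.mul_apply, Matrix.transpose_apply, Matrix.diagonal_apply] at this
  simp only [comp1, lower]
  rw [this, kron]
  simp

/-- The determinant of two frame vectors and two vectors given by frame components. -/
theorem det_frame (J : Matrix (Fin 4) (Fin 4) ℝ) (a b : Fin 4) (V W : Fin 4 → ℝ) :
    (Matrix.of ![J a, J b, fun β => ∑ c, V c * J c β, fun β => ∑ c, W c * J c β]).det =
      (∑ c, ∑ e, (leviInt a b c e : ℝ) * V c * W e) * J.det := by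
  have e : Matrix.of ![J a, J b, fun β => ∑ c, V c * J c β, fun β => ∑ c, W c * J c β] =
      Matrix.of ![kron a, kron b, V, W] * J := by
    ext i j
    fin_cases i <;> simp [Matrix.mul_apply]
  rw [e, Matrix.det_mul, sum_levi_kron, sum_kron_mul]

/-- Frame components of the contraction of the volume form with two vectors. -/
theorem comp2_levi (G J : Matrix (Fin 4) (Fin 4) ℝ) (a b : Fin 4) {V W X Y : Fin 4 → ℝ}
    (hX : X = fun β => ∑ c, V c * J c β) (hY : Y = fun β => ∑ c, W c * J c β) :
    comp2 J (fun α β => ∑ γ, ∑ δ, √|G.det| * (leviInt α β γ δ : ℝ) * X γ * Y δ) a b =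
      sign G J * ∑ c, ∑ e, (leviInt a b c e : ℝ) * V c * W e := by
  have h := det_frame J a b V W
  rw [← hX, ← hY, ← sum_levi] at h
  rw [sign]
  have : √|G.det| * J.det * ∑ c, ∑ e, (leviInt a b c e : ℝ) * V c * W e =
    √|G.det| * ((∑ c, ∑ e, (leviInt a b c e : ℝ) * V c * W e) * J.det) := by ring
  rw [this, ← h, comp2]
  simp only [Finset.mul_sum]
  refine Finset.sum_congr rfl fun _ _ => Finset.sum_congr rfl fun _ _ =>
    Finset.sum_congr rfl fun _ _ => Finset.sum_congr rfl fun _ _ => by ring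

end IsFrame

end Frames

end EinsteinCartan

end

noncomputable section

namespace EinsteinCartan

/-! ### Existence of orthonormal frames -/

section FrameExistence

-- Reversing the sign of the metric in the direction of `u` gives a positive definite form `E`. If
-- `E = BᵀB`, then `B` carries `E` to the standard inner product and `u` to a unit vector. Extend
-- that vector to an orthonormal basis and pull back by `B⁻¹`.
open scoped MatrixOrder in
theorem exists_isFrame {G : Matrix (Fin 4) (Fin 4) ℝ} {u : Fin 4 → ℝ} (hG : ∀ α β, G α β = G β α)
    (hu : ∑ α, lower G u α * u α = -1)
    (hpos : ∀ v : Fin 4 → ℝ, v ≠ 0 → ∑ α, lower G u α * v α = 0 → 0 < ∑ α, lower G v α * v α) :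
    ∃ J, IsFrame G u J := by
  set ul := lower G u with hul
  have hGs : G.transpose = G := by ext α β; exact hG β α
  have swap : ∀ v w : Fin 4 → ℝ, (G.mulVec v) ⬝ᵥ w = v ⬝ᵥ G.mulVec w := by
    intro v w
    rw [Matrix.dotProduct_mulVec, ← Matrix.mulVec_transpose, hGs]
  have huu : ul ⬝ᵥ u = -1 := hu
  -- The factor 2 turns `g(u, u) = -1` into `E(u, u) = 1` and leaves the form unchanged on the
  -- complement of `u`.
  let E : Matrix (Fin 4) (Fin 4) ℝ := G + (2 : ℝ) • Matrix.vecMulVec ul ul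
  have hE : ∀ v, E.mulVec v = G.mulVec v + (2 * (ul ⬝ᵥ v)) • ul := by
    intro v
    simp only [E, Matrix.add_mulVec, Matrix.smul_mulVec, Matrix.vecMulVec_mulVec]
    congr 1
    ext i
    simp
    ring
  have hEpos : E.PosDef := by
    refine Matrix.PosDef.of_dotProduct_mulVec_pos ?_ ?_
    · ext α β
      simp [E, Matrix.vecMulVec_apply, hG α β, mul_comm]
    · intro x hx
      have hw1 : ul ⬝ᵥ (x + (ul ⬝ᵥ x) • u) = 0 := by
        rw [dotProduct_add, dotProduct_smul, huu]; simp
      -- Split `x` into its part orthogonal to `u` and a multiple of `u`.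
      have hform : star x ⬝ᵥ E.mulVec x =
          (G.mulVec (x + (ul ⬝ᵥ x) • u)) ⬝ᵥ (x + (ul ⬝ᵥ x) • u) + (ul ⬝ᵥ x) ^ 2 := by
        have h1 : x ⬝ᵥ ul = ul ⬝ᵥ x := dotProduct_comm _ _
        have h2 : G.mulVec u = ul := rfl
        have h3 : G.mulVec x ⬝ᵥ u = ul ⬝ᵥ x := by rw [swap, h2, h1]
        have h4 : x ⬝ᵥ G.mulVec x = G.mulVec x ⬝ᵥ x := dotProduct_comm _ _
        simp only [hE, star_trivial, dotProduct_add, add_dotProduct, dotProduct_smul, smul_dotProduct,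
          Matrix.mulVec_add, Matrix.mulVec_smul, h1, h2, h3, h4, huu, smul_eq_mul]
        ring
      rw [hform]
      by_cases hw : x + (ul ⬝ᵥ x) • u = 0
      · rw [hw]
        have : ul ⬝ᵥ x ≠ 0 := by
          intro h0
          rw [h0] at hw
          exact hx (by simpa using hw)
        simp only [Matrix.mulVec_zero, dotProduct_zero, zero_add]
        positivity
      · have := hpos _ hw hw1
        have h5 : 0 < (G.mulVec (x + (ul ⬝ᵥ x) • u)) ⬝ᵥ (x + (ul ⬝ᵥ x) • u) := this
        positivity
  obtain ⟨B, hB⟩ := CStarAlgebra.nonneg_iff_eq_star_mul_self.mp hEpos.posSemidef.nonneg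
  have hBE : E = B.transpose * B := by
    rw [hB, Matrix.star_eq_conjTranspose, Matrix.conjTranspose_eq_transpose_of_trivial]
  have hBdet : IsUnit B.det := by
    have h1 : E.det ≠ 0 := hEpos.det_pos.ne'
    rw [hBE, Matrix.det_mul] at h1
    exact isUnit_iff_ne_zero.mpr (right_ne_zero_of_mul h1)
  have hdot : ∀ v w, (B.mulVec v) ⬝ᵥ (B.mulVec w) = v ⬝ᵥ E.mulVec w := by
    intro v w
    rw [hBE, ← Matrix.mulVec_mulVec, Matrix.dotProduct_mulVec v, Matrix.vecMul_transpose]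
  have hEu : E.mulVec u = -ul := by
    rw [hE, huu]
    have : G.mulVec u = ul := rfl
    rw [this]
    ext i; simp; ring
  let v : Fin 4 → EuclideanSpace ℝ (Fin 4) := fun _ => WithLp.toLp 2 (B.mulVec u)
  have hv : Orthonormal ℝ (({0} : Set (Fin 4)).domRestrict v) := by
    rw [orthonormal_iff_ite]
    rintro ⟨i, rfl⟩ ⟨j, rfl⟩
    have h1 : inner ℝ (v 0) (v 0) = 1 := by
      rw [EuclideanSpace.inner_eq_star_dotProduct]
      simp only [v, star_trivial]
      rw [hdot, hEu, dotProduct_neg, dotProduct_comm, huu]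
      norm_num
    simpa using h1
  obtain ⟨b, hb⟩ := hv.exists_orthonormalBasis_extension_of_card_eq (by simp)
  have hBinv : ∀ v, B.mulVec (B⁻¹.mulVec v) = v := by
    intro v
    rw [Matrix.mulVec_mulVec, Matrix.mul_nonsing_inv _ hBdet, Matrix.one_mulVec]
  have hBinv' : ∀ v, B⁻¹.mulVec (B.mulVec v) = v := by
    intro v
    rw [Matrix.mulVec_mulVec, Matrix.nonsing_inv_mul _ hBdet, Matrix.one_mulVec]
  let J : Fin 4 → Fin 4 → ℝ := fun a => B⁻¹.mulVec (WithLp.ofLp (b a))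
  have hJ0 : J 0 = u := by
    simp only [J, hb 0 rfl, v]
    exact hBinv' u
  have hJE : ∀ a c, J a ⬝ᵥ E.mulVec (J c) = if a = c then 1 else 0 := by
    intro a c
    rw [← hdot]
    simp only [J, hBinv]
    have := (orthonormal_iff_ite.mp b.orthonormal) c a
    rw [EuclideanSpace.inner_eq_star_dotProduct] at this
    rw [star_trivial] at this
    rw [this]
    simp [eq_comm]
  have hulJ : ∀ a, ul ⬝ᵥ J a = -(if a = 0 then 1 else 0) := by
    intro a
    have h1 := hJE a 0
    rw [hJ0, hEu, dotProduct_neg, dotProduct_comm] at h1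
    linarith
  refine ⟨Matrix.of J, hJ0, ?_⟩
  ext a c
  have h1 := hJE a c
  rw [hE, dotProduct_add, dotProduct_smul, dotProduct_comm (J a) ul, hulJ, hulJ] at h1
  have h2 : (Matrix.of J * G * (Matrix.of J).transpose) a c = J a ⬝ᵥ G.mulVec (J c) := by
    rw [Matrix.mul_assoc, Matrix.mul_apply]
    rfl
  rw [h2, Matrix.diagonal_apply]
  have h3 : J a ⬝ᵥ G.mulVec (J c) =
    (if a = c then 1 else 0) - 2 * (if c = 0 then 1 else 0) * (if a = 0 then 1 else 0) := by
    rw [← h1, smul_eq_mul]; ring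
  rw [h3]
  unfold eta
  by_cases hac : a = c
  · subst hac
    by_cases ha : a = 0 <;> simp [ha]; norm_num
  · simp only [hac, if_false]
    by_cases ha : a = 0
    · have hc : c ≠ 0 := fun hc => hac (ha.trans hc.symm)
      simp [hc]
    · simp [ha]

end FrameExistence

/-! ### Duality of spatial 2-forms and vectors -/

section Duality

variable (F : LocalFields) (y : Coord 4) {J : Matrix (Fin 4) (Fin 4) ℝ}

/-- The covector `(1/2) ε_α^{μν} B_{μν}`. -/
def dualLow (B : Fin 4 → Fin 4 → ℝ) (α : Fin 4) : ℝ :=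
  (1 / 2) * ∑ μ, ∑ ν, F.epsUp2 y α μ ν * B μ ν

variable {F y}

/-- Since `u` is the frame vector with index 0, contracting the volume form with it fixes the last
index of the symbol to 0. -/
theorem comp1_eps (hJ : IsFrame (F.g y) (F.u y) J) (a m n : Fin 4) :
    ∑ α, J a α * comp2 J (F.eps y α) m n = IsFrame.sign (F.g y) J * (leviInt a m n 0 : ℝ) := by
  have h := IsFrame.det_frame J a m (kron n) (kron 0)
  simp only [sum_kron_mul] at h
  have h2 : ∑ c, ∑ e, (leviInt a m c e : ℝ) * kron n c * kron 0 e = (leviInt a m n 0 : ℝ) := by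
    simp
  rw [h2, ← sum_levi, hJ.zero] at h
  have : IsFrame.sign (F.g y) J * (leviInt a m n 0 : ℝ)
    = √|(F.g y).det| * ((leviInt a m n 0 : ℝ) * J.det) := by rw [IsFrame.sign]; ring
  rw [this, ← h]
  simp only [comp2, LocalFields.eps, LocalFields.eps4, leviCivitaSymbol_eq, Finset.mul_sum]
  exact Finset.sum_congr rfl fun _ _ => Finset.sum_congr rfl fun _ _ =>
    Finset.sum_congr rfl fun _ _ => Finset.sum_congr rfl fun _ _ => by ring

theorem comp1_dualLow (hJ : IsFrame (F.g y) (F.u y) J) (B : Fin 4 → Fin 4 → ℝ) (a : Fin 4) :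
    comp1 J (dualLow F y B) a = (1 / 2) * ∑ m, ∑ n, eta m * eta n *
      (IsFrame.sign (F.g y) J * (leviInt a m n 0 : ℝ)) * comp2 J B m n := by
  simp only [← comp1_eps hJ]
  have h : ∀ α, dualLow F y B α =
      (1 / 2) * ∑ m, ∑ n, eta m * eta n * comp2 J (F.eps y α) m n * comp2 J B m n := by
    intro α
    rw [← hJ.contract_two]
    rfl
  simp only [comp1, h, Finset.mul_sum, Finset.sum_mul]
  rw [← Finset.sum_comm_cycle]
  exact Finset.sum_congr rfl fun _ _ => Finset.sum_congr rfl fun _ _ =>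
    Finset.sum_congr rfl fun _ _ => by ring

/-- The frame components of the dual of a 2-tensor. -/
theorem comp1_dualLow_eq (hJ : IsFrame (F.g y) (F.u y) J) (B : Fin 4 → Fin 4 → ℝ) :
    comp1 J (dualLow F y B) 0 = 0 ∧
    comp1 J (dualLow F y B) 1 = -(IsFrame.sign (F.g y) J / 2) * (comp2 J B 2 3 - comp2 J B 3 2) ∧
    comp1 J (dualLow F y B) 2 = -(IsFrame.sign (F.g y) J / 2) * (comp2 J B 3 1 - comp2 J B 1 3) ∧
    comp1 J (dualLow F y B) 3 = -(IsFrame.sign (F.g y) J / 2) * (comp2 J B 1 2 - comp2 J B 2 1) := by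
  -- The minus signs come from `leviInt 1 2 3 0 = -1`: moving the index 0 past three others is an
  -- odd permutation.
  simp only [comp1_dualLow hJ, Fin.sum_univ_four]
  refine ⟨?_, ?_, ?_, ?_⟩ <;> simp [leviInt, eta] <;> ring

theorem lower_axial (hJ : IsFrame (F.g y) (F.u y) J) (A : Coord 4 → Fin 4 → Fin 4 → ℝ) :
    lower (F.g y) (F.axial y A) = dualLow F y (A y) := by
  have h : F.axial y A = (F.g y)⁻¹.mulVec (dualLow F y (A y)) := by
    funext γ
    simp only [LocalFields.axial, dualLow, Matrix.mulVec, dotProduct, Finset.mul_sum,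
      LocalFields.gInv]
    exact Finset.sum_congr rfl fun _ _ => Finset.sum_congr rfl fun _ _ =>
      Finset.sum_congr rfl fun _ _ => by ring
  have h2 : lower (F.g y) (F.axial y A) = (F.g y).mulVec (F.axial y A) := rfl
  rw [h2, h, Matrix.mulVec_mulVec,
    Matrix.mul_nonsing_inv _ (isUnit_iff_ne_zero.mpr hJ.det_ne_zero), Matrix.one_mulVec]

end Duality

end EinsteinCartan

end

noncomputable section

namespace EinsteinCartan

/-! ### Double duality and norms of spatial 2-forms -/

section PointwiseDuality

theorem sum_rotate {R : Type*} [AddCommMonoid R] (f : Fin 4 → Fin 4 → Fin 4 → R) :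
    ∑ a, ∑ b, ∑ c, f a b c = ∑ b, ∑ c, ∑ a, f a b c := by
  rw [Finset.sum_comm]
  exact Finset.sum_congr rfl fun _ _ => Finset.sum_comm

/-- The contraction `ε_{αβγδ} V^γ W^δ`, where `s` is the volume density. -/
def eps2 {R : Type*} [CommRing R] (s : R) (V W : Fin 4 → R) (α β : Fin 4) : R :=
  ∑ γ, ∑ δ, s * (leviInt α β γ δ : R) * V γ * W δ

variable {F : LocalFields} {y : Coord 4} {J : Matrix (Fin 4) (Fin 4) ℝ}

theorem comp1_lower_u (hJ : IsFrame (F.g y) (F.u y) J) (a : Fin 4) :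
    comp1 J (lower (F.g y) (F.u y)) a = eta a * kron a 0 := by
  rw [← hJ.comp1_lower_frame, hJ.zero]

theorem comp1_zero (hJ : IsFrame (F.g y) (F.u y) J) (v : Fin 4 → ℝ) :
    comp1 J v 0 = ∑ α, F.u y α * v α := by
  rw [comp1, hJ.zero]

theorem lower_dot_symm {G : Fin 4 → Fin 4 → ℝ} (hG : ∀ α β, G α β = G β α) (V W : Fin 4 → ℝ) :
    ∑ α, lower G V α * W α = ∑ α, lower G W α * V α := by
  simp only [lower, Finset.sum_mul]
  rw [Finset.sum_comm]
  exact Finset.sum_congr rfl fun _ _ => Finset.sum_congr rfl fun _ _ => by rw [hG]; ring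

theorem comp2_eps2 (hJ : IsFrame (F.g y) (F.u y) J) (V W : Fin 4 → ℝ) (a b : Fin 4) :
    comp2 J (eps2 (√|(F.g y).det|) V W) a b = IsFrame.sign (F.g y) J *
      ∑ c, ∑ e, (leviInt a b c e : ℝ) * (eta c * comp1 J (lower (F.g y) V) c)
        * (eta e * comp1 J (lower (F.g y) W) e) :=
  IsFrame.comp2_levi (F.g y) J a b (hJ.expand V) (hJ.expand W)

/-- A spatial 2-form is the contraction of the volume form with its dual vector and `u`. -/
theorem eq_eps2_axial (hJ : IsFrame (F.g y) (F.u y) J) (A : Coord 4 → Fin 4 → Fin 4 → ℝ)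
    (hA : ∀ α β, A y α β = -A y β α) (hu : ∀ α, ∑ β, A y α β * F.u y β = 0) :
    A y = eps2 (√|(F.g y).det|) (F.axial y A) (F.u y) := by
  have has : ∀ a b, comp2 J (A y) a b = -comp2 J (A y) b a := by
    intro a b
    simp only [comp2]
    rw [Finset.sum_comm, ← Finset.sum_neg_distrib]
    refine Finset.sum_congr rfl fun α _ => ?_
    rw [← Finset.sum_neg_distrib]
    exact Finset.sum_congr rfl fun β _ => by rw [hA]; ring
  have h0 : ∀ a, comp2 J (A y) a 0 = 0 := by
    intro a
    rw [comp2_eq_comp1]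
    refine Finset.sum_eq_zero fun α _ => ?_
    rw [comp1_zero hJ]
    have := hu α
    simp only [mul_comm] at this ⊢
    rw [this]; simp
  have h0' : ∀ a, comp2 J (A y) 0 a = 0 := fun a => by rw [has, h0, neg_zero]
  have hd : ∀ a, comp2 J (A y) a a = 0 := fun a => by linarith [has a a]
  obtain ⟨d0, d1, d2, d3⟩ := comp1_dualLow_eq hJ (A y)
  rw [has 3 2] at d1
  rw [has 1 3] at d2
  rw [has 2 1] at d3
  have hk := hJ.sign_mul_self
  -- In a frame both sides have three independent spatial components, and dualising twice multiplies
  -- them by the squared sign.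
  apply hJ.comp2_ext
  intro a b
  simp only [comp2_eps2 hJ, lower_axial hJ, comp1_lower_u hJ, Fin.sum_univ_four, d0, d1, d2, d3]
  set k := IsFrame.sign (F.g y) J
  fin_cases a <;> fin_cases b <;> simp [leviInt, eta, kron, h0, h0', hd]
  · linear_combination (-(comp2 J (A y) 1 2)) * hk
  · rw [has 1 3]; linear_combination comp2 J (A y) 3 1 * hk
  · rw [has 2 1]; linear_combination comp2 J (A y) 1 2 * hk
  · linear_combination (-(comp2 J (A y) 2 3)) * hk
  · linear_combination (-(comp2 J (A y) 3 1)) * hk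
  · rw [has 3 2]; linear_combination comp2 J (A y) 2 3 * hk

theorem axial_orth (hJ : IsFrame (F.g y) (F.u y) J) (hG : ∀ α β, F.g y α β = F.g y β α)
    (A : Coord 4 → Fin 4 → Fin 4 → ℝ) :
    ∑ α, lower (F.g y) (F.u y) α * F.axial y A α = 0 := by
  rw [lower_dot_symm hG, lower_axial hJ]
  have := (comp1_dualLow_eq hJ (A y)).1
  rw [comp1_zero hJ] at this
  simpa only [mul_comm] using this

/-- The square of a vector in frame components. -/
theorem lower_dot (hJ : IsFrame (F.g y) (F.u y) J) (V W : Fin 4 → ℝ) :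
    ∑ α, lower (F.g y) V α * W α
      = ∑ a, eta a * comp1 J (lower (F.g y) V) a * comp1 J (lower (F.g y) W) a := by
  have e : ∀ α, lower (F.g y) V α * W α
      = ∑ a, lower (F.g y) V α * (eta a * comp1 J (lower (F.g y) W) a * J a α) := by
    intro α
    rw [← Finset.mul_sum]
    exact congrArg _ (congrFun (hJ.expand W) α)
  simp only [e]
  rw [Finset.sum_comm]
  refine Finset.sum_congr rfl fun a _ => ?_
  have e2 : ∀ α, lower (F.g y) V α * (eta a * comp1 J (lower (F.g y) W) a * J a α)
      = eta a * comp1 J (lower (F.g y) W) a * (J a α * lower (F.g y) V α) := fun α => by ring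
  rw [Finset.sum_congr rfl fun α _ => e2 α, ← Finset.mul_sum]
  simp only [comp1]
  ring

/-- The norm of a spatial 2-form and the norm of its dual vector. -/
theorem norm_axial (hJ : IsFrame (F.g y) (F.u y) J) (A : Coord 4 → Fin 4 → Fin 4 → ℝ)
    (hA : ∀ α β, A y α β = -A y β α) (hu : ∀ α, ∑ β, A y α β * F.u y β = 0) :
    ∑ μ, ∑ ν, (∑ ρ, ∑ σ, F.gInv y μ ρ * F.gInv y ν σ * A y ρ σ) * A y μ ν
      = 2 * ∑ α, lower (F.g y) (F.axial y A) α * F.axial y A α := by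
  have hc := hJ.contract_two (A y) (A y)
  have e : ∀ a b, comp2 J (A y) a b = _ := fun a b => by
    rw [eq_eps2_axial hJ A hA hu, comp2_eps2 hJ]
  simp only [LocalFields.gInv]
  rw [hc, lower_dot hJ]
  have d0 : comp1 J (lower (F.g y) (F.axial y A)) 0 = 0 := by
    rw [lower_axial hJ]; exact (comp1_dualLow_eq hJ (A y)).1
  have hk := hJ.sign_mul_self
  simp only [e, comp1_lower_u hJ, Fin.sum_univ_four, d0]
  simp [leviInt, eta, kron]
  linear_combination 2 * (comp1 J (lower (F.g y) (F.axial y A)) 1 ^ 2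
    + comp1 J (lower (F.g y) (F.axial y A)) 2 ^ 2
    + comp1 J (lower (F.g y) (F.axial y A)) 3 ^ 2) * hk

/-- A spatial vector has nonnegative square. -/
theorem lower_dot_self_nonneg (hJ : IsFrame (F.g y) (F.u y) J) (V : Fin 4 → ℝ)
    (hV : comp1 J (lower (F.g y) V) 0 = 0) : 0 ≤ ∑ α, lower (F.g y) V α * V α := by
  rw [lower_dot hJ]
  simp only [Fin.sum_univ_four, hV]
  simp only [eta, Fin.reduceEq, if_false, if_true]
  nlinarith [mul_self_nonneg (comp1 J (lower (F.g y) V) 1),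
    mul_self_nonneg (comp1 J (lower (F.g y) V) 2), mul_self_nonneg (comp1 J (lower (F.g y) V) 3)]

end PointwiseDuality

/-! ### The gradient of the spin vector -/

section SpinGradient

variable {F : LocalFields} {y : Coord 4} {J : Matrix (Fin 4) (Fin 4) ℝ}

/-- The pointwise relations between a spatial vector `S`, its gradient `NS μ γ = ∇_μ S^γ`, the dual
2-form `A` and its gradient `NA μ α β = ∇_μ A_{αβ}` for a Hubble flow. -/
structure IsSpinGradient (F : LocalFields) (y : Coord 4) (H : ℝ) (S : Fin 4 → ℝ)
    (NS A : Fin 4 → Fin 4 → ℝ) (NA : Fin 4 → Fin 4 → Fin 4 → ℝ) : Prop where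
  orth : ∑ α, F.u y α * lower (F.g y) S α = 0
  grad_orth : ∀ μ, ∑ γ, F.u y γ * lower (F.g y) (NS μ) γ = -(H * lower (F.g y) S μ)
  dual : ∀ α β, A α β = eps2 (√|(F.g y).det|) S (F.u y) α β
  grad_dual : ∀ μ α β, NA μ α β = eps2 (√|(F.g y).det|) (NS μ) (F.u y) α β
    + eps2 (√|(F.g y).det|) S
      (fun δ => H * (kron μ δ + lower (F.g y) (F.u y) μ * F.u y δ)) α β
  evolution : ∀ α β, ∑ μ, F.u y μ * NA μ α β = -(3 * H * A α β)
  divergence : ∀ α, ∑ μ, ∑ ν, F.gInv y μ ν * NA μ ν α = 0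

variable {H : ℝ} {S : Fin 4 → ℝ} {NS A : Fin 4 → Fin 4 → ℝ} {NA : Fin 4 → Fin 4 → Fin 4 → ℝ}

/-- Frame components of the gradient of the spin vector. -/
def gradComp (F : LocalFields) (y : Coord 4) (J : Matrix (Fin 4) (Fin 4) ℝ)
    (NS : Fin 4 → Fin 4 → ℝ) (a b : Fin 4) : ℝ := comp2 J (fun μ => lower (F.g y) (NS μ)) a b

namespace IsSpinGradient

/-- Differentiate `A = ε(S, u)`: the first sum comes from `∇S`, the second from `∇u = H h`, and the
volume form is parallel. Components of `∇S` are extracted from this formula below. -/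
theorem comp_grad_dual (hJ : IsFrame (F.g y) (F.u y) J) (h : IsSpinGradient F y H S NS A NA)
    (m a b : Fin 4) : ∑ μ, J m μ * comp2 J (NA μ) a b = IsFrame.sign (F.g y) J *
      (∑ c, (leviInt a b c 0 : ℝ) * (eta c * gradComp F y J NS m c)
        + H * ∑ c, ∑ e, (leviInt a b c e : ℝ) * (eta c * comp1 J (lower (F.g y) S) c)
          * (kron m e + eta m * kron m 0 * kron 0 e)) := by
  have e1 : ∀ μ, comp2 J (NA μ) a b = comp2 J (eps2 (√|(F.g y).det|) (NS μ) (F.u y)) a b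
      + comp2 J (eps2 (√|(F.g y).det|) S
        (fun δ => H * (kron μ δ + lower (F.g y) (F.u y) μ * F.u y δ))) a b := by
    intro μ
    simp only [comp2, ← Finset.sum_add_distrib, ← mul_add, h.grad_dual]
  have e2 : ∀ μ e, comp1 J (lower (F.g y)
      (fun δ => H * (kron μ δ + lower (F.g y) (F.u y) μ * F.u y δ))) e
      = H * (comp1 J (fun α => F.g y α μ) e
        + lower (F.g y) (F.u y) μ * (eta e * kron e 0)) := by
    intro μ e
    rw [← comp1_lower_u hJ]
    simp only [comp1, Finset.mul_sum, ← Finset.sum_add_distrib]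
    refine Finset.sum_congr rfl fun α _ => ?_
    have : lower (F.g y) (fun δ => H * (kron μ δ + lower (F.g y) (F.u y) μ * F.u y δ)) α
        = H * (F.g y α μ + lower (F.g y) (F.u y) μ * lower (F.g y) (F.u y) α) := by
      have e3 : ∀ β, F.g y α β * (H * (kron μ β + lower (F.g y) (F.u y) μ * F.u y β))
        = H * (F.g y α β * kron μ β)
          + H * lower (F.g y) (F.u y) μ * (F.g y α β * F.u y β) := fun β => by ring
      have e6 := Finset.sum_congr (rfl : (Finset.univ : Finset (Fin 4)) = _) fun β _ => e3 β
      rw [Finset.sum_add_distrib, ← Finset.mul_sum, ← Finset.mul_sum, sum_mul_kron'] at e6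
      refine e6.trans ?_
      simp only [lower]
      ring
    rw [this]; ring
  have e4 : ∀ e, ∑ μ, J m μ * comp1 J (fun α => F.g y α μ) e = eta e * kron e m := by
    intro e
    rw [← hJ.comp1_lower_frame]
    simp only [comp1, lower, Finset.mul_sum]
    rw [Finset.sum_comm]
    exact Finset.sum_congr rfl fun _ _ => Finset.sum_congr rfl fun _ _ => by ring
  have e5 : ∑ μ, J m μ * lower (F.g y) (F.u y) μ = eta m * kron m 0 := comp1_lower_u hJ m
  have t1 : ∑ μ, J m μ * comp2 J (eps2 (√|(F.g y).det|) (NS μ) (F.u y)) a b =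
      IsFrame.sign (F.g y) J *
        ∑ c, (leviInt a b c 0 : ℝ) * (eta c * gradComp F y J NS m c) := by
    have f1 : ∀ μ, comp2 J (eps2 (√|(F.g y).det|) (NS μ) (F.u y)) a b =
        IsFrame.sign (F.g y) J * ∑ c, (leviInt a b c 0 : ℝ) *
          (eta c * comp1 J (lower (F.g y) (NS μ)) c) := by
      intro μ
      rw [comp2_eps2 hJ]
      congr 1
      refine Finset.sum_congr rfl fun c _ => ?_
      have : ∀ e, eta e * comp1 J (lower (F.g y) (F.u y)) e = kron e 0 := fun e => by
        rw [comp1_lower_u hJ, ← mul_assoc, eta_mul_self, one_mul]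
      simp only [this, sum_mul_kron]
    simp only [f1, gradComp, comp2_eq_comp1, Finset.mul_sum]
    rw [Finset.sum_comm]
    exact Finset.sum_congr rfl fun _ _ => Finset.sum_congr rfl fun _ _ => by ring
  have t2 : ∑ μ, J m μ * comp2 J (eps2 (√|(F.g y).det|) S
        (fun δ => H * (kron μ δ + lower (F.g y) (F.u y) μ * F.u y δ))) a b =
      IsFrame.sign (F.g y) J * (H * ∑ c, ∑ e, (leviInt a b c e : ℝ) *
        (eta c * comp1 J (lower (F.g y) S) c) * (kron m e + eta m * kron m 0 * kron 0 e)) := by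
    have f1 : ∀ e, ∑ μ, J m μ * (eta e * (H * (comp1 J (fun α => F.g y α μ) e
        + lower (F.g y) (F.u y) μ * (eta e * kron e 0)))) =
        H * (kron m e + eta m * kron m 0 * kron 0 e) := by
      intro e
      have f2 : ∀ μ, J m μ * (eta e * (H * (comp1 J (fun α => F.g y α μ) e
        + lower (F.g y) (F.u y) μ * (eta e * kron e 0)))) =
          eta e * H * (J m μ * comp1 J (fun α => F.g y α μ) e)
          + eta e * eta e * H * kron e 0 * (J m μ * lower (F.g y) (F.u y) μ) := fun μ => by ring
      rw [Finset.sum_congr rfl fun μ _ => f2 μ, Finset.sum_add_distrib, ← Finset.mul_sum,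
        ← Finset.mul_sum, e4, e5, kron_comm e m, kron_comm e 0]
      linear_combination (H * kron m e + H * kron 0 e * eta m * kron m 0) * eta_mul_self e
    have f3 : ∀ c e, H * ((leviInt a b c e : ℝ) * (eta c * comp1 J (lower (F.g y) S) c)
        * (kron m e + eta m * kron m 0 * kron 0 e)) =
        ∑ μ, (leviInt a b c e : ℝ) * (eta c * comp1 J (lower (F.g y) S) c) *
          (J m μ * (eta e * (H * (comp1 J (fun α => F.g y α μ) e
        + lower (F.g y) (F.u y) μ * (eta e * kron e 0))))) := by
      intro c e
      rw [← Finset.mul_sum, f1]; ring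
    simp only [comp2_eps2 hJ, e2]
    simp only [Finset.mul_sum (a := H), f3]
    simp only [Finset.mul_sum]
    rw [← Finset.sum_comm_cycle]
    exact Finset.sum_congr rfl fun _ _ => Finset.sum_congr rfl fun _ _ =>
      Finset.sum_congr rfl fun _ _ => by ring
  have e7 : ∀ μ, J m μ * comp2 J (NA μ) a b = _ := fun μ => by rw [e1, mul_add]
  rw [Finset.sum_congr rfl fun μ _ => e7 μ, Finset.sum_add_distrib, t1, t2, ← mul_add]

theorem comp_dual (hJ : IsFrame (F.g y) (F.u y) J) (h : IsSpinGradient F y H S NS A NA)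
    (a b : Fin 4) : comp2 J A a b = IsFrame.sign (F.g y) J *
      ∑ c, (leviInt a b c 0 : ℝ) * (eta c * comp1 J (lower (F.g y) S) c) := by
  have e : A = eps2 (√|(F.g y).det|) S (F.u y) := by funext α β; exact h.dual α β
  rw [e, comp2_eps2 hJ]
  congr 1
  refine Finset.sum_congr rfl fun c _ => ?_
  have : ∀ e, eta e * comp1 J (lower (F.g y) (F.u y)) e = kron e 0 := fun e => by
    rw [comp1_lower_u hJ, ← mul_assoc, eta_mul_self, one_mul]
  simp only [this, sum_mul_kron]

theorem comp_zero (hJ : IsFrame (F.g y) (F.u y) J) (h : IsSpinGradient F y H S NS A NA) :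
    comp1 J (lower (F.g y) S) 0 = 0 := by
  rw [comp1_zero hJ, h.orth]

theorem gradComp_zero_right (hJ : IsFrame (F.g y) (F.u y) J)
    (h : IsSpinGradient F y H S NS A NA) (a : Fin 4) :
    gradComp F y J NS a 0 = -(H * comp1 J (lower (F.g y) S) a) := by
  rw [gradComp, comp2_eq_comp1]
  simp only [comp1_zero hJ, h.grad_orth]
  rw [comp1, Finset.mul_sum, ← Finset.sum_neg_distrib]
  exact Finset.sum_congr rfl fun _ _ => by ring

/-- Use the evolution law of `A` in the components (2,3), (3,1) and (1,2). In the direction of `u`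
the term from `∇u` vanishes, and duality transfers the law to `S`. -/
theorem gradComp_zero_left (hJ : IsFrame (F.g y) (F.u y) J)
    (h : IsSpinGradient F y H S NS A NA) (a : Fin 4) :
    gradComp F y J NS 0 a = -(3 * H * comp1 J (lower (F.g y) S) a) := by
  have hk := hJ.sign_mul_self
  have key : ∀ a b, ∑ μ, J 0 μ * comp2 J (NA μ) a b = -(3 * H * comp2 J A a b) := by
    intro a b
    rw [hJ.zero]
    simp only [comp2, Finset.mul_sum, ← Finset.sum_neg_distrib]
    rw [sum_rotate]
    refine Finset.sum_congr rfl fun α _ => Finset.sum_congr rfl fun β _ => ?_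
    have := h.evolution α β
    have e : ∀ μ, F.u y μ * (J a α * J b β * NA μ α β)
      = J a α * J b β * (F.u y μ * NA μ α β) := fun μ => by ring
    rw [Finset.sum_congr rfl fun μ _ => e μ, ← Finset.mul_sum, this]
    ring
  simp only [comp_grad_dual hJ h, comp_dual hJ h, Fin.sum_univ_four] at key
  have k1 := key 2 3
  have k2 := key 3 1
  have k3 := key 1 2
  simp [leviInt, eta, kron] at k1 k2 k3
  set k := IsFrame.sign (F.g y) J
  fin_cases a
  · have := gradComp_zero_right hJ h 0
    simp only [comp_zero hJ h] at this
    simpa [comp_zero hJ h] using this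
  · change gradComp F y J NS 0 1 = -(3 * H * comp1 J (lower (F.g y) S) 1)
    linear_combination (-k) * k1
      - (gradComp F y J NS 0 1 + 3 * H * comp1 J (lower (F.g y) S) 1) * hk
  · change gradComp F y J NS 0 2 = -(3 * H * comp1 J (lower (F.g y) S) 2)
    linear_combination (-k) * k2
      - (gradComp F y J NS 0 2 + 3 * H * comp1 J (lower (F.g y) S) 2) * hk
  · change gradComp F y J NS 0 3 = -(3 * H * comp1 J (lower (F.g y) S) 3)
    linear_combination (-k) * k3
      - (gradComp F y J NS 0 3 + 3 * H * comp1 J (lower (F.g y) S) 3) * hk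

/-- The divergence of a 2-form is the curl of its dual vector, so the spatial components of `div A =
0` are these three symmetries. -/
theorem gradComp_symm (hJ : IsFrame (F.g y) (F.u y) J) (h : IsSpinGradient F y H S NS A NA) :
    gradComp F y J NS 1 2 = gradComp F y J NS 2 1 ∧
    gradComp F y J NS 1 3 = gradComp F y J NS 3 1 ∧
    gradComp F y J NS 2 3 = gradComp F y J NS 3 2 := by
  have hk := hJ.sign_mul_self
  have key : ∀ b, ∑ m, eta m * ∑ μ, J m μ * comp2 J (NA μ) m b = 0 := by
    intro b
    have h1 : ∑ α, J b α * ∑ μ, ∑ ν, F.gInv y μ ν * NA μ ν α = 0 := by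
      simp [h.divergence]
    have h2 : ∀ α, ∑ μ, ∑ ν, F.gInv y μ ν * NA μ ν α =
        ∑ m, eta m * comp2 J (fun μ ν => NA μ ν α) m m := fun α =>
      hJ.contract (fun μ ν => NA μ ν α)
    simp only [h2] at h1
    rw [← h1]
    simp only [comp2, Finset.mul_sum]
    rw [Finset.sum_comm (f := fun α m => ∑ μ, ∑ ν, J b α * (eta m * (J m μ * J m ν * NA μ ν α)))]
    refine Finset.sum_congr rfl fun m _ => ?_
    rw [sum_rotate (f := fun α μ ν => J b α * (eta m * (J m μ * J m ν * NA μ ν α)))]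
    exact Finset.sum_congr rfl fun _ _ => Finset.sum_congr rfl fun _ _ =>
      Finset.sum_congr rfl fun _ _ => by ring
  simp only [comp_grad_dual hJ h, Fin.sum_univ_four] at key
  have k1 := key 1
  have k2 := key 2
  have k3 := key 3
  simp [leviInt, eta, kron, comp_zero hJ h] at k1 k2 k3
  set k := IsFrame.sign (F.g y) J
  set N := gradComp F y J NS
  refine ⟨?_, ?_, ?_⟩
  · linear_combination k * k3 - (N 1 2 - N 2 1) * hk
  · linear_combination -k * k2 - (N 1 3 - N 3 1) * hk
  · linear_combination k * k1 - (N 2 3 - N 3 2) * hk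

theorem vec_ext (hJ : IsFrame (F.g y) (F.u y) J) {V W : Fin 4 → ℝ}
    (h : ∀ a, comp1 J (lower (F.g y) V) a = comp1 J (lower (F.g y) W) a) : V = W := by
  rw [hJ.expand V, hJ.expand W]
  simp only [h]

/-- The spin vector decays along `u`. -/
theorem evolution_vec (hJ : IsFrame (F.g y) (F.u y) J) (h : IsSpinGradient F y H S NS A NA)
    (γ : Fin 4) : ∑ μ, F.u y μ * NS μ γ = -(3 * H * S γ) := by
  refine congrFun (vec_ext hJ (V := fun γ => ∑ μ, F.u y μ * NS μ γ)
    (W := fun γ => -(3 * H * S γ)) fun a => ?_) γ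
  have h1 := gradComp_zero_left hJ h a
  rw [gradComp, comp2_eq_comp1, hJ.zero] at h1
  have h2 : comp1 J (lower (F.g y) fun γ => ∑ μ, F.u y μ * NS μ γ) a
      = ∑ μ, F.u y μ * comp1 J (lower (F.g y) (NS μ)) a := by
    simp only [comp1, lower, Finset.mul_sum]
    rw [← sum_rotate]
    exact Finset.sum_congr rfl fun _ _ => Finset.sum_congr rfl fun _ _ =>
      Finset.sum_congr rfl fun _ _ => by ring
  rw [h2, h1]
  simp only [comp1, lower, Finset.mul_sum, ← Finset.sum_neg_distrib]
  exact Finset.sum_congr rfl fun _ _ => Finset.sum_congr rfl fun _ _ => by ring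

/-- The exterior derivative of the spin covector. -/
theorem curl (hJ : IsFrame (F.g y) (F.u y) J) (h : IsSpinGradient F y H S NS A NA) (μ ν : Fin 4) :
    lower (F.g y) (NS μ) ν - lower (F.g y) (NS ν) μ =
      2 * H * (lower (F.g y) (F.u y) μ * lower (F.g y) S ν
        - lower (F.g y) (F.u y) ν * lower (F.g y) S μ) := by
  refine congrFun (congrFun (hJ.comp2_ext
    (S := fun μ ν => lower (F.g y) (NS μ) ν - lower (F.g y) (NS ν) μ)
    (T := fun μ ν => 2 * H * (lower (F.g y) (F.u y) μ * lower (F.g y) S ν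
        - lower (F.g y) (F.u y) ν * lower (F.g y) S μ)) fun a b => ?_) μ) ν
  have e1 : comp2 J (fun μ ν => lower (F.g y) (NS μ) ν - lower (F.g y) (NS ν) μ) a b =
      gradComp F y J NS a b - gradComp F y J NS b a := by
    simp only [gradComp, comp2, mul_sub, Finset.sum_sub_distrib]
    congr 1
    rw [Finset.sum_comm]
    exact Finset.sum_congr rfl fun _ _ => Finset.sum_congr rfl fun _ _ => by ring
  have e2 : comp2 J (fun μ ν => 2 * H * (lower (F.g y) (F.u y) μ * lower (F.g y) S ν
        - lower (F.g y) (F.u y) ν * lower (F.g y) S μ)) a b =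
      2 * H * (comp1 J (lower (F.g y) (F.u y)) a * comp1 J (lower (F.g y) S) b
        - comp1 J (lower (F.g y) (F.u y)) b * comp1 J (lower (F.g y) S) a) := by
    rw [comp1, comp1, comp1, comp1, Finset.sum_mul_sum, Finset.sum_mul_sum,
      Finset.sum_comm (f := fun i j => J b i * _ * (J a j * _)), ← Finset.sum_sub_distrib,
      Finset.mul_sum]
    refine Finset.sum_congr rfl fun _ _ => ?_
    rw [← Finset.sum_sub_distrib, Finset.mul_sum]
    exact Finset.sum_congr rfl fun _ _ => by ring
  obtain ⟨s1, s2, s3⟩ := gradComp_symm hJ h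
  have zl := gradComp_zero_left hJ h
  have zr := gradComp_zero_right hJ h
  have z0 := comp_zero hJ h
  rw [e1, e2, comp1_lower_u hJ, comp1_lower_u hJ]
  fin_cases a <;> fin_cases b <;> simp [eta, kron, zl, zr, z0, s1, s2, s3] <;> ring

set_option maxHeartbeats 1000000 in
/-- The dual of a 2-form valued covector that agrees with the gradient of the spin 2-form up to
longitudinal terms. -/
theorem dualLow_grad (hJ : IsFrame (F.g y) (F.u y) J) (h : IsSpinGradient F y H S NS A NA)
    {B : Fin 4 → Fin 4 → Fin 4 → ℝ} {X Y : Fin 4 → Fin 4 → ℝ}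
    (hB : ∀ β μ ν, B β μ ν = -NA β μ ν + 3 * H * lower (F.g y) (F.u y) β * A μ ν
      + lower (F.g y) (F.u y) μ * X β ν + Y β μ * lower (F.g y) (F.u y) ν) (β α : Fin 4) :
    dualLow F y (B β) α = -(lower (F.g y) (NS β) α
      - 3 * H * lower (F.g y) (F.u y) β * lower (F.g y) S α
      - H * lower (F.g y) S β * lower (F.g y) (F.u y) α) := by
  refine congrFun (congrFun (hJ.comp2_ext (S := fun β => dualLow F y (B β))
    (T := fun β α => -(lower (F.g y) (NS β) α
      - 3 * H * lower (F.g y) (F.u y) β * lower (F.g y) S α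
      - H * lower (F.g y) S β * lower (F.g y) (F.u y) α)) fun b a => ?_) β) α
  have e2 : comp2 J (fun β α => -(lower (F.g y) (NS β) α
      - 3 * H * lower (F.g y) (F.u y) β * lower (F.g y) S α
      - H * lower (F.g y) S β * lower (F.g y) (F.u y) α)) b a =
      -(gradComp F y J NS b a
        - 3 * H * (comp1 J (lower (F.g y) (F.u y)) b * comp1 J (lower (F.g y) S) a)
        - H * (comp1 J (lower (F.g y) S) b * comp1 J (lower (F.g y) (F.u y)) a)) := by
    rw [gradComp, comp2, comp2, comp1, comp1, comp1, comp1, Finset.sum_mul_sum, Finset.sum_mul_sum,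
      Finset.mul_sum, Finset.mul_sum, ← Finset.sum_sub_distrib, ← Finset.sum_sub_distrib,
      ← Finset.sum_neg_distrib]
    refine Finset.sum_congr rfl fun _ _ => ?_
    rw [Finset.mul_sum, Finset.mul_sum, ← Finset.sum_sub_distrib, ← Finset.sum_sub_distrib,
      ← Finset.sum_neg_distrib]
    exact Finset.sum_congr rfl fun _ _ => by ring
  have hu0 : ∀ m : Fin 4, m ≠ 0 → comp1 J (lower (F.g y) (F.u y)) m = 0 := fun m hm => by
    rw [comp1_lower_u hJ, kron, if_neg hm, mul_zero]
  -- The terms with `X` and `Y` carry a frame component of `u` with index `m` or `n`, which is zero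
  -- for spatial indices.
  have e3 : ∀ m n : Fin 4, m ≠ 0 → n ≠ 0 → ∑ β, J b β * comp2 J (B β) m n =
      -∑ β, J b β * comp2 J (NA β) m n
        + 3 * H * comp1 J (lower (F.g y) (F.u y)) b * comp2 J A m n := by
    intro m n hm hn
    have f1 : ∀ β, comp2 J (B β) m n = -comp2 J (NA β) m n
        + 3 * H * lower (F.g y) (F.u y) β * comp2 J A m n
        + comp1 J (lower (F.g y) (F.u y)) m * comp1 J (X β) n
        + comp1 J (Y β) m * comp1 J (lower (F.g y) (F.u y)) n := by
      intro β
      rw [comp2, comp2, comp2, comp1, comp1, comp1, comp1, Finset.sum_mul_sum, Finset.sum_mul_sum,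
        Finset.mul_sum, ← Finset.sum_neg_distrib, ← Finset.sum_add_distrib,
        ← Finset.sum_add_distrib, ← Finset.sum_add_distrib]
      refine Finset.sum_congr rfl fun _ _ => ?_
      rw [Finset.mul_sum, ← Finset.sum_neg_distrib, ← Finset.sum_add_distrib,
        ← Finset.sum_add_distrib, ← Finset.sum_add_distrib]
      exact Finset.sum_congr rfl fun _ _ => by rw [hB]; ring
    have f2 : ∀ β, J b β * comp2 J (B β) m n = -(J b β * comp2 J (NA β) m n)
        + 3 * H * comp2 J A m n * (J b β * lower (F.g y) (F.u y) β) := fun β => by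
      rw [f1, hu0 m hm, hu0 n hn]; ring
    rw [Finset.sum_congr rfl fun β _ => f2 β, Finset.sum_add_distrib, Finset.sum_neg_distrib,
      ← Finset.mul_sum, comp1]
    ring
  have e5 : ∀ k m n, m ≠ 0 → n ≠ 0 → ∑ β, J b β * (k * (comp2 J (B β) m n - comp2 J (B β) n m)) =
      k * ((-∑ β, J b β * comp2 J (NA β) m n
        + 3 * H * comp1 J (lower (F.g y) (F.u y)) b * comp2 J A m n)
        - (-∑ β, J b β * comp2 J (NA β) n m
        + 3 * H * comp1 J (lower (F.g y) (F.u y)) b * comp2 J A n m)) := by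
    intro k m n hm hn
    rw [← e3 m n hm hn, ← e3 n m hn hm, ← Finset.sum_sub_distrib, Finset.mul_sum]
    exact Finset.sum_congr rfl fun _ _ => by ring
  have d := fun β => comp1_dualLow_eq hJ (B β)
  have hk := hJ.sign_mul_self
  have zl := gradComp_zero_left hJ h
  have zr := gradComp_zero_right hJ h
  have z0 := comp_zero hJ h
  have n1 : (1 : Fin 4) ≠ 0 := by decide
  have n2 : (2 : Fin 4) ≠ 0 := by decide
  have n3 : (3 : Fin 4) ≠ 0 := by decide
  rw [e2, comp2_eq_comp1, comp1_lower_u hJ, comp1_lower_u hJ]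
  have c1 := e5 (-(IsFrame.sign (F.g y) J / 2)) 2 3 n2 n3
  have c2 := e5 (-(IsFrame.sign (F.g y) J / 2)) 3 1 n3 n1
  have c3 := e5 (-(IsFrame.sign (F.g y) J / 2)) 1 2 n1 n2
  simp only [← (d _).2.1] at c1
  simp only [← (d _).2.2.1] at c2
  simp only [← (d _).2.2.2] at c3
  have c0 : ∑ β, J b β * comp1 J (dualLow F y (B β)) 0 = 0 := by simp [(d _).1]
  clear e2 e3 e5 d hu0 n1 n2 n3
  fin_cases a
  · change ∑ β, J b β * comp1 J (dualLow F y (B β)) 0 = -(gradComp F y J NS b 0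
      - 3 * H * (eta b * kron b 0 * comp1 J (lower (F.g y) S) 0)
      - H * (comp1 J (lower (F.g y) S) b * (eta 0 * kron 0 0)))
    rw [c0, zr, z0]
    simp [eta, kron]
  · change ∑ β, J b β * comp1 J (dualLow F y (B β)) 1 = -(gradComp F y J NS b 1
      - 3 * H * (eta b * kron b 0 * comp1 J (lower (F.g y) S) 1)
      - H * (comp1 J (lower (F.g y) S) b * (eta 1 * kron 1 0)))
    rw [c1]
    clear c1 c2 c3 c0
    simp only [comp_grad_dual hJ h, comp_dual hJ h, comp1_lower_u hJ]
    fin_cases b <;> simp [Fin.sum_univ_four, leviInt, eta, kron, zl, zr, z0]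
    · right; ring
    · linear_combination gradComp F y J NS 1 1 * hk
    · linear_combination gradComp F y J NS 2 1 * hk
    · linear_combination gradComp F y J NS 3 1 * hk
  · change ∑ β, J b β * comp1 J (dualLow F y (B β)) 2 = -(gradComp F y J NS b 2
      - 3 * H * (eta b * kron b 0 * comp1 J (lower (F.g y) S) 2)
      - H * (comp1 J (lower (F.g y) S) b * (eta 2 * kron 2 0)))
    rw [c2]
    clear c1 c2 c3 c0
    simp only [comp_grad_dual hJ h, comp_dual hJ h, comp1_lower_u hJ]
    fin_cases b <;> simp [Fin.sum_univ_four, leviInt, eta, kron, zl, zr, z0]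
    · right; ring
    · linear_combination gradComp F y J NS 1 2 * hk
    · linear_combination gradComp F y J NS 2 2 * hk
    · linear_combination gradComp F y J NS 3 2 * hk
  · change ∑ β, J b β * comp1 J (dualLow F y (B β)) 3 = -(gradComp F y J NS b 3
      - 3 * H * (eta b * kron b 0 * comp1 J (lower (F.g y) S) 3)
      - H * (comp1 J (lower (F.g y) S) b * (eta 3 * kron 3 0)))
    rw [c3]
    clear c1 c2 c3 c0
    simp only [comp_grad_dual hJ h, comp_dual hJ h, comp1_lower_u hJ]
    fin_cases b <;> simp [Fin.sum_univ_four, leviInt, eta, kron, zl, zr, z0]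
    · right; ring
    · linear_combination gradComp F y J NS 1 3 * hk
    · linear_combination gradComp F y J NS 2 3 * hk
    · linear_combination gradComp F y J NS 3 3 * hk

end IsSpinGradient

end SpinGradient

end EinsteinCartan

end

noncomputable section

namespace EinsteinCartan

/-! ### Decomposition of the Einstein equations along the flow -/

section FieldEquations

variable {R : Type*} [CommRing R] [Algebra ℝ R] {d : Fin 4 → Derivation ℝ R R}
  {G Gi A a : Fin 4 → Fin 4 → R} {Γ : Fin 4 → Fin 4 → Fin 4 → R} {u q : Fin 4 → R}
  {H Hd lam kap : R}

/-- Gradients without spatial part are parallel to `u`. -/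
theorem grad_eq_of_proj {f : R} (hf : ∀ α, ∑ ν, (kron α ν + lower G u α * u ν) * d ν f = 0)
    (μ : Fin 4) : d μ f = -((∑ ν, u ν * d ν f) * lower G u μ) := by
  have h := hf μ
  have e : ∀ ν, (kron μ ν + lower G u μ * u ν) * d ν f
      = kron μ ν * d ν f + lower G u μ * (u ν * d ν f) := fun ν => by ring
  simp only [e, Finset.sum_add_distrib, sum_kron_mul, ← Finset.mul_sum] at h
  linear_combination h

namespace IsSpin

theorem div_raise (h : IsLeviCivita d G Gi Γ) (s : IsSpin G Gi A a u) (α : Fin 4) :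
    ∑ μ, ∑ ν, Gi μ ν * covTwo d Γ A μ ν α = ∑ μ, covEnd d Γ a μ α μ := by
  refine Finset.sum_congr rfl fun μ _ => ?_
  simp only [← cov_raise_lower h s, Finset.mul_sum]
  rw [Finset.sum_comm]
  have e : ∀ γ, ∑ ν, Gi μ ν * (G ν γ * covEnd d Γ a μ α γ) = kron μ γ * covEnd d Γ a μ α γ := by
    intro γ
    simp only [← mul_assoc, ← Finset.sum_mul, h.inv_mul]
    rfl
  simp only [e, sum_kron_mul]

/-- The content of the Einstein equations for a fluid with spin torsion whose flow is a Hubble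
flow: there is no heat flow, the divergence of the spin vanishes, the spin is transported along `u`,
and the Levi-Civita Ricci tensor is that of a perfect fluid. -/
theorem einstein_split (h : IsHubbleFlow d G Gi Γ u H Hd) (s : IsSpin G Gi A a u)
    (hq : ∑ α, u α * q α = 0)
    (hE : ∀ α γ, ∑ μ, curv d (fun α β γ => Γ α β γ + spinContorsion G A a u α β γ) α μ γ μ =
      lam * (G α γ + lower G u α * lower G u γ) + kap * (lower G u α * lower G u γ)
        + q α * lower G u γ) :
    (∀ α, q α = 0) ∧ (∀ α, ∑ μ, covEnd d Γ a μ α μ = 0) ∧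
    (∀ α β, ∑ μ, u μ * covTwo d Γ A μ α β = -(3 * H * A α β)) ∧
    kap = -(3 * (H ^ 2 + Hd)) - ∑ μ, ∑ σ, a μ σ * a σ μ ∧
    (∀ α γ, ∑ μ, curv d Γ α μ γ μ = lam * (G α γ + lower G u α * lower G u γ)
      - 3 * (H ^ 2 + Hd) * (lower G u α * lower G u γ)) := by
  set ul := lower G u with hul
  set t := ∑ μ, ∑ σ, a μ σ * a σ μ with ht
  set W : Fin 4 → Fin 4 → R := fun α γ => ∑ μ, u μ * covTwo d Γ A μ α γ with hW
  set D : Fin 4 → R := fun α => ∑ μ, covEnd d Γ a μ α μ with hD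
  set r : Fin 4 → Fin 4 → R := fun α γ => ∑ μ, curv d Γ α μ γ μ with hr
  have hu : ∑ α, ul α * u α = -1 := h.unit
  have rs : ∀ α γ, r α γ = r γ α := h.lc.ricci_symm h.comm
  have ru : ∀ α, ∑ γ, r α γ * u γ = 3 * (H ^ 2 + Hd) * ul α := h.ricci_u
  have Wa : ∀ α γ, W α γ = -W γ α := by
    intro α γ
    simp only [hW, ← Finset.sum_neg_distrib]
    exact Finset.sum_congr rfl fun μ _ => by rw [covTwo_antisymm s.antisymm]; ring
  have Wu : ∀ α, ∑ γ, W α γ * u γ = 0 := by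
    intro α
    simp only [hW, Finset.sum_mul]
    rw [Finset.sum_comm]
    have : ∀ μ, ∑ γ, u μ * covTwo d Γ A μ α γ * u γ = -H * (A α μ * u μ) := by
      intro μ
      simp only [mul_assoc, ← Finset.mul_sum, cov_orth h s]
      ring
    simp only [this, ← Finset.mul_sum, s.orth, mul_zero]
  have Du : ∑ γ, D γ * u γ = 0 := by
    simp only [hD, Finset.sum_mul]
    rw [Finset.sum_comm]
    simp only [cov_raise_orth_left h s, Finset.sum_neg_distrib, ← Finset.mul_sum,
      trace_raise h.lc s, mul_zero, neg_zero]
  have hE' : ∀ α γ, r α γ + W α γ + 3 * H * A α γ + D α * ul γ + D γ * ul α - t * (ul α * ul γ) =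
      lam * (G α γ + ul α * ul γ) + kap * (ul α * ul γ) + q α * ul γ := fun α γ => by
    rw [← hE, ricci_contorsion h s]
  have Gu : ∀ α, ∑ γ, G α γ * u γ = ul α := fun α => rfl
  -- Contract the second index of the Einstein equation with `u`.
  have c1 : ∀ α, 3 * (H ^ 2 + Hd) * ul α - D α + t * ul α = -(kap * ul α) - q α := by
    intro α
    have e1 : ∑ γ, (r α γ + W α γ + 3 * H * A α γ + D α * ul γ + D γ * ul α - t * (ul α * ul γ)) * u γ
        = ∑ γ, r α γ * u γ + ∑ γ, W α γ * u γ + 3 * H * ∑ γ, A α γ * u γ + D α * ∑ γ, ul γ * u γ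
          + ul α * ∑ γ, D γ * u γ - t * ul α * ∑ γ, ul γ * u γ := by
      simp only [Finset.mul_sum, ← Finset.sum_add_distrib, ← Finset.sum_sub_distrib]
      exact Finset.sum_congr rfl fun _ _ => by ring
    have e2 : ∑ γ, (lam * (G α γ + ul α * ul γ) + kap * (ul α * ul γ) + q α * ul γ) * u γ
        = lam * (∑ γ, G α γ * u γ + ul α * ∑ γ, ul γ * u γ) + kap * ul α * ∑ γ, ul γ * u γ
          + q α * ∑ γ, ul γ * u γ := by
      simp only [Finset.mul_sum, ← Finset.sum_add_distrib]
      exact Finset.sum_congr rfl fun _ _ => by ring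
    simp only [hE'] at e1
    rw [e2, ru, Wu, s.orth, Du, hu, Gu] at e1
    linear_combination -e1
  -- Contract the first index instead. The Levi-Civita Ricci tensor is symmetric, the antisymmetric
  -- spin terms are orthogonal to `u`, and so is `q`. Comparison with `c1` therefore isolates `q`.
  have c2 : ∀ α, 3 * (H ^ 2 + Hd) * ul α - D α + t * ul α = -(kap * ul α) := by
    intro α
    have e1 : ∑ γ, (r γ α + W γ α + 3 * H * A γ α + D γ * ul α + D α * ul γ - t * (ul γ * ul α)) * u γ
        = ∑ γ, r α γ * u γ - ∑ γ, W α γ * u γ - 3 * H * ∑ γ, A α γ * u γ + D α * ∑ γ, ul γ * u γ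
          + ul α * ∑ γ, D γ * u γ - t * ul α * ∑ γ, ul γ * u γ := by
      simp only [Finset.mul_sum, ← Finset.sum_add_distrib, ← Finset.sum_sub_distrib]
      exact Finset.sum_congr rfl fun γ _ => by rw [rs γ α, Wa γ α, s.antisymm γ α]; ring
    have e2 : ∑ γ, (lam * (G γ α + ul γ * ul α) + kap * (ul γ * ul α) + q γ * ul α) * u γ
        = lam * (∑ γ, G α γ * u γ + ul α * ∑ γ, ul γ * u γ) + kap * ul α * ∑ γ, ul γ * u γ
          + ul α * ∑ γ, u γ * q γ := by
      simp only [Finset.mul_sum, ← Finset.sum_add_distrib]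
      exact Finset.sum_congr rfl fun γ _ => by rw [h.lc.metric_symm γ α]; ring
    simp only [hE'] at e1
    rw [e2, ru, Wu, s.orth, Du, hu, Gu, hq] at e1
    linear_combination -e1
  -- A second contraction with `u` gives the longitudinal component.
  have hk : kap = -(3 * (H ^ 2 + Hd)) - t := by
    have e1 : ∑ α, (3 * (H ^ 2 + Hd) * ul α - D α + t * ul α) * u α
        = 3 * (H ^ 2 + Hd) * ∑ α, ul α * u α - ∑ α, D α * u α + t * ∑ α, ul α * u α := by
      simp only [Finset.mul_sum, ← Finset.sum_add_distrib, ← Finset.sum_sub_distrib]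
      exact Finset.sum_congr rfl fun _ _ => by ring
    have e2 : ∑ α, -(kap * ul α) * u α = -kap * ∑ α, ul α * u α := by
      simp only [Finset.mul_sum]
      exact Finset.sum_congr rfl fun _ _ => by ring
    simp only [c2] at e1
    rw [e2, hu, Du] at e1
    linear_combination e1
  have hq0 : ∀ α, q α = 0 := fun α => by linear_combination c1 α - c2 α
  have hD0 : ∀ α, D α = 0 := fun α => by linear_combination -c2 α + ul α * hk
  -- Once `q` and `D` are known to vanish, the antisymmetric part of the equation is the transport
  -- law.
  have hW0 : ∀ α β, W α β = -(3 * H * A α β) := by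
    intro α β
    apply half_cancel
    have e1 := hE' α β
    have e2 := hE' β α
    rw [rs β α, Wa β α, s.antisymm β α, h.lc.metric_symm β α] at e2
    simp only [hq0, hD0] at e1 e2
    linear_combination e1 - e2
  refine ⟨hq0, hD0, hW0, hk, fun α γ => ?_⟩
  have e1 := hE' α γ
  rw [hW0, hD0, hD0, hq0] at e1
  change r α γ = _
  linear_combination e1 + (ul α * ul γ) * hk

end IsSpin

end FieldEquations

end EinsteinCartan

end

noncomputable section

namespace EinsteinCartan

/-! ### The Bochner argument for the spin vector -/

section SpinVector

variable {R : Type*} [CommRing R] [Algebra ℝ R]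

/-- A spatial vector field `S` on a Hubble flow with perfect fluid Ricci tensor that is transported
along `u`, is closed up to the expansion, and has homogeneous norm and divergence. -/
structure IsSpinVector (d : Fin 4 → Derivation ℝ R R) (G Gi : Fin 4 → Fin 4 → R)
    (Γ : Fin 4 → Fin 4 → Fin 4 → R) (u : Fin 4 → R) (H Hd : R) (S : Fin 4 → R) (lam : R) :
    Prop where
  flow : IsHubbleFlow d G Gi Γ u H Hd
  orth : ∑ α, lower G u α * S α = 0
  evol : ∀ γ, ∑ μ, u μ * covVec d Γ S μ γ = -(3 * H * S γ)
  curl : ∀ μ ν, lower G (covVec d Γ S μ) ν - lower G (covVec d Γ S ν) μ =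
    2 * H * (lower G u μ * lower G S ν - lower G u ν * lower G S μ)
  norm : ∀ μ, d μ (∑ α, lower G S α * S α)
    = -((∑ ν, u ν * d ν (∑ α, lower G S α * S α)) * lower G u μ)
  div : ∑ μ, S μ * d μ (∑ ν, covVec d Γ S ν ν) = 0
  ricci : ∀ α γ, ∑ μ, curv d Γ α μ γ μ = lam * (G α γ + lower G u α * lower G u γ)
      - 3 * (H ^ 2 + Hd) * (lower G u α * lower G u γ)

variable {d : Fin 4 → Derivation ℝ R R} {G Gi : Fin 4 → Fin 4 → R}
  {Γ : Fin 4 → Fin 4 → Fin 4 → R} {u S : Fin 4 → R} {H Hd lam : R}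

namespace IsSpinVector

theorem orth_symm (h : IsSpinVector d G Gi Γ u H Hd S lam) : ∑ α, lower G S α * u α = 0 := by
  rw [← h.orth]
  simp only [lower, Finset.sum_mul]
  rw [Finset.sum_comm]
  exact Finset.sum_congr rfl fun _ _ => Finset.sum_congr rfl fun _ _ => by
    rw [h.flow.lc.metric_symm]; ring

theorem cov_orth (h : IsSpinVector d G Gi Γ u H Hd S lam) (μ : Fin 4) :
    ∑ γ, lower G u γ * covVec d Γ S μ γ = -(H * lower G S μ) := by
  have e := h.flow.lc.d_inner u S μ
  have e1 : ∀ α, lower G S α * (H * (kron μ α + lower G u μ * u α))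
      = H * (lower G S α * kron μ α) + H * lower G u μ * (lower G S α * u α) := fun α => by ring
  simp only [h.orth, map_zero, h.flow.nabla, e1, Finset.sum_add_distrib, ← Finset.mul_sum,
    h.orth_symm, sum_mul_kron'] at e
  linear_combination -e

/-- By homogeneity the gradient of `|S|²` is along `u`, and the transport law determines its rate as
`2 S · (-3H S)`. -/
theorem norm_grad (h : IsSpinVector d G Gi Γ u H Hd S lam) (μ : Fin 4) :
    d μ (∑ α, lower G S α * S α) = 6 * H * (∑ α, lower G S α * S α) * lower G u μ := by
  have e : ∑ ν, u ν * d ν (∑ α, lower G S α * S α) = -(6 * H * ∑ α, lower G S α * S α) := by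
    have e1 : ∀ ν, u ν * d ν (∑ α, lower G S α * S α)
        = 2 * ∑ α, lower G S α * (u ν * covVec d Γ S ν α) := fun ν => by
      rw [h.flow.lc.d_inner, ← two_mul, mul_left_comm, Finset.mul_sum]
      congr 1
      exact Finset.sum_congr rfl fun _ _ => by ring
    simp only [e1, ← Finset.mul_sum]
    rw [Finset.sum_comm]
    simp only [← Finset.mul_sum, h.evol]
    have e2 : ∀ α, lower G S α * -(3 * H * S α) = -(3 * H) * (lower G S α * S α) := fun α => by ring
    simp only [e2, ← Finset.mul_sum]
    ring
  rw [h.norm, e]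
  ring

/-- The covariant derivative of the spin vector along itself. -/
theorem self_transport (h : IsSpinVector d G Gi Γ u H Hd S lam) :
    (fun γ => ∑ ν, covVec d Γ S ν γ * S ν) = fun γ => H * (∑ α, lower G S α * S α) * u γ := by
  refine eq_of_lower_eq h.flow.lc.inv_mul fun μ => ?_
  have e1 : ∑ γ, G μ γ * ∑ ν, covVec d Γ S ν γ * S ν = ∑ ν, lower G (covVec d Γ S ν) μ * S ν := by
    simp only [lower, Finset.mul_sum, Finset.sum_mul]
    rw [Finset.sum_comm]
    exact Finset.sum_congr rfl fun _ _ => Finset.sum_congr rfl fun _ _ => by ring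
  have e2 : ∑ γ, G μ γ * (H * (∑ α, lower G S α * S α) * u γ)
      = H * (∑ α, lower G S α * S α) * lower G u μ := by
    simp only [lower, Finset.mul_sum (s := Finset.univ) (f := fun γ => G μ γ * u γ)]
    exact Finset.sum_congr rfl fun _ _ => by ring
  have e3 : ∑ ν, lower G (covVec d Γ S μ) ν * S ν = ∑ ν, lower G S ν * covVec d Γ S μ ν := by
    simp only [lower, Finset.sum_mul]
    rw [Finset.sum_comm]
    exact Finset.sum_congr rfl fun _ _ => Finset.sum_congr rfl fun _ _ => by
      rw [h.flow.lc.metric_symm]; ring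
  -- Contract the curl equation with `S`: one term is half the gradient of `|S|²`, the other is the
  -- lowered `∇_S S`.
  have e4 : ∑ ν, (lower G (covVec d Γ S μ) ν - lower G (covVec d Γ S ν) μ) * S ν
      = 2 * H * (lower G u μ * ∑ ν, lower G S ν * S ν - lower G S μ * ∑ ν, lower G u ν * S ν) := by
    simp only [h.curl, Finset.mul_sum, ← Finset.sum_sub_distrib]
    exact Finset.sum_congr rfl fun _ _ => by ring
  have e5 := h.flow.lc.d_inner S S μ
  rw [h.norm_grad] at e5
  rw [e1, e2]
  simp only [sub_mul, Finset.sum_sub_distrib] at e4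
  rw [e3, h.orth] at e4
  apply half_cancel
  linear_combination -2 * e4 - e5

/-- The Bochner identity for the spin vector. -/
theorem bochner (h : IsSpinVector d G Gi Γ u H Hd S lam) :
    ∑ β, ∑ γ, covVec d Γ S β γ * covVec d Γ S γ β
      = (Hd - 3 * H ^ 2 - lam) * ∑ α, lower G S α * S α := by
  set σ := ∑ α, lower G S α * S α with hσ
  have hu := h.flow.unit
  -- The divergence of `∇_S S`, first from its closed form `H |S|² u`.
  have l : ∑ i, covVec d Γ (fun γ => H * σ * u γ) i i = Hd * σ - 3 * H ^ 2 * σ := by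
    have e1 : ∀ i, covVec d Γ (fun γ => H * σ * u γ) i i
        = (6 * H ^ 2 * σ - Hd * σ + H ^ 2 * σ) * (lower G u i * u i) + H ^ 2 * σ * kron i i := by
      intro i
      rw [covVec_mul, h.flow.nabla, Derivation.leibniz, h.flow.grad, h.norm_grad, smul_eq_mul,
        smul_eq_mul]
      ring
    have k1 : ∑ μ : Fin 4, (kron μ μ : R) = 4 := by simp [kron]
    simp only [e1, Finset.sum_add_distrib, ← Finset.mul_sum, hu, k1]
    ring
  -- The same divergence by the product rule. Exchanging the two derivatives of `S` produces `S(div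
  -- S)`, which is zero by hypothesis, and `Ric(S, S) = lam |S|²`.
  have r : ∑ i, covVec d Γ (fun γ => ∑ ν, covVec d Γ S ν γ * S ν) i i
      = ∑ β, ∑ γ, covVec d Γ S β γ * covVec d Γ S γ β + lam * σ := by
    simp only [covVec_contract_end, Finset.sum_add_distrib]
    have e1 : ∑ i, ∑ j, covEnd d Γ (covVec d Γ S) i j i * S j = lam * σ := by
      have e2 : ∀ i j, covEnd d Γ (covVec d Γ S) i j i = covEnd d Γ (covVec d Γ S) j i i
          + ∑ γ, curv d Γ j i γ i * S γ := fun i j => by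
        linear_combination h.flow.lc.ricci_identity h.flow.comm S j i i
      rw [Finset.sum_comm]
      have e3 : ∀ j, ∑ i, covEnd d Γ (covVec d Γ S) i j i * S j
          = S j * d j (∑ ν, covVec d Γ S ν ν) + S j * ∑ γ, (∑ i, curv d Γ j i γ i) * S γ := by
        intro j
        simp only [e2, d_trace_end d Γ, add_mul, Finset.sum_add_distrib, Finset.mul_sum,
          Finset.sum_mul]
        congr 1
        · exact Finset.sum_congr rfl fun _ _ => by ring
        · rw [Finset.sum_comm]
          exact Finset.sum_congr rfl fun _ _ => Finset.sum_congr rfl fun _ _ => by ring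
      have e4 : ∀ j, ∑ γ, (∑ i, curv d Γ j i γ i) * S γ = lam * lower G S j := by
        intro j
        have e5 : ∀ γ, (∑ i, curv d Γ j i γ i) * S γ = lam * (G j γ * S γ)
            + (lam - 3 * (H ^ 2 + Hd)) * lower G u j * (lower G u γ * S γ) := fun γ => by
          rw [h.ricci]; ring
        simp only [e5, Finset.sum_add_distrib, ← Finset.mul_sum, h.orth]
        simp only [lower]
        ring
      simp only [e3, Finset.sum_add_distrib, h.div, e4, zero_add, hσ, Finset.mul_sum]
      exact Finset.sum_congr rfl fun _ _ => by ring
    rw [e1, Finset.sum_comm, add_comm]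
  rw [h.self_transport, l] at r
  linear_combination -r

/-- Pair symmetry moves the contraction with `u` into the slot covered by `curv_u`; orthogonality of
`S` and `u` removes one of the resulting terms. -/
theorem curv_mixed (h : IsSpinVector d G Gi Γ u H Hd S lam) (β : Fin 4) :
    (fun γ => ∑ α, u α * ∑ ε, curv d Γ β α ε γ * S ε)
      = fun γ => (Hd + H ^ 2) * lower G S β * u γ := by
  refine eq_of_lower_eq h.flow.lc.inv_mul fun μ => ?_
  have e1 : ∑ γ, G μ γ * ∑ α, u α * ∑ ε, curv d Γ β α ε γ * S ε
      = ∑ α, ∑ ε, u α * S ε * curvLow d G Γ β α ε μ := by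
    simp only [curvLow, Finset.mul_sum]
    rw [sum_rotate]
    exact Finset.sum_congr rfl fun _ _ => Finset.sum_congr rfl fun _ _ =>
      Finset.sum_congr rfl fun _ _ => by rw [h.flow.lc.metric_symm μ]; ring
  have e2 : ∀ α ε, u α * S ε * curvLow d G Γ β α ε μ
      = -(S ε * (u α * curvLow d G Γ ε μ α β)) := by
    intro α ε
    rw [h.flow.lc.curvLow_pair h.flow.comm, h.flow.lc.curvLow_antisymm h.flow.comm]
    ring
  have e3 : ∀ ε, ∑ α, u α * curvLow d G Γ ε μ α β = (Hd + H ^ 2) *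
      (lower G u ε * (G μ β + lower G u μ * lower G u β)
        - lower G u μ * (G ε β + lower G u ε * lower G u β)) := by
    intro ε
    simp only [curvLow, Finset.mul_sum]
    rw [Finset.sum_comm]
    have e4 : ∀ ρ, ∑ α, u α * (curv d Γ ε μ α ρ * G ρ β) = (Hd + H ^ 2) *
        (lower G u ε * (kron μ ρ * G ρ β + lower G u μ * (G β ρ * u ρ))
        - lower G u μ * (kron ε ρ * G ρ β + lower G u ε * (G β ρ * u ρ))) := by
      intro ρ
      have e5 : ∀ α, u α * (curv d Γ ε μ α ρ * G ρ β) = G ρ β * (curv d Γ ε μ α ρ * u α) :=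
        fun α => by ring
      simp only [e5, ← Finset.mul_sum, h.flow.curv_u]
      rw [h.flow.lc.metric_symm β ρ]
      ring
    simp only [e4, ← Finset.mul_sum, Finset.sum_sub_distrib, Finset.sum_add_distrib, sum_kron_mul]
    rfl
  rw [e1, Finset.sum_comm]
  simp only [e2, Finset.sum_neg_distrib, ← Finset.mul_sum, e3]
  have e6 : ∀ ε, S ε * ((Hd + H ^ 2) *
      (lower G u ε * (G μ β + lower G u μ * lower G u β)
        - lower G u μ * (G ε β + lower G u ε * lower G u β)))
      = (Hd + H ^ 2) * (G μ β) * (lower G u ε * S ε) -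
        (Hd + H ^ 2) * lower G u μ * (G β ε * S ε) := by
    intro ε
    rw [h.flow.lc.metric_symm β ε]
    ring
  simp only [e6, Finset.sum_sub_distrib, ← Finset.mul_sum, h.orth]
  have e7 : ∑ γ, G μ γ * ((Hd + H ^ 2) * lower G S β * u γ)
      = (Hd + H ^ 2) * lower G S β * lower G u μ := by
    have : ∀ γ, G μ γ * ((Hd + H ^ 2) * lower G S β * u γ)
      = (Hd + H ^ 2) * lower G S β * (G μ γ * u γ) := fun γ => by ring
    simp only [this, ← Finset.mul_sum]
    rfl
  rw [e7]
  simp only [lower]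
  ring

/-- Exchange the two derivatives by the Ricci identity. The result is the gradient of `∇_u S = -3H
S`, minus the derivative of `S` along `∇u`, plus the curvature term of `curv_mixed`. -/
theorem second_cov_u (h : IsSpinVector d G Gi Γ u H Hd S lam) (β γ : Fin 4) :
    ∑ α, u α * covEnd d Γ (covVec d Γ S) α β γ =
      3 * (Hd + H ^ 2) * lower G u β * S γ - 4 * H * covVec d Γ S β γ
        + (Hd + H ^ 2) * lower G S β * u γ := by
  have e1 : ∀ α, u α * covEnd d Γ (covVec d Γ S) α β γ
      = covEnd d Γ (covVec d Γ S) β α γ * u α + u α * ∑ ε, curv d Γ β α ε γ * S ε := fun α => by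
    linear_combination u α * h.flow.lc.ricci_identity h.flow.comm S β α γ
  have e2 := congrFun (h.curv_mixed β) γ
  have e3 := covVec_contract_end d Γ (covVec d Γ S) u β γ
  have e4 : (fun ρ => ∑ α, covVec d Γ S α ρ * u α) = fun ρ => -(3 * H) * S ρ := by
    funext ρ
    have := h.evol ρ
    simp only [mul_comm (u _)] at this
    rw [this]; ring
  have e5 : ∑ α, covVec d Γ S α γ * covVec d Γ u β α
      = H * covVec d Γ S β γ - 3 * H ^ 2 * lower G u β * S γ := by
    have e6 : ∀ α, covVec d Γ S α γ * covVec d Γ u β α = H * (covVec d Γ S α γ * kron β α)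
        + H * lower G u β * (u α * covVec d Γ S α γ) := fun α => by
      rw [h.flow.nabla]; ring
    simp only [e6, Finset.sum_add_distrib, ← Finset.mul_sum, h.evol, sum_mul_kron']
    ring
  rw [e4, covVec_mul, Finset.sum_add_distrib, e5] at e3
  have e7 : d β (-(3 * H)) = 3 * Hd * lower G u β := by
    have : -(3 * H) = -(H + H + H) := by ring
    rw [this, map_neg, map_add, map_add, h.flow.grad]
    ring
  rw [e7] at e3
  simp only [e1, Finset.sum_add_distrib, e2]
  linear_combination -e3

/-- Evolution of the square of the gradient of the spin vector. -/
theorem square_evol (h : IsSpinVector d G Gi Γ u H Hd S lam) :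
    ∑ α, u α * d α (∑ β, ∑ γ, covVec d Γ S β γ * covVec d Γ S γ β) =
      -8 * H * (∑ β, ∑ γ, covVec d Γ S β γ * covVec d Γ S γ β)
        - 12 * H * (Hd + H ^ 2) * ∑ α, lower G S α * S α := by
  set N := covVec d Γ S with hN
  -- The square is the trace of an endomorphism, so only covariant derivatives of `∇S` appear, and
  -- both factors contribute equally.
  have e1 : ∀ α, d α (∑ β, ∑ γ, N β γ * N γ β) = 2 * ∑ β, ∑ γ, covEnd d Γ N α β γ * N γ β := by
    intro α
    have : ∀ β, ∑ γ, N β γ * N γ β = ∑ γ, N γ β * N β γ := fun β =>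
      Finset.sum_congr rfl fun _ _ => by ring
    rw [Finset.sum_congr rfl fun β _ => this β,
      d_trace_end d Γ (fun α ρ => ∑ γ, N γ ρ * N α γ) α]
    have e2 : ∀ β, covEnd d Γ (fun α ρ => ∑ γ, N γ ρ * N α γ) α β β
        = ∑ γ, covEnd d Γ N α γ β * N β γ + ∑ γ, covEnd d Γ N α β γ * N γ β := by
      intro β
      simp only [covEnd, Fin.sum_univ_four, map_add, Derivation.leibniz, smul_eq_mul]
      ring
    simp only [e2, Finset.sum_add_distrib]
    rw [Finset.sum_comm, two_mul]
  have e3 : ∑ α, u α * d α (∑ β, ∑ γ, N β γ * N γ β)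
      = 2 * ∑ β, ∑ γ, (∑ α, u α * covEnd d Γ N α β γ) * N γ β := by
    simp only [e1, Finset.mul_sum, Finset.sum_mul]
    rw [sum_rotate]
    exact Finset.sum_congr rfl fun _ _ => Finset.sum_congr rfl fun _ _ =>
      Finset.sum_congr rfl fun _ _ => by ring
  have e4 : ∀ β γ, (∑ α, u α * covEnd d Γ N α β γ) * N γ β =
      3 * (Hd + H ^ 2) * (S γ * (lower G u β * N γ β)) - 4 * H * (N β γ * N γ β)
        + (Hd + H ^ 2) * (lower G S β * (u γ * N γ β)) := fun β γ => by
    rw [h.second_cov_u]; ring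
  have e5 : ∑ β, ∑ γ, S γ * (lower G u β * N γ β) = -(H * ∑ α, lower G S α * S α) := by
    rw [Finset.sum_comm]
    simp only [← Finset.mul_sum, hN, h.cov_orth]
    rw [Finset.mul_sum, ← Finset.sum_neg_distrib]
    exact Finset.sum_congr rfl fun _ _ => by ring
  have e6 : ∑ β, ∑ γ, lower G S β * (u γ * N γ β) = -(3 * H * ∑ α, lower G S α * S α) := by
    simp only [← Finset.mul_sum, hN, h.evol]
    rw [Finset.mul_sum, ← Finset.sum_neg_distrib]
    exact Finset.sum_congr rfl fun _ _ => by ring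
  have e7 : ∑ β, ∑ γ, (∑ α, u α * covEnd d Γ N α β γ) * N γ β =
      3 * (Hd + H ^ 2) * (∑ β, ∑ γ, S γ * (lower G u β * N γ β))
        - 4 * H * (∑ β, ∑ γ, N β γ * N γ β)
        + (Hd + H ^ 2) * (∑ β, ∑ γ, lower G S β * (u γ * N γ β)) := by
    simp only [e4, Finset.sum_add_distrib, Finset.sum_sub_distrib, Finset.mul_sum]
  rw [e3, e7, e5, e6]
  ring

/-- The spatial curvature decays with the square of the scale factor. -/
theorem curvature_grad (h : IsSpinVector d G Gi Γ u H Hd S lam) {k : R}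
    (hlam : lam = 2 * k + Hd + 3 * H ^ 2) (hσ : IsUnit (∑ α, lower G S α * S α))
    (hk : ∀ μ, d μ k = -((∑ ν, u ν * d ν k) * lower G u μ)) (μ : Fin 4) :
    d μ k = 2 * H * k * lower G u μ := by
  -- By the Bochner identity both sides of the evolution law for `tr (∇S ∇S)` are multiples of
  -- `|S|²`. Cancelling it and comparing coefficients gives the rate of `k` without differentiating
  -- the curvature tensor.
  have e := h.square_evol
  rw [h.bochner, hlam] at e
  have hσg := h.norm_grad
  have hu := h.flow.unit
  set σ := ∑ α, lower G S α * S α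
  set kd := ∑ ν, u ν * d ν k with hkd
  -- The coefficient is written out as sums and products, so that only additivity and the Leibniz
  -- rule are needed to differentiate it.
  have e1 : (Hd - 3 * H ^ 2 - (2 * k + Hd + 3 * H ^ 2)) * σ
      = -((k + k + (H * H + H * H + H * H + H * H + H * H + H * H)) * σ) := by ring
  have e2 : ∀ α, u α * d α ((Hd - 3 * H ^ 2 - (2 * k + Hd + 3 * H ^ 2)) * σ)
      = (2 * kd * σ + 12 * H * Hd * σ - 6 * H * σ * (2 * k + 6 * H ^ 2))
        * (lower G u α * u α) := by
    intro α
    rw [e1]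
    simp only [map_neg, Derivation.leibniz, map_add, smul_eq_mul, h.flow.grad, hσg, hk]
    ring
  simp only [e2, ← Finset.mul_sum, hu] at e
  have e3 : kd = -(2 * H * k) := by
    apply half_cancel
    apply hσ.mul_right_cancel
    linear_combination -e
  rw [hk, e3]
  ring

end IsSpinVector

end SpinVector

end EinsteinCartan

end

noncomputable section

namespace EinsteinCartan

/-! ### The Levi-Civita connection of a smooth metric on an open set -/

section SmoothMetrics

variable {n : ℕ} {U : TopologicalSpace.Opens (Coord n)}

/-- A smooth nondegenerate metric on an open set. -/
structure SmoothMetric (U : TopologicalSpace.Opens (Coord n))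
    (G : Coord n → Matrix (Fin n) (Fin n) ℝ) : Prop where
  smooth : ∀ i j, ContDiffOn ℝ ∞ (fun y => G y i j) U
  symm : ∀ y ∈ U, ∀ i j, G y i j = G y j i
  det_ne : ∀ y ∈ U, (G y).det ≠ 0

/-- Curvature of connection coefficients that are smooth on `U`. -/
theorem riemann_eq_ev {C : Coord n → Fin n → Fin n → Fin n → ℝ} {Cs : Fin n → Fin n → Fin n → Sm U}
    (h : ∀ (y : U) α β γ, C y α β γ = Sm.ev y (Cs α β γ)) (y : U) (α β γ ρ : Fin n) :
    riemann C y α β γ ρ = Sm.ev y (curv Sm.d Cs α β γ ρ) := by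
  simp only [riemann, curv, map_add, map_sub, map_sum, map_mul, h]
  rw [Sm.pd_eq (Cs α γ ρ) (fun z => h z α γ ρ), Sm.pd_eq (Cs β γ ρ) (fun z => h z β γ ρ)]

namespace SmoothMetric

variable {G : Coord n → Matrix (Fin n) (Fin n) ℝ} (h : SmoothMetric U G)

/-- The metric coefficients as smooth functions. -/
def met (i j : Fin n) : Sm U := Sm.mk _ (h.smooth i j)

theorem ev_met (y : U) (i j : Fin n) : Sm.ev y (h.met i j) = G y i j := rfl

theorem map_met (y : U) : (Matrix.of h.met).map (Sm.ev y) = G y := rfl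

theorem ev_det (y : U) : Sm.ev y (Matrix.of h.met).det = (G y).det := by
  have := AlgHom.map_det (Sm.ev y) (Matrix.of h.met)
  rw [this]
  rfl

theorem isUnit_det : IsUnit (Matrix.of h.met).det :=
  Sm.isUnit_of_ev_ne_zero _ fun y => by rw [h.ev_det]; exact h.det_ne y y.2

/-- The coefficients of the inverse metric. -/
def inv (i j : Fin n) : Sm U := (Matrix.of h.met)⁻¹ i j

theorem ev_inv (y : U) (i j : Fin n) : Sm.ev y (h.inv i j) = (G y)⁻¹ i j := by
  have h1 : (Matrix.of h.met)⁻¹ * Matrix.of h.met = 1 := Matrix.nonsing_inv_mul _ h.isUnit_det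
  have h2 := congrArg (fun M => M.map (Sm.ev y)) h1
  simp only [Matrix.map_mul] at h2
  rw [h.map_met, Matrix.map_one _ (map_zero _) (map_one _)] at h2
  rw [Matrix.inv_eq_left_inv h2]
  rfl

/-- The Christoffel symbols as smooth functions. -/
def chr (α β γ : Fin n) : Sm U :=
  algebraMap ℝ (Sm U) (1 / 2) * ∑ σ, h.inv γ σ *
    (Sm.d α (h.met σ β) + Sm.d β (h.met α σ) - Sm.d σ (h.met α β))

theorem ev_chr (y : U) (α β γ : Fin n) : christoffel G y α β γ = Sm.ev y (h.chr α β γ) := by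
  simp only [christoffel, chr, map_mul, map_sum, map_add, map_sub, h.ev_inv, AlgHom.commutes]
  congr 1
  refine Finset.sum_congr rfl fun σ _ => ?_
  rw [Sm.pd_eq (h.met σ β) (fun _ => rfl), Sm.pd_eq (h.met α σ) (fun _ => rfl),
    Sm.pd_eq (h.met α β) (fun _ => rfl)]

theorem met_symm (α β : Fin n) : h.met α β = h.met β α :=
  Sm.ev_ext fun y => h.symm y y.2 α β

theorem inv_symm (α β : Fin n) : h.inv α β = h.inv β α := by
  have : (Matrix.of h.met).transpose = Matrix.of h.met := 
    Matrix.ext fun i j => h.met_symm j i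
  have h2 := Matrix.transpose_nonsing_inv (Matrix.of h.met)
  rw [this] at h2
  exact (congrFun (congrFun h2 β) α)

theorem inv_mul (α β : Fin n) : ∑ σ, h.inv α σ * h.met σ β = if α = β then 1 else 0 := by
  have h1 : (Matrix.of h.met)⁻¹ * Matrix.of h.met = 1 := Matrix.nonsing_inv_mul _ h.isUnit_det
  have := congrFun (congrFun h1 α) β
  rwa [Matrix.mul_apply, Matrix.one_apply] at this

theorem chr_lower (μ α β : Fin n) : ∑ σ, h.chr μ α σ * h.met σ β = algebraMap ℝ (Sm U) (1 / 2) *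
    (Sm.d μ (h.met β α) + Sm.d α (h.met μ β) - Sm.d β (h.met μ α)) := by
  have e : ∀ τ, ∑ σ, algebraMap ℝ (Sm U) (1 / 2) * (h.inv σ τ *
      (Sm.d μ (h.met τ α) + Sm.d α (h.met μ τ) - Sm.d τ (h.met μ α))) * h.met σ β
      = algebraMap ℝ (Sm U) (1 / 2) * (if τ = β then
        (Sm.d μ (h.met τ α) + Sm.d α (h.met μ τ) - Sm.d τ (h.met μ α)) else 0) := by
    intro τ
    have e2 : ∀ σ, algebraMap ℝ (Sm U) (1 / 2) * (h.inv σ τ *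
      (Sm.d μ (h.met τ α) + Sm.d α (h.met μ τ) - Sm.d τ (h.met μ α))) * h.met σ β
      = algebraMap ℝ (Sm U) (1 / 2) *
        ((Sm.d μ (h.met τ α) + Sm.d α (h.met μ τ) - Sm.d τ (h.met μ α))
          * (h.inv τ σ * h.met σ β)) := fun σ => by rw [h.inv_symm σ τ]; ring
    simp only [e2, ← Finset.mul_sum, h.inv_mul, mul_ite, mul_one, mul_zero]
  simp only [chr, Finset.mul_sum, Finset.sum_mul]
  rw [Finset.sum_comm]
  simp only [e]
  simp

theorem isLeviCivita : IsLeviCivita Sm.d h.met h.inv h.chr where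
  metric_symm := h.met_symm
  inv_symm := h.inv_symm
  inv_mul := h.inv_mul
  symm α β γ := by
    simp only [chr]
    congr 1
    refine Finset.sum_congr rfl fun σ _ => ?_
    rw [h.met_symm σ β, h.met_symm α σ, h.met_symm α β]
    ring
  compat μ α β := by
    rw [h.chr_lower, h.chr_lower, h.met_symm α β, h.met_symm μ α, h.met_symm μ β]
    have h2 : (algebraMap ℝ (Sm U) (1 / 2)) * 2 = 1 := by
      rw [← map_ofNat (algebraMap ℝ (Sm U)) 2, ← map_mul]; norm_num
    linear_combination -(Sm.d μ (h.met β α)) * h2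

theorem ev_curv (y : U) (α β γ ρ : Fin n) :
    riemann (christoffel G) y α β γ ρ = Sm.ev y (curv Sm.d h.chr α β γ ρ) :=
  riemann_eq_ev h.ev_chr y α β γ ρ

end SmoothMetric

end SmoothMetrics

/-! ### The volume density -/

section VolumeDensity

/-- The volume density is parallel. -/
theorem covTwo_eps2 {R : Type*} [CommRing R] [Algebra ℝ R] (d : Fin 4 → Derivation ℝ R R)
    (Γ : Fin 4 → Fin 4 → Fin 4 → R) {s : R} {μ : Fin 4} (hs : d μ s = s * ∑ σ, Γ μ σ σ)
    (V W : Fin 4 → R) (α β : Fin 4) :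
    covTwo d Γ (eps2 s V W) μ α β
      = eps2 s (covVec d Γ V μ) W α β + eps2 s V (covVec d Γ W μ) α β := by
  -- The trace term of this identity matches the derivative of the density `s`.
  have hl := levi_derivation (Γ μ) V W α β
  have e0 : ∀ α β, eps2 s V W α β = s * ∑ γ, ∑ δ, (leviInt α β γ δ : R) * V γ * W δ := by
    intro α β
    simp only [eps2, Finset.mul_sum]
    exact Finset.sum_congr rfl fun _ _ => Finset.sum_congr rfl fun _ _ => by ring
  have e1 : d μ (eps2 s V W α β) =
      s * (∑ σ, Γ μ σ σ) * ∑ γ, ∑ δ, (leviInt α β γ δ : R) * V γ * W δ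
      + s * (∑ γ, ∑ δ, (leviInt α β γ δ : R) * d μ (V γ) * W δ
        + ∑ γ, ∑ δ, (leviInt α β γ δ : R) * V γ * d μ (W δ)) := by
    have e2 : ∀ γ δ, d μ ((leviInt α β γ δ : R) * V γ * W δ)
        = (leviInt α β γ δ : R) * d μ (V γ) * W δ + (leviInt α β γ δ : R) * V γ * d μ (W δ) := by
      intro γ δ
      simp only [Derivation.leibniz, smul_eq_mul, Derivation.map_intCast]
      ring
    rw [e0, Derivation.leibniz, hs]
    simp only [map_sum, e2, Finset.sum_add_distrib, smul_eq_mul]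
    ring
  have e3 : eps2 s (covVec d Γ V μ) W α β = s * (∑ γ, ∑ δ, (leviInt α β γ δ : R) * d μ (V γ) * W δ
      + ∑ γ, ∑ δ, (leviInt α β γ δ : R) * (∑ σ, Γ μ σ γ * V σ) * W δ) := by
    simp only [eps2, covVec, ← Finset.sum_add_distrib, Finset.mul_sum (a := s)]
    exact Finset.sum_congr rfl fun _ _ => Finset.sum_congr rfl fun _ _ => by ring
  have e4 : eps2 s V (covVec d Γ W μ) α β = s * (∑ γ, ∑ δ, (leviInt α β γ δ : R) * V γ * d μ (W δ)
      + ∑ γ, ∑ δ, (leviInt α β γ δ : R) * V γ * ∑ σ, Γ μ σ δ * W σ) := by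
    simp only [eps2, covVec, ← Finset.sum_add_distrib, Finset.mul_sum (a := s)]
    exact Finset.sum_congr rfl fun _ _ => Finset.sum_congr rfl fun _ _ => by ring
  have e5 : ∀ (v : Fin 4 → R) (f : Fin 4 → R), ∑ σ, v σ * (s * f σ) = s * ∑ σ, v σ * f σ := by
    intro v f
    rw [Finset.mul_sum]
    exact Finset.sum_congr rfl fun _ _ => by ring
  rw [covTwo, e1, e3, e4]
  simp only [e0, e5]
  linear_combination s * hl

variable {U : TopologicalSpace.Opens (Coord 4)} {G : Coord 4 → Matrix (Fin 4) (Fin 4) ℝ}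

namespace SmoothMetric

/-- The volume density of a metric with negative determinant. -/
theorem exists_density (h : SmoothMetric U G) (hneg : ∀ y ∈ U, (G y).det < 0) :
    ∃ s : Sm U, (∀ y, Sm.ev y s = √|(G y).det|) ∧ ∀ μ, Sm.d μ s = s * ∑ σ, h.chr μ σ σ := by
  have hdet : ContDiffOn ℝ ∞ (fun y => -(G y).det) U := by
    refine (Sm.smooth (-(Matrix.of h.met).det)).congr fun y hy => ?_
    rw [Sm.extendZero_ev _ ⟨y, hy⟩, map_neg, h.ev_det]
  have hs : ContDiffOn ℝ ∞ (fun y => √(-(G y).det)) U :=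
    hdet.sqrt fun y hy => (neg_pos.mpr (hneg y hy)).ne'
  have hev : ∀ y, Sm.ev y (Sm.mk _ hs) = √|(G y).det| := fun y => by
    rw [Sm.ev_mk, abs_of_neg (hneg y y.2)]
  refine ⟨Sm.mk _ hs, hev, fun μ => ?_⟩
  set s := Sm.mk _ hs
  -- The density is handled through its square `-det g`, whose derivative is given by Jacobi's
  -- formula; afterwards `2s` is cancelled.
  have hss : s * s = -(Matrix.of h.met).det := Sm.ev_ext fun y => by
    rw [map_mul, map_neg, h.ev_det, Sm.ev_mk,
      Real.mul_self_sqrt (neg_pos.mpr (hneg y y.2)).le]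
  have hunit : IsUnit s := Sm.isUnit_of_ev_ne_zero s fun y => by
    rw [Sm.ev_mk]
    exact (Real.sqrt_pos.mpr (neg_pos.mpr (hneg y y.2))).ne'
  have hd := d_det (Sm.d μ) h.met (h.chr μ) fun α β => by
    rw [h.isLeviCivita.compat]
    congr 1
    exact Finset.sum_congr rfl fun σ _ => by rw [h.met_symm α σ]
  have h1 : Sm.d μ (s * s) = -(2 * (∑ σ, h.chr μ σ σ) * (Matrix.of h.met).det) := by
    rw [hss, map_neg, hd]
  rw [Derivation.leibniz, smul_eq_mul] at h1
  apply half_cancel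
  apply hunit.mul_left_cancel
  linear_combination h1 - 2 * (∑ σ, h.chr μ σ σ) * hss

end SmoothMetric

end VolumeDensity

end EinsteinCartan

end

noncomputable section

namespace EinsteinCartan

/-! ### Solving the Cartan equation -/

section PointwiseAlgebra

/-- The algebraic solution of the Cartan equation. -/
theorem cartan_solve {G : Matrix (Fin 4) (Fin 4) ℝ} (hG : G.transpose = G) (hdet : G.det ≠ 0)
    {T : Fin 4 → Fin 4 → Fin 4 → ℝ} {A : Fin 4 → Fin 4 → ℝ} {u : Fin 4 → ℝ}
    (hA : ∀ α, ∑ β, A α β * u β = 0)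
    (h : ∀ α β γ, (∑ ρ, ∑ σ, G⁻¹ α ρ * G⁻¹ β σ * T ρ σ γ)
      + (G⁻¹ γ α * (∑ ρ, ∑ μ, G⁻¹ β ρ * T ρ μ μ) - G⁻¹ γ β * (∑ ρ, ∑ μ, G⁻¹ α ρ * T ρ μ μ))
      = (∑ ρ, ∑ σ, G⁻¹ α ρ * G⁻¹ β σ * A ρ σ) * u γ) (α β γ : Fin 4) :
    T α β γ = A α β * u γ := by
  have hu : IsUnit G.det := isUnit_iff_ne_zero.mpr hdet
  have hGi : G⁻¹.transpose = G⁻¹ := by rw [Matrix.transpose_nonsing_inv, hG]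
  set t : Fin 4 → ℝ := fun ρ => ∑ μ, T ρ μ μ with ht
  -- Lowering the two raised indices turns the Cartan equation into one that does not contain the
  -- metric.
  have key : ∀ γ α β, T α β γ - A α β * u γ + (kron γ α * t β - t α * kron γ β) = 0 := by
    intro γ
    set Z : Matrix (Fin 4) (Fin 4) ℝ := Matrix.of fun α β =>
      T α β γ - A α β * u γ + (kron γ α * t β - t α * kron γ β) with hZ
    have h1 : G⁻¹ * Z * G⁻¹.transpose = 0 := by
      ext α β
      have e1 : ∀ σ, (G⁻¹ * Z) α σ = ∑ ρ, G⁻¹ α ρ * T ρ σ γ - (∑ ρ, G⁻¹ α ρ * A ρ σ) * u γ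
          + (G⁻¹ α γ * t σ - (∑ ρ, G⁻¹ α ρ * t ρ) * kron γ σ) := by
        intro σ
        have : G⁻¹ α γ = ∑ ρ, G⁻¹ α ρ * kron γ ρ := by simp
        rw [Matrix.mul_apply, this]
        simp only [hZ, Matrix.of_apply, Finset.sum_mul, ← Finset.sum_add_distrib,
          ← Finset.sum_sub_distrib]
        exact Finset.sum_congr rfl fun ρ _ => by ring
      have e2 : (G⁻¹ * Z * G⁻¹.transpose) α β =
          (∑ ρ, ∑ σ, G⁻¹ α ρ * G⁻¹ β σ * T ρ σ γ) - (∑ ρ, ∑ σ, G⁻¹ α ρ * G⁻¹ β σ * A ρ σ) * u γ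
          + (G⁻¹ α γ * (∑ σ, G⁻¹ β σ * t σ) - (∑ ρ, G⁻¹ α ρ * t ρ) * G⁻¹ β γ) := by
        have : G⁻¹ β γ = ∑ σ, G⁻¹ β σ * kron γ σ := by simp
        have x : ∀ (M : Fin 4 → Fin 4 → ℝ) σ, ∑ ρ, G⁻¹ α ρ * G⁻¹ β σ * M ρ σ
            = (∑ ρ, G⁻¹ α ρ * M ρ σ) * G⁻¹ β σ := fun M σ => by
          rw [Finset.sum_mul]
          exact Finset.sum_congr rfl fun ρ _ => by ring
        rw [Matrix.mul_apply, this, Finset.sum_comm, Finset.sum_comm (f := fun ρ σ => _ * A ρ σ)]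
        simp only [x (fun ρ σ => T ρ σ γ), x A, e1, Matrix.transpose_apply,
          Finset.mul_sum (a := G⁻¹ α γ), Finset.mul_sum (a := ∑ ρ, G⁻¹ α ρ * t ρ)]
        rw [Finset.sum_mul, ← Finset.sum_sub_distrib, ← Finset.sum_sub_distrib,
          ← Finset.sum_add_distrib]
        exact Finset.sum_congr rfl fun σ _ => by ring
      have s1 : G⁻¹ α γ = G⁻¹ γ α := congrFun (congrFun hGi γ) α
      have s2 : G⁻¹ β γ = G⁻¹ γ β := congrFun (congrFun hGi γ) β
      have e3 := h α β γ
      simp only [← Finset.mul_sum] at e3 e2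
      rw [e2, s1, s2, Matrix.zero_apply]
      linear_combination e3
    have h2 : Z = 0 := by
      have e1 := congrArg (fun M => G * M * G) h1
      simp only [hGi, Matrix.mul_zero, Matrix.zero_mul] at e1
      rw [Matrix.mul_assoc, Matrix.mul_assoc, Matrix.nonsing_inv_mul _ hu, Matrix.mul_one,
        ← Matrix.mul_assoc, Matrix.mul_nonsing_inv _ hu, Matrix.one_mul] at e1
      exact e1
    intro α β
    exact congrFun (congrFun h2 α) β
  -- Tracing over `β` and `γ` gives `t + t - 4t = 0`, as the spin term drops out by `A u = 0`. The
  -- torsion trace therefore vanishes.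
  have ht0 : ∀ α, t α = 0 := by
    intro α
    have e1 : ∑ β, (T α β β - A α β * u β + (kron β α * t β - t α * kron β β)) = 0 :=
      Finset.sum_eq_zero fun β _ => key β α β
    have k1 : ∑ μ : Fin 4, (kron μ μ : ℝ) = 4 := by simp [kron]
    have e2 : ∑ β, T α β β = t α := rfl
    simp only [Finset.sum_add_distrib, Finset.sum_sub_distrib, hA, ← Finset.mul_sum, k1, e2,
      sum_kron_mul'] at e1
    linarith
  have := key γ α β
  rw [ht0, ht0] at this
  linarith

variable {R : Type*} [CommRing R]

/-- Projection does not change a tensor orthogonal to `u`. -/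
theorem proj_two_of_orth {v u : Fin 4 → R} {B : Fin 4 → Fin 4 → R}
    (h1 : ∀ γ, ∑ σ, B γ σ * u σ = 0) (h2 : ∀ σ, ∑ γ, u γ * B γ σ = 0) (α β : Fin 4) :
    ∑ γ, ∑ σ, (kron α γ + v α * u γ) * (kron β σ + v β * u σ) * B γ σ = B α β := by
  have e1 : ∀ γ, ∑ σ, (kron α γ + v α * u γ) * (kron β σ + v β * u σ) * B γ σ
      = kron α γ * B γ β + v α * (u γ * B γ β) := by
    intro γ
    have e2 : ∀ σ, (kron α γ + v α * u γ) * (kron β σ + v β * u σ) * B γ σ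
        = (kron α γ + v α * u γ) * (kron β σ * B γ σ)
          + (kron α γ + v α * u γ) * v β * (B γ σ * u σ) := fun σ => by ring
    simp only [e2, Finset.sum_add_distrib, ← Finset.mul_sum, h1, sum_kron_mul]
    ring
  simp only [e1, Finset.sum_add_distrib, ← Finset.mul_sum, h2, sum_kron_mul]
  ring

end PointwiseAlgebra

/-! ### Kinematics of the fluid in a chart -/

section LocalSolutions

/-- A solution of the field equations of a cosmological Weyssenhoff fluid in a coordinate domain. -/
structure IsLocalSolution (U : TopologicalSpace.Opens (Coord 4)) (F : LocalFields)
    (A : Coord 4 → Fin 4 → Fin 4 → ℝ) (mu p : Coord 4 → ℝ) (q : Coord 4 → Fin 4 → ℝ)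
    (f : ℝ × ℝ → ℝ) (Λ : ℝ) : Prop where
  metric : SmoothMetric U F.g
  tor_smooth : ∀ α β γ, ContDiffOn ℝ ∞ (fun y => F.tor y α β γ) U
  u_smooth : ∀ α, ContDiffOn ℝ ∞ (fun y => F.u y α) U
  unit : ∀ y ∈ U, ∑ α, lower (F.g y) (F.u y) α * F.u y α = -1
  frame : ∀ y ∈ U, ∃ J, IsFrame (F.g y) (F.u y) J
  spin_antisymm : ∀ y ∈ U, ∀ α β, A y α β = -A y β α
  spin_orth : ∀ y ∈ U, ∀ α, ∑ β, A y α β * F.u y β = 0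
  heat_orth : ∀ y ∈ U, ∑ α, F.u y α * q y α = 0
  einstein : ∀ y ∈ U, ∀ α β, F.ric y α β - (1 / 2) * F.g y α β * F.scal y + Λ * F.g y α β =
    8 * Real.pi * (mu y * F.uLow y α * F.uLow y β + p y * F.h y α β + q y α * F.uLow y β)
  cartan : ∀ y ∈ U, ∀ α β γ, (∑ ρ, ∑ σ, F.gInv y α ρ * F.gInv y β σ * F.tor y ρ σ γ)
      + (F.gInv y γ α * (∑ ρ, ∑ μ, F.gInv y β ρ * F.tor y ρ μ μ)
        - F.gInv y γ β * (∑ ρ, ∑ μ, F.gInv y α ρ * F.tor y ρ μ μ))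
      = (∑ ρ, ∑ σ, F.gInv y α ρ * F.gInv y β σ * A y ρ σ) * F.u y γ
  shear_free : ∀ y ∈ U, ∀ α β, F.shear y α β = 0
  expansion_homogeneous : ∀ y ∈ U, ∀ α, F.projGrad y F.expansion α = 0
  energy_homogeneous : ∀ y ∈ U, ∀ α, F.projGrad y mu α = 0
  pressure_homogeneous : ∀ y ∈ U, ∀ α, F.projGrad y p α = 0
  geodesic : ∀ y ∈ U, ∀ α, F.accel y α = 0
  vorticity_eq : ∀ y ∈ U, ∀ α β, F.vorticity y α β = F.torS y α β
  spin_ne_zero : ∀ y ∈ U, F.torVecSq y ≠ 0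
  differentiable : ∀ y ∈ U, DifferentiableAt ℝ f (mu y, p y)
  divergence : ∀ y ∈ U, F.projDiv y (fun z γ => F.axial z A γ) = f (mu y, p y)

variable {U : TopologicalSpace.Opens (Coord 4)} {F : LocalFields}
  {A : Coord 4 → Fin 4 → Fin 4 → ℝ} {mu p : Coord 4 → ℝ} {q : Coord 4 → Fin 4 → ℝ}
  {f : ℝ × ℝ → ℝ} {Λ : ℝ}

@[simp] theorem Sm.ev_kron (y : U) (α β : Fin 4) : Sm.ev y (kron α β) = kron α β := by
  unfold kron; split_ifs <;> simp

namespace IsLocalSolution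

variable (h : IsLocalSolution U F A mu p q f Λ)

/-- The velocity components as smooth functions. -/
def vel (α : Fin 4) : Sm U := Sm.mk _ (h.u_smooth α)

/-- The lowered velocity. -/
abbrev velLow : Fin 4 → Sm U := lower h.metric.met h.vel

theorem ev_vel (y : U) (α : Fin 4) : Sm.ev y (h.vel α) = F.u y α := rfl

theorem ev_lower (y : U) (V : Fin 4 → Sm U) (α : Fin 4) :
    Sm.ev y (lower h.metric.met V α) = lower (F.g y) (fun β => Sm.ev y (V β)) α := by
  simp only [lower, map_sum, map_mul, h.metric.ev_met]

theorem ev_velLow (y : U) (α : Fin 4) : Sm.ev y (h.velLow α) = lower (F.g y) (F.u y) α :=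
  h.ev_lower y _ α

theorem uLow_eq (y : Coord 4) (α : Fin 4) : F.uLow y α = lower (F.g y) (F.u y) α := rfl

theorem hMix_eq (y : U) (α β : Fin 4) :
    F.hMix y α β = Sm.ev y (kron α β + h.velLow α * h.vel β) := by
  rw [map_add, map_mul, h.ev_velLow, Sm.ev_kron]
  rfl

theorem gInv_eq (y : U) (α β : Fin 4) : F.gInv y α β = Sm.ev y (h.metric.inv α β) :=
  (h.metric.ev_inv y α β).symm

theorem tor_eq (h : IsLocalSolution U F A mu p q f Λ) (y : U) (α β γ : Fin 4) : F.tor y α β γ = A y α β * F.u y γ :=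
  cartan_solve (Matrix.ext fun i j => h.metric.symm y y.2 j i) (h.metric.det_ne y y.2)
    (h.spin_orth y y.2) (h.cartan y y.2) α β γ

/-- The spin density as a smooth tensor. -/
def spin (α β : Fin 4) : Sm U := -∑ γ, Sm.mk _ (h.tor_smooth α β γ) * h.velLow γ

/-- Smoothness of the spin density is not assumed. It is recovered from the smooth torsion `A u` by
contraction with `u`, and the sign compensates `u_γ u^γ = -1`. -/
theorem ev_spin (y : U) (α β : Fin 4) : Sm.ev y (h.spin α β) = A y α β := by
  have e : ∀ γ, F.tor y α β γ * lower (F.g y) (F.u y) γ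
      = A y α β * (lower (F.g y) (F.u y) γ * F.u y γ) := fun γ => by rw [h.tor_eq]; ring
  simp only [spin, map_neg, map_sum, map_mul, Sm.ev_mk, h.ev_velLow, e, ← Finset.mul_sum,
    h.unit y y.2]
  ring

/-- The spin density with its first index raised. -/
def spinMix (α γ : Fin 4) : Sm U := ∑ δ, h.metric.inv γ δ * h.spin δ α

theorem isSpin : IsSpin h.metric.met h.metric.inv h.spin h.spinMix h.vel where
  antisymm α β := Sm.ev_ext fun y => by
    rw [map_neg, h.ev_spin, h.ev_spin, h.spin_antisymm y y.2]
  orth α := Sm.ev_ext fun y => by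
    simp only [map_sum, map_mul, h.ev_spin, h.ev_vel, map_zero]
    exact h.spin_orth y y.2 α
  raise _ _ := rfl
  lowered δ α := by
    have e := h.metric.isLeviCivita
    have inv' : ∀ τ, ∑ γ, h.metric.met δ γ * h.metric.inv γ τ = kron δ τ := by
      intro τ
      have := h.metric.inv_mul τ δ
      rw [kron_comm, kron, ← this]
      exact Finset.sum_congr rfl fun γ _ => by
        rw [h.metric.inv_symm τ γ, h.metric.met_symm δ γ]; ring
    simp only [spinMix, Finset.mul_sum]
    rw [Finset.sum_comm]
    simp only [← mul_assoc, ← Finset.sum_mul, inv', sum_kron_mul]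

/-- The coefficients of the connection with torsion. -/
def con (α β γ : Fin 4) : Sm U :=
  h.metric.chr α β γ + spinContorsion h.metric.met h.spin h.spinMix h.vel α β γ

theorem torLow_eq (h : IsLocalSolution U F A mu p q f Λ) (y : U) (α β γ : Fin 4) :
    F.torLow y α β γ = A y α β * lower (F.g y) (F.u y) γ := by
  simp only [LocalFields.torLow, lower, Finset.mul_sum]
  exact Finset.sum_congr rfl fun σ _ => by
    rw [h.tor_eq, h.metric.symm y y.2 σ γ]; ring

/-- For the torsion `A u` the general contorsion reduces to `spinContorsion`; antisymmetry of `A`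
accounts for the sign of its last term. -/
theorem conn_eq (y : U) (α β γ : Fin 4) : F.conn y α β γ = Sm.ev y (h.con α β γ) := by
  simp only [LocalFields.conn, con, spinContorsion, map_add, map_mul, h.ev_spin, h.ev_vel,
    h.ev_velLow, spinMix, map_sum, h.metric.ev_chr y, LocalFields.contorsion, h.torLow_eq,
    h.tor_eq, h.gInv_eq, Finset.sum_mul]
  have e : ∑ ρ, Sm.ev y (h.metric.inv γ ρ) * (A y β ρ * lower (F.g y) (F.u y) α)
      = -∑ ρ, Sm.ev y (h.metric.inv γ ρ) * A y ρ β * lower (F.g y) (F.u y) α := by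
    rw [← Finset.sum_neg_distrib]
    exact Finset.sum_congr rfl fun ρ _ => by rw [h.spin_antisymm y y.2 β ρ]; ring
  rw [e]
  simp only [mul_assoc]
  ring

theorem riem_eq (y : U) (α β γ ρ : Fin 4) :
    riemann F.conn y α β γ ρ = Sm.ev y (curv Sm.d h.con α β γ ρ) :=
  riemann_eq_ev h.conn_eq y α β γ ρ

theorem nablaVec_eq {Y : Coord 4 → Fin 4 → ℝ} {Ys : Fin 4 → Sm U}
    (hY : ∀ (y : U) β, Y y β = Sm.ev y (Ys β)) (y : U) (α β : Fin 4) :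
    F.nablaVec y Y α β = Sm.ev y (covVec Sm.d h.con Ys α β) := by
  simp only [LocalFields.nablaVec, covVec, map_add, map_sum, map_mul, h.conn_eq, hY]
  rw [Sm.pd_eq (Ys β) (fun z => hY z β)]

/-- The Levi-Civita derivative of the velocity. -/
abbrev dVel : Fin 4 → Fin 4 → Sm U := covVec Sm.d h.metric.chr h.vel

theorem unit_ring : ∑ α, h.velLow α * h.vel α = -1 := Sm.ev_ext fun y => by
  simp only [map_sum, map_mul, map_neg, map_one, h.ev_velLow, h.ev_vel]
  exact h.unit y y.2

/-- Contracting the contorsion with `u` leaves only the term containing `u_ρ u^ρ = -1`. -/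
theorem covVec_con_vel (α β : Fin 4) :
    covVec Sm.d h.con h.vel α β = h.dVel α β - h.spinMix α β := by
  have e1 := h.isSpin.orth α
  have e2 := h.isSpin.raise_orth_left β
  have e3 := h.unit_ring
  have : ∀ ρ, h.con α ρ β * h.vel ρ = h.metric.chr α ρ β * h.vel ρ
      + h.vel β * (h.spin α ρ * h.vel ρ) + h.spinMix α β * (h.velLow ρ * h.vel ρ)
      + h.velLow α * (h.spinMix ρ β * h.vel ρ) := fun ρ => by
    simp only [con, spinContorsion]; ring
  simp only [covVec, this, Finset.sum_add_distrib, ← Finset.mul_sum, e1, e2, e3]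
  ring

/-- The explicit torsion term of `B` contains `A_{γα} u^γ = 0`. The torsion thus enters through the
connection only, and lowering the index turns its contribution into `A`. -/
theorem bLow_eq (y : U) (α β : Fin 4) :
    F.bLow y α β = Sm.ev y (lower h.metric.met (h.dVel α) β + h.spin α β) := by
  have e1 : ∀ σ, ∑ γ, F.tor y γ α σ * F.u y γ = 0 := by
    intro σ
    have : ∀ γ, F.tor y γ α σ * F.u y γ = -(F.u y σ) * (A y α γ * F.u y γ) := fun γ => by
      rw [h.tor_eq, h.spin_antisymm y y.2 γ α]; ring
    simp only [this, ← Finset.mul_sum, h.spin_orth y y.2, mul_zero]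
  have e2 : lower h.metric.met (h.dVel α) β + h.spin α β
      = ∑ σ, covVec Sm.d h.con h.vel α σ * h.metric.met σ β := by
    have e3 := h.isSpin.lowered β α
    have e4 := h.isSpin.antisymm α β
    simp only [h.covVec_con_vel, sub_mul, Finset.sum_sub_distrib, lower]
    have e5 : ∀ V : Fin 4 → Sm U, ∑ σ, V σ * h.metric.met σ β = ∑ σ, h.metric.met β σ * V σ :=
      fun V => Finset.sum_congr rfl fun σ _ => by rw [h.metric.met_symm σ β]; ring
    rw [e5, e5, e3]
    linear_combination e4
  rw [e2]
  simp only [LocalFields.bLow, e1, h.nablaVec_eq (Ys := h.vel) (fun _ _ => rfl), map_sum, map_mul,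
    h.metric.ev_met, mul_zero, add_zero]

theorem accel_ring (α : Fin 4) : ∑ γ, h.vel γ * h.dVel γ α = 0 := Sm.ev_ext fun y => by
  have e1 := h.geodesic y y.2 α
  have e2 := h.isSpin.raise_orth_left α
  simp only [LocalFields.accel, h.nablaVec_eq (Ys := h.vel) (fun _ _ => rfl),
    h.covVec_con_vel, ← h.ev_vel, ← map_mul, ← map_sum] at e1
  have e3 : ∑ γ, h.vel γ * (h.dVel γ α - h.spinMix γ α)
      = ∑ γ, h.vel γ * h.dVel γ α - ∑ γ, h.spinMix γ α * h.vel γ := by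
    rw [← Finset.sum_sub_distrib]
    exact Finset.sum_congr rfl fun _ _ => by ring
  rw [e3, e2, sub_zero] at e1
  rw [e1, map_zero]

/-- The derivative of the velocity, lowered, plus the spin. -/
abbrev kin (α β : Fin 4) : Sm U := lower h.metric.met (h.dVel α) β + h.spin α β

theorem kin_orth_right (α : Fin 4) : ∑ β, h.kin α β * h.vel β = 0 := by
  have e1 := h.metric.isLeviCivita.d_inner h.vel h.vel α
  rw [h.unit_ring, map_neg, Derivation.map_one_eq_zero, neg_zero] at e1
  have e2 : ∑ β, lower h.metric.met (h.dVel α) β * h.vel β = ∑ β, h.velLow β * h.dVel α β := by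
    simp only [lower, velLow, Finset.sum_mul]
    rw [Finset.sum_comm]
    exact Finset.sum_congr rfl fun _ _ => Finset.sum_congr rfl fun _ _ => by
      rw [h.metric.met_symm]; ring
  simp only [kin, add_mul, Finset.sum_add_distrib, h.isSpin.orth, e2, add_zero]
  apply half_cancel
  rw [mul_zero, two_mul, ← e1]

theorem kin_orth_left (β : Fin 4) : ∑ α, h.vel α * h.kin α β = 0 := by
  have e1 : ∀ α, h.vel α * h.kin α β = h.vel α * lower h.metric.met (h.dVel α) β
      + h.vel α * h.spin α β := fun α => by ring
  have e2 : ∑ α, h.vel α * lower h.metric.met (h.dVel α) β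
      = ∑ ρ, h.metric.met β ρ * ∑ α, h.vel α * h.dVel α ρ := by
    simp only [lower, Finset.mul_sum]
    rw [Finset.sum_comm]
    exact Finset.sum_congr rfl fun _ _ => Finset.sum_congr rfl fun _ _ => by ring
  simp only [e1, Finset.sum_add_distrib, e2, h.accel_ring, h.isSpin.orth', mul_zero,
    Finset.sum_const_zero, add_zero]

/-- Unit length and vanishing acceleration make the tensor orthogonal to `u` in both slots, so
projecting changes nothing. -/
theorem bPerp_eq (y : U) (α β : Fin 4) : F.bPerp y α β = Sm.ev y (h.kin α β) := by
  rw [← proj_two_of_orth (v := h.velLow) h.kin_orth_right h.kin_orth_left]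
  simp only [LocalFields.bPerp, h.bLow_eq, h.hMix_eq, ← map_mul, ← map_sum]

theorem torS_eq (y : U) (α β : Fin 4) : F.torS y α β = Sm.ev y (h.spin α β) := by
  rw [← proj_two_of_orth (v := h.velLow) h.isSpin.orth h.isSpin.orth']
  have e : ∀ μ ν, ∑ σ, F.hMix y α μ * F.hMix y β ν * F.u y σ * F.torLow y μ ν σ
      = -(F.hMix y α μ * F.hMix y β ν * Sm.ev y (h.spin μ ν)) := by
    intro μ ν
    have e2 : ∀ σ, F.hMix y α μ * F.hMix y β ν * F.u y σ * F.torLow y μ ν σ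
      = F.hMix y α μ * F.hMix y β ν * A y μ ν * (lower (F.g y) (F.u y) σ * F.u y σ) := fun σ => by
      rw [h.torLow_eq]; ring
    simp only [e2, ← Finset.mul_sum, h.unit y y.2, h.ev_spin]
    ring
  simp only [LocalFields.torS, e, Finset.sum_neg_distrib, neg_neg]
  simp only [h.hMix_eq, ← map_mul, ← map_sum]

/-- A third of the expansion. -/
def hub : Sm U := algebraMap ℝ (Sm U) (1 / 3) * ∑ μ, h.dVel μ μ

theorem expansion_eq (y : U) : F.expansion y = Sm.ev y (∑ μ, h.dVel μ μ) := by
  simp only [LocalFields.expansion, h.bPerp_eq, h.gInv_eq, ← map_mul, ← map_sum]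
  congr 1
  have e1 : ∑ α, ∑ β, h.metric.inv α β * h.spin α β = 0 := by
    rw [← IsSpin.trace_raise h.metric.isLeviCivita h.isSpin]
    rw [Finset.sum_comm]
    refine Finset.sum_congr rfl fun β _ => Finset.sum_congr rfl fun α _ => ?_
    rw [h.metric.inv_symm]
  have e2 : ∀ α, ∑ β, h.metric.inv α β * lower h.metric.met (h.dVel α) β = h.dVel α α := by
    intro α
    simp only [lower, Finset.mul_sum]
    rw [Finset.sum_comm]
    simp only [← mul_assoc, ← Finset.sum_mul, h.metric.inv_mul]
    simp
  simp only [kin, mul_add, Finset.sum_add_distrib, e1, e2, add_zero]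

theorem ev_hub (y : U) : Sm.ev y h.hub = F.expansion y / 3 := by
  rw [hub, map_mul, AlgHom.commutes, h.expansion_eq]
  simp only [Algebra.algebraMap_self, RingHom.id_apply]
  ring

/-- The antisymmetric part of `B` is that of the Levi-Civita derivative plus `A`, and `ω = S` says
that it equals `A`. So the Levi-Civita derivative of `u` is symmetric, and vanishing shear makes it
pure trace. -/
theorem lower_dVel (α β : Fin 4) : lower h.metric.met (h.dVel α) β
    = h.hub * (h.metric.met α β + h.velLow α * h.velLow β) := Sm.ev_ext fun y => by
  have e1 := h.shear_free y y.2 α β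
  have e2 := h.vorticity_eq y y.2 α β
  have e3 : Sm.ev y (h.spin β α) = -Sm.ev y (h.spin α β) := by
    rw [h.isSpin.antisymm β α, map_neg]
  simp only [LocalFields.shear, LocalFields.vorticity, h.bPerp_eq, h.torS_eq, LocalFields.h,
    uLow_eq, kin, map_add, e3] at e1 e2
  rw [map_mul, map_add, map_mul, h.ev_velLow, h.ev_velLow, h.ev_hub, h.metric.ev_met]
  linarith

/-- The rate of change of a third of the expansion. -/
def hubRate : Sm U := ∑ ν, h.vel ν * Sm.d ν h.hub

/-- Functions without projected gradient. -/
theorem grad_of_projGrad {φ : Coord 4 → ℝ} {φs : Sm U} (hφ : ∀ y : U, φ y = Sm.ev y φs)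
    (hp : ∀ y ∈ U, ∀ α, F.projGrad y φ α = 0) (μ : Fin 4) :
    Sm.d μ φs = -((∑ ν, h.vel ν * Sm.d ν φs) * h.velLow μ) := by
  refine grad_eq_of_proj (fun α => Sm.ev_ext fun y => ?_) μ
  have := hp y y.2 α
  simp only [LocalFields.projGrad, Sm.pd_eq φs hφ, h.hMix_eq, ← map_mul, ← map_sum] at this
  rw [this, map_zero]

theorem isHubbleFlow : IsHubbleFlow Sm.d h.metric.met h.metric.inv h.metric.chr h.vel h.hub
    h.hubRate where
  comm := Sm.d_comm
  lc := h.metric.isLeviCivita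
  unit := h.unit_ring
  nabla μ ρ := by
    have : h.dVel μ = fun ρ => h.hub * (kron μ ρ + h.velLow μ * h.vel ρ) := by
      refine eq_of_lower_eq h.metric.inv_mul fun δ => ?_
      have e1 := h.lower_dVel μ δ
      have e2 : ∀ γ, h.metric.met δ γ * (h.hub * (kron μ γ + h.velLow μ * h.vel γ))
          = h.hub * (h.metric.met δ γ * kron μ γ)
            + h.hub * h.velLow μ * (h.metric.met δ γ * h.vel γ) := fun γ => by ring
      simp only [e2, Finset.sum_add_distrib, ← Finset.mul_sum, sum_mul_kron']
      rw [lower] at e1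
      rw [e1, h.metric.met_symm δ μ]
      simp only [velLow, lower]
      ring
    exact congrFun this ρ
  grad μ := by
    have e := h.grad_of_projGrad h.expansion_eq h.expansion_homogeneous μ
    simp only [hubRate, hub, ← Algebra.smul_def, Derivation.map_smul, e]
    simp only [mul_smul_comm, ← Finset.smul_sum, smul_mul_assoc, smul_neg]

end IsLocalSolution

end LocalSolutions

end EinsteinCartan

end

noncomputable section

namespace EinsteinCartan

/-! ### Squares of gradients in a frame -/

section MagneticPart

variable {F : LocalFields} {y : Coord 4} {J : Matrix (Fin 4) (Fin 4) ℝ}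
  {H : ℝ} {S : Fin 4 → ℝ} {NS A : Fin 4 → Fin 4 → ℝ} {NA : Fin 4 → Fin 4 → Fin 4 → ℝ}

/-- The trace of the square of an endomorphism in frame components. -/
theorem trace_square (hJ : IsFrame (F.g y) (F.u y) J) (N : Fin 4 → Fin 4 → ℝ) :
    ∑ β, ∑ γ, N β γ * N γ β
      = ∑ a, ∑ b, eta a * eta b * gradComp F y J N a b * gradComp F y J N b a := by
  have e : ∀ β γ, N β γ = ∑ c, eta c * comp1 J (lower (F.g y) (N β)) c * J c γ := fun β γ =>
    congrFun (hJ.expand (N β)) γ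
  have e1 : ∀ β, ∑ γ, N β γ * N γ β
      = ∑ c, eta c * comp1 J (lower (F.g y) (N β)) c * ∑ γ, J c γ * N γ β := by
    intro β
    have : ∀ γ, N β γ * N γ β
        = ∑ c, eta c * comp1 J (lower (F.g y) (N β)) c * (J c γ * N γ β) := fun γ => by
      conv_lhs => rw [e β γ]
      rw [Finset.sum_mul]
      exact Finset.sum_congr rfl fun _ _ => by ring
    simp only [this, Finset.mul_sum]
    exact Finset.sum_comm
  have e2 : ∀ c β, ∑ γ, J c γ * N γ β = ∑ b, eta b * gradComp F y J N c b * J b β := by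
    intro c β
    have : ∀ γ, J c γ * N γ β = ∑ b, J c γ * (eta b * comp1 J (lower (F.g y) (N γ)) b * J b β) :=
      fun γ => by
        conv_lhs => rw [e γ β]
        rw [Finset.mul_sum]
    simp only [this]
    rw [Finset.sum_comm]
    refine Finset.sum_congr rfl fun b _ => ?_
    rw [gradComp, comp2_eq_comp1, Finset.mul_sum, Finset.sum_mul]
    exact Finset.sum_congr rfl fun _ _ => by ring
  simp only [e1, e2, Finset.mul_sum]
  rw [Finset.sum_comm]
  refine Finset.sum_congr rfl fun c _ => ?_
  rw [Finset.sum_comm]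
  refine Finset.sum_congr rfl fun b _ => ?_
  rw [gradComp, gradComp, comp2_eq_comp1 (T := fun μ => lower (F.g y) (N μ)) (a := b),
    Finset.mul_sum]
  exact Finset.sum_congr rfl fun _ _ => by ring

namespace IsSpinGradient

/-- The square of the spatial part of the gradient of the spin vector. -/
theorem square_spatial (hJ : IsFrame (F.g y) (F.u y) J) (h : IsSpinGradient F y H S NS A NA)
    {L : Fin 4 → Fin 4 → ℝ}
    (hL : ∀ α β, L α β = -(lower (F.g y) (NS β) α
      - 3 * H * lower (F.g y) (F.u y) β * lower (F.g y) S α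
      - H * lower (F.g y) S β * lower (F.g y) (F.u y) α)) :
    (∑ μ, ∑ ν, (∑ ρ, ∑ σ, F.gInv y μ ρ * F.gInv y ν σ * L ρ σ) * L μ ν
      = ∑ β, ∑ γ, NS β γ * NS γ β + 6 * H ^ 2 * ∑ α, lower (F.g y) S α * S α) ∧
    (∑ μ, ∑ ν, (∑ ρ, ∑ σ, F.gInv y μ ρ * F.gInv y ν σ * L ρ σ) * L μ ν = 0 → L = 0) ∧
    0 ≤ ∑ μ, ∑ ν, (∑ ρ, ∑ σ, F.gInv y μ ρ * F.gInv y ν σ * L ρ σ) * L μ ν := by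
  have e2 : ∀ a b, comp2 J L a b = -(gradComp F y J NS b a
        - 3 * H * (eta b * kron b 0) * comp1 J (lower (F.g y) S) a
        - H * (eta a * kron a 0) * comp1 J (lower (F.g y) S) b) := by
    intro a b
    have e3 : comp2 J L a b = -(gradComp F y J NS b a
        - 3 * H * (comp1 J (lower (F.g y) S) a * comp1 J (lower (F.g y) (F.u y)) b)
        - H * (comp1 J (lower (F.g y) (F.u y)) a * comp1 J (lower (F.g y) S) b)) := by
      have e4 : gradComp F y J NS b a = ∑ α, ∑ β, J a α * J b β * lower (F.g y) (NS β) α := by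
        rw [gradComp, comp2, Finset.sum_comm]
        exact Finset.sum_congr rfl fun _ _ => Finset.sum_congr rfl fun _ _ => by ring
      rw [e4, comp2, comp1, comp1, comp1, comp1, Finset.sum_mul_sum, Finset.sum_mul_sum,
        Finset.mul_sum, Finset.mul_sum, ← Finset.sum_sub_distrib, ← Finset.sum_sub_distrib,
        ← Finset.sum_neg_distrib]
      refine Finset.sum_congr rfl fun _ _ => ?_
      rw [Finset.mul_sum, Finset.mul_sum, ← Finset.sum_sub_distrib, ← Finset.sum_sub_distrib,
        ← Finset.sum_neg_distrib]
      exact Finset.sum_congr rfl fun _ _ => by rw [hL]; ring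
    rw [e3, comp1_lower_u hJ, comp1_lower_u hJ]
    ring
  have zl := gradComp_zero_left hJ h
  have zr := gradComp_zero_right hJ h
  have z0 := comp_zero hJ h
  obtain ⟨s1, s2, s3⟩ := gradComp_symm hJ h
  set N := gradComp F y J NS with hN
  have l0 : ∀ a, comp2 J L a 0 = 0 := by
    intro a
    rw [e2, zl]
    by_cases ha : a = 0
    · subst ha; rw [z0]; ring
    · simp [eta, kron, ha]
  have l0' : ∀ a, comp2 J L 0 a = 0 := by
    intro a
    rw [e2, zr, z0]
    simp [eta, kron]
  have l1 : ∀ a b : Fin 4, a ≠ 0 → b ≠ 0 → comp2 J L a b = -N b a := by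
    intro a b ha hb
    rw [e2, kron, kron, if_neg ha, if_neg hb]
    ring
  have n1 : (1 : Fin 4) ≠ 0 := by decide
  have n2 : (2 : Fin 4) ≠ 0 := by decide
  have n3 : (3 : Fin 4) ≠ 0 := by decide
  -- In the frame `L` is a symmetric spatial matrix, so its square is a sum of squares;
  -- nonnegativity and the vanishing criterion both follow from this.
  have sq : ∑ μ, ∑ ν, (∑ ρ, ∑ σ, F.gInv y μ ρ * F.gInv y ν σ * L ρ σ) * L μ ν
      = N 1 1 ^ 2 + N 2 2 ^ 2 + N 3 3 ^ 2 + 2 * N 1 2 ^ 2 + 2 * N 1 3 ^ 2 + 2 * N 2 3 ^ 2 := by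
    have hc := hJ.contract_two L L
    simp only [LocalFields.gInv]
    rw [hc]
    simp only [Fin.sum_univ_four, l0, l0', l1 _ _ n1 n1, l1 _ _ n1 n2, l1 _ _ n1 n3, l1 _ _ n2 n1,
      l1 _ _ n2 n2, l1 _ _ n2 n3, l1 _ _ n3 n1, l1 _ _ n3 n2, l1 _ _ n3 n3, s1, s2, s3]
    simp only [eta, n1, n2, n3, if_false, if_true]
    ring
  refine ⟨?_, ?_, ?_⟩
  -- The components of `∇S` along `u` contribute `2 · (-3H S) · (-H S)` with a timelike sign, which
  -- is the correction `6H² |S|²`.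
  · rw [sq, trace_square hJ, lower_dot hJ]
    simp only [← hN, Fin.sum_univ_four, zl, zr, z0, s1, s2, s3]
    simp only [eta, n1, n2, n3, if_false, if_true]
    ring
  · intro h0
    rw [sq] at h0
    have b11 := sq_nonneg (N 1 1)
    have b22 := sq_nonneg (N 2 2)
    have b33 := sq_nonneg (N 3 3)
    have b12 := sq_nonneg (N 1 2)
    have b13 := sq_nonneg (N 1 3)
    have b23 := sq_nonneg (N 2 3)
    have c11 : N 1 1 = 0 := pow_eq_zero_iff (two_ne_zero) |>.mp (by linarith)
    have c22 : N 2 2 = 0 := pow_eq_zero_iff (two_ne_zero) |>.mp (by linarith)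
    have c33 : N 3 3 = 0 := pow_eq_zero_iff (two_ne_zero) |>.mp (by linarith)
    have c12 : N 1 2 = 0 := pow_eq_zero_iff (two_ne_zero) |>.mp (by linarith)
    have c13 : N 1 3 = 0 := pow_eq_zero_iff (two_ne_zero) |>.mp (by linarith)
    have c23 : N 2 3 = 0 := pow_eq_zero_iff (two_ne_zero) |>.mp (by linarith)
    refine hJ.comp2_ext fun a b => ?_
    have hz : comp2 J (0 : Fin 4 → Fin 4 → ℝ) a b = 0 := by simp [comp2]
    rw [hz]
    by_cases ha : a = 0
    · rw [ha, l0']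
    by_cases hb : b = 0
    · rw [hb, l0]
    rw [l1 a b ha hb, neg_eq_zero]
    have hall : ∀ a b : Fin 4, a ≠ 0 → b ≠ 0 → N b a = 0 := by
      intro a b ha hb
      fin_cases a
      · exact absurd rfl ha
      all_goals
        fin_cases b
        · exact absurd rfl hb
        all_goals first | assumption | exact s1 ▸ c12 | exact s2 ▸ c13 | exact s3 ▸ c23
    exact hall a b ha hb
  · rw [sq]; positivity

end IsSpinGradient

end MagneticPart

/-! ### Trace reversal of the Einstein equations -/

section EinsteinTrace

/-- The Ricci tensor in terms of the sources. -/
theorem ricci_of_einstein {G Gi r : Fin 4 → Fin 4 → ℝ} {u q : Fin 4 → ℝ} {m p Λ s : ℝ}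
    (hinv : ∀ α β, ∑ σ, Gi α σ * G σ β = kron α β) (hsymm : ∀ α β, G α β = G β α)
    (hu : ∑ α, lower G u α * u α = -1) (hq : ∑ α, u α * q α = 0)
    (hs : s = ∑ α, ∑ β, Gi α β * r α β)
    (hE : ∀ α β, r α β - 1 / 2 * G α β * s + Λ * G α β = m * lower G u α * lower G u β
      + p * (G α β + lower G u α * lower G u β) + q α * lower G u β) :
    s = 4 * Λ + m - 3 * p ∧ ∀ α β, r α β
      = ((2 * Λ + m - p) / 2) * (G α β + lower G u α * lower G u β)
        + ((m + 3 * p) / 2 - Λ) * (lower G u α * lower G u β) + q α * lower G u β := by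
  have e1 : ∀ α, ∑ β, Gi α β * lower G u β = u α := by
    intro α
    simp only [lower, Finset.mul_sum]
    rw [Finset.sum_comm]
    simp only [← mul_assoc, ← Finset.sum_mul, hinv, sum_kron_mul]
  have e2 : ∀ α, ∑ β, Gi α β * G α β = 1 := by
    intro α
    simp only [hsymm α]
    rw [hinv]; simp [kron]
  have e3 : ∀ α, ∑ β, Gi α β * r α β
      = (1 / 2 * s - Λ + p) + (m + p) * (lower G u α * u α) + u α * q α := by
    intro α
    have : ∀ β, Gi α β * r α β = (1 / 2 * s - Λ + p) * (Gi α β * G α β)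
        + ((m + p) * lower G u α + q α) * (Gi α β * lower G u β) := fun β => by
      linear_combination Gi α β * hE α β
    simp only [this, Finset.sum_add_distrib, ← Finset.mul_sum, e1, e2]
    ring
  have e4 : s = 4 * Λ + m - 3 * p := by
    simp only [e3, Finset.sum_add_distrib, ← Finset.mul_sum, hu, hq, Finset.sum_const] at hs
    simp at hs
    linarith
  refine ⟨e4, fun α β => ?_⟩
  have := hE α β
  rw [e4] at this
  linear_combination this

end EinsteinTrace

/-! ### Spatially homogeneous functions -/

section Homogeneous

variable {R : Type*} [CommRing R] [Algebra ℝ R]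

/-- Functions whose gradient is parallel to `u`. -/
def IsHomogeneous (d : Fin 4 → Derivation ℝ R R) (G : Fin 4 → Fin 4 → R) (u : Fin 4 → R) (φ : R) :
    Prop :=
  ∀ μ, d μ φ = -((∑ ν, u ν * d ν φ) * lower G u μ)

namespace IsHomogeneous

variable {d : Fin 4 → Derivation ℝ R R} {G : Fin 4 → Fin 4 → R} {u : Fin 4 → R} {φ ψ : R}

theorem of_grad (hu : ∑ α, lower G u α * u α = -1) {c : R} (h : ∀ μ, d μ φ = c * lower G u μ) :
    IsHomogeneous d G u φ := by
  intro μ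
  have e : ∀ ν, u ν * d ν φ = c * (lower G u ν * u ν) := fun ν => by rw [h]; ring
  simp only [e, ← Finset.mul_sum, hu, h μ]
  ring

theorem add (h1 : IsHomogeneous d G u φ) (h2 : IsHomogeneous d G u ψ) :
    IsHomogeneous d G u (φ + ψ) := by
  intro μ
  have e : ∀ ν, u ν * d ν (φ + ψ) = u ν * d ν φ + u ν * d ν ψ := fun ν => by
    rw [map_add, mul_add]
  simp only [e, Finset.sum_add_distrib]
  rw [map_add, h1 μ, h2 μ]
  ring

theorem mul (h1 : IsHomogeneous d G u φ) (h2 : IsHomogeneous d G u ψ) :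
    IsHomogeneous d G u (φ * ψ) := by
  intro μ
  have e : ∀ ν, u ν * d ν (φ * ψ) = φ * (u ν * d ν ψ) + ψ * (u ν * d ν φ) := fun ν => by
    rw [Derivation.leibniz, smul_eq_mul, smul_eq_mul]; ring
  simp only [e, Finset.sum_add_distrib, ← Finset.mul_sum]
  rw [Derivation.leibniz, smul_eq_mul, smul_eq_mul, h1 μ, h2 μ]
  ring

theorem const (r : ℝ) : IsHomogeneous d G u (algebraMap ℝ R r) := by
  intro μ
  simp

end IsHomogeneous

end Homogeneous

end EinsteinCartan

end

noncomputable section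

namespace EinsteinCartan

/-! ### The Einstein equations in a chart -/

section LocalEinstein

variable {U : TopologicalSpace.Opens (Coord 4)} {F : LocalFields}
  {A : Coord 4 → Fin 4 → Fin 4 → ℝ} {mu p : Coord 4 → ℝ} {q : Coord 4 → Fin 4 → ℝ}
  {f : ℝ × ℝ → ℝ} {Λ : ℝ}

namespace IsLocalSolution

variable (h : IsLocalSolution U F A mu p q f Λ)

/-- The Ricci tensor of the connection with torsion. -/
abbrev ricS (α γ : Fin 4) : Sm U := ∑ μ, curv Sm.d h.con α μ γ μ

theorem ric_eq (y : U) (α γ : Fin 4) : F.ric y α γ = Sm.ev y (h.ricS α γ) := by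
  simp only [LocalFields.ric, ricci, h.riem_eq, ricS, map_sum]

theorem scal_eq (y : U) : F.scal y = Sm.ev y (∑ α, ∑ β, h.metric.inv α β * h.ricS α β) := by
  have e : ∀ α β, ricci F.conn y α β = Sm.ev y (h.ricS α β) := h.ric_eq y
  simp only [LocalFields.scal, ricciScalar, e, map_sum (Sm.ev y), map_mul, h.metric.ev_inv]

theorem ricci_source (h : IsLocalSolution U F A mu p q f Λ) (y : U) :
    F.scal y = 4 * Λ + 8 * Real.pi * mu y - 3 * (8 * Real.pi * p y) ∧ ∀ α β, F.ric y α β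
      = ((2 * Λ + 8 * Real.pi * mu y - 8 * Real.pi * p y) / 2) *
          (F.g y α β + lower (F.g y) (F.u y) α * lower (F.g y) (F.u y) β)
        + ((8 * Real.pi * mu y + 3 * (8 * Real.pi * p y)) / 2 - Λ) *
          (lower (F.g y) (F.u y) α * lower (F.g y) (F.u y) β)
        + 8 * Real.pi * q y α * lower (F.g y) (F.u y) β := by
  refine ricci_of_einstein (Gi := fun α β => (F.g y)⁻¹ α β) (u := F.u y)
    (q := fun α => 8 * Real.pi * q y α) ?_ (h.metric.symm y y.2) (h.unit y y.2) ?_ rfl ?_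
  · intro α β
    have := congrFun (congrFun (Matrix.nonsing_inv_mul (F.g y)
      (isUnit_iff_ne_zero.mpr (h.metric.det_ne y y.2))) α) β
    rwa [Matrix.mul_apply, Matrix.one_apply] at this
  · have e : ∀ α, F.u y α * (8 * Real.pi * q y α) = 8 * Real.pi * (F.u y α * q y α) :=
      fun α => by ring
    simp only [e, ← Finset.mul_sum, h.heat_orth y y.2, mul_zero]
  · intro α β
    have := h.einstein y y.2 α β
    simp only [LocalFields.h, uLow_eq] at this
    linear_combination this

/-- The longitudinal component of the Ricci tensor. -/
def kap : Sm U := ∑ α, ∑ γ, h.vel α * h.vel γ * h.ricS α γ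

/-- The transversal component of the Ricci tensor. -/
def lam : Sm U := algebraMap ℝ (Sm U) (1 / 3) *
  (∑ α, ∑ β, h.metric.inv α β * h.ricS α β + h.kap)

/-- The heat flow. -/
def heat (α : Fin 4) : Sm U := -(∑ γ, h.ricS α γ * h.vel γ) - h.kap * h.velLow α

theorem sum_ric_vel (h : IsLocalSolution U F A mu p q f Λ) (y : U) (α : Fin 4) :
    ∑ γ, F.ric y α γ * F.u y γ =
      -((8 * Real.pi * mu y + 3 * (8 * Real.pi * p y)) / 2 - Λ) * lower (F.g y) (F.u y) α
        - 8 * Real.pi * q y α := by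
  have e := (h.ricci_source y).2
  have hu := h.unit y y.2
  set l := (2 * Λ + 8 * Real.pi * mu y - 8 * Real.pi * p y) / 2
  set k := (8 * Real.pi * mu y + 3 * (8 * Real.pi * p y)) / 2 - Λ
  have e1 : ∀ γ, F.ric y α γ * F.u y γ = l * (F.g y α γ * F.u y γ)
      + ((l + k) * lower (F.g y) (F.u y) α + 8 * Real.pi * q y α) *
        (lower (F.g y) (F.u y) γ * F.u y γ) := fun γ => by rw [e]; ring
  simp only [e1, Finset.sum_add_distrib, ← Finset.mul_sum, hu]
  simp only [lower]
  ring

/-- Energy density, pressure and heat flow are not assumed smooth. The Ricci tensor is, and its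
components relative to `u` express the sources as elements of the ring. -/
theorem ev_kap (y : U) :
    Sm.ev y h.kap = (8 * Real.pi * mu y + 3 * (8 * Real.pi * p y)) / 2 - Λ := by
  have hu := h.unit y y.2
  have hq := h.heat_orth y y.2
  have e1 : Sm.ev y h.kap = ∑ α, F.u y α * ∑ γ, F.ric y α γ * F.u y γ := by
    rw [kap, map_sum]
    refine Finset.sum_congr rfl fun α _ => ?_
    rw [map_sum, Finset.mul_sum]
    refine Finset.sum_congr rfl fun γ _ => ?_
    rw [map_mul, map_mul, h.ev_vel, h.ev_vel, ← h.ric_eq]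
    ring
  set k := (8 * Real.pi * mu y + 3 * (8 * Real.pi * p y)) / 2 - Λ with hk
  have e2 : ∀ α, F.u y α * ∑ γ, F.ric y α γ * F.u y γ = -k * (lower (F.g y) (F.u y) α * F.u y α)
      - 8 * Real.pi * (F.u y α * q y α) := fun α => by rw [h.sum_ric_vel]; ring
  rw [e1]
  simp only [e2, Finset.sum_sub_distrib, ← Finset.mul_sum, hu, hq]
  ring

theorem ev_lam (y : U) :
    Sm.ev y h.lam = (2 * Λ + 8 * Real.pi * mu y - 8 * Real.pi * p y) / 2 := by
  rw [lam, map_mul, map_add, ← h.scal_eq, h.ev_kap, (h.ricci_source y).1, AlgHom.commutes]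
  simp only [Algebra.algebraMap_self, RingHom.id_apply]
  ring

theorem ev_heat (y : U) (α : Fin 4) : Sm.ev y (h.heat α) = 8 * Real.pi * q y α := by
  have e : Sm.ev y (∑ γ, h.ricS α γ * h.vel γ) = ∑ γ, F.ric y α γ * F.u y γ := by
    rw [map_sum]
    exact Finset.sum_congr rfl fun γ _ => by rw [map_mul, h.ric_eq, h.ev_vel]
  rw [heat, map_sub, map_neg, map_mul, e, h.sum_ric_vel, h.ev_kap, h.ev_velLow]
  ring

theorem ricS_eq (α γ : Fin 4) :
    h.ricS α γ = h.lam * (h.metric.met α γ + h.velLow α * h.velLow γ)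
      + h.kap * (h.velLow α * h.velLow γ) + h.heat α * h.velLow γ := by
  refine Sm.ev_ext fun y => ?_
  rw [← h.ric_eq, (h.ricci_source y).2 α γ]
  simp only [map_add, map_mul, h.ev_lam, h.ev_kap, h.ev_heat, h.ev_velLow, h.metric.ev_met]

/-- The consequences of the Einstein equations. -/
theorem split : (∀ α, h.heat α = 0) ∧
    (∀ α, ∑ μ, covEnd Sm.d h.metric.chr h.spinMix μ α μ = 0) ∧
    (∀ α β, ∑ μ, h.vel μ * covTwo Sm.d h.metric.chr h.spin μ α β = -(3 * h.hub * h.spin α β)) ∧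
    h.kap = -(3 * (h.hub ^ 2 + h.hubRate)) - ∑ μ, ∑ σ, h.spinMix μ σ * h.spinMix σ μ ∧
    (∀ α γ, ∑ μ, curv Sm.d h.metric.chr α μ γ μ
      = h.lam * (h.metric.met α γ + h.velLow α * h.velLow γ)
        - 3 * (h.hub ^ 2 + h.hubRate) * (h.velLow α * h.velLow γ)) := by
  refine h.isSpin.einstein_split (q := h.heat) (kap := h.kap) (lam := h.lam) h.isHubbleFlow ?_ ?_
  · refine Sm.ev_ext fun y => ?_
    have e : ∀ α, Sm.ev y (h.vel α * h.heat α) = 8 * Real.pi * (F.u y α * q y α) := fun α => by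
      rw [map_mul, h.ev_heat, h.ev_vel]; ring
    rw [map_sum, map_zero]
    simp only [e, ← Finset.mul_sum, h.heat_orth y y.2, mul_zero]
  · exact h.ricS_eq

/-- Energy density and pressure are smooth. -/
theorem exists_sources (h : IsLocalSolution U F A mu p q f Λ) :
    ∃ m' p' : Sm U, (∀ y : U, mu y = Sm.ev y m') ∧ ∀ y : U, p y = Sm.ev y p' := by
  have hpi := Real.pi_ne_zero
  have ev_const : ∀ (y : U) (r : ℝ), Sm.ev y (algebraMap ℝ (Sm U) r) = r := fun y r => by
    rw [AlgHom.commutes]; rfl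
  -- Solve for the sources: `3 lam + kap - 2Λ = 16π mu` and `kap - lam + 2Λ = 16π p`.
  refine ⟨algebraMap ℝ (Sm U) (1 / (8 * Real.pi)) * (h.lam + h.lam + h.lam + h.kap
      - algebraMap ℝ (Sm U) (2 * Λ)) * algebraMap ℝ (Sm U) (1 / 2),
    algebraMap ℝ (Sm U) (1 / (8 * Real.pi)) * (h.kap - h.lam + algebraMap ℝ (Sm U) (2 * Λ))
      * algebraMap ℝ (Sm U) (1 / 2), fun y => ?_, fun y => ?_⟩
  · simp only [map_mul, map_add, map_sub, h.ev_lam, h.ev_kap, ev_const]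
    field_simp
    ring
  · simp only [map_mul, map_add, map_sub, h.ev_lam, h.ev_kap, ev_const]
    field_simp
    ring

end IsLocalSolution

end LocalEinstein

end EinsteinCartan

end

noncomputable section

namespace EinsteinCartan

/-! ### Projected divergence in the presence of torsion -/

section ProjectedDivergence

variable {R : Type*} [CommRing R] [Algebra ℝ R] {d : Fin 4 → Derivation ℝ R R}
  {G Gi A a : Fin 4 → Fin 4 → R} {Γ : Fin 4 → Fin 4 → Fin 4 → R} {u S : Fin 4 → R} {H Hd : R}

namespace IsSpin

theorem covVec_contorsion (μ lam : Fin 4) :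
    covVec d (fun α β γ => Γ α β γ + spinContorsion G A a u α β γ) S μ lam = covVec d Γ S μ lam
      + (∑ ρ, A μ ρ * S ρ) * u lam + (∑ ρ, lower G u ρ * S ρ) * a μ lam
      + lower G u μ * ∑ ρ, S ρ * a ρ lam := by
  simp only [covVec, spinContorsion, Finset.sum_mul, Finset.mul_sum, add_assoc,
    ← Finset.sum_add_distrib]
  congr 1
  exact Finset.sum_congr rfl fun _ _ => by ring

/-- The correction is the trace of the contorsion, which vanishes. -/
theorem covVec_contorsion_trace (h : IsLeviCivita d G Gi Γ) (s : IsSpin G Gi A a u) :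
    ∑ μ, covVec d (fun α β γ => Γ α β γ + spinContorsion G A a u α β γ) S μ μ
      = ∑ μ, covVec d Γ S μ μ := by
  have e := contorsion_trace h s
  have e1 : ∀ μ, covVec d (fun α β γ => Γ α β γ + spinContorsion G A a u α β γ) S μ μ
      = covVec d Γ S μ μ + ∑ ρ, spinContorsion G A a u μ ρ μ * S ρ := fun μ => by
    simp only [covVec, add_mul, Finset.sum_add_distrib]
    ring
  simp only [e1, Finset.sum_add_distrib]
  rw [Finset.sum_comm (f := fun μ ρ => spinContorsion G A a u μ ρ μ * S ρ)]
  simp only [← Finset.sum_mul, e]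
  simp

/-- This is the component that the projection removes from the divergence. Its Levi-Civita part is
`-H S · u`, and the torsion terms vanish by the orthogonality of `A`, `a` and `S` to `u`. -/
theorem covVec_contorsion_long (h : IsHubbleFlow d G Gi Γ u H Hd) (s : IsSpin G Gi A a u)
    (hS : ∑ ρ, lower G u ρ * S ρ = 0)
    (hN : ∀ μ, ∑ γ, lower G u γ * covVec d Γ S μ γ = -(H * lower G S μ)) :
    ∑ μ, ∑ lam, lower G u lam * u μ *
      covVec d (fun α β γ => Γ α β γ + spinContorsion G A a u α β γ) S μ lam = 0 := by
  have e1 : ∀ μ lam, lower G u lam * u μ *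
      covVec d (fun α β γ => Γ α β γ + spinContorsion G A a u α β γ) S μ lam
      = u μ * (lower G u lam * covVec d Γ S μ lam)
        + (∑ ρ, A μ ρ * S ρ) * u μ * (lower G u lam * u lam)
        + (lower G u μ * u μ) * ∑ ρ, S ρ * (lower G u lam * a ρ lam) := by
    intro μ lam
    have e3 : ∑ ρ, S ρ * (lower G u lam * a ρ lam) = lower G u lam * ∑ ρ, S ρ * a ρ lam := by
      rw [Finset.mul_sum]
      exact Finset.sum_congr rfl fun _ _ => by ring
    rw [covVec_contorsion, e3, hS]
    ring
  have o := raise_orth_right h.lc s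
  have o' : ∑ μ, u μ * lower G S μ = 0 := by
    rw [← hS]
    simp only [lower, Finset.mul_sum, Finset.sum_mul]
    rw [Finset.sum_comm]
    exact Finset.sum_congr rfl fun _ _ => Finset.sum_congr rfl fun _ _ => by
      rw [h.lc.metric_symm]; ring
  have e4 : ∀ μ, ∑ lam, lower G u lam * u μ *
      covVec d (fun α β γ => Γ α β γ + spinContorsion G A a u α β γ) S μ lam
      = -H * (u μ * lower G S μ) - ∑ ρ, S ρ * (u μ * A μ ρ) := by
    intro μ
    have e5 : ∑ ρ, S ρ * (u μ * A μ ρ) = (∑ ρ, A μ ρ * S ρ) * u μ := by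
      rw [Finset.sum_mul]
      exact Finset.sum_congr rfl fun _ _ => by ring
    have e6 : ∑ lam, ∑ ρ, S ρ * (lower G u lam * a ρ lam) = 0 := by
      rw [Finset.sum_comm]
      simp only [← Finset.mul_sum, o]
      simp
    simp only [e1, Finset.sum_add_distrib, ← Finset.mul_sum (s := Finset.univ) (a := u μ),
      ← Finset.mul_sum (s := Finset.univ) (a := (∑ ρ, A μ ρ * S ρ) * u μ),
      ← Finset.mul_sum (s := Finset.univ) (a := lower G u μ * u μ), hN, h.unit, e5, e6]
    ring
  simp only [e4, Finset.sum_sub_distrib, ← Finset.mul_sum, o']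
  rw [Finset.sum_comm]
  simp only [← Finset.mul_sum, s.orth']
  simp

/-- The projected divergence of a spatial vector field. -/
theorem projected_div (h : IsHubbleFlow d G Gi Γ u H Hd) (s : IsSpin G Gi A a u)
    (hS : ∑ ρ, lower G u ρ * S ρ = 0)
    (hN : ∀ μ, ∑ γ, lower G u γ * covVec d Γ S μ γ = -(H * lower G S μ)) :
    ∑ α, ∑ μ, ∑ lam, (kron α μ + lower G u α * u μ) * (kron lam α + lower G u lam * u α)
        * covVec d (fun α β γ => Γ α β γ + spinContorsion G A a u α β γ) S μ lam
      = ∑ μ, covVec d Γ S μ μ := by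
  rw [← covVec_contorsion_trace h.lc s]
  have hl := covVec_contorsion_long h s hS hN
  set N := covVec d (fun α β γ => Γ α β γ + spinContorsion G A a u α β γ) S
  have e1 : ∀ μ lam, ∑ α, (kron α μ + lower G u α * u μ)
      * (kron lam α + lower G u lam * u α) * N μ lam
      = kron lam μ * N μ lam + lower G u lam * u μ * N μ lam := by
    intro μ lam
    have e2 : ∀ α, (kron α μ + lower G u α * u μ) * (kron lam α + lower G u lam * u α) * N μ lam
      = N μ lam * (kron lam α * kron α μ) + N μ lam * lower G u lam * (u α * kron α μ)
        + N μ lam * u μ * (kron lam α * lower G u α)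
        + N μ lam * u μ * lower G u lam * (lower G u α * u α) := fun α => by ring
    simp only [e2, Finset.sum_add_distrib, ← Finset.mul_sum, h.unit, sum_kron_mul, sum_mul_kron]
    ring
  rw [sum_rotate]
  simp only [e1, Finset.sum_add_distrib, hl, sum_kron_mul', add_zero]

end IsSpin

end ProjectedDivergence

/-! ### The spin vector in a chart -/

section LocalSpin

variable {U : TopologicalSpace.Opens (Coord 4)} {F : LocalFields}
  {A : Coord 4 → Fin 4 → Fin 4 → ℝ} {mu p : Coord 4 → ℝ} {q : Coord 4 → Fin 4 → ℝ}
  {f : ℝ × ℝ → ℝ} {Λ : ℝ}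

namespace IsLocalSolution

variable (h : IsLocalSolution U F A mu p q f Λ)

theorem exists_vol : ∃ s : Sm U, (∀ y, Sm.ev y s = √|(F.g y).det|) ∧
    ∀ μ, Sm.d μ s = s * ∑ σ, h.metric.chr μ σ σ :=
  h.metric.exists_density fun y hy => by
    obtain ⟨J, hJ⟩ := h.frame y hy
    exact hJ.det_neg

/-- The volume density. -/
def vol : Sm U := h.exists_vol.choose

theorem ev_vol (y : U) : Sm.ev y h.vol = √|(F.g y).det| := h.exists_vol.choose_spec.1 y

theorem d_vol (μ : Fin 4) : Sm.d μ h.vol = h.vol * ∑ σ, h.metric.chr μ σ σ :=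
  h.exists_vol.choose_spec.2 μ

/-- The tensor `ε_α^{μν}` as smooth functions. -/
def epsS (α μ ν : Fin 4) : Sm U := ∑ ρ, ∑ σ, h.metric.inv μ ρ * h.metric.inv ν σ *
  ∑ τ, h.vol * (leviInt α ρ σ τ : Sm U) * h.vel τ

theorem ev_epsS (y : U) (α μ ν : Fin 4) : F.epsUp2 y α μ ν = Sm.ev y (h.epsS α μ ν) := by
  simp only [LocalFields.epsUp2, epsS, LocalFields.eps, LocalFields.eps4, leviCivitaSymbol_eq,
    map_sum, map_mul, map_intCast, h.ev_vol, h.ev_vel, h.gInv_eq]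

/-- The spin vector as smooth functions. -/
def sv (γ : Fin 4) : Sm U := algebraMap ℝ (Sm U) (1 / 2) *
  ∑ α, ∑ μ, ∑ ν, h.metric.inv γ α * h.epsS α μ ν * h.spin μ ν

theorem ev_sv (y : U) (γ : Fin 4) : F.axial y A γ = Sm.ev y (h.sv γ) := by
  simp only [LocalFields.axial, sv, map_mul, map_sum, AlgHom.commutes, h.ev_spin, h.gInv_eq,
    h.ev_epsS]
  rfl

theorem torVec_eq (y : U) (γ : Fin 4) : F.torVec y γ = Sm.ev y (h.sv γ) := by
  rw [← h.ev_sv]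
  simp only [LocalFields.torVec, LocalFields.axial, h.torS_eq, h.ev_spin]

/-- The square of the spin vector. -/
def svSq : Sm U := ∑ α, lower h.metric.met h.sv α * h.sv α

theorem ev_lower_sv (y : U) (α : Fin 4) :
    Sm.ev y (lower h.metric.met h.sv α) = lower (F.g y) (F.axial y A) α := by
  rw [h.ev_lower]
  simp only [← h.ev_sv]

theorem ev_svSq' (y : U) : Sm.ev y h.svSq = ∑ α, lower (F.g y) (F.axial y A) α * F.axial y A α := by
  rw [svSq, map_sum]
  exact Finset.sum_congr rfl fun α _ => by rw [map_mul, h.ev_lower_sv, h.ev_sv]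

theorem ev_svSq (y : U) : Sm.ev y h.svSq = F.torVecSq y := by
  rw [ev_svSq']
  simp only [LocalFields.torVecSq, h.torVec_eq, ← h.ev_sv, lower, Finset.sum_mul]
  exact Finset.sum_congr rfl fun _ _ => Finset.sum_congr rfl fun _ _ => by ring

/-- A vector orthogonal to `u` has nonnegative square, and the value zero is excluded by hypothesis.
-/
theorem svSq_pos (y : U) : 0 < Sm.ev y h.svSq := by
  obtain ⟨J, hJ⟩ := h.frame y y.2
  refine lt_of_le_of_ne ?_ (by rw [h.ev_svSq]; exact (h.spin_ne_zero y y.2).symm)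
  rw [h.ev_svSq']
  refine lower_dot_self_nonneg hJ _ ?_
  rw [lower_axial hJ]
  exact (comp1_dualLow_eq hJ (A y)).1

theorem spin_norm (y : U) : ∑ μ, ∑ ν, (∑ ρ, ∑ σ, F.gInv y μ ρ * F.gInv y ν σ * A y ρ σ) * A y μ ν
    = 2 * Sm.ev y h.svSq := by
  obtain ⟨J, hJ⟩ := h.frame y y.2
  rw [h.ev_svSq', norm_axial hJ A (h.spin_antisymm y y.2) (h.spin_orth y y.2)]

/-- Antisymmetry gives `tr a² = -A_{μν} A^{μν}`, and the full square of a spatial 2-form is twice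
that of its dual vector. -/
theorem spinMix_square : ∑ μ, ∑ σ, h.spinMix μ σ * h.spinMix σ μ = -(2 * h.svSq) :=
    Sm.ev_ext fun y => by
  rw [map_neg, map_mul, map_ofNat, ← h.spin_norm y]
  simp only [spinMix, map_sum, map_mul, h.ev_spin, ← h.gInv_eq, Finset.sum_mul, Finset.mul_sum,
    ← Finset.sum_neg_distrib]
  refine Finset.sum_congr rfl fun μ _ => ?_
  rw [sum_rotate, Finset.sum_comm]
  refine Finset.sum_congr rfl fun δ _ => Finset.sum_congr rfl fun ε _ =>
    Finset.sum_congr rfl fun σ _ => ?_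
  rw [h.spin_antisymm y y.2 δ μ, h.gInv_eq y σ δ, h.metric.inv_symm σ δ, ← h.gInv_eq]
  ring

theorem sv_orth : ∑ α, h.velLow α * h.sv α = 0 := Sm.ev_ext fun y => by
  obtain ⟨J, hJ⟩ := h.frame y y.2
  have := axial_orth hJ (h.metric.symm y y.2) A
  rw [map_sum, map_zero, ← this]
  exact Finset.sum_congr rfl fun α _ => by rw [map_mul, h.ev_velLow, h.ev_sv]

theorem spin_eq_eps2 : h.spin = eps2 h.vol h.sv h.vel := by
  funext α β
  refine Sm.ev_ext fun y => ?_
  obtain ⟨J, hJ⟩ := h.frame y y.2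
  have := congrFun (congrFun
    (eq_eps2_axial hJ A (h.spin_antisymm y y.2) (h.spin_orth y y.2)) α) β
  rw [h.ev_spin, this]
  simp only [eps2, map_sum, map_mul, map_intCast, h.ev_vol, h.ev_vel, h.ev_sv]

/-- The gradient of the spin vector. -/
abbrev dSv : Fin 4 → Fin 4 → Sm U := covVec Sm.d h.metric.chr h.sv

theorem ev_eps2 (y : U) (V W : Fin 4 → Sm U) (α β : Fin 4) :
    Sm.ev y (eps2 h.vol V W α β)
      = eps2 (√|(F.g y).det|) (fun γ => Sm.ev y (V γ)) (fun γ => Sm.ev y (W γ)) α β := by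
  simp only [eps2, map_sum, map_mul, map_intCast, h.ev_vol]

theorem dSv_orth (μ : Fin 4) :
    ∑ γ, h.velLow γ * h.dSv μ γ = -(h.hub * lower h.metric.met h.sv μ) := by
  have e := h.metric.isLeviCivita.d_inner h.vel h.sv μ
  have o : ∑ α, lower h.metric.met h.sv α * h.vel α = 0 := by
    rw [← h.sv_orth]
    simp only [velLow, lower, Finset.sum_mul]
    rw [Finset.sum_comm]
    exact Finset.sum_congr rfl fun _ _ => Finset.sum_congr rfl fun _ _ => by
      rw [h.metric.met_symm]; ring
  have e1 : ∀ α, lower h.metric.met h.sv α * covVec Sm.d h.metric.chr h.vel μ α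
      = h.hub * (lower h.metric.met h.sv α * kron μ α)
        + h.hub * h.velLow μ * (lower h.metric.met h.sv α * h.vel α) := fun α => by
    rw [h.isHubbleFlow.nabla]; ring
  rw [h.sv_orth, map_zero] at e
  simp only [e1, Finset.sum_add_distrib, ← Finset.mul_sum, o, sum_mul_kron'] at e
  linear_combination -e

/-- The evolution and the divergence come from the Einstein equations (`split`); the other relations
come from duality, `∇u = H h` and the parallel volume form. -/
theorem isSpinGradient (y : U) : IsSpinGradient F y (Sm.ev y h.hub) (F.axial y A)
    (fun μ γ => Sm.ev y (h.dSv μ γ)) (A y)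
    (fun μ α β => Sm.ev y (covTwo Sm.d h.metric.chr h.spin μ α β)) where
  orth := by
    obtain ⟨J, hJ⟩ := h.frame y y.2
    have := axial_orth hJ (h.metric.symm y y.2) A
    rw [lower_dot_symm (h.metric.symm y y.2)] at this
    rw [← this]
    exact Finset.sum_congr rfl fun _ _ => by ring
  grad_orth μ := by
    have e := congrArg (Sm.ev y) (h.dSv_orth μ)
    rw [map_neg, map_mul, h.ev_lower_sv] at e
    rw [← e, map_sum]
    have := lower_dot_symm (h.metric.symm y y.2) (F.u y) (fun γ => Sm.ev y (h.dSv μ γ))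
    simp only [map_mul, h.ev_velLow, this]
    exact Finset.sum_congr rfl fun _ _ => by ring
  dual α β := congrFun (congrFun (by
    obtain ⟨J, hJ⟩ := h.frame y y.2
    exact eq_eps2_axial hJ A (h.spin_antisymm y y.2) (h.spin_orth y y.2)) α) β
  grad_dual μ α β := by
    have e := covTwo_eps2 Sm.d h.metric.chr (h.d_vol μ) h.sv h.vel α β
    have e2 : covVec Sm.d h.metric.chr h.vel μ
        = fun ρ => h.hub * (kron μ ρ + h.velLow μ * h.vel ρ) :=
      funext fun ρ => h.isHubbleFlow.nabla μ ρ
    rw [h.spin_eq_eps2, e, map_add, h.ev_eps2, h.ev_eps2, e2]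
    simp only [map_mul, map_add, h.ev_velLow, h.ev_vel, Sm.ev_kron, ← h.ev_sv]
  evolution α β := by
    have e := congrArg (Sm.ev y) (h.split.2.2.1 α β)
    rw [map_neg, map_mul, map_mul, map_ofNat, h.ev_spin, map_sum] at e
    rw [← e]
    exact Finset.sum_congr rfl fun _ _ => by rw [map_mul, h.ev_vel]
  divergence α := by
    have e := congrArg (Sm.ev y) (h.split.2.1 α)
    rw [← IsSpin.div_raise h.metric.isLeviCivita h.isSpin, map_zero] at e
    rw [← e, map_sum]
    refine Finset.sum_congr rfl fun _ _ => ?_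
    rw [map_sum]
    exact Finset.sum_congr rfl fun _ _ => by rw [map_mul, h.gInv_eq]

theorem sv_evol (γ : Fin 4) : ∑ μ, h.vel μ * h.dSv μ γ = -(3 * h.hub * h.sv γ) :=
    Sm.ev_ext fun y => by
  obtain ⟨J, hJ⟩ := h.frame y y.2
  have e := IsSpinGradient.evolution_vec hJ (h.isSpinGradient y) γ
  rw [map_neg, map_mul, map_mul, map_ofNat, ← h.ev_sv, ← e, map_sum]
  exact Finset.sum_congr rfl fun _ _ => by rw [map_mul, h.ev_vel]

theorem sv_curl (μ ν : Fin 4) :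
    lower h.metric.met (h.dSv μ) ν - lower h.metric.met (h.dSv ν) μ =
      2 * h.hub * (h.velLow μ * lower h.metric.met h.sv ν
        - h.velLow ν * lower h.metric.met h.sv μ) := Sm.ev_ext fun y => by
  obtain ⟨J, hJ⟩ := h.frame y y.2
  have e := IsSpinGradient.curl hJ (h.isSpinGradient y) μ ν
  simp only [map_sub, map_mul, map_ofNat, h.ev_lower_sv, h.ev_velLow]
  rw [h.ev_lower, h.ev_lower, e]

/-- The divergence in the hypothesis is formed with torsion and projection; by `projected_div`
neither makes a difference. -/
theorem ev_div (y : U) : F.projDiv y (fun z γ => F.axial z A γ)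
    = Sm.ev y (∑ μ, h.dSv μ μ) := by
  have e0 := IsSpin.projected_div h.isHubbleFlow h.isSpin h.sv_orth h.dSv_orth
  rw [← e0]
  simp only [LocalFields.projDiv, h.hMix_eq, map_sum, ← map_mul,
    h.nablaVec_eq (Y := fun z γ => F.axial z A γ) (Ys := h.sv) h.ev_sv]
  rfl

end IsLocalSolution

end LocalSpin

end EinsteinCartan

end

noncomputable section

namespace EinsteinCartan

/-! ### Spatial curvature and the magnetic part in a chart -/

section LocalCurvature

variable {U : TopologicalSpace.Opens (Coord 4)} {F : LocalFields}
  {A : Coord 4 → Fin 4 → Fin 4 → ℝ} {mu p : Coord 4 → ℝ} {q : Coord 4 → Fin 4 → ℝ}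
  {f : ℝ × ℝ → ℝ} {Λ : ℝ}

theorem Sm.ev_const (y : U) (r : ℝ) : Sm.ev y (algebraMap ℝ (Sm U) r) = r := by
  rw [AlgHom.commutes]; rfl

namespace IsLocalSolution

variable (h : IsLocalSolution U F A mu p q f Λ)

/-- Functions with gradient parallel to the velocity. -/
abbrev Hom (φ : Sm U) : Prop := IsHomogeneous Sm.d h.metric.met h.vel φ

theorem hom_sources {m' p' : Sm U} (hm : ∀ y : U, mu y = Sm.ev y m')
    (hp : ∀ y : U, p y = Sm.ev y p') : h.Hom m' ∧ h.Hom p' :=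
  ⟨h.grad_of_projGrad hm h.energy_homogeneous, h.grad_of_projGrad hp h.pressure_homogeneous⟩

theorem hom_lam_kap : h.Hom h.lam ∧ h.Hom h.kap := by
  obtain ⟨m', p', hm, hp⟩ := h.exists_sources
  obtain ⟨h1, h2⟩ := h.hom_sources hm hp
  have e1 : h.lam = algebraMap ℝ (Sm U) (4 * Real.pi) * m'
      + algebraMap ℝ (Sm U) (-(4 * Real.pi)) * p' + algebraMap ℝ (Sm U) Λ := by
    refine Sm.ev_ext fun y => ?_
    simp only [map_add, map_mul (Sm.ev y), Sm.ev_const, ← hm, ← hp, h.ev_lam]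
    ring
  have e2 : h.kap = algebraMap ℝ (Sm U) (4 * Real.pi) * m'
      + algebraMap ℝ (Sm U) (12 * Real.pi) * p' + algebraMap ℝ (Sm U) (-Λ) := by
    refine Sm.ev_ext fun y => ?_
    simp only [map_add, map_mul (Sm.ev y), Sm.ev_const, ← hm, ← hp, h.ev_kap]
    ring
  rw [e1, e2]
  exact ⟨(((IsHomogeneous.const _).mul h1).add ((IsHomogeneous.const _).mul h2)).add
      (IsHomogeneous.const _),
    (((IsHomogeneous.const _).mul h1).add ((IsHomogeneous.const _).mul h2)).add
      (IsHomogeneous.const _)⟩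

theorem hom_hub : h.Hom h.hub :=
  IsHomogeneous.of_grad h.unit_ring (c := -h.hubRate) fun μ => by
    rw [h.isHubbleFlow.grad]; ring

theorem hom_hubRate : h.Hom h.hubRate := h.isHubbleFlow.grad_rate

/-- The longitudinal Einstein equation reads `kap = -3(H² + Hd) + 2|S|²`, and every other term in it
is homogeneous. -/
theorem hom_svSq : h.Hom h.svSq := by
  have e := h.split.2.2.2.1
  rw [h.spinMix_square] at e
  have e1 : h.svSq = algebraMap ℝ (Sm U) (1 / 2) *
      (h.kap + algebraMap ℝ (Sm U) 3 * (h.hub * h.hub + h.hubRate)) := by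
    refine Sm.ev_ext fun y => ?_
    have e2 := congrArg (Sm.ev y) e
    simp only [map_neg, map_sub, map_mul (Sm.ev y), map_add, map_pow, map_ofNat (Sm.ev y),
      Sm.ev_const] at e2 ⊢
    linarith
  rw [e1]
  exact (IsHomogeneous.const _).mul (h.hom_lam_kap.2.add ((IsHomogeneous.const _).mul
    ((h.hom_hub.mul h.hom_hub).add h.hom_hubRate)))

/-- The spatial curvature. -/
def curvK : Sm U := algebraMap ℝ (Sm U) (1 / 2) *
  (h.lam + algebraMap ℝ (Sm U) (-1) * (h.hubRate + algebraMap ℝ (Sm U) 3 * (h.hub * h.hub)))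

theorem lam_eq : h.lam = 2 * h.curvK + h.hubRate + 3 * h.hub ^ 2 := by
  refine Sm.ev_ext fun y => ?_
  simp only [curvK, map_mul (Sm.ev y), map_add, map_pow, map_ofNat (Sm.ev y), Sm.ev_const]
  ring

theorem hom_curvK : h.Hom h.curvK :=
  (IsHomogeneous.const _).mul (h.hom_lam_kap.1.add ((IsHomogeneous.const _).mul
    (h.hom_hubRate.add ((IsHomogeneous.const _).mul (h.hom_hub.mul h.hom_hub)))))

theorem sum_sv_hom {φ : Sm U} (hφ : h.Hom φ) : ∑ μ, h.sv μ * Sm.d μ φ = 0 := by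
  have e : ∀ μ, h.sv μ * Sm.d μ φ = -(∑ ν, h.vel ν * Sm.d ν φ) * (h.velLow μ * h.sv μ) :=
    fun μ => by rw [hφ μ]; ring
  rw [Finset.sum_congr rfl fun μ _ => e μ, ← Finset.mul_sum, h.sv_orth, mul_zero]

/-- The divergence is a function of `mu` and `p`, whose derivatives along `S` vanish. As `f` is only
assumed differentiable, the chain rule is applied at each point rather than in the ring. -/
theorem sv_div : ∑ μ, h.sv μ * Sm.d μ (∑ ν, h.dSv ν ν) = 0 := by
  obtain ⟨m', p', hm, hp⟩ := h.exists_sources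
  obtain ⟨h1, h2⟩ := h.hom_sources hm hp
  refine Sm.ev_ext fun y => ?_
  have hd : ∀ (φ : Coord 4 → ℝ) (φ' : Sm U), (∀ y : U, φ y = Sm.ev y φ') →
      DifferentiableAt ℝ φ y := by
    intro φ φ' hφ
    refine (Sm.differentiableAt φ' y).congr_of_eventuallyEq ?_
    refine Filter.eventuallyEq_of_mem (U.isOpen.mem_nhds y.2) fun z hz => ?_
    rw [hφ ⟨z, hz⟩, ← Sm.extendZero_ev]
  have e1 : ∀ μ, Sm.ev y (Sm.d μ (∑ ν, h.dSv ν ν))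
      = fderiv ℝ f (mu y, p y) (Sm.ev y (Sm.d μ m'), Sm.ev y (Sm.d μ p')) := by
    intro μ
    rw [← Sm.pd_eq (F := fun z => f (mu z, p z)) (∑ ν, h.dSv ν ν)
      (fun z => by rw [← h.ev_div, h.divergence z z.2]), ← Sm.pd_eq m' hm, ← Sm.pd_eq p' hp]
    have hc := fderiv_comp (y : Coord 4) (g := f) (f := fun z => (mu z, p z))
      (h.differentiable y y.2) ((hd mu m' hm).prodMk (hd p p' hp))
    have hc2 : fderiv ℝ (fun z => f (mu z, p z)) (y : Coord 4)
      = (fderiv ℝ f (mu y, p y)).comp (fderiv ℝ (fun z => (mu z, p z)) y) := hc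
    rw [pd, hc2, (hd mu m' hm).fderiv_prodMk (hd p p' hp)]
    rfl
  have e2 := congrArg (Sm.ev y) (h.sum_sv_hom h1)
  have e3 := congrArg (Sm.ev y) (h.sum_sv_hom h2)
  rw [map_sum, map_zero] at e2 e3 ⊢
  have e4 : ∀ μ, Sm.ev y (h.sv μ * Sm.d μ (∑ ν, h.dSv ν ν)) = fderiv ℝ f (mu y, p y)
      (Sm.ev y (h.sv μ * Sm.d μ m'), Sm.ev y (h.sv μ * Sm.d μ p')) := by
    intro μ
    have : (Sm.ev y (h.sv μ * Sm.d μ m'), Sm.ev y (h.sv μ * Sm.d μ p'))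
        = Sm.ev y (h.sv μ) • (Sm.ev y (Sm.d μ m'), Sm.ev y (Sm.d μ p')) := by
      simp only [map_mul, Prod.smul_mk, smul_eq_mul]
    rw [this, map_smul, map_mul, e1, smul_eq_mul]
  simp only [e4]
  have e5 : ∑ μ, (Sm.ev y (h.sv μ * Sm.d μ m'), Sm.ev y (h.sv μ * Sm.d μ p')) = 0 :=
    Prod.ext (by rw [Prod.fst_sum]; exact e2) (by rw [Prod.snd_sum]; exact e3)
  rw [← map_sum, e5, map_zero]

theorem isSpinVector : IsSpinVector Sm.d h.metric.met h.metric.inv h.metric.chr h.vel h.hub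
    h.hubRate h.sv h.lam where
  flow := h.isHubbleFlow
  orth := h.sv_orth
  evol := h.sv_evol
  curl := h.sv_curl
  norm := h.hom_svSq
  div := h.sv_div
  ricci := h.split.2.2.2.2

theorem svSq_grad (μ : Fin 4) : Sm.d μ h.svSq = 6 * h.hub * h.svSq * h.velLow μ :=
  h.isSpinVector.norm_grad μ

theorem curvK_grad (μ : Fin 4) : Sm.d μ h.curvK = 2 * h.hub * h.curvK * h.velLow μ :=
  h.isSpinVector.curvature_grad h.lam_eq
    (Sm.isUnit_of_ev_ne_zero h.svSq fun y => (h.svSq_pos y).ne') h.hom_curvK μ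

theorem ricci_eq (α γ : Fin 4) : ∑ μ, curv Sm.d h.metric.chr α μ γ μ
    = (2 * h.curvK + h.hubRate + 3 * h.hub ^ 2) * (h.metric.met α γ + h.velLow α * h.velLow γ)
      - 3 * (h.hub ^ 2 + h.hubRate) * (h.velLow α * h.velLow γ) := by
  rw [← h.lam_eq]
  exact h.split.2.2.2.2 α γ

theorem riemannLow_eq (y : U) (α β γ δ : Fin 4) :
    riemannLow F.g F.conn y α β γ δ = Sm.ev y (curvLow Sm.d h.metric.met h.con α β γ δ) := by
  rw [riemannLow, curvLow, map_sum]
  exact Finset.sum_congr rfl fun ρ _ => by rw [map_mul, h.riem_eq, h.metric.ev_met]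

/-- Contracted with `u`, the Ricci and scalar terms of the Weyl tensor acquire a factor `u_μ` or
`u_ν`, because `u` is an eigenvector of the Ricci tensor. The Levi-Civita curvature has such a
factor too. The dual therefore sees only the gradient of `A`, and what remains is minus the spatial
part of `∇S`; the two correction terms subtract the components along `u`. -/
theorem hBarLow_eq (y : U) (α β : Fin 4) :
    F.hBarLow y α β = -(lower (F.g y) (fun γ => Sm.ev y (h.dSv β γ)) α
      - 3 * Sm.ev y h.hub * lower (F.g y) (F.u y) β * lower (F.g y) (F.axial y A) α
      - Sm.ev y h.hub * lower (F.g y) (F.axial y A) β * lower (F.g y) (F.u y) α) := by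
  obtain ⟨J, hJ⟩ := h.frame y y.2
  obtain ⟨X, Y, hXY⟩ := h.isSpin.curvLow_contorsion_u h.isHubbleFlow h.split.2.2.1
  set P : Fin 4 → Fin 4 → Fin 4 → ℝ := fun β μ ν => ∑ δ, F.weyl y β δ μ ν * F.u y δ with hP
  set ul := lower (F.g y) (F.u y) with hul
  set κ := Sm.ev y h.kap with hκ
  have hg := h.metric.symm y y.2
  have gu : ∀ ν, ∑ δ, F.g y ν δ * F.u y δ = ul ν := fun ν => rfl
  -- Here the vanishing of the heat flow enters.
  have ru : ∀ μ, ∑ δ, F.ric y δ μ * F.u y δ = -κ * ul μ := by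
    intro μ
    have e1 : ∀ δ, F.ric y δ μ * F.u y δ = Sm.ev y h.lam * (F.g y μ δ * F.u y δ)
        + (Sm.ev y h.lam + κ) * ul μ * (ul δ * F.u y δ) := by
      intro δ
      have e2 := congrArg (Sm.ev y) (h.ricS_eq δ μ)
      rw [h.split.1 δ] at e2
      rw [h.ric_eq, e2, hg μ δ]
      simp only [map_add, map_mul, h.ev_velLow, h.metric.ev_met, map_zero]
      ring
    simp only [e1, Finset.sum_add_distrib, ← Finset.mul_sum, gu]
    rw [hul, h.unit y y.2]
    ring
  have hB : ∀ β μ ν, P β μ ν = -Sm.ev y (covTwo Sm.d h.metric.chr h.spin β μ ν)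
      + 3 * Sm.ev y h.hub * ul β * A y μ ν
      + ul μ * (Sm.ev y (X β ν) + 1 / 2 * F.ric y β ν - 1 / 2 * κ * F.g y ν β
        - 1 / 6 * F.scal y * F.g y β ν)
      + (Sm.ev y (Y β μ) - 1 / 2 * F.ric y β μ + 1 / 2 * κ * F.g y μ β
        + 1 / 6 * F.scal y * F.g y β μ) * ul ν := by
    intro β μ ν
    have e1 : P β μ ν = ∑ δ, riemannLow F.g F.conn y β δ μ ν * F.u y δ
        - 1 / 2 * (F.ric y β μ * (∑ δ, F.g y ν δ * F.u y δ)
          - F.ric y β ν * ∑ δ, F.g y μ δ * F.u y δ)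
        + 1 / 2 * ((∑ δ, F.ric y δ μ * F.u y δ) * F.g y ν β
          - (∑ δ, F.ric y δ ν * F.u y δ) * F.g y μ β)
        + 1 / 3 * F.scal y * (1 / 2 * (F.g y β μ * (∑ δ, F.g y ν δ * F.u y δ)
          - F.g y β ν * ∑ δ, F.g y μ δ * F.u y δ)) := by
      simp only [hP, LocalFields.weyl, Fin.sum_univ_four]
      ring
    have e2 : ∑ δ, riemannLow F.g F.conn y β δ μ ν * F.u y δ
        = -Sm.ev y (covTwo Sm.d h.metric.chr h.spin β μ ν)
          + 3 * Sm.ev y h.hub * ul β * A y μ ν + ul μ * Sm.ev y (X β ν)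
          + Sm.ev y (Y β μ) * ul ν := by
      have e3 := congrArg (Sm.ev y) (hXY β μ ν)
      rw [map_sum] at e3
      simp only [map_add, map_neg, map_mul (Sm.ev y), map_ofNat (Sm.ev y), h.ev_velLow,
        h.ev_spin] at e3
      rw [hul, ← e3]
      exact Finset.sum_congr rfl fun δ _ => by rw [h.riemannLow_eq, h.ev_vel]; rfl
    rw [e1, e2, gu, gu, ru, ru]
    ring
  have e0 : F.hBarLow y α β = dualLow F y (P β) α := by
    simp only [LocalFields.hBarLow, dualLow, hP, Finset.mul_sum]
    exact Finset.sum_congr rfl fun _ _ => Finset.sum_congr rfl fun _ _ =>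
      Finset.sum_congr rfl fun _ _ => by ring
  rw [e0]
  exact IsSpinGradient.dualLow_grad hJ (h.isSpinGradient y) hB β α

/-- Combine `|DS|² = tr (∇S ∇S) + 6H²|S|²` with the Bochner identity `tr (∇S ∇S) = -(2k + 6H²)|S|²`.
The other two claims hold because the left side is a sum of squares. -/
theorem hBarSq_props (y : U) :
    F.hBarSq y = -2 * Sm.ev y h.curvK * Sm.ev y h.svSq ∧ 0 ≤ F.hBarSq y ∧
    (F.hBarSq y = 0 → ∀ α β, F.hBar y α β = 0) := by
  obtain ⟨J, hJ⟩ := h.frame y y.2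
  obtain ⟨e1, e2, e3⟩ := IsSpinGradient.square_spatial hJ (h.isSpinGradient y) (h.hBarLow_eq y)
  have e0 : F.hBarSq y = ∑ μ, ∑ ν, (∑ ρ, ∑ σ, F.gInv y μ ρ * F.gInv y ν σ * F.hBarLow y ρ σ)
      * F.hBarLow y μ ν := rfl
  rw [← e0] at e1 e2 e3
  refine ⟨?_, e3, fun h0 α β => ?_⟩
  · have b := congrArg (Sm.ev y) h.isSpinVector.bochner
    rw [map_sum, map_mul, h.lam_eq] at b
    have b1 : ∀ β, Sm.ev y (∑ γ, covVec Sm.d h.metric.chr h.sv β γ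
        * covVec Sm.d h.metric.chr h.sv γ β)
        = ∑ γ, Sm.ev y (h.dSv β γ) * Sm.ev y (h.dSv γ β) := fun β => by
      rw [map_sum]
      exact Finset.sum_congr rfl fun γ _ => map_mul _ _ _
    simp only [b1] at b
    rw [e1, b, ← h.ev_svSq']
    simp only [map_sub, map_add, map_mul (Sm.ev y), map_pow, map_ofNat (Sm.ev y), svSq]
    ring
  · have := e2 h0
    simp only [LocalFields.hBar, this]
    simp

theorem curvK_nonpos (y : U) : Sm.ev y h.curvK ≤ 0 := by
  obtain ⟨e1, e2, -⟩ := h.hBarSq_props y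
  have := h.svSq_pos y
  nlinarith

theorem hBar_eq_zero_iff (y : U) : (∀ α β, F.hBar y α β = 0) ↔ Sm.ev y h.curvK = 0 := by
  obtain ⟨e1, e2, e3⟩ := h.hBarSq_props y
  have hs := h.svSq_pos y
  constructor
  · intro h0
    have : F.hBarSq y = 0 := by simp [LocalFields.hBarSq, h0]
    rw [this] at e1
    by_contra hk
    have : Sm.ev y h.curvK * Sm.ev y h.svSq ≠ 0 := mul_ne_zero hk hs.ne'
    apply this
    linarith
  · intro hk
    exact e3 (by rw [e1, hk]; ring)

end IsLocalSolution

end LocalCurvature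

end EinsteinCartan

end

noncomputable section

namespace EinsteinCartan

/-! ### Curvature of the orthogonal space at a point -/

section SpatialCurvature

variable {G : Matrix (Fin 4) (Fin 4) ℝ} {u : Fin 4 → ℝ} {J : Matrix (Fin 4) (Fin 4) ℝ}

/-- Frame components of a 4-tensor. -/
def comp4 (J : Matrix (Fin 4) (Fin 4) ℝ) (T : Fin 4 → Fin 4 → Fin 4 → Fin 4 → ℝ)
    (a b c e : Fin 4) : ℝ :=
  comp2 J (fun α β => comp2 J (T α β) c e) a b

theorem comp4_apply (J : Matrix (Fin 4) (Fin 4) ℝ) (T : Fin 4 → Fin 4 → Fin 4 → Fin 4 → ℝ)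
    (a b c e : Fin 4) : comp4 J T a b c e
      = ∑ α, ∑ β, ∑ γ, ∑ δ, J a α * J b β * (J c γ * J e δ * T α β γ δ) := by
  simp only [comp4, comp2, Finset.mul_sum]

theorem comp4_antisymm_left {T : Fin 4 → Fin 4 → Fin 4 → Fin 4 → ℝ}
    (h : ∀ α β γ δ, T α β γ δ = -T β α γ δ) (a b c e : Fin 4) :
    comp4 J T a b c e = -comp4 J T b a c e := by
  simp only [comp4_apply]
  rw [Finset.sum_comm]
  simp only [← Finset.sum_neg_distrib]
  exact Finset.sum_congr rfl fun _ _ => Finset.sum_congr rfl fun _ _ =>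
    Finset.sum_congr rfl fun _ _ => Finset.sum_congr rfl fun _ _ => by rw [h]; ring

theorem comp4_antisymm_right {T : Fin 4 → Fin 4 → Fin 4 → Fin 4 → ℝ}
    (h : ∀ α β γ δ, T α β γ δ = -T α β δ γ) (a b c e : Fin 4) :
    comp4 J T a b c e = -comp4 J T a b e c := by
  simp only [comp4_apply, ← Finset.sum_neg_distrib]
  refine Finset.sum_congr rfl fun _ _ => Finset.sum_congr rfl fun _ _ => ?_
  rw [Finset.sum_comm]
  exact Finset.sum_congr rfl fun _ _ => Finset.sum_congr rfl fun _ _ => by rw [h]; ring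

theorem comp4_pair {T : Fin 4 → Fin 4 → Fin 4 → Fin 4 → ℝ}
    (h : ∀ α β γ δ, T α β γ δ = T γ δ α β) (a b c e : Fin 4) :
    comp4 J T a b c e = comp4 J T c e a b := by
  simp only [comp4_apply]
  have e1 : ∀ α, ∑ β, ∑ γ, ∑ δ, J a α * J b β * (J c γ * J e δ * T α β γ δ)
      = ∑ γ, ∑ β, ∑ δ, J a α * J b β * (J c γ * J e δ * T α β γ δ) := fun α => Finset.sum_comm
  simp only [e1]
  rw [Finset.sum_comm]
  refine Finset.sum_congr rfl fun γ _ => ?_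
  have e2 : ∀ α, ∑ β, ∑ δ, J a α * J b β * (J c γ * J e δ * T α β γ δ)
      = ∑ δ, ∑ β, J a α * J b β * (J c γ * J e δ * T α β γ δ) := fun α => Finset.sum_comm
  simp only [e2]
  rw [Finset.sum_comm]
  exact Finset.sum_congr rfl fun _ _ => Finset.sum_congr rfl fun _ _ =>
    Finset.sum_congr rfl fun _ _ => by rw [h]; ring

theorem sum_two_expand (T : Fin 4 → Fin 4 → ℝ) (J : Matrix (Fin 4) (Fin 4) ℝ) (x y : Fin 4 → ℝ) :
    ∑ α, ∑ β, (∑ a, x a * J a α) * (∑ b, y b * J b β) * T α β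
      = ∑ a, ∑ b, x a * y b * comp2 J T a b := by
  have e1 : ∀ α, ∑ β, (∑ a, x a * J a α) * (∑ b, y b * J b β) * T α β
      = ∑ a, x a * (J a α * ∑ b, y b * comp1 J (T α) b) := by
    intro α
    have e2 : ∑ b, y b * comp1 J (T α) b = ∑ β, (∑ b, y b * J b β) * T α β := by
      simp only [comp1, Finset.mul_sum, Finset.sum_mul]
      rw [Finset.sum_comm]
      exact Finset.sum_congr rfl fun _ _ => Finset.sum_congr rfl fun _ _ => by ring
    have e3 : ∑ a, x a * (J a α * ∑ b, y b * comp1 J (T α) b)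
        = (∑ a, x a * J a α) * ∑ b, y b * comp1 J (T α) b := by
      rw [Finset.sum_mul]
      exact Finset.sum_congr rfl fun _ _ => by ring
    rw [e3, e2, Finset.mul_sum]
    exact Finset.sum_congr rfl fun _ _ => by ring
  simp only [e1]
  rw [Finset.sum_comm]
  refine Finset.sum_congr rfl fun a _ => ?_
  simp only [comp2_eq_comp1, Finset.mul_sum]
  rw [Finset.sum_comm]
  exact Finset.sum_congr rfl fun _ _ => Finset.sum_congr rfl fun _ _ => by ring

theorem sum_four_expand (T : Fin 4 → Fin 4 → Fin 4 → Fin 4 → ℝ) (J : Matrix (Fin 4) (Fin 4) ℝ)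
    (x y z w : Fin 4 → ℝ) :
    ∑ α, ∑ β, ∑ γ, ∑ δ, (∑ a, x a * J a α) * (∑ b, y b * J b β) * (∑ c, z c * J c γ)
      * (∑ e, w e * J e δ) * T α β γ δ
      = ∑ a, ∑ b, ∑ c, ∑ e, x a * y b * z c * w e * comp4 J T a b c e := by
  have e1 : ∀ α β : Fin 4, ∑ γ, ∑ δ, (∑ a, x a * J a α) * (∑ b, y b * J b β) * (∑ c, z c * J c γ)
      * (∑ e, w e * J e δ) * T α β γ δ = (∑ a, x a * J a α) * (∑ b, y b * J b β) *
        ∑ c, ∑ e, z c * w e * comp2 J (T α β) c e := by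
    intro α β
    rw [← sum_two_expand (T α β) J z w]
    generalize (∑ a, x a * J a α) = p
    generalize (∑ b, y b * J b β) = q
    rw [Finset.mul_sum]
    refine Finset.sum_congr rfl fun γ _ => ?_
    generalize (∑ c, z c * J c γ) = s
    rw [Finset.mul_sum]
    exact Finset.sum_congr rfl fun δ _ => by ring
  simp only [e1]
  rw [sum_two_expand (fun α β => ∑ c, ∑ e, z c * w e * comp2 J (T α β) c e)]
  refine Finset.sum_congr rfl fun a _ => Finset.sum_congr rfl fun b _ => ?_
  simp only [comp4, comp2, Finset.mul_sum]
  have e2 : ∀ α, ∑ β, ∑ c, ∑ e, ∑ γ, ∑ δ,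
      x a * y b * (J a α * J b β * (z c * w e * (J c γ * J e δ * T α β γ δ)))
      = ∑ c, ∑ e, ∑ β, ∑ γ, ∑ δ,
      x a * y b * (J a α * J b β * (z c * w e * (J c γ * J e δ * T α β γ δ))) := by
    intro α
    rw [Finset.sum_comm]
    exact Finset.sum_congr rfl fun _ _ => Finset.sum_comm
  simp only [e2]
  rw [Finset.sum_comm]
  refine Finset.sum_congr rfl fun c _ => ?_
  rw [Finset.sum_comm]
  exact Finset.sum_congr rfl fun _ _ => Finset.sum_congr rfl fun _ _ =>
    Finset.sum_congr rfl fun _ _ => Finset.sum_congr rfl fun _ _ =>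
    Finset.sum_congr rfl fun _ _ => by ring

/-- In three dimensions the curvature is determined by the Ricci tensor. -/
theorem comp_of_ricci {r : Fin 4 → Fin 4 → Fin 4 → Fin 4 → ℝ} {k : ℝ}
    (h1 : ∀ a b c e, r a b c e = -r b a c e) (h2 : ∀ a b c e, r a b c e = -r a b e c)
    (h3 : ∀ a b c e, r a b c e = r c e a b)
    (hr : ∀ a c : Fin 4, a ≠ 0 → c ≠ 0 → r a 1 c 1 + r a 2 c 2 + r a 3 c 3 = 2 * k * kron a c)
    (a b c e : Fin 4) (ha : a ≠ 0) (hb : b ≠ 0) (hc : c ≠ 0) (he : e ≠ 0) :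
    r a b c e = k * (kron a c * kron b e - kron a e * kron b c) := by
  have n1 : (1 : Fin 4) ≠ 0 := by decide
  have n2 : (2 : Fin 4) ≠ 0 := by decide
  have n3 : (3 : Fin 4) ≠ 0 := by decide
  have z : ∀ a c e, r a a c e = 0 := fun a c e => by linarith [h1 a a c e]
  have z' : ∀ a b c, r a b c c = 0 := fun a b c => by linarith [h2 a b c c]
  have k11 := hr 1 1 n1 n1
  have k22 := hr 2 2 n2 n2
  have k33 := hr 3 3 n3 n3
  have k12 := hr 1 2 n1 n2
  have k13 := hr 1 3 n1 n3
  have k23 := hr 2 3 n2 n3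
  simp only [z, z'] at k11 k22 k33 k12 k13 k23
  simp [kron] at k11 k22 k33 k12 k13 k23
  have s21 : r 2 1 2 1 = r 1 2 1 2 := by rw [h1, h2]; ring
  have s31 : r 3 1 3 1 = r 1 3 1 3 := by rw [h1, h2]; ring
  have s32 : r 3 2 3 2 = r 2 3 2 3 := by rw [h1, h2]; ring
  rw [s21] at k22
  rw [s31, s32] at k33
  -- Each diagonal Ricci equation sets a sum of two sectional curvatures equal to `2k`, so all three
  -- are `k`. Each off-diagonal equation kills a single mixed component.
  have v12 : r 1 2 1 2 = k := by linarith
  have v13 : r 1 3 1 3 = k := by linarith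
  have v23 : r 2 3 2 3 = k := by linarith
  have w1 : r 1 2 2 3 = 0 := by rw [h2]; linarith
  have w2 : r 1 3 2 3 = 0 := k12
  have w3 : r 1 2 1 3 = 0 := by rw [h1, h2]; linarith
  have row : ∀ a b : Fin 4, (∀ c e : Fin 4, (c = 1 ∧ e = 2) ∨ (c = 1 ∧ e = 3) ∨ (c = 2 ∧ e = 3) →
      r a b c e = k * (kron a c * kron b e - kron a e * kron b c)) →
      ∀ c e : Fin 4, c ≠ 0 → e ≠ 0 → r a b c e = k * (kron a c * kron b e - kron a e * kron b c) := by
    intro a b hab c e hc he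
    rcases lt_trichotomy c e with hlt | heq | hgt
    · exact hab c e (by revert c e; decide)
    · subst heq; rw [z']; ring
    · rw [h2, hab e c (by revert c e; decide)]; ring
  have base : ∀ a b : Fin 4, (a = 1 ∧ b = 2) ∨ (a = 1 ∧ b = 3) ∨ (a = 2 ∧ b = 3) →
      ∀ c e : Fin 4, c ≠ 0 → e ≠ 0 → r a b c e = k * (kron a c * kron b e - kron a e * kron b c) := by
    intro a b hab
    refine row a b fun c e hce => ?_
    rcases hab with ⟨rfl, rfl⟩ | ⟨rfl, rfl⟩ | ⟨rfl, rfl⟩ <;>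
      rcases hce with ⟨rfl, rfl⟩ | ⟨rfl, rfl⟩ | ⟨rfl, rfl⟩ <;>
      simp [kron, v12, v13, v23, w1, w2, w3, h3 1 3 1 2, h3 2 3 1 2, h3 2 3 1 3]
  rcases lt_trichotomy a b with hlt | heq | hgt
  · exact base a b (by clear hr base row; revert a b; decide) c e hc he
  · subst heq; rw [z]; ring
  · rw [h1, base b a (by clear hr base row; revert a b; decide) c e hc he]; ring

/-- The curvature of the space orthogonal to `u` when the curvature in direction of `u` and the
Ricci tensor are isotropic. -/
theorem spatial_curvature (hJ : IsFrame G u J) {T : Fin 4 → Fin 4 → Fin 4 → Fin 4 → ℝ}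
    {e lam kk k : ℝ} (h1 : ∀ α β γ δ, T α β γ δ = -T β α γ δ)
    (h2 : ∀ α β γ δ, T α β γ δ = -T α β δ γ) (h3 : ∀ α β γ δ, T α β γ δ = T γ δ α β)
    (hu : ∀ α β δ, ∑ γ, T α β γ δ * u γ = e * (lower G u α * (G β δ + lower G u β * lower G u δ)
      - lower G u β * (G α δ + lower G u α * lower G u δ)))
    (hr : ∀ α γ, ∑ μ, ∑ ν, G⁻¹ μ ν * T α μ γ ν = lam * (G α γ + lower G u α * lower G u γ)
      + kk * (lower G u α * lower G u γ)) (hk : lam = 2 * k + e)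
    {X Y Z W : Fin 4 → ℝ} (hX : ∑ α, u α * lower G X α = 0) (hY : ∑ α, u α * lower G Y α = 0)
    (hZ : ∑ α, u α * lower G Z α = 0) (hW : ∑ α, u α * lower G W α = 0) :
    ∑ α, ∑ β, ∑ γ, ∑ δ, X α * Y β * Z γ * W δ * T α β γ δ
      = k * ((∑ α, lower G X α * Z α) * (∑ α, lower G Y α * W α)
        - (∑ α, lower G X α * W α) * (∑ α, lower G Y α * Z α)) := by
  have hA : ∀ a, comp1 J (lower G u) a = eta a * kron a 0 := fun a => by
    rw [← hJ.zero]; exact hJ.comp1_lower_frame a 0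
  have hG : ∀ a b, comp2 J (fun α β => G α β) a b = eta a * kron a b := fun a b => by
    rw [comp2_eq]
    have := congrFun (congrFun hJ.ortho a) b
    rw [Matrix.diagonal_apply] at this
    have e1 : (Matrix.of fun α β => G α β : Matrix (Fin 4) (Fin 4) ℝ) = G := rfl
    rw [e1, this, kron]
    split_ifs <;> simp
  have hGs : ∀ α β, G α β = G β α := fun α β => by
    have : (fun α β => G α β) = fun α β => G β α := hJ.comp2_ext fun a b => by
      have e1 : comp2 J (fun α β => G β α) a b = comp2 J (fun α β => G α β) b a := by
        simp only [comp2]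
        rw [Finset.sum_comm]
        exact Finset.sum_congr rfl fun _ _ => Finset.sum_congr rfl fun _ _ => by ring
      rw [e1, hG b a]
      refine (hG a b).trans ?_
      simp only [kron, eq_comm]
      split_ifs with h <;> simp [h]
    exact congrFun (congrFun this α) β
  have huu : ∑ β, u β * lower G u β = -1 := by
    have := hA 0
    simp only [comp1, hJ.zero] at this
    rw [this]; simp [eta, kron]
  have huG : ∀ e, ∑ β, u β * comp1 J (G β) e = comp1 J (lower G u) e := fun e => by
    simp only [comp1, lower, Finset.mul_sum]
    rw [Finset.sum_comm]
    exact Finset.sum_congr rfl fun _ _ => Finset.sum_congr rfl fun _ _ => by rw [hGs]; ring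
  set r := comp4 J T with hrdef
  have r1 := fun a b c e => comp4_antisymm_left (J := J) h1 a b c e
  have r2 := fun a b c e => comp4_antisymm_right (J := J) h2 a b c e
  have r3 := fun a b c e => comp4_pair (J := J) h3 a b c e
  -- The components with `u` in both pairs, needed to subtract the timelike term from the Ricci
  -- trace.
  have hzero : ∀ a c : Fin 4, c ≠ 0 → r a 0 0 c = e * (eta a * kron a c) := by
    intro a c hc
    have hAc : comp1 J (lower G u) c = 0 := by rw [hA]; simp [kron, hc]
    have e1 : ∀ α β, comp2 J (T α β) 0 c = e * (lower G u α * comp1 J (G β) c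
        - lower G u β * comp1 J (G α) c) := by
      intro α β
      have e2 : comp2 J (T α β) 0 c = comp1 J (fun δ => ∑ γ, T α β γ δ * u γ) c := by
        simp only [comp2, comp1, hJ.zero, Finset.mul_sum]
        rw [Finset.sum_comm]
        exact Finset.sum_congr rfl fun _ _ => Finset.sum_congr rfl fun _ _ => by ring
      have e3 : comp1 J (fun δ => ∑ γ, T α β γ δ * u γ) c = e * (lower G u α * (comp1 J (G β) c
          + lower G u β * comp1 J (lower G u) c)
          - lower G u β * (comp1 J (G α) c + lower G u α * comp1 J (lower G u) c)) := by
        simp only [hu, comp1, Finset.mul_sum, ← Finset.sum_add_distrib, ← Finset.sum_sub_distrib]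
        exact Finset.sum_congr rfl fun _ _ => by ring
      rw [e2, e3, hAc]; ring
    have e4 : r a 0 0 c = comp1 J (fun α => ∑ β, u β * (e * (lower G u α * comp1 J (G β) c
        - lower G u β * comp1 J (G α) c))) a := by
      simp only [hrdef, comp4, e1]
      simp only [comp2, hJ.zero]
      simp only [comp1, Finset.mul_sum, mul_assoc]
    have e5 : ∀ α, ∑ β, u β * (e * (lower G u α * comp1 J (G β) c
        - lower G u β * comp1 J (G α) c)) = e * comp1 J (G α) c := by
      intro α
      have : ∑ β, u β * (e * (lower G u α * comp1 J (G β) c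
        - lower G u β * comp1 J (G α) c)) = e * (lower G u α * ∑ β, u β * comp1 J (G β) c
          - (∑ β, u β * lower G u β) * comp1 J (G α) c) := by
        rw [Finset.mul_sum, Finset.sum_mul, ← Finset.sum_sub_distrib, Finset.mul_sum]
        exact Finset.sum_congr rfl fun _ _ => by ring
      rw [this, huG, huu, hAc]; ring
    rw [e4]
    simp only [e5]
    rw [← hG]
    simp only [comp2, comp1, Finset.mul_sum]
    exact Finset.sum_congr rfl fun _ _ => Finset.sum_congr rfl fun _ _ => by ring
  have hric : ∀ a c : Fin 4, a ≠ 0 → c ≠ 0 →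
      r a 1 c 1 + r a 2 c 2 + r a 3 c 3 = 2 * k * kron a c := by
    intro a c ha hc
    have e1 : comp2 J (fun α γ => ∑ μ, ∑ ν, G⁻¹ μ ν * T α μ γ ν) a c
        = ∑ m, eta m * r a m c m := by
      have e2 : comp2 J (fun α γ => ∑ μ, ∑ ν, G⁻¹ μ ν * T α μ γ ν) a c
          = ∑ μ, ∑ ν, G⁻¹ μ ν * comp2 J (fun α γ => T α μ γ ν) a c := by
        simp only [comp2, Finset.mul_sum]
        rw [Finset.sum_comm_cycle]
        refine Finset.sum_congr rfl fun μ _ => ?_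
        rw [Finset.sum_comm_cycle]
        exact Finset.sum_congr rfl fun _ _ => Finset.sum_congr rfl fun _ _ =>
          Finset.sum_congr rfl fun _ _ => by ring
      rw [e2, hJ.contract]
      refine Finset.sum_congr rfl fun m _ => ?_
      congr 1
      rw [hrdef, comp4_apply]
      simp only [comp2, Finset.mul_sum]
      rw [Finset.sum_comm_cycle]
      refine Finset.sum_congr rfl fun α _ => ?_
      rw [Finset.sum_comm_cycle]
      rw [Finset.sum_comm]
      exact Finset.sum_congr rfl fun _ _ => Finset.sum_congr rfl fun _ _ =>
        Finset.sum_congr rfl fun _ _ => by ring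
    have e3 : comp2 J (fun α γ => ∑ μ, ∑ ν, G⁻¹ μ ν * T α μ γ ν) a c = lam * kron a c := by
      have e4 : comp2 J (fun α γ => ∑ μ, ∑ ν, G⁻¹ μ ν * T α μ γ ν) a c
          = lam * (comp2 J (fun α β => G α β) a c + comp1 J (lower G u) a * comp1 J (lower G u) c)
            + kk * (comp1 J (lower G u) a * comp1 J (lower G u) c) := by
        simp only [hr, comp2, comp1]
        rw [Finset.sum_mul_sum]
        simp only [Finset.mul_sum, ← Finset.sum_add_distrib]
        exact Finset.sum_congr rfl fun _ _ => Finset.sum_congr rfl fun _ _ => by ring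
      rw [e4, hA, hA, hG]
      simp [kron, ha, hc, eta]
    rw [e1, Fin.sum_univ_four] at e3
    have e5 : r a 0 c 0 = -(e * kron a c) := by
      rw [hrdef, r2 a 0 c 0, ← hrdef, hzero a c hc]; simp [eta, ha]
    simp only [eta, e5] at e3
    simp at e3
    rw [hk] at e3
    linear_combination e3
  have hcomp := comp_of_ricci r1 r2 r3 hric
  set x := fun a => eta a * comp1 J (lower G X) a
  set y := fun a => eta a * comp1 J (lower G Y) a
  set z := fun a => eta a * comp1 J (lower G Z) a
  set w := fun a => eta a * comp1 J (lower G W) a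
  have dot : ∀ P Q : Fin 4 → ℝ, ∑ α, lower G P α * Q α = ∑ a, eta a *
      (eta a * comp1 J (lower G P) a) * (eta a * comp1 J (lower G Q) a) := by
    intro P Q
    conv_lhs => rw [hJ.expand Q]
    simp only [Finset.mul_sum]
    rw [Finset.sum_comm]
    refine Finset.sum_congr rfl fun a _ => ?_
    have : ∑ α, lower G P α * (eta a * comp1 J (lower G Q) a * J a α)
        = eta a * comp1 J (lower G Q) a * comp1 J (lower G P) a := by
      simp only [comp1, Finset.mul_sum]
      exact Finset.sum_congr rfl fun _ _ => by ring
    rw [this]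
    linear_combination (-eta a * comp1 J (lower G Q) a * comp1 J (lower G P) a) * eta_mul_self a
  have hz : ∀ P : Fin 4 → ℝ, ∑ α, u α * lower G P α = 0 → eta 0 * comp1 J (lower G P) 0 = 0 := by
    intro P hP
    have : comp1 J (lower G P) 0 = 0 := by simpa only [comp1, hJ.zero] using hP
    rw [this, mul_zero]
  have x0 : x 0 = 0 := hz X hX
  have y0 : y 0 = 0 := hz Y hY
  have z0 : z 0 = 0 := hz Z hZ
  have w0 : w 0 = 0 := hz W hW
  have e0 : ∑ α, ∑ β, ∑ γ, ∑ δ, X α * Y β * Z γ * W δ * T α β γ δ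
      = ∑ a, ∑ b, ∑ c, ∑ e, x a * y b * z c * w e * r a b c e := by
    rw [← sum_four_expand T J x y z w]
    have hX' := fun α => congrFun (hJ.expand X) α
    have hY' := fun α => congrFun (hJ.expand Y) α
    have hZ' := fun α => congrFun (hJ.expand Z) α
    have hW' := fun α => congrFun (hJ.expand W) α
    exact Finset.sum_congr rfl fun α _ => Finset.sum_congr rfl fun β _ =>
      Finset.sum_congr rfl fun γ _ => Finset.sum_congr rfl fun δ _ => by
        rw [← hX' α, ← hY' β, ← hZ' γ, ← hW' δ]
  have e1 : ∀ a b c e, x a * y b * z c * w e * r a b c e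
      = k * (x a * z c * kron a c * (y b * w e * kron b e)
        - x a * w e * kron a e * (y b * z c * kron b c)) := by
    intro a b c e
    by_cases ha : a = 0
    · rw [ha, x0]; ring
    by_cases hb : b = 0
    · rw [hb, y0]; ring
    by_cases hc : c = 0
    · rw [hc, z0]; ring
    by_cases he : e = 0
    · rw [he, w0]; ring
    rw [hrdef, hcomp a b c e ha hb hc he]; ring
  have dot' : ∀ p q : Fin 4 → ℝ, p 0 = 0 → ∑ a, eta a * p a * q a = p 1 * q 1 + p 2 * q 2
      + p 3 * q 3 := by
    intro p q hp
    rw [Fin.sum_univ_four, hp]; simp [eta]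
  rw [e0, dot X Z, dot Y W, dot X W, dot Y Z, dot' x z x0, dot' y w y0, dot' x w x0, dot' y z y0]
  simp only [e1]
  simp only [Fin.sum_univ_four, x0, y0, z0, w0, kron]
  simp
  ring

end SpatialCurvature

end EinsteinCartan

end

noncomputable section

namespace EinsteinCartan

/-! ### The Gauss equation for hypersurfaces orthogonal to a Hubble flow -/

section AlongMap

variable {R S : Type*} [CommRing R] [Algebra ℝ R] [CommRing S] [Algebra ℝ S]

/-- Covariant derivative of a vector field along a map, for connection forms `Ω`. -/
def covAlong (d : Fin 3 → Derivation ℝ S S) (Ω : Fin 3 → Fin 4 → Fin 4 → S) (i : Fin 3)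
    (V : Fin 4 → S) (ρ : Fin 4) : S :=
  d i (V ρ) + ∑ σ, Ω i σ ρ * V σ

theorem covAlong_smul (d : Fin 3 → Derivation ℝ S S) (Ω : Fin 3 → Fin 4 → Fin 4 → S) (i : Fin 3)
    (f : S) (V : Fin 4 → S) :
    covAlong d Ω i (f • V) = d i f • V + f • covAlong d Ω i V := by
  funext ρ
  simp only [covAlong, Pi.add_apply, Pi.smul_apply, smul_eq_mul, Derivation.leibniz, mul_add,
    Finset.mul_sum]
  have : ∀ σ, Ω i σ ρ * (f * V σ) = f * (Ω i σ ρ * V σ) := fun σ => by ring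
  simp only [this]
  ring

theorem covAlong_add (d : Fin 3 → Derivation ℝ S S) (Ω : Fin 3 → Fin 4 → Fin 4 → S) (i : Fin 3)
    (V W : Fin 4 → S) : covAlong d Ω i (V + W) = covAlong d Ω i V + covAlong d Ω i W := by
  funext ρ
  simp only [covAlong, Pi.add_apply, map_add, mul_add, Finset.sum_add_distrib]
  ring

theorem covAlong_sum (d : Fin 3 → Derivation ℝ S S) (Ω : Fin 3 → Fin 4 → Fin 4 → S) (i : Fin 3)
    (V : Fin 3 → Fin 4 → S) : covAlong d Ω i (∑ l, V l) = ∑ l, covAlong d Ω i (V l) := by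
  simp only [Fin.sum_univ_three, covAlong_add]

theorem covAlong_comm {d : Fin 3 → Derivation ℝ S S} (hd : ∀ i j f, d i (d j f) = d j (d i f))
    (Ω : Fin 3 → Fin 4 → Fin 4 → S) (i j : Fin 3) (V : Fin 4 → S) (ρ : Fin 4) :
    covAlong d Ω j (covAlong d Ω i V) ρ - covAlong d Ω i (covAlong d Ω j V) ρ
      = ∑ σ, (d j (Ω i σ ρ) - d i (Ω j σ ρ) + ∑ τ, (Ω j τ ρ * Ω i σ τ - Ω i τ ρ * Ω j σ τ)) * V σ := by
  simp only [covAlong, Fin.sum_univ_four, map_add, Derivation.leibniz, smul_eq_mul, hd j i]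
  ring

/-- The pairing of vector fields along a map. -/
abbrev pair {S : Type*} [CommRing S] (g : Fin 4 → Fin 4 → S) : (Fin 4 → S) →ₗ[S] (Fin 4 → S) →ₗ[S] S :=
  Matrix.toLinearMap₂' S (Matrix.of g)

theorem pair_apply {S : Type*} [CommRing S] (g : Fin 4 → Fin 4 → S) (V W : Fin 4 → S) :
    pair g V W = ∑ α, ∑ β, g α β * V α * W β := by
  simp only [pair, Matrix.toLinearMap₂'_apply, Matrix.of_apply, smul_eq_mul]
  exact Finset.sum_congr rfl fun _ _ => Finset.sum_congr rfl fun _ _ => by ring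

theorem pair_comm {S : Type*} [CommRing S] {g : Fin 4 → Fin 4 → S} (hg : ∀ α β, g α β = g β α) (V W : Fin 4 → S) :
    pair g V W = pair g W V := by
  rw [pair_apply, pair_apply, Finset.sum_comm]
  exact Finset.sum_congr rfl fun _ _ => Finset.sum_congr rfl fun _ _ => by rw [hg]; ring

theorem d_pair {d : Fin 3 → Derivation ℝ S S} {Ω : Fin 3 → Fin 4 → Fin 4 → S}
    {g : Fin 4 → Fin 4 → S} (hg : ∀ α β, g α β = g β α)
    (hd : ∀ i α β, d i (g α β) = ∑ σ, Ω i α σ * g σ β + ∑ σ, Ω i β σ * g σ α) (i : Fin 3)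
    (V W : Fin 4 → S) :
    d i (pair g V W) = pair g (covAlong d Ω i V) W + pair g V (covAlong d Ω i W) := by
  simp only [pair_apply]
  have e1 : d i (∑ α, ∑ β, g α β * V α * W β) = ∑ α, ∑ β, ((∑ σ, Ω i α σ * g σ β) * V α * W β
      + (∑ σ, Ω i β σ * g α σ) * V α * W β + g α β * d i (V α) * W β + g α β * V α * d i (W β)) := by
    simp only [map_sum, Derivation.leibniz, smul_eq_mul, hd]
    refine Finset.sum_congr rfl fun α _ => Finset.sum_congr rfl fun β _ => ?_
    simp only [fun σ => hg σ α]
    ring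
  have e2 : ∑ α, ∑ β, (∑ σ, Ω i α σ * g σ β) * V α * W β
      = ∑ α, ∑ β, g α β * (∑ σ, Ω i σ α * V σ) * W β := by
    simp only [Finset.sum_mul, Finset.mul_sum]
    rw [Finset.sum_comm_cycle]
    refine Finset.sum_congr rfl fun _ _ => ?_
    rw [Finset.sum_comm]
    exact Finset.sum_congr rfl fun _ _ => Finset.sum_congr rfl fun _ _ => by ring
  have e3 : ∑ α, ∑ β, (∑ σ, Ω i β σ * g α σ) * V α * W β
      = ∑ α, ∑ β, g α β * V α * (∑ σ, Ω i σ β * W σ) := by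
    simp only [Finset.sum_mul, Finset.mul_sum]
    refine Finset.sum_congr rfl fun _ _ => ?_
    rw [Finset.sum_comm]
    exact Finset.sum_congr rfl fun _ _ => Finset.sum_congr rfl fun _ _ => by ring
  rw [e1]
  simp only [covAlong, mul_add, add_mul, Finset.sum_add_distrib, e2, e3]
  ring

/-- Pullback of functions under a map from a 3-dimensional to a 4-dimensional domain, with
Jacobian `P`. -/
structure IsPullback (d : Fin 4 → Derivation ℝ R R) (d' : Fin 3 → Derivation ℝ S S)
    (π : R →ₐ[ℝ] S) (P : Fin 3 → Fin 4 → S) : Prop where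
  chain : ∀ i f, d' i (π f) = ∑ α, P i α * π (d α f)
  symm : ∀ i j α, d' i (P j α) = d' j (P i α)

/-- The pulled back connection forms. -/
def pullConn (π : R →ₐ[ℝ] S) (P : Fin 3 → Fin 4 → S) (Γ : Fin 4 → Fin 4 → Fin 4 → R)
    (i : Fin 3) (σ ρ : Fin 4) : S :=
  ∑ α, P i α * π (Γ α σ ρ)

variable {d : Fin 4 → Derivation ℝ R R} {d' : Fin 3 → Derivation ℝ S S} {π : R →ₐ[ℝ] S}
  {P : Fin 3 → Fin 4 → S}

namespace IsPullback

/-- Naturality of the curvature form: second derivatives of the map cancel by symmetry, and the rest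
is the chain rule. -/
theorem curv_pullConn (h : IsPullback d d' π P) (Γ : Fin 4 → Fin 4 → Fin 4 → R) (i j : Fin 3)
    (σ ρ : Fin 4) :
    d' j (pullConn π P Γ i σ ρ) - d' i (pullConn π P Γ j σ ρ)
      + ∑ τ, (pullConn π P Γ j τ ρ * pullConn π P Γ i σ τ
        - pullConn π P Γ i τ ρ * pullConn π P Γ j σ τ)
      = ∑ α, ∑ β, P i α * P j β * π (curv d Γ α β σ ρ) := by
  simp only [pullConn, curv, Fin.sum_univ_four, map_add, map_sub, map_mul, Derivation.leibniz,
    smul_eq_mul, h.chain, h.symm j i]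
  ring

theorem covAlong_curv (h : IsPullback d d' π P) (hd : ∀ i j f, d' i (d' j f) = d' j (d' i f))
    (Γ : Fin 4 → Fin 4 → Fin 4 → R) (i j : Fin 3) (V : Fin 4 → S) (ρ : Fin 4) :
    covAlong d' (pullConn π P Γ) j (covAlong d' (pullConn π P Γ) i V) ρ
      - covAlong d' (pullConn π P Γ) i (covAlong d' (pullConn π P Γ) j V) ρ
      = ∑ σ, (∑ α, ∑ β, P i α * P j β * π (curv d Γ α β σ ρ)) * V σ := by
  rw [covAlong_comm hd]
  simp only [h.curv_pullConn]

theorem d_metric (h : IsPullback d d' π P) {G Gi : Fin 4 → Fin 4 → R}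
    {Γ : Fin 4 → Fin 4 → Fin 4 → R} (hG : IsLeviCivita d G Gi Γ) (i : Fin 3) (α β : Fin 4) :
    d' i (π (G α β)) = ∑ σ, pullConn π P Γ i α σ * π (G σ β)
      + ∑ σ, pullConn π P Γ i β σ * π (G σ α) := by
  rw [h.chain]
  simp only [hG.compat, pullConn, map_add, map_sum, map_mul, mul_add, Finset.sum_add_distrib,
    Finset.mul_sum, Finset.sum_mul]
  congr 1 <;>
  · rw [Finset.sum_comm]
    exact Finset.sum_congr rfl fun _ _ => Finset.sum_congr rfl fun _ _ => by ring

/-- Second derivatives of the map and the connection coefficients are both symmetric. -/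
theorem covAlong_symm (h : IsPullback d d' π P) {Γ : Fin 4 → Fin 4 → Fin 4 → R}
    (hΓ : ∀ α β γ, Γ α β γ = Γ β α γ) (i j : Fin 3) :
    covAlong d' (pullConn π P Γ) i (P j) = covAlong d' (pullConn π P Γ) j (P i) := by
  funext ρ
  simp only [covAlong, pullConn, Finset.sum_mul]
  rw [h.symm i j, Finset.sum_comm]
  congr 1
  exact Finset.sum_congr rfl fun α _ => Finset.sum_congr rfl fun σ _ => by rw [hΓ]; ring

theorem covAlong_comp (h : IsPullback d d' π P) (Γ : Fin 4 → Fin 4 → Fin 4 → R) (V : Fin 4 → R)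
    (i : Fin 3) (ρ : Fin 4) :
    covAlong d' (pullConn π P Γ) i (fun ρ => π (V ρ)) ρ = ∑ α, P i α * π (covVec d Γ V α ρ) := by
  simp only [covAlong, pullConn, h.chain, covVec, map_add, map_sum, map_mul, mul_add,
    Finset.sum_add_distrib, Finset.mul_sum, Finset.sum_mul]
  congr 1
  rw [Finset.sum_comm]
  exact Finset.sum_congr rfl fun α _ => Finset.sum_congr rfl fun σ _ => by ring

end IsPullback

/-- A connection that is symmetric and metric is determined by the metric. -/
theorem koszul_unique {E : Fin 3 → Fin 3 → Fin 3 → S} (h1 : ∀ i j k, E i j k = E j i k)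
    (h2 : ∀ i j k, E i j k + E i k j = 0) (i j k : Fin 3) : E i j k = 0 := by
  -- The permutation argument behind the Koszul formula: symmetry in the first two indices and
  -- antisymmetry in the last two are incompatible with a nonzero value.
  apply half_cancel
  linear_combination h2 i j k - h1 i k j - h2 k i j + h1 k j i + h2 j k i - h1 j i k

/-- Vectors orthogonal to a unit normal and to the tangent vectors of a nondegenerate
hypersurface vanish. -/
theorem eq_zero_of_orth {S : Type*} [CommRing S] {g : Fin 4 → Fin 4 → S} {N : Fin 4 → S}
    {P : Fin 3 → Fin 4 → S} (hN : pair g N N = -1) (hNP : ∀ i, pair g N (P i) = 0)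
    (hdet : IsUnit (Matrix.of fun i j => pair g (P i) (P j)).det) {V : Fin 4 → S}
    (hVN : pair g N V = 0) (hVP : ∀ i, pair g (P i) V = 0) : V = 0 := by
  -- The rows are the normal and the three tangent vectors. Their Gram matrix is block diagonal with
  -- determinant `-det h`, a unit, so orthogonality to all rows forces zero even over a ring.
  set J : Matrix (Fin 4) (Fin 4) S := Matrix.of (Fin.cons N P)
  have hJ : ∀ V W : Fin 4 → S, pair g V W = dotProduct V ((Matrix.of g).mulVec W) := by
    intro V W
    rw [pair_apply, dotProduct]
    refine Finset.sum_congr rfl fun α _ => ?_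
    rw [Matrix.mulVec, dotProduct, Finset.mul_sum]
    exact Finset.sum_congr rfl fun _ _ => by rw [Matrix.of_apply]; ring
  have hent : ∀ a b, (J * Matrix.of g * J.transpose) a b = pair g (J a) (J b) := by
    intro a b
    rw [Matrix.mul_assoc, Matrix.mul_apply, hJ, dotProduct]
    refine Finset.sum_congr rfl fun _ _ => ?_
    rw [Matrix.mul_apply, Matrix.mulVec, dotProduct]
    rfl
  have hd : (J * Matrix.of g * J.transpose).det
      = -(Matrix.of fun i j => pair g (P i) (P j)).det := by
    rw [Matrix.det_succ_row_zero, Fin.sum_univ_succ]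
    have e0 : (J * Matrix.of g * J.transpose) 0 0 = -1 := by rw [hent]; exact hN
    have e1 : ∀ i : Fin 3, (J * Matrix.of g * J.transpose) 0 i.succ = 0 := fun i => by
      rw [hent]; exact hNP i
    have e2 : (J * Matrix.of g * J.transpose).submatrix Fin.succ (Fin.succAbove 0)
        = Matrix.of fun i j => pair g (P i) (P j) := by
      ext i j
      rw [Matrix.submatrix_apply, hent]
      rfl
    rw [e0, e2]
    simp [e1]
  have hu : IsUnit (J * Matrix.of g).det := by
    have : IsUnit (J * Matrix.of g * J.transpose).det := by rw [hd]; exact hdet.neg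
    rw [Matrix.det_mul] at this
    exact isUnit_of_mul_isUnit_left this
  have hz : (J * Matrix.of g).mulVec V = 0 := by
    rw [← Matrix.mulVec_mulVec]
    funext a
    change dotProduct (J a) _ = 0
    rw [← hJ]
    refine Fin.cases ?_ ?_ a
    · exact hVN
    · exact hVP
  have := congrArg ((J * Matrix.of g)⁻¹).mulVec hz
  rwa [Matrix.mulVec_mulVec, Matrix.nonsing_inv_mul _ hu, Matrix.one_mulVec,
    Matrix.mulVec_zero] at this

end AlongMap

end EinsteinCartan

end

noncomputable section

namespace EinsteinCartan

/-! ### Second fundamental form and Gauss equation -/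

section Gauss

variable {R S : Type*} [CommRing R] [Algebra ℝ R] [CommRing S] [Algebra ℝ S]
  {d : Fin 4 → Derivation ℝ R R} {d' : Fin 3 → Derivation ℝ S S} {π : R →ₐ[ℝ] S}
  {P : Fin 3 → Fin 4 → S} {G Gi : Fin 4 → Fin 4 → R} {Γ : Fin 4 → Fin 4 → Fin 4 → R}
  {u : Fin 4 → R} {H Hd : R} {h3 hi : Fin 3 → Fin 3 → S} {Γ3 : Fin 3 → Fin 3 → Fin 3 → S}

theorem sum_reorder {S : Type*} [AddCommMonoid S] (f : Fin 4 → Fin 4 → Fin 4 → Fin 4 → Fin 4 → S) :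
    ∑ ρ, ∑ δ, ∑ γ, ∑ α, ∑ β, f ρ δ γ α β = ∑ α, ∑ β, ∑ γ, ∑ δ, ∑ ρ, f ρ δ γ α β := by
  have e1 : ∀ ρ δ, ∑ γ, ∑ α, ∑ β, f ρ δ γ α β = ∑ α, ∑ β, ∑ γ, f ρ δ γ α β := fun ρ δ => by
    rw [Finset.sum_comm_cycle, Finset.sum_comm_cycle]
  simp only [e1]
  rw [Finset.sum_comm_cycle]
  refine Finset.sum_congr rfl fun α _ => ?_
  rw [Finset.sum_comm_cycle]
  refine Finset.sum_congr rfl fun β _ => ?_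
  rw [Finset.sum_comm_cycle]
  exact Finset.sum_congr rfl fun γ _ => Finset.sum_comm

namespace IsHubbleFlow

/-- The projector `h` acts as the identity on tangent vectors of the slice, so `∇u = H h` makes the
slice umbilic with factor `H`. -/
theorem covAlong_normal (hf : IsHubbleFlow d G Gi Γ u H Hd) (h : IsPullback d d' π P)
    (horth : ∀ i, pair (fun α β => π (G α β)) (fun α => π (u α)) (P i) = 0) (i : Fin 3) :
    covAlong d' (pullConn π P Γ) i (fun α => π (u α)) = π H • P i := by
  funext ρ
  have h0 : ∑ α, P i α * π (lower G u α) = 0 := by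
    rw [← horth i, pair_apply, Finset.sum_comm]
    refine Finset.sum_congr rfl fun α _ => ?_
    simp only [lower, map_sum, map_mul, Finset.mul_sum]
    exact Finset.sum_congr rfl fun _ _ => by rw [hf.lc.metric_symm α]; ring
  have e : ∀ α, P i α * π (H * (kron α ρ + lower G u α * u ρ))
      = π H * (P i α * kron α ρ) + π H * π (u ρ) * (P i α * π (lower G u α)) := fun α => by
    have : π (kron α ρ) = (kron α ρ : S) := by unfold kron; split_ifs <;> simp
    rw [map_mul, map_add, map_mul, this]; ring
  rw [h.covAlong_comp]
  simp only [hf.nabla, e, Finset.sum_add_distrib, ← Finset.mul_sum, h0, sum_mul_kron, Pi.smul_apply,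
    smul_eq_mul]
  ring

/-- The second derivatives of the embedding of a hypersurface orthogonal to the flow. -/
theorem covAlong_tangent (hf : IsHubbleFlow d G Gi Γ u H Hd) (h : IsPullback d d' π P)
    (hlc : IsLeviCivita d' h3 hi Γ3)
    (hh : ∀ i j, h3 i j = pair (fun α β => π (G α β)) (P i) (P j))
    (horth : ∀ i, pair (fun α β => π (G α β)) (fun α => π (u α)) (P i) = 0) (i j : Fin 3) :
    covAlong d' (pullConn π P Γ) i (P j)
      = ∑ l, Γ3 i j l • P l + (π H * h3 i j) • fun α => π (u α) := by
  set g : Fin 4 → Fin 4 → S := fun α β => π (G α β) with hgdef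
  set N : Fin 4 → S := fun α => π (u α) with hNdef
  have hg : ∀ α β, g α β = g β α := fun α β => congrArg π (hf.lc.metric_symm α β)
  have hdp := fun i V W => d_pair (d := d') hg (h.d_metric hf.lc) i V W
  have hNN : pair g N N = -1 := by
    have := congrArg π hf.unit
    simp only [lower, map_sum, map_mul, map_neg, map_one, Finset.sum_mul] at this
    rw [← this, pair_apply]
    exact Finset.sum_congr rfl fun _ _ => Finset.sum_congr rfl fun _ _ => by ring
  have hPN : ∀ i, pair g (P i) N = 0 := fun i => by rw [pair_comm hg, horth]
  have hdet : IsUnit (Matrix.of fun i j => pair g (P i) (P j)).det := by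
    have h1 : Matrix.of hi * Matrix.of h3 = 1 := by
      ext a b
      rw [Matrix.mul_apply, Matrix.one_apply]
      exact hlc.inv_mul a b
    have h2 : (Matrix.of fun i j => pair g (P i) (P j)) = Matrix.of h3 := by
      ext a b; exact (hh a b).symm
    rw [h2]
    have := congrArg Matrix.det h1
    rw [Matrix.det_mul, Matrix.det_one, mul_comm] at this
    exact IsUnit.of_mul_eq_one _ this
  set Q := fun i j => covAlong d' (pullConn π P Γ) i (P j) with hQ
  -- Tangential part: the induced connection and `Γ3` are both symmetric and metric, so they agree
  -- by `koszul_unique`.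
  have hE : ∀ i j k, pair g (Q i j) (P k) - ∑ l, Γ3 i j l * h3 l k = 0 := by
    refine koszul_unique (fun i j k => ?_) (fun i j k => ?_)
    · simp only [hQ, h.covAlong_symm hf.lc.symm i j, hlc.symm i j]
    · have e1 := hdp i (P j) (P k)
      rw [← hh, hlc.compat, pair_comm hg (P j)] at e1
      linear_combination -e1
  -- Normal part: differentiate the orthogonality of the normal and the tangent vectors.
  have hQN : ∀ i j, pair g N (Q i j) = -(π H * h3 i j) := by
    intro i j
    have e1 := hdp i N (P j)
    rw [horth, map_zero, hf.covAlong_normal h horth, map_smul, LinearMap.smul_apply, ← hh,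
      smul_eq_mul] at e1
    linear_combination -e1
  have hlin : ∀ V : Fin 4 → S, pair g V (∑ l, Γ3 i j l • P l + (π H * h3 i j) • N)
      = ∑ l, Γ3 i j l * pair g V (P l) + π H * h3 i j * pair g V N := by
    intro V
    rw [map_add, map_sum, map_smul]
    simp only [map_smul, smul_eq_mul]
  refine sub_eq_zero.mp (eq_zero_of_orth hNN horth hdet ?_ fun k => ?_)
  · rw [map_sub, hlin, hQN, hNN]
    simp only [horth, mul_zero, Finset.sum_const_zero]
    ring
  · rw [map_sub, hlin, hPN, pair_comm hg]
    have e2 := hE i j k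
    have e3 : ∑ l, Γ3 i j l * pair g (P k) (P l) = ∑ l, Γ3 i j l * h3 l k :=
      Finset.sum_congr rfl fun l _ => by rw [← hh, hlc.metric_symm k l]
    rw [e3]
    linear_combination e2

/-- The Gauss equation for a hypersurface orthogonal to the flow. -/
theorem gauss (hf : IsHubbleFlow d G Gi Γ u H Hd) (h : IsPullback d d' π P)
    (hd : ∀ i j f, d' i (d' j f) = d' j (d' i f)) (hlc : IsLeviCivita d' h3 hi Γ3)
    (hh : ∀ i j, h3 i j = pair (fun α β => π (G α β)) (P i) (P j))
    (horth : ∀ i, pair (fun α β => π (G α β)) (fun α => π (u α)) (P i) = 0) (i j k m : Fin 3) :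
    curvLow d' h3 Γ3 i j k m
      = ∑ α, ∑ β, ∑ γ, ∑ δ, P i α * P j β * P k γ * P m δ * π (curvLow d G Γ α β γ δ)
        - π H ^ 2 * (h3 i k * h3 j m - h3 j k * h3 i m) := by
  set g : Fin 4 → Fin 4 → S := fun α β => π (G α β) with hgdef
  set N : Fin 4 → S := fun α => π (u α) with hNdef
  -- Differentiate the decomposition of `covAlong_tangent` once more and keep the tangential part.
  -- The derivative of the normal yields the term in `H²`; the derivative of its coefficient is
  -- normal and drops out.
  have key : ∀ i j, pair g (covAlong d' (pullConn π P Γ) j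
      (covAlong d' (pullConn π P Γ) i (P k))) (P m)
      = ∑ s, (d' j (Γ3 i k s) + ∑ l, Γ3 j l s * Γ3 i k l) * h3 s m
        + π H ^ 2 * (h3 i k * h3 j m) := by
    intro i j
    rw [hf.covAlong_tangent h hlc hh horth i k, covAlong_add, covAlong_sum, covAlong_smul]
    simp only [covAlong_smul, hf.covAlong_tangent h hlc hh horth, hf.covAlong_normal h horth]
    simp only [map_add, map_smul, LinearMap.add_apply, LinearMap.smul_apply, ← hNdef, horth, ← hh, smul_eq_mul, Fin.sum_univ_three]
    ring
  have e1 : pair g (covAlong d' (pullConn π P Γ) j (covAlong d' (pullConn π P Γ) i (P k))) (P m)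
      - pair g (covAlong d' (pullConn π P Γ) i (covAlong d' (pullConn π P Γ) j (P k))) (P m)
      = ∑ α, ∑ β, ∑ γ, ∑ δ, P i α * P j β * P k γ * P m δ * π (curvLow d G Γ α β γ δ) := by
    rw [← LinearMap.sub_apply, ← map_sub]
    have e2 : (covAlong d' (pullConn π P Γ) j (covAlong d' (pullConn π P Γ) i (P k))
        - covAlong d' (pullConn π P Γ) i (covAlong d' (pullConn π P Γ) j (P k)))
        = fun ρ => ∑ σ, (∑ α, ∑ β, P i α * P j β * π (curv d Γ α β σ ρ)) * P k σ := by
      funext ρ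
      exact h.covAlong_curv hd Γ i j (P k) ρ
    rw [e2, pair_apply]
    simp only [curvLow, map_sum, map_mul, Finset.sum_mul, Finset.mul_sum, hgdef]
    rw [sum_reorder]
    exact Finset.sum_congr rfl fun _ _ => Finset.sum_congr rfl fun _ _ =>
      Finset.sum_congr rfl fun _ _ => Finset.sum_congr rfl fun _ _ =>
      Finset.sum_congr rfl fun _ _ => by ring
  rw [key, key] at e1
  rw [← e1]
  simp only [curvLow, curv, Fin.sum_univ_three]
  ring

end IsHubbleFlow

end Gauss

end EinsteinCartan

end

noncomputable section

namespace EinsteinCartan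

/-! ### Ambient curvature in spatial directions and pullback to a slice -/

section LocalSlices

/-- Contraction of the lowered curvature with the inverse metric. -/
theorem IsLeviCivita.contract_curvLow {R : Type*} [CommRing R] [Algebra ℝ R] {n : ℕ}
    {d : Fin n → Derivation ℝ R R} {G Gi : Fin n → Fin n → R} {Γ : Fin n → Fin n → Fin n → R}
    (h : IsLeviCivita d G Gi Γ) (α γ : Fin n) :
    ∑ μ, ∑ ν, Gi μ ν * curvLow d G Γ α μ γ ν = ∑ μ, curv d Γ α μ γ μ := by
  refine Finset.sum_congr rfl fun μ _ => ?_
  simp only [curvLow, Finset.mul_sum]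
  rw [Finset.sum_comm]
  have : ∀ ρ, ∑ ν, Gi μ ν * (curv d Γ α μ γ ρ * G ρ ν)
      = curv d Γ α μ γ ρ * if μ = ρ then 1 else 0 := by
    intro ρ
    rw [← h.inv_mul, Finset.mul_sum]
    exact Finset.sum_congr rfl fun ν _ => by rw [h.metric_symm ρ ν]; ring
  simp [this]

/-- The lowered form of the curvature in direction of a Hubble flow. -/
theorem IsHubbleFlow.curvLow_u {R : Type*} [CommRing R] [Algebra ℝ R]
    {d : Fin 4 → Derivation ℝ R R} {G Gi : Fin 4 → Fin 4 → R} {Γ : Fin 4 → Fin 4 → Fin 4 → R}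
    {u : Fin 4 → R} {H Hd : R} (h : IsHubbleFlow d G Gi Γ u H Hd) (α β δ : Fin 4) :
    ∑ γ, curvLow d G Γ α β γ δ * u γ = (Hd + H ^ 2) *
      (lower G u α * (G β δ + lower G u β * lower G u δ)
        - lower G u β * (G α δ + lower G u α * lower G u δ)) := by
  have e1 : ∑ γ, curvLow d G Γ α β γ δ * u γ = ∑ ρ, (∑ γ, curv d Γ α β γ ρ * u γ) * G ρ δ := by
    simp only [curvLow, Finset.sum_mul]
    rw [Finset.sum_comm]
    exact Finset.sum_congr rfl fun _ _ => Finset.sum_congr rfl fun _ _ => by ring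
  have e2 : ∑ ρ, u ρ * G ρ δ = lower G u δ :=
    Finset.sum_congr rfl fun ρ _ => by rw [h.lc.metric_symm ρ]; ring
  rw [e1]
  simp only [h.curv_u]
  have e3 : ∀ ρ, (Hd + H ^ 2) * (lower G u α * (kron β ρ + lower G u β * u ρ)
        - lower G u β * (kron α ρ + lower G u α * u ρ)) * G ρ δ
      = (Hd + H ^ 2) * lower G u α * (kron β ρ * G ρ δ)
        - (Hd + H ^ 2) * lower G u β * (kron α ρ * G ρ δ) := fun ρ => by ring
  simp only [e3, Finset.sum_sub_distrib, ← Finset.mul_sum, sum_kron_mul]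
  ring

variable {U : TopologicalSpace.Opens (Coord 4)} {F : LocalFields}
  {A : Coord 4 → Fin 4 → Fin 4 → ℝ} {mu p : Coord 4 → ℝ} {q : Coord 4 → Fin 4 → ℝ}
  {f : ℝ × ℝ → ℝ} {Λ : ℝ}

/-- `spatial_curvature` with `e = Hd + H²`: since `lam = 2(k + H²) + e`, the ambient sectional
curvature of spatial planes is `k + H²`. -/
theorem IsLocalSolution.spatial_curvLow (h : IsLocalSolution U F A mu p q f Λ) (y : U)
    {X Y Z W : Fin 4 → ℝ}
    (hX : ∑ α, F.u y α * lower (F.g y) X α = 0) (hY : ∑ α, F.u y α * lower (F.g y) Y α = 0)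
    (hZ : ∑ α, F.u y α * lower (F.g y) Z α = 0) (hW : ∑ α, F.u y α * lower (F.g y) W α = 0) :
    ∑ α, ∑ β, ∑ γ, ∑ δ, X α * Y β * Z γ * W δ
        * Sm.ev y (curvLow Sm.d h.metric.met h.metric.chr α β γ δ)
      = (Sm.ev y h.curvK + Sm.ev y h.hub ^ 2) *
        ((∑ α, lower (F.g y) X α * Z α) * (∑ α, lower (F.g y) Y α * W α)
        - (∑ α, lower (F.g y) X α * W α) * (∑ α, lower (F.g y) Y α * Z α)) := by
  obtain ⟨J, hJ⟩ := h.frame y y.2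
  refine spatial_curvature hJ (T := fun α β γ δ =>
      Sm.ev y (curvLow Sm.d h.metric.met h.metric.chr α β γ δ))
    (e := Sm.ev y h.hubRate + Sm.ev y h.hub ^ 2)
    (lam := 2 * Sm.ev y h.curvK + Sm.ev y h.hubRate + 3 * Sm.ev y h.hub ^ 2)
    (kk := -3 * (Sm.ev y h.hub ^ 2 + Sm.ev y h.hubRate))
    (fun α β γ δ => ?_) (fun α β γ δ => ?_) (fun α β γ δ => ?_) (fun α β δ => ?_)
    (fun α γ => ?_) (by ring) hX hY hZ hW
  · rw [← map_neg, ← curvLow_swap]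
  · rw [← map_neg, ← h.metric.isLeviCivita.curvLow_antisymm Sm.d_comm]
  · rw [← h.metric.isLeviCivita.curvLow_pair Sm.d_comm]
  · have := congrArg (Sm.ev y) (h.isHubbleFlow.curvLow_u α β δ)
    simp only [map_sum, map_mul (Sm.ev y), map_add, map_sub, map_pow, h.ev_vel] at this
    simp only [h.ev_velLow, h.metric.ev_met] at this
    exact this
  · have := congrArg (Sm.ev y)
      ((h.metric.isLeviCivita.contract_curvLow α γ).trans (h.ricci_eq α γ))
    simp only [map_sum, map_mul (Sm.ev y), map_add, map_sub, map_pow, map_ofNat (Sm.ev y)] at this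
    simp only [h.ev_velLow, h.metric.ev_met, h.metric.ev_inv] at this
    rw [this]
    ring

/-! ### Pullback of smooth functions -/

variable {V : TopologicalSpace.Opens (Coord 3)} {φ : Coord 3 → Coord 4}

theorem contDiffOn_comp_extendZero (hφ : ContDiffOn ℝ ∞ φ V) (hm : ∀ z ∈ V, φ z ∈ U) (f : Sm U) :
    ContDiffOn ℝ ∞ (fun z => extendZero U f.1 (φ z)) V :=
  (Sm.smooth f).comp hφ hm

/-- Pullback of smooth functions. -/
def Sm.pull (hφ : ContDiffOn ℝ ∞ φ V) (hm : ∀ z ∈ V, φ z ∈ U) : Sm U →ₐ[ℝ] Sm V where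
  toFun f := Sm.mk _ (contDiffOn_comp_extendZero hφ hm f)
  map_one' := Sm.ev_ext fun z => by
    simp only [Sm.ev_mk, extendZero_of_mem _ (hm z z.2), map_one]; rfl
  map_zero' := Sm.ev_ext fun z => by
    simp only [Sm.ev_mk, extendZero_of_mem _ (hm z z.2), map_zero]; rfl
  map_mul' f g := Sm.ev_ext fun z => by
    simp only [Sm.ev_mk, extendZero_of_mem _ (hm z z.2), map_mul]; rfl
  map_add' f g := Sm.ev_ext fun z => by
    simp only [Sm.ev_mk, extendZero_of_mem _ (hm z z.2), map_add]; rfl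
  commutes' r := Sm.ev_ext fun z => by
    rw [Sm.ev_mk, AlgHom.commutes, extendZero_of_mem _ (hm z z.2)]; rfl

theorem Sm.ev_pull (hφ : ContDiffOn ℝ ∞ φ V) (hm : ∀ z ∈ V, φ z ∈ U) (f : Sm U) (z : V) :
    Sm.ev z (Sm.pull hφ hm f) = Sm.ev ⟨φ z, hm z z.2⟩ f := by
  change extendZero U f.1 (φ z) = _
  rw [extendZero_of_mem _ (hm z z.2)]
  rfl

theorem contDiffOn_coord (hφ : ContDiffOn ℝ ∞ φ V) (α : Fin 4) :
    ContDiffOn ℝ ∞ (fun z => φ z α) V :=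
  contDiffOn_euclidean.mp hφ α

/-- The Jacobian of a smooth map. -/
def Sm.jac (hφ : ContDiffOn ℝ ∞ φ V) (i : Fin 3) (α : Fin 4) : Sm V :=
  Sm.d i (Sm.mk _ (contDiffOn_coord hφ α))

theorem Sm.ev_jac (hφ : ContDiffOn ℝ ∞ φ V) (i : Fin 3) (α : Fin 4) (z : V) :
    Sm.ev z (Sm.jac hφ i α) = pd i (fun z => φ z α) z :=
  (Sm.pd_eq _ (fun _ => rfl) i z).symm

theorem fderiv_eq_sum_pd {n : ℕ} (F : Coord n → ℝ) (y : Coord n) (v : Coord n) :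
    fderiv ℝ F y v = ∑ α, v α * pd α F y := by
  have : v = ∑ α, v α • EuclideanSpace.single α (1 : ℝ) := by
    ext i
    simp [Pi.single_apply]
  conv_lhs => rw [this]
  simp [pd]

theorem pd_coord (hφ : ContDiffOn ℝ ∞ φ V) (i : Fin 3) (α : Fin 4) {z : Coord 3} (hz : z ∈ V) :
    pd i (fun z => φ z α) z = fderiv ℝ φ z (EuclideanSpace.single i 1) α := by
  have hd : DifferentiableAt ℝ φ z :=
    (hφ.contDiffAt (V.isOpen.mem_nhds hz)).differentiableAt (by simp)
  have := ((EuclideanSpace.proj (𝕜 := ℝ) α : Coord 4 →L[ℝ] ℝ).hasFDerivAt (x := φ z)).comp z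
    hd.hasFDerivAt
  have h2 : fderiv ℝ (fun z => φ z α) z = _ := this.fderiv
  rw [pd, h2]
  rfl

theorem Sm.isPullback (hφ : ContDiffOn ℝ ∞ φ V) (hm : ∀ z ∈ V, φ z ∈ U) :
    IsPullback (Sm.d (U := U)) Sm.d (Sm.pull hφ hm) (Sm.jac hφ) where
  symm i j α := Sm.d_comm i j _
  chain i f := Sm.ev_ext fun z => by
    have hd : DifferentiableAt ℝ φ z :=
      (hφ.contDiffAt (V.isOpen.mem_nhds z.2)).differentiableAt (by simp)
    have hf : DifferentiableAt ℝ (extendZero U f.1) (φ z) := Sm.differentiableAt f ⟨φ z, hm z z.2⟩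
    have e1 : Sm.ev z (Sm.d i (Sm.pull hφ hm f)) = pd i (fun z => extendZero U f.1 (φ z)) z :=
      (Sm.pd_eq _ (fun _ => rfl) i z).symm
    have e2 : fderiv ℝ (fun z => extendZero U f.1 (φ z)) z
        = (fderiv ℝ (extendZero U f.1) (φ z)).comp (fderiv ℝ φ z) := fderiv_comp (z : Coord 3) hf hd
    rw [e1, pd, e2, ContinuousLinearMap.comp_apply, fderiv_eq_sum_pd]
    simp only [map_sum, map_mul, Sm.ev_jac, Sm.ev_pull, Sm.ev_d]
    exact Finset.sum_congr rfl fun α _ => by rw [pd_coord hφ i α z.2]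

end LocalSlices

end EinsteinCartan

end

noncomputable section

namespace EinsteinCartan

/-! ### Intrinsic curvature of parametrised slices -/

section LocalSlices

variable {U : TopologicalSpace.Opens (Coord 4)} {F : LocalFields}
  {A : Coord 4 → Fin 4 → Fin 4 → ℝ} {mu p : Coord 4 → ℝ} {q : Coord 4 → Fin 4 → ℝ}
  {f : ℝ × ℝ → ℝ} {Λ : ℝ} {V : TopologicalSpace.Opens (Coord 3)} {φ : Coord 3 → Coord 4}
  {h3 : Coord 3 → Matrix (Fin 3) (Fin 3) ℝ}

/-- A parametrised hypersurface orthogonal to the velocity, with its induced metric. -/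
structure IsLocalSlice (U : TopologicalSpace.Opens (Coord 4)) (F : LocalFields)
    (V : TopologicalSpace.Opens (Coord 3)) (φ : Coord 3 → Coord 4)
    (h3 : Coord 3 → Matrix (Fin 3) (Fin 3) ℝ) : Prop where
  smooth : ContDiffOn ℝ ∞ φ V
  maps : ∀ z ∈ V, φ z ∈ U
  metric_eq : ∀ z ∈ V, ∀ i j, h3 z i j = ∑ α, ∑ β, F.g (φ z) α β
    * fderiv ℝ φ z (EuclideanSpace.single i 1) α * fderiv ℝ φ z (EuclideanSpace.single j 1) β
  det_ne : ∀ z ∈ V, (h3 z).det ≠ 0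
  orth : ∀ z ∈ V, ∀ i, ∑ α, F.u (φ z) α
    * lower (F.g (φ z)) (fun β => fderiv ℝ φ z (EuclideanSpace.single i 1) β) α = 0

namespace IsLocalSlice

theorem ev_pair (s : IsLocalSlice U F V φ h3) (hG : SmoothMetric U F.g) (z : V) (i j : Fin 3) :
    Sm.ev z (pair (fun α β => Sm.pull s.smooth s.maps (hG.met α β)) (Sm.jac s.smooth i)
      (Sm.jac s.smooth j)) = h3 z i j := by
  rw [s.metric_eq z z.2, pair_apply]
  simp only [map_sum, map_mul, Sm.ev_pull, Sm.ev_jac, hG.ev_met, pd_coord s.smooth _ _ z.2]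

theorem smoothMetric (s : IsLocalSlice U F V φ h3) (hG : SmoothMetric U F.g) :
    SmoothMetric V h3 where
  smooth i j := by
    refine (Sm.smooth (pair (fun α β => Sm.pull s.smooth s.maps (hG.met α β)) (Sm.jac s.smooth i)
      (Sm.jac s.smooth j))).congr fun z hz => ?_
    rw [Sm.extendZero_ev _ ⟨z, hz⟩, s.ev_pair]
  symm z hz i j := by
    rw [s.metric_eq z hz, s.metric_eq z hz, Finset.sum_comm]
    exact Finset.sum_congr rfl fun _ _ => Finset.sum_congr rfl fun _ _ => by
      rw [hG.symm _ (s.maps z hz)]; ring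
  det_ne := s.det_ne

theorem met_eq (s : IsLocalSlice U F V φ h3) (hG : SmoothMetric U F.g) (i j : Fin 3) :
    (s.smoothMetric hG).met i j = pair (fun α β => Sm.pull s.smooth s.maps (hG.met α β))
      (Sm.jac s.smooth i) (Sm.jac s.smooth j) :=
  Sm.ev_ext fun z => by rw [s.ev_pair]; rfl

variable (s : IsLocalSlice U F V φ h3) (h : IsLocalSolution U F A mu p q f Λ)

/-- The Gauss equation removes `H²` from the ambient value `k + H²`, so the intrinsic curvature no
longer involves the expansion. -/
theorem curvLow_eq (z : V) (i j k l : Fin 3) :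
    Sm.ev z (curvLow Sm.d (s.smoothMetric h.metric).met (s.smoothMetric h.metric).chr i j k l)
      = Sm.ev ⟨φ z, s.maps z z.2⟩ h.curvK * (h3 z i k * h3 z j l - h3 z i l * h3 z j k) := by
  have horth : ∀ i, pair (fun α β => Sm.pull s.smooth s.maps (h.metric.met α β))
      (fun α => Sm.pull s.smooth s.maps (h.vel α)) (Sm.jac s.smooth i) = 0 := fun i =>
    Sm.ev_ext fun z => by
      rw [map_zero, ← s.orth z z.2 i, pair_apply]
      simp only [map_sum, map_mul, Sm.ev_pull, Sm.ev_jac, h.metric.ev_met, h.ev_vel,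
        pd_coord s.smooth _ _ z.2, lower, Finset.mul_sum]
      exact Finset.sum_congr rfl fun _ _ => Finset.sum_congr rfl fun _ _ => by ring
  have e := h.isHubbleFlow.gauss (Sm.isPullback s.smooth s.maps) Sm.d_comm
    (s.smoothMetric h.metric).isLeviCivita (s.met_eq h.metric) horth i j k l
  rw [e]
  simp only [map_sub, map_sum, map_mul (Sm.ev z), map_pow, Sm.ev_pull, Sm.ev_jac,
    (s.smoothMetric h.metric).ev_met, pd_coord s.smooth _ _ z.2]
  rw [h.spatial_curvLow ⟨φ z, s.maps z z.2⟩ (s.orth z z.2 i) (s.orth z z.2 j) (s.orth z z.2 k)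
    (s.orth z z.2 l)]
  have hp : ∀ i j, ∑ α, lower (F.g (φ z)) (fun β => fderiv ℝ φ z (EuclideanSpace.single i 1) β) α
      * fderiv ℝ φ z (EuclideanSpace.single j 1) α = h3 z i j := by
    intro i j
    rw [(s.smoothMetric h.metric).symm z z.2 i j, s.metric_eq z z.2]
    simp only [lower, Finset.sum_mul]
    exact Finset.sum_congr rfl fun _ _ => Finset.sum_congr rfl fun _ _ => by ring
  simp only [hp]
  have e2 : h3 z j k * h3 z i l = h3 z i l * h3 z j k := mul_comm _ _
  rw [e2]
  ring

/-- The intrinsic curvature of an orthogonal hypersurface. -/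
theorem riemannLow_eq (z : V) (i j k l : Fin 3) :
    riemannLow h3 (christoffel h3) z i j k l
      = Sm.ev ⟨φ z, s.maps z z.2⟩ h.curvK * (h3 z i k * h3 z j l - h3 z i l * h3 z j k) := by
  rw [← s.curvLow_eq h z i j k l, riemannLow, curvLow, map_sum]
  exact Finset.sum_congr rfl fun ρ _ => by
    rw [map_mul, (s.smoothMetric h.metric).ev_curv]; rfl

/-- The intrinsic scalar curvature of an orthogonal hypersurface. -/
theorem ricciScalar_eq (z : V) :
    ricciScalar h3 (christoffel h3) z = 6 * Sm.ev ⟨φ z, s.maps z z.2⟩ h.curvK := by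
  have hs := s.smoothMetric h.metric
  have inv : ∀ a b, ∑ c, (h3 z)⁻¹ a c * h3 z c b = if a = b then 1 else 0 := fun a b => by
    have := congrArg (Sm.ev z) (hs.inv_mul a b)
    simp only [map_sum, map_mul, hs.ev_inv, hs.ev_met] at this
    rw [this]; split_ifs <;> simp
  have e1 : ∀ α β, ricci (christoffel h3) z α β
      = 2 * Sm.ev ⟨φ z, s.maps z z.2⟩ h.curvK * h3 z α β := by
    intro α β
    have e2 := congrArg (Sm.ev z) (hs.isLeviCivita.contract_curvLow α β)
    simp only [map_sum, map_mul] at e2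
    have e3 : ricci (christoffel h3) z α β = ∑ μ, Sm.ev z (curv Sm.d hs.chr α μ β μ) :=
      Finset.sum_congr rfl fun μ _ => hs.ev_curv z α μ β μ
    rw [e3, ← e2]
    simp only [hs.ev_inv, s.curvLow_eq h z]
    have e4 : ∀ μ ν, (h3 z)⁻¹ μ ν * (Sm.ev ⟨φ z, s.maps z z.2⟩ h.curvK
        * (h3 z α β * h3 z μ ν - h3 z α ν * h3 z μ β))
        = Sm.ev ⟨φ z, s.maps z z.2⟩ h.curvK * h3 z α β * ((h3 z)⁻¹ μ ν * h3 z ν μ)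
          - Sm.ev ⟨φ z, s.maps z z.2⟩ h.curvK * h3 z μ β * ((h3 z)⁻¹ μ ν * h3 z ν α) := by
      intro μ ν
      rw [hs.symm z z.2 μ ν, hs.symm z z.2 α ν]; ring
    simp only [e4, Finset.sum_sub_distrib, ← Finset.mul_sum, inv]
    simp
    ring
  simp only [ricciScalar, e1]
  have e5 : ∀ α β, (h3 z)⁻¹ α β * (2 * Sm.ev ⟨φ z, s.maps z z.2⟩ h.curvK * h3 z α β)
      = 2 * Sm.ev ⟨φ z, s.maps z z.2⟩ h.curvK * ((h3 z)⁻¹ α β * h3 z β α) := fun α β => by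
    rw [hs.symm z z.2 α β]; ring
  simp only [e5, ← Finset.mul_sum, inv]
  simp
  ring

end IsLocalSlice

end LocalSlices

end EinsteinCartan

end

noncomputable section

namespace EinsteinCartan

/-! ### Components in charts -/

section Charts

variable {n : ℕ} {M : Type w} [TopologicalSpace M] [ChartedSpace (Coord n) M]
  [IsManifold (𝓡 n) ∞ M] {e : OpenPartialHomeomorph M (Coord n)}

theorem chart_mdifferentiable (he : e ∈ atlas (Coord n) M) : e.MDifferentiable (𝓡 n) (𝓡 n) :=
  mdifferentiable_of_mem_atlas he

/-- The components in the chart `e` of a tangent vector at `x`. -/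
def tangentComp (e : OpenPartialHomeomorph M (Coord n)) (x : M) :
    TangentSpace (𝓡 n) x →ₗ[ℝ] Coord n :=
  (mfderiv (𝓡 n) (𝓡 n) e x).toLinearMap

theorem tangentComp_injective (he : e ∈ atlas (Coord n) M) {x : M} (hx : x ∈ e.source) :
    Function.Injective (tangentComp e x) :=
  (chart_mdifferentiable he).mfderiv_injective hx

theorem tangentComp_coordVec (he : e ∈ atlas (Coord n) M) {y : Coord n} (hy : y ∈ e.target)
    (i : Fin n) : tangentComp e (e.symm y) (coordVec e y i) = EuclideanSpace.single i 1 := by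
  have := (chart_mdifferentiable he).comp_symm_deriv hy
  exact congrArg (fun L => L (EuclideanSpace.single i 1 : Coord n)) this

theorem eq_sum_coordVec (he : e ∈ atlas (Coord n) M) {y : Coord n} (hy : y ∈ e.target)
    (v : TangentSpace (𝓡 n) (e.symm y)) :
    v = ∑ i, tangentComp e (e.symm y) v i • coordVec e y i := by
  apply tangentComp_injective he (e.map_target hy)
  rw [map_sum]
  simp only [map_smul, tangentComp_coordVec he hy]
  ext j
  simp [Pi.single_apply]

theorem bilin_apply (he : e ∈ atlas (Coord n) M)
    (b : ∀ x : M, TangentSpace (𝓡 n) x →ₗ[ℝ] TangentSpace (𝓡 n) x →ₗ[ℝ] ℝ) {x : M}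
    (hx : x ∈ e.source) (v v' : TangentSpace (𝓡 n) x) :
    b x v v' = ∑ i, ∑ j, bilinComp b e (e x) i j * tangentComp e x v i * tangentComp e x v' j := by
  obtain ⟨y, hy, rfl⟩ : ∃ y ∈ e.target, e.symm y = x := ⟨e x, e.map_source hx, e.left_inv hx⟩
  rw [e.right_inv hy]
  conv_lhs => rw [eq_sum_coordVec he hy v, eq_sum_coordVec he hy v']
  simp only [map_sum, map_smul, LinearMap.sum_apply, LinearMap.smul_apply, smul_eq_mul,
    Finset.mul_sum]
  rw [Finset.sum_comm]
  exact Finset.sum_congr rfl fun i _ => Finset.sum_congr rfl fun j _ => by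
    rw [bilinComp, Matrix.of_apply]; ring

theorem exists_tangentComp_eq (he : e ∈ atlas (Coord n) M) {y : Coord n} (hy : y ∈ e.target)
    (a : Fin n → ℝ) : ∃ v, ∀ i, tangentComp e (e.symm y) v i = a i :=
  ⟨∑ i, a i • coordVec e y i, fun j => by
    rw [map_sum]
    simp only [map_smul, tangentComp_coordVec he hy]
    simp [Pi.single_apply]⟩

end Charts

/-- A form that is positive on the orthogonal complement of one timelike vector is so for all. -/
theorem pos_of_lorentzian {E : Type*} [AddCommGroup E] [Module ℝ E] (b : E →ₗ[ℝ] E →ₗ[ℝ] ℝ)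
    (hsymm : ∀ v v', b v v' = b v' v)
    (hb : ∃ v, b v v < 0 ∧ ∀ v', b v v' = 0 → v' ≠ 0 → 0 < b v' v') {u : E} (hu : b u u = -1)
    {x : E} (hux : b u x = 0) (hx : x ≠ 0) : 0 < b x x := by
  obtain ⟨v, -, hpos⟩ := hb
  by_contra hneg
  have hvu : b v u ≠ 0 := fun h0 => by
    have := hpos u h0 (fun h => by simp [h] at hu)
    linarith
  -- This combination of `u` and `x` is orthogonal to `v`. If `b x x ≤ 0`, its square is
  -- nonpositive, so it vanishes, which forces `x = 0`.
  set t := b v x • u - b v u • x with ht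
  have hvt : b v t = 0 := by
    simp only [ht, map_sub, map_smul, smul_eq_mul]; ring
  have hut : b u t = -b v x := by
    simp only [ht, map_sub, map_smul, smul_eq_mul, hu, hux]; ring
  have htt : b t t = -(b v x) ^ 2 + (b v u) ^ 2 * b x x := by
    simp only [ht, map_sub, map_smul, smul_eq_mul, LinearMap.sub_apply, LinearMap.smul_apply, hu,
      hux, hsymm x u]
    ring
  have ht0 : t = 0 := by
    by_contra h0
    have := hpos t hvt h0
    nlinarith [sq_nonneg (b v x), sq_nonneg (b v u)]
  rw [ht0, map_zero] at hut
  have hvx : b v x = 0 := by linarith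
  rw [hvx, zero_smul, zero_sub] at ht
  rw [ht0] at ht
  have := smul_eq_zero.mp (neg_eq_zero.mp ht.symm)
  tauto

/-! ### From the manifold to charts -/

section ChartSolutions

variable {M : Type w} [TopologicalSpace M] [ChartedSpace (Coord 4) M]
  {X : Spacetime M} {W : WeyssenhoffFluid X} {Λ : ℝ} {f : ℝ × ℝ → ℝ}
  {e : OpenPartialHomeomorph M (Coord 4)}

/-- The range of a chart. -/
def chartDomain {n : ℕ} {N : Type*} [TopologicalSpace N]
    (e : OpenPartialHomeomorph N (Coord n)) : TopologicalSpace.Opens (Coord n) :=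
  ⟨e.target, e.open_target⟩

namespace WeyssenhoffFluid

/-- The components of the velocity in a chart. -/
theorem fields_u_apply (W : WeyssenhoffFluid X) {x : M} (hx : x ∈ e.source) (α : Fin 4) :
    (W.fields e).u (e x) α = tangentComp e x (W.u x) α := by
  obtain ⟨y, hy, rfl⟩ : ∃ y ∈ e.target, e.symm y = x := ⟨e x, e.map_source hx, e.left_inv hx⟩
  rw [e.right_inv hy]
  rfl

variable [IsManifold (𝓡 4) ∞ M]

theorem metric_apply (W : WeyssenhoffFluid X) (he : e ∈ atlas (Coord 4) M) {x : M}
    (hx : x ∈ e.source) (v v' : TangentSpace (𝓡 4) x) :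
    X.metric x v v' = ∑ α, lower ((W.fields e).g (e x)) (fun β => tangentComp e x v β) α
      * tangentComp e x v' α := by
  rw [X.metric_symm, bilin_apply he X.metric hx]
  simp only [lower, Finset.sum_mul]
  exact Finset.sum_congr rfl fun _ _ => Finset.sum_congr rfl fun _ _ => by
    simp only [fields]; ring

/-- Mostly a translation of the hypotheses into components. Frames exist because the orthogonal
complement of `u` is positive definite (`pos_of_lorentzian`), and the factors `8π` cancel in the
Cartan equation. -/
theorem isLocalSolution (he : e ∈ atlas (Coord 4) M) (hfield : W.FieldEquations Λ)
    (hcosm : W.IsCosmological)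
    (htor : ∀ e ∈ atlas (Coord 4) M, ∀ y ∈ e.target, (W.fields e).torVecSq y ≠ 0)
    (hf : ∀ x, DifferentiableAt ℝ f (W.energy x, W.pressure x))
    (hdiv : ∀ e ∈ atlas (Coord 4) M, ∀ y ∈ e.target,
      (W.fields e).projDiv y (W.spinVec e) = f (W.energy (e.symm y), W.pressure (e.symm y))) :
    IsLocalSolution (chartDomain e) (W.fields e) (W.spinLow e) (fun y => W.energy (e.symm y))
      (fun y => W.pressure (e.symm y)) (fun y α => W.heat (e.symm y) (coordVec e y α)) f Λ := by
  have hsymm : ∀ y α β, (W.fields e).g y α β = (W.fields e).g y β α := fun y α β =>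
    X.metric_symm _ _ _
  have hmet : ∀ y ∈ e.target, ∀ v v', X.metric (e.symm y) v v'
      = ∑ α, lower ((W.fields e).g y) (fun β => tangentComp e (e.symm y) v β) α
        * tangentComp e (e.symm y) v' α := by
    intro y hy v v'
    rw [W.metric_apply he (e.map_target hy), e.right_inv hy]
  have hunit : ∀ y ∈ e.target,
      ∑ α, lower ((W.fields e).g y) ((W.fields e).u y) α * (W.fields e).u y α = -1 := by
    intro y hy
    rw [← W.u_unit (e.symm y)]
    exact (hmet y hy _ _).symm
  have hframe : ∀ y ∈ e.target, ∃ J, IsFrame ((W.fields e).g y) ((W.fields e).u y) J := by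
    intro y hy
    refine exists_isFrame (hsymm y) (hunit y hy) fun a ha h0 => ?_
    obtain ⟨v, hv⟩ := exists_tangentComp_eq he hy a
    have hv' : (fun β => tangentComp e (e.symm y) v β) = a := funext hv
    have e1 := hmet y hy v v
    have e2 := hmet y hy (W.u (e.symm y)) v
    rw [hv'] at e1
    simp only [hv] at e1 e2
    rw [← e1]
    refine pos_of_lorentzian (X.metric (e.symm y)) (X.metric_symm _) (X.metric_lorentzian _)
      (W.u_unit _) (e2.trans h0) fun hv0 => ha ?_
    rw [← hv', hv0]
    funext i
    simp
  refine ⟨⟨X.metric_smooth e he, fun y _ => hsymm y, fun y hy => ?_⟩, X.torsion_smooth e he,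
    W.u_smooth e he, hunit, hframe, fun y _ α β => W.spin_antisymm _ _ _, fun y hy α => ?_,
    fun y hy => ?_, hfield.einstein e he, fun y hy α β γ => ?_, hcosm.shear_free e he,
    hcosm.expansion_homogeneous e he, hcosm.energy_homogeneous e he,
    hcosm.pressure_homogeneous e he, hcosm.geodesic e he, hcosm.vorticity_eq e he, htor e he,
    fun y _ => hf _, hdiv e he⟩
  · obtain ⟨J, hJ⟩ := hframe y hy
    exact hJ.det_ne_zero
  · have := W.spin_orth (e.symm y) (coordVec e y α)
    rw [eq_sum_coordVec he hy (W.u (e.symm y)), map_sum] at this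
    simp only [map_smul, smul_eq_mul] at this
    rw [← this]
    exact Finset.sum_congr rfl fun β _ => mul_comm _ _
  · have := W.heat_orth (e.symm y)
    rw [eq_sum_coordVec he hy (W.u (e.symm y)), map_sum] at this
    simp only [map_smul, smul_eq_mul] at this
    rw [← this]
    rfl
  · have := hfield.cartan e he y hy α β γ
    simp only [torTrace] at this
    rw [this, hypermomentum]
    have hpi := Real.pi_ne_zero
    field_simp

end WeyssenhoffFluid

end ChartSolutions

end EinsteinCartan

end

noncomputable section

namespace EinsteinCartan

/-! ### Slices in charts -/

section Slices

variable {M : Type w} [TopologicalSpace M] [ChartedSpace (Coord 4) M] [IsManifold (𝓡 4) ∞ M]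
  {X : Spacetime M} {W : WeyssenhoffFluid X} {e : OpenPartialHomeomorph M (Coord 4)}

namespace WeyssenhoffFluid.OrthogonalSlice

variable (V : W.OrthogonalSlice) {c : OpenPartialHomeomorph V.carrier (Coord 3)}

/-- The part of the chart `c` of a slice that lies in the domain of the chart `e`. -/
def overlap (c : OpenPartialHomeomorph V.carrier (Coord 3)) (e : OpenPartialHomeomorph M (Coord 4)) :
    TopologicalSpace.Opens (Coord 3) :=
  ⟨c.target ∩ c.symm ⁻¹' (V.ι ⁻¹' e.source),
    c.isOpen_inter_preimage_symm (e.open_source.preimage V.ι_smooth.continuous)⟩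

/-- The coordinate expression of the embedding of a slice. -/
def param (c : OpenPartialHomeomorph V.carrier (Coord 3)) (e : OpenPartialHomeomorph M (Coord 4))
    (z : Coord 3) : Coord 4 := e (V.ι (c.symm z))

theorem contDiffOn_param (hc : c ∈ atlas (Coord 3) V.carrier) (he : e ∈ atlas (Coord 4) M) :
    ContDiffOn ℝ ∞ (V.param c e) (V.overlap c e) := by
  rw [← contMDiffOn_iff_contDiffOn]
  have h1 : ContMDiffOn (𝓡 3) (𝓡 3) ∞ c.symm c.target :=
    contMDiffOn_symm_of_mem_maximalAtlas (IsManifold.subset_maximalAtlas hc)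
  have h2 : ContMDiffOn (𝓡 4) (𝓡 4) ∞ e e.source :=
    contMDiffOn_of_mem_maximalAtlas (IsManifold.subset_maximalAtlas he)
  have h3 : ContMDiffOn (𝓡 3) (𝓡 4) ∞ (V.ι ∘ c.symm) (V.overlap c e) :=
    V.ι_smooth.comp_contMDiffOn (h1.mono fun z hz => hz.1)
  exact h2.comp h3 fun z hz => hz.2

theorem fderiv_param (hc : c ∈ atlas (Coord 3) V.carrier) (he : e ∈ atlas (Coord 4) M)
    {z : Coord 3} (hz : z ∈ V.overlap c e) (i : Fin 3) :
    fderiv ℝ (V.param c e) z (EuclideanSpace.single i 1) = tangentComp e (V.ι (c.symm z))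
      (mfderiv (𝓡 3) (𝓡 4) V.ι (c.symm z) (coordVec c z i)) := by
  have h1 : MDifferentiableAt (𝓡 3) (𝓡 3) c.symm z := mdifferentiableAt_atlas_symm hc hz.1
  have h2 : MDifferentiableAt (𝓡 4) (𝓡 4) e (V.ι (c.symm z)) := mdifferentiableAt_atlas he hz.2
  have h3 : MDifferentiableAt (𝓡 3) (𝓡 4) V.ι (c.symm z) :=
    (V.ι_smooth _).mdifferentiableAt (by simp)
  have e1 : mfderiv (𝓡 3) (𝓡 4) (V.ι ∘ c.symm) z = _ := mfderiv_comp z h3 h1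
  have e2 : mfderiv (𝓡 3) (𝓡 4) (e ∘ (V.ι ∘ c.symm)) z = _ := mfderiv_comp z h2 (h3.comp z h1)
  have e3 : fderiv ℝ (V.param c e) z = mfderiv (𝓡 3) (𝓡 4) (e ∘ (V.ι ∘ c.symm)) z :=
    mfderiv_eq_fderiv.symm
  rw [e3, e2, e1]
  rfl

theorem isLocalSlice (hc : c ∈ atlas (Coord 3) V.carrier) (he : e ∈ atlas (Coord 4) M) :
    IsLocalSlice (chartDomain e) (W.fields e) (V.overlap c e) (V.param c e)
      (bilinComp V.induced c) where
  smooth := V.contDiffOn_param hc he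
  maps z hz := e.map_source hz.2
  metric_eq z hz i j := by
    simp only [V.fderiv_param hc he hz]
    exact bilin_apply he X.metric hz.2 _ _
  det_ne z hz := by
    -- A null vector of the matrix would give a nonzero tangent vector of zero length, whereas its
    -- image under the immersion is nonzero and orthogonal to `u`, hence spacelike.
    intro h0
    obtain ⟨a, ha, hza⟩ := Matrix.exists_mulVec_eq_zero_iff.mpr h0
    set v := ∑ i, a i • coordVec c z i with hv
    have hcomp : ∀ i, tangentComp c (c.symm z) v i = a i := fun i => by
      rw [hv, map_sum]
      simp only [map_smul, tangentComp_coordVec hc hz.1]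
      simp [Pi.single_apply]
    have hv0 : v ≠ 0 := fun h => ha (funext fun i => by
      rw [← hcomp i, h, map_zero]; rfl)
    have hpos := pos_of_lorentzian (X.metric (V.ι (c.symm z))) (X.metric_symm _)
      (X.metric_lorentzian _) (W.u_unit _) (V.ι_orthogonal (c.symm z) v)
      (fun h => hv0 (V.ι_immersion _ (h.trans (map_zero _).symm)))
    have e1 : V.induced (c.symm z) v v = ∑ i, a i * (Matrix.mulVec (bilinComp V.induced c z) a) i := by
      rw [hv]
      simp only [map_sum, map_smul, LinearMap.sum_apply, LinearMap.smul_apply, smul_eq_mul,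
        Matrix.mulVec, dotProduct, Finset.mul_sum]
      rw [Finset.sum_comm]
      exact Finset.sum_congr rfl fun i _ => Finset.sum_congr rfl fun j _ => by
        rw [bilinComp, Matrix.of_apply]; ring
    rw [hza] at e1
    have e2 : V.induced (c.symm z) v v = 0 := by rw [e1]; simp
    exact hpos.ne' e2
  orth z hz i := by
    simp only [V.fderiv_param hc he hz]
    have := V.ι_orthogonal (c.symm z) (coordVec c z i)
    rw [X.metric_symm, W.metric_apply he hz.2] at this
    rw [← this]
    refine Finset.sum_congr rfl fun α _ => ?_
    rw [mul_comm, param, W.fields_u_apply hz.2]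

end WeyssenhoffFluid.OrthogonalSlice

end Slices

end EinsteinCartan

end

noncomputable section

namespace EinsteinCartan

/-! ### The scale factor in a chart -/

section LocalScale

variable {U : TopologicalSpace.Opens (Coord 4)} {F : LocalFields}
  {A : Coord 4 → Fin 4 → Fin 4 → ℝ} {mu p : Coord 4 → ℝ} {q : Coord 4 → Fin 4 → ℝ}
  {f : ℝ × ℝ → ℝ} {Λ : ℝ}

/-- The gradient of a power of a function with known logarithmic gradient. -/
theorem grad_of_pow_mul {R : Type*} [CommRing R] [Algebra ℝ R] (D : Derivation ℝ R R) {s L H v : R}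
    (h : s * L ^ 6 = 1) (hs : D s = 6 * H * s * v) : D L = -(H * L * v) := by
  -- Differentiate `s L⁶ = 1`; multiplication by `L` then replaces division by `s L⁵`.
  have h1 := congrArg D h
  rw [Derivation.leibniz, Derivation.leibniz_pow, hs, Derivation.map_one_eq_zero] at h1
  simp only [smul_eq_mul, nsmul_eq_mul, Nat.reduceSub] at h1
  have h6 : (algebraMap ℝ R (1 / 6)) * 6 = 1 := by
    rw [← map_ofNat (algebraMap ℝ R) 6, ← map_mul]; norm_num
  push_cast at h1
  linear_combination (algebraMap ℝ R (1 / 6)) * L * h1 - (s * L ^ 6 * (D L + H * L * v)) * h6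
    - (D L + H * L * v) * h

namespace IsLocalSolution

variable (h : IsLocalSolution U F A mu p q f Λ)

/-- As `|S|²` has logarithmic rate `-6H`, its power `-1/6` has rate `H`. This provides a scale
factor without integrating `θ`; positivity of `|S|²` makes it smooth. -/
theorem contDiffOn_scale (h : IsLocalSolution U F A mu p q f Λ) :
    ContDiffOn ℝ ∞ (fun y => F.torVecSq y ^ (-(1 / 6) : ℝ)) U := by
  have h1 : ContDiffOn ℝ ∞ (fun y => extendZero U h.svSq.1 y ^ (-(1 / 6) : ℝ)) U :=
    (Sm.smooth h.svSq).rpow_const_of_ne fun y hy => by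
      rw [Sm.extendZero_ev h.svSq ⟨y, hy⟩]
      exact (h.svSq_pos _).ne'
  refine h1.congr fun y hy => ?_
  rw [Sm.extendZero_ev h.svSq ⟨y, hy⟩, h.ev_svSq]

/-- The scale factor, up to a constant. -/
def scale : Sm U := Sm.mk _ h.contDiffOn_scale

theorem ev_scale (y : U) : Sm.ev y h.scale = F.torVecSq y ^ (-(1 / 6) : ℝ) := rfl

theorem torVecSq_pos (h : IsLocalSolution U F A mu p q f Λ) (y : U) : 0 < F.torVecSq y := by
  rw [← h.ev_svSq]; exact h.svSq_pos y

theorem scale_pos (y : U) : 0 < Sm.ev y h.scale := Real.rpow_pos_of_pos (h.torVecSq_pos y) _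

theorem svSq_mul_scale : h.svSq * h.scale ^ 6 = 1 := Sm.ev_ext fun y => by
  have hp := h.torVecSq_pos y
  rw [map_mul, map_pow, map_one, h.ev_svSq, h.ev_scale, ← Real.rpow_natCast, ← Real.rpow_mul hp.le]
  norm_num
  rw [Real.rpow_neg_one, mul_inv_cancel₀ hp.ne']

theorem scale_grad (μ : Fin 4) : Sm.d μ h.scale = -(h.hub * h.scale * h.velLow μ) :=
  grad_of_pow_mul (Sm.d μ) h.svSq_mul_scale (h.svSq_grad μ)

/-- The logarithmic rate `-2H` of `k` cancels the rate `2H` of the squared scale factor, and neither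
function has a spatial gradient. -/
theorem curvK_mul_scale_grad (μ : Fin 4) : Sm.d μ (h.curvK * h.scale ^ 2) = 0 := by
  -- Stated for a derivation of an arbitrary ring, where the two contributions cancel by `ring`.
  have e : ∀ {R : Type} [CommRing R] [Algebra ℝ R] (D : Derivation ℝ R R) {k L H v : R}
      (_ : D k = 2 * H * k * v) (_ : D L = -(H * L * v)), D (k * L ^ 2) = 0 := by
    intro R _ _ D k L H v h1 h2
    rw [Derivation.leibniz, Derivation.leibniz_pow, h1, h2]
    simp only [smul_eq_mul, nsmul_eq_mul, Nat.reduceSub, pow_one]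
    push_cast
    ring
  exact e (Sm.d μ) (h.curvK_grad μ) (h.scale_grad μ)

/-- A multiple of the scale factor is homogeneous and has logarithmic derivative `θ/3`. -/
theorem scale_props {l : Coord 4 → ℝ} {a : ℝ} (ha : 0 < a)
    (hl : ∀ y : U, l y = a * Sm.ev y h.scale) (y : U) :
    (∀ α, F.projGrad y l α = 0) ∧ (1 / 3) * F.expansion y = F.dot y l / l y := by
  have hpd : ∀ ν, pd ν l y
      = -(a * (F.expansion y / 3) * Sm.ev y h.scale) * lower (F.g y) (F.u y) ν := by
    intro ν
    rw [Sm.pd_eq (algebraMap ℝ (Sm U) a * h.scale) (fun y => by rw [hl, map_mul, Sm.ev_const]) ν y,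
      Derivation.leibniz, Derivation.map_algebraMap, h.scale_grad, smul_zero, add_zero, smul_eq_mul,
      map_mul, map_neg, map_mul, map_mul, Sm.ev_const, h.ev_hub, h.ev_velLow]
    ring
  have hu : ∑ ν, F.u y ν * lower (F.g y) (F.u y) ν = -1 := by
    rw [← h.unit y y.2]
    exact Finset.sum_congr rfl fun _ _ => mul_comm _ _
  have hdot : F.dot y l = a * (F.expansion y / 3) * Sm.ev y h.scale := by
    have e : ∀ ν, F.u y ν * pd ν l y = -(a * (F.expansion y / 3) * Sm.ev y h.scale)
        * (F.u y ν * lower (F.g y) (F.u y) ν) := fun ν => by rw [hpd]; ring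
    simp only [LocalFields.dot, e, ← Finset.mul_sum, hu]
    ring
  constructor
  · intro α
    have e : ∀ ν, F.hMix y α ν * pd ν l y = (if α = ν then 1 else 0) * pd ν l y
        + lower (F.g y) (F.u y) α * (F.u y ν * pd ν l y) := fun ν => by
      simp only [LocalFields.hMix, uLow_eq]; ring
    have hdot' : ∑ ν, F.u y ν * pd ν l y = _ := hdot
    simp only [LocalFields.projGrad, e, Finset.sum_add_distrib, ← Finset.mul_sum, hdot']
    simp only [ite_mul, one_mul, zero_mul, Finset.sum_ite_eq, Finset.mem_univ, if_true, hpd]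
    ring
  · have := h.scale_pos y
    rw [hdot, hl]
    field_simp

end IsLocalSolution

end LocalScale

/-! ### Independence of the chart -/

section ChartInvariance

variable {M : Type w} [TopologicalSpace M] [ChartedSpace (Coord 4) M] [IsManifold (𝓡 4) ∞ M]
  {X : Spacetime M} {W : WeyssenhoffFluid X} {Λ : ℝ} {f : ℝ × ℝ → ℝ}
  {e e' : OpenPartialHomeomorph M (Coord 4)}

namespace WeyssenhoffFluid

/-- The fluid solves the field equations in every chart. -/
def IsSolution (W : WeyssenhoffFluid X) (f : ℝ × ℝ → ℝ) (Λ : ℝ) : Prop :=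
  ∀ e ∈ atlas (Coord 4) M, IsLocalSolution (chartDomain e) (W.fields e) (W.spinLow e)
    (fun y => W.energy (e.symm y)) (fun y => W.pressure (e.symm y))
    (fun y α => W.heat (e.symm y) (coordVec e y α)) f Λ

/-- The square of the torsion vector in terms of an orthonormal basis of the tangent space. -/
theorem torVecSq_eq (h : W.IsSolution f Λ) (he : e ∈ atlas (Coord 4) M) {x : M}
    (hx : x ∈ e.source) {v : Fin 4 → TangentSpace (𝓡 4) x} (hv0 : v 0 = W.u x)
    (hv : ∀ a b, X.metric x (v a) (v b) = (Matrix.diagonal eta : Matrix (Fin 4) (Fin 4) ℝ) a b) :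
    2 * (W.fields e).torVecSq (e x)
      = ∑ a, ∑ b, eta a * eta b * W.spin x (v a) (v b) * W.spin x (v a) (v b) := by
  have hs := h e he
  set J : Matrix (Fin 4) (Fin 4) ℝ := Matrix.of fun a α => tangentComp e x (v a) α with hJdef
  have hJ : IsFrame ((W.fields e).g (e x)) ((W.fields e).u (e x)) J := by
    refine ⟨?_, ?_⟩
    · funext α
      rw [W.fields_u_apply hx, ← hv0]
      rfl
    · ext a b
      rw [← hv a b, bilin_apply he X.metric hx, Matrix.mul_assoc, Matrix.mul_apply]
      refine Finset.sum_congr rfl fun α _ => ?_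
      rw [Matrix.mul_apply, Finset.mul_sum]
      refine Finset.sum_congr rfl fun β _ => ?_
      simp only [hJdef, Matrix.of_apply, Matrix.transpose_apply, fields]
      ring
  have hn := hs.spin_norm ⟨e x, e.map_source hx⟩
  rw [hs.ev_svSq] at hn
  refine hn.symm.trans ((hJ.contract_two _ _).trans ?_)
  have hcomp : ∀ a b, comp2 J (W.spinLow e (e x)) a b = W.spin x (v a) (v b) := fun a b => by
    rw [bilin_apply he W.spin hx, comp2]
    exact Finset.sum_congr rfl fun _ _ => Finset.sum_congr rfl fun _ _ => by
      simp only [hJdef, Matrix.of_apply, spinLow]; ring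
  simp only [hcomp]

/-- An orthonormal frame found in one chart comes from a basis of the tangent space. In that basis
both values are half the square of the spin tensor, which refers to no chart. -/
theorem torVecSq_invariant (h : W.IsSolution f Λ) (he : e ∈ atlas (Coord 4) M)
    (he' : e' ∈ atlas (Coord 4) M) {x : M} (hx : x ∈ e.source) (hx' : x ∈ e'.source) :
    (W.fields e).torVecSq (e x) = (W.fields e').torVecSq (e' x) := by
  obtain ⟨J, hJ⟩ := (h e he).frame (e x) (e.map_source hx)
  have hex : ∀ a, ∃ v : TangentSpace (𝓡 4) x, ∀ α, tangentComp e x v α = J a α := by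
    intro a
    obtain ⟨y, hy, rfl⟩ : ∃ y ∈ e.target, e.symm y = x := ⟨e x, e.map_source hx, e.left_inv hx⟩
    exact exists_tangentComp_eq he hy (J a)
  choose v hv using hex
  have hv0 : v 0 = W.u x := by
    apply tangentComp_injective he hx
    ext α
    rw [hv, hJ.zero, W.fields_u_apply hx]
  have hvv : ∀ a b, X.metric x (v a) (v b)
      = (Matrix.diagonal eta : Matrix (Fin 4) (Fin 4) ℝ) a b := by
    intro a b
    rw [← hJ.ortho, bilin_apply he X.metric hx, Matrix.mul_assoc, Matrix.mul_apply]
    refine Finset.sum_congr rfl fun α _ => ?_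
    rw [Matrix.mul_apply, Finset.mul_sum]
    refine Finset.sum_congr rfl fun β _ => ?_
    rw [hv, hv, Matrix.transpose_apply]
    simp only [fields]
    ring
  have h1 := torVecSq_eq h he hx hv0 hvv
  have h2 := torVecSq_eq h he' hx' hv0 hvv
  linarith

end WeyssenhoffFluid

end ChartInvariance

end EinsteinCartan

end

noncomputable section

namespace EinsteinCartan

/-! ### Global constancy and normalisation of the curvature -/

section Global

variable {M : Type w} [TopologicalSpace M] [ChartedSpace (Coord 4) M] [IsManifold (𝓡 4) ∞ M]
  {X : Spacetime M} {W : WeyssenhoffFluid X} {Λ : ℝ} {f : ℝ × ℝ → ℝ}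
  {e e' : OpenPartialHomeomorph M (Coord 4)}

namespace WeyssenhoffFluid

/-- A sixth of the spatial scalar curvature, computed in the chart `e`. -/
def IsSolution.curvK (h : W.IsSolution f Λ) (he : e ∈ atlas (Coord 4) M) {x : M}
    (hx : x ∈ e.source) : ℝ :=
  Sm.ev ⟨e x, e.map_source hx⟩ (h e he).curvK

namespace OrthogonalSlice

theorem scalarCurvature_eq (V : W.OrthogonalSlice) (h : W.IsSolution f Λ)
    (he : e ∈ atlas (Coord 4) M) {y : V.carrier} (hy : V.ι y ∈ e.source) :
    V.scalarCurvature y = 6 * h.curvK he hy := by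
  have hc := chart_mem_atlas (Coord 3) y
  have hys := mem_chart_source (Coord 3) y
  have hz : chartAt (Coord 3) y y ∈ V.overlap (chartAt (Coord 3) y) e := by
    refine ⟨(chartAt (Coord 3) y).map_source hys, ?_⟩
    rw [Set.mem_preimage, (chartAt (Coord 3) y).left_inv hys]
    exact hy
  rw [scalarCurvature, (V.isLocalSlice hc he).ricciScalar_eq (h e he) ⟨_, hz⟩]
  congr 3
  apply Subtype.ext
  simp only [param]
  rw [(chartAt (Coord 3) y).left_inv hys]

theorem riemann3_eq (V : W.OrthogonalSlice) (h : W.IsSolution f Λ)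
    {c : OpenPartialHomeomorph V.carrier (Coord 3)} (hc : c ∈ atlas (Coord 3) V.carrier)
    {z : Coord 3} (hz : z ∈ c.target) (he : e ∈ atlas (Coord 4) M)
    (hy : V.ι (c.symm z) ∈ e.source) (i j k l : Fin 3) :
    V.riemann3 c z i j k l = h.curvK he hy *
      (bilinComp V.induced c z i k * bilinComp V.induced c z j l
        - bilinComp V.induced c z i l * bilinComp V.induced c z j k) := by
  have hz' : z ∈ V.overlap c e := ⟨hz, hy⟩
  rw [riemann3, (V.isLocalSlice hc he).riemannLow_eq (h e he) ⟨z, hz'⟩ i j k l, IsSolution.curvK]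
  simp only [param]

end OrthogonalSlice

/-- A slice passes through each point, and its scalar curvature `6k` is computed within the slice,
without reference to a chart of `M`. -/
theorem IsSolution.curvK_invariant (h : W.IsSolution f Λ)
    (hslices : ∀ x : M, ∃ V : W.OrthogonalSlice, x ∈ Set.range V.ι)
    (he : e ∈ atlas (Coord 4) M) (he' : e' ∈ atlas (Coord 4) M) {x : M} (hx : x ∈ e.source)
    (hx' : x ∈ e'.source) : h.curvK he hx = h.curvK he' hx' := by
  obtain ⟨V, y, rfl⟩ := hslices x
  have h1 := V.scalarCurvature_eq h he hx
  have h2 := V.scalarCurvature_eq h he' hx'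
  linarith

/-- The scale factor up to a constant. -/
def scale (W : WeyssenhoffFluid X) (x : M) : ℝ :=
  (W.fields (chartAt (Coord 4) x)).torVecSq (chartAt (Coord 4) x x) ^ (-(1 / 6) : ℝ)

namespace IsSolution

theorem scale_eq (h : W.IsSolution f Λ) (he : e ∈ atlas (Coord 4) M) {x : M} (hx : x ∈ e.source) :
    W.scale x = Sm.ev ⟨e x, e.map_source hx⟩ (h e he).scale := by
  rw [scale, torVecSq_invariant h (chart_mem_atlas _ x) he (mem_chart_source _ x) hx]
  rfl

theorem scale_symm (h : W.IsSolution f Λ) (he : e ∈ atlas (Coord 4) M) (y : chartDomain e) :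
    W.scale (e.symm y) = Sm.ev y (h e he).scale := by
  rw [h.scale_eq he (e.map_target y.2)]
  congr 2
  exact Subtype.ext (e.right_inv y.2)

theorem scale_pos (h : W.IsSolution f Λ) (x : M) : 0 < W.scale x := by
  rw [h.scale_eq (chart_mem_atlas _ x) (mem_chart_source _ x)]
  exact (h _ (chart_mem_atlas _ x)).scale_pos _

theorem contMDiff_scale (h : W.IsSolution f Λ) : ContMDiff (𝓡 4) 𝓘(ℝ) ∞ W.scale := by
  intro x
  have he := chart_mem_atlas (Coord 4) x
  set e := chartAt (Coord 4) x
  have hx : x ∈ e.source := mem_chart_source (Coord 4) x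
  have h1 : ContMDiffOn (𝓡 4) (𝓡 4) ∞ e e.source :=
    contMDiffOn_of_mem_maximalAtlas (IsManifold.subset_maximalAtlas he)
  have h2 : ContMDiffOn (𝓡 4) 𝓘(ℝ) ∞ (extendZero (chartDomain e) (h e he).scale.1) e.target :=
    (Sm.smooth (h e he).scale).contMDiffOn
  have h3 : ContMDiffOn (𝓡 4) 𝓘(ℝ) ∞ W.scale e.source := by
    refine (h2.comp h1 fun z hz => e.map_source hz).congr fun z hz => ?_
    rw [h.scale_eq he hz, Function.comp_apply]
    exact (Sm.extendZero_ev (h e he).scale ⟨e z, e.map_source hz⟩).symm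
  exact h3.contMDiffAt (e.open_source.mem_nhds hx)

/-- The product of spatial curvature and squared scale factor is constant. -/
theorem exists_curvK_mul_scale [ConnectedSpace M] (h : W.IsSolution f Λ)
    (hslices : ∀ x : M, ∃ V : W.OrthogonalSlice, x ∈ Set.range V.ι) :
    ∃ C ≤ 0, ∀ e (he : e ∈ atlas (Coord 4) M) (x : M) (hx : x ∈ e.source),
      h.curvK he hx * W.scale x ^ 2 = C := by
  set φ : M → ℝ := fun x =>
    h.curvK (chart_mem_atlas (Coord 4) x) (mem_chart_source (Coord 4) x) * W.scale x ^ 2 with hφ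
  have hφe : ∀ e (he : e ∈ atlas (Coord 4) M) (x : M) (hx : x ∈ e.source),
      h.curvK he hx * W.scale x ^ 2 = φ x := fun e he x hx => by
    rw [hφ, h.curvK_invariant hslices he (chart_mem_atlas (Coord 4) x) hx]
  -- In a chart the product has zero gradient, hence it is constant on a coordinate ball around each
  -- point.
  have hloc : IsLocallyConstant φ := by
    refine (IsLocallyConstant.iff_eventually_eq φ).mpr fun x => ?_
    have he := chart_mem_atlas (Coord 4) x
    set e := chartAt (Coord 4) x
    have hx : x ∈ e.source := mem_chart_source (Coord 4) x
    have hs := h e he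
    set c := hs.curvK * hs.scale ^ 2 with hc
    have hφc : ∀ x' (hx' : x' ∈ e.source), φ x' = extendZero (chartDomain e) c.1 (e x') := by
      intro x' hx'
      rw [← hφe e he x' hx', h.scale_eq he hx',
        Sm.extendZero_ev c ⟨e x', e.map_source hx'⟩, hc, map_mul, map_pow, curvK]
    obtain ⟨r, hr, hball⟩ := Metric.isOpen_iff.mp e.open_target (e x) (e.map_source hx)
    have hconst : ∀ y ∈ Metric.ball (e x) r, extendZero (chartDomain e) c.1 y
        = extendZero (chartDomain e) c.1 (e x) := by
      intro y hy
      refine Metric.isOpen_ball.is_const_of_fderiv_eq_zero (𝕜 := ℝ)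
        (convex_ball (e x) r).isPreconnected (fun z hz =>
          (Sm.differentiableAt c ⟨z, hball hz⟩).differentiableWithinAt) (fun z hz => ?_) hy
        (Metric.mem_ball_self hr)
      ext v
      rw [fderiv_eq_sum_pd]
      have : ∀ α, pd α (extendZero (chartDomain e) c.1) z = 0 := fun α => by
        have h0 := Sm.ev_d α c ⟨z, hball hz⟩
        rw [hc, hs.curvK_mul_scale_grad, map_zero, ← hc] at h0
        exact h0.symm
      simp [this]
    have hnhds : e.source ∩ e ⁻¹' Metric.ball (e x) r ∈ 𝓝 x :=
      Filter.inter_mem (e.open_source.mem_nhds hx)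
        ((e.continuousAt hx).preimage_mem_nhds (Metric.ball_mem_nhds _ hr))
    filter_upwards [hnhds] with x' hx'
    rw [hφc x' hx'.1, hφc x hx, hconst _ hx'.2]
  obtain ⟨x₀⟩ := (inferInstance : Nonempty M)
  refine ⟨φ x₀, ?_, fun e he x hx => ?_⟩
  · exact mul_nonpos_of_nonpos_of_nonneg ((h _ (chart_mem_atlas _ x₀)).curvK_nonpos _) (sq_nonneg _)
  · rw [hφe]
    exact hloc.apply_eq_of_preconnectedSpace x x₀

/-- The normalised scale factor. -/
theorem exists_scale [ConnectedSpace M] (h : W.IsSolution f Λ)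
    (hslices : ∀ x : M, ∃ V : W.OrthogonalSlice, x ∈ Set.range V.ι) :
    ∃ K a : ℝ, (K = -1 ∨ K = 0) ∧ 0 < a ∧ ∀ e (he : e ∈ atlas (Coord 4) M) (x : M)
      (hx : x ∈ e.source), h.curvK he hx = K / (a * W.scale x) ^ 2 := by
  obtain ⟨C, hC, hk⟩ := h.exists_curvK_mul_scale hslices
  -- For `C < 0` the scale factor is multiplied by `1/√(-C)`, which normalises `k ℓ²` to `-1`; for
  -- `C = 0` any factor will do.
  rcases hC.lt_or_eq with hneg | rfl
  · refine ⟨-1, (√(-C))⁻¹, Or.inl rfl, inv_pos.mpr (Real.sqrt_pos.mpr (by linarith)),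
      fun e he x hx => ?_⟩
    have hs := h.scale_pos x
    rw [mul_pow, inv_pow, Real.sq_sqrt (by linarith), ← hk e he x hx]
    have hC0 : h.curvK he hx ≠ 0 := fun h0 => by
      have := hk e he x hx
      rw [h0, zero_mul] at this
      linarith
    field_simp
  · refine ⟨0, 1, Or.inr rfl, one_pos, fun e he x hx => ?_⟩
    have hs := h.scale_pos x
    rw [zero_div]
    exact (mul_eq_zero.mp (hk e he x hx)).resolve_right (pow_pos hs 2).ne'

end IsSolution

end WeyssenhoffFluid

end Global

end EinsteinCartan

end

/-! ### The geometry of the orthogonal hypersurfaces -/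

theorem theorem1 {M : Type w} [TopologicalSpace M] [ChartedSpace (EinsteinCartan.Coord 4) M]
    [IsManifold (𝓡 4) ∞ M] [ConnectedSpace M] (hor : EinsteinCartan.OrientedAtlas 4 M)
    (X : EinsteinCartan.Spacetime M) (W : EinsteinCartan.WeyssenhoffFluid X) (Λ : ℝ)
    (hfield : W.FieldEquations Λ) (hcosm : W.IsCosmological)
    (hslices : ∀ x : M, ∃ V : W.OrthogonalSlice,
      x ∈ Set.range V.ι ∧ V.IsComplete ∧ SimplyConnectedSpace V.carrier)
    (htor : ∀ e ∈ atlas (EinsteinCartan.Coord 4) M, ∀ y ∈ e.target,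
      (W.fields e).torVecSq y ≠ 0)
    (f : ℝ × ℝ → ℝ) (hf : ∀ x, DifferentiableAt ℝ f (W.energy x, W.pressure x))
    (hdiv : ∀ e ∈ atlas (EinsteinCartan.Coord 4) M, ∀ y ∈ e.target,
      (W.fields e).projDiv y (W.spinVec e) = f (W.energy (e.symm y), W.pressure (e.symm y))) :
    -- `³R ≤ 0` on every orthogonal hypersurface
    (∀ (V : W.OrthogonalSlice) (y : V.carrier), V.scalarCurvature y ≤ 0) ∧
    -- the curvature constant `K` of the FLRW metric with scale factor `ℓ` is `-1` or `0`
    (∃ (K : ℝ) (ℓ : M → ℝ), (K = -1 ∨ K = 0) ∧ ContMDiff (𝓡 4) 𝓘(ℝ) ∞ ℓ ∧ (∀ x, 0 < ℓ x) ∧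
      (∀ e ∈ atlas (EinsteinCartan.Coord 4) M, ∀ y ∈ e.target,
        (∀ α, (W.fields e).projGrad y (fun z => ℓ (e.symm z)) α = 0) ∧
        (1 / 3) * (W.fields e).expansion y =
          (W.fields e).dot y (fun z => ℓ (e.symm z)) / ℓ (e.symm y)) ∧
      ∀ V : W.OrthogonalSlice,
        (∀ y : V.carrier, V.scalarCurvature y = 6 * K / ℓ (V.ι y) ^ 2) ∧
        ∀ c ∈ atlas (EinsteinCartan.Coord 3) V.carrier, ∀ z ∈ c.target, ∀ i j k l,
          V.riemann3 c z i j k l = K / ℓ (V.ι (c.symm z)) ^ 2 *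
            (EinsteinCartan.bilinComp V.induced c z i k * EinsteinCartan.bilinComp V.induced c z j l
              - EinsteinCartan.bilinComp V.induced c z i l *
                EinsteinCartan.bilinComp V.induced c z j k)) ∧
    -- a slice is flat exactly when the magnetic part `H̄^{αβ}` vanishes on it
    (∀ V : W.OrthogonalSlice, (∀ y, V.scalarCurvature y = 0) ↔
      ∀ y, ∀ e ∈ atlas (EinsteinCartan.Coord 4) M, V.ι y ∈ e.source →
        ∀ α β, (W.fields e).hBar (e (V.ι y)) α β = 0) ∧
    -- the identity `H̄^{μν} H̄_{μν} = -(³R/3) S_δ S^δ`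
    (∀ (V : W.OrthogonalSlice) (y : V.carrier), ∀ e ∈ atlas (EinsteinCartan.Coord 4) M,
      V.ι y ∈ e.source →
        (W.fields e).hBarSq (e (V.ι y)) =
          -(V.scalarCurvature y / 3) * (W.fields e).torVecSq (e (V.ι y))) := by
  have h : W.IsSolution f Λ := fun e he =>
    EinsteinCartan.WeyssenhoffFluid.isLocalSolution he hfield hcosm htor hf hdiv
  have hsl : ∀ x : M, ∃ V : W.OrthogonalSlice, x ∈ Set.range V.ι := fun x =>
    (hslices x).imp fun _ hV => hV.1
  have hsc : ∀ (V : W.OrthogonalSlice) (y : V.carrier) e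
      (he : e ∈ atlas (EinsteinCartan.Coord 4) M) (hy : V.ι y ∈ e.source),
      V.scalarCurvature y = 6 * h.curvK he hy := fun V y e he hy => V.scalarCurvature_eq h he hy
  obtain ⟨K, a, hK, ha, hk⟩ := h.exists_scale hsl
  refine ⟨fun V y => ?_, ⟨K, fun x => a * W.scale x, hK, contMDiff_const.mul h.contMDiff_scale,
    fun x => mul_pos ha (h.scale_pos x), fun e he y hy => ?_, fun V => ⟨fun y => ?_,
    fun c hc z hz i j k l => ?_⟩⟩, fun V => ⟨fun h0 y e he hy => ?_, fun h0 y => ?_⟩,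
    fun V y e he hy => ?_⟩
  · rw [hsc V y _ (chart_mem_atlas _ (V.ι y)) (mem_chart_source _ _)]
    exact mul_nonpos_of_nonneg_of_nonpos (by norm_num)
      ((h _ (chart_mem_atlas _ (V.ι y))).curvK_nonpos _)
  · exact (h e he).scale_props ha (fun y => congrArg (a * ·) (h.scale_symm he y)) ⟨y, hy⟩
  · rw [hsc V y _ (chart_mem_atlas _ (V.ι y)) (mem_chart_source _ _), hk, mul_div_assoc]
  · rw [V.riemann3_eq h hc hz (chart_mem_atlas _ (V.ι (c.symm z))) (mem_chart_source _ _), hk]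
  · refine ((h e he).hBar_eq_zero_iff ⟨e (V.ι y), e.map_source hy⟩).mpr ?_
    have h1 := hsc V y e he hy
    rw [h0 y, EinsteinCartan.WeyssenhoffFluid.IsSolution.curvK] at h1
    linarith
  · have he := chart_mem_atlas (EinsteinCartan.Coord 4) (V.ι y)
    have hy := mem_chart_source (EinsteinCartan.Coord 4) (V.ι y)
    rw [hsc V y _ he hy, EinsteinCartan.WeyssenhoffFluid.IsSolution.curvK,
      ((h _ he).hBar_eq_zero_iff ⟨_, (chartAt _ (V.ι y)).map_source hy⟩).mp (h0 y _ he hy), mul_zero]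
  · have h1 := ((h e he).hBarSq_props ⟨e (V.ι y), e.map_source hy⟩).1
    rw [(h e he).ev_svSq] at h1
    rw [hsc V y e he hy, EinsteinCartan.WeyssenhoffFluid.IsSolution.curvK]
    linear_combination h1
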